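/- Let $G$ be a finite group with a split $BN$-pair $(B,N)$ of characteristic $p$ satisfying the commutator relations; put $T=B\cap N$ and let $\mathcal L$ be the set of $N$-conjugates of the standard Levi subgroups of $G$. Let $\mathcal L'\subseteq\mathcal L$ be an $N$-stable subset containing $G$ and $T$ with $L\cap {}^xM\in\mathcal L'$ for all $L,M\in\mathcal L'$ and $x\in N$. Let $k$ be a field of characteristic different from $p$ that is a splitting field for all subgroups of $G$. For Levi subgroups $L\le M$ in $\mathcal L$ and a parabolic subgroup $Q$ of $M$ with Levi complement $L$, Harish-Chandra induction and restriction are $R_L^M(X)=kM\otimes_{kQ}\mathrm{Infl}_L^Q(X)$ and ${}^*\!R_L^M(V)=\mathrm{Fix}_{O_p(Q)}(V)$; up to isomorphism they do not depend on the choice of $Q$. Let $L\in\mathcal L'$ and let $X$ be a simple $kL$-module that is weakly cuspidal, i.e. ${}^*\!R_K^L(X)=0$ for all $K\in\mathcal L'$ with $K\lneq L$. Let $M\in\mathcal L'$ with $L\le M$, and put $$Y=R_L^G(X),\quad Z=R_L^M(X),\quad H_G=\mathrm{End}_{kG}(Y),\quad H_M=\mathrm{End}_{kM}(Z).$$ Let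 $F_Y=\mathrm{Hom}_{kG}(Y,-)$ and $F_Z=\mathrm{Hom}_{kM}(Z,-)$ be the covariant Hom-functors, with values in right $H_G$-modules and right $H_M$-modules, respectively. Let $kG\text{-mod}_Y$ denote the category of those $kG$-modules that are both a quotient and a submodule of a finite direct sum of copies of $Y$, and define $kM\text{-mod}_Z$ in the same way. Then $R_M^G(Z)\cong Y$. Fix any such isomorphism, and let $\mathrm{Res}^{H_G}_{H_M}$ be the restriction functor from right $H_G$-modules to right $H_M$-modules along the resulting homomorphism $H_M\to\mathrm{End}_{kG}(R_M^G(Z))\cong H_G$. Let $S\in kM\text{-mod}_Z$ and $T'\in kG\text{-mod}_Y$, and suppose that $H_M$ is self-injective. Then there is an isomorphism of $k$-vector spaces $$\mathrm{Hom}_{H_M}\bigl(F_Z(S),\mathrm{Res}^{H_G}_{H_M}(F_Y(T'))\bigr)\;\cong\;\mathrm{Hom}_{kM}\bigl(S,{}^*\!R_M^G(T')\bigr).$$ -/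

import Mathlib

open scoped TensorProduct Pointwise

universe u v w

noncomputable section

namespace HarishChandra

/-! ### Finite groups with a split BN-pair -/

/-- The conjugate `g H g⁻¹` of a subgroup. -/
def conjSub {G : Type v} [Group G] (g : G) (H : Subgroup G) : Subgroup G :=
  H.map (MulAut.conj g).toMonoidHom

/-- The largest normal `p`-subgroup `O_p(Q)` of a subgroup `Q` of the finite group `G`: the subgroup
generated by all normal `p`-subgroups of `Q`. -/
def pRadical {G : Type v} [Group G] (p : ℕ) (Q : Subgroup G) : Subgroup G :=
  sSup {V : Subgroup G | V ≤ Q ∧ (∀ q ∈ Q, conjSub q V ≤ V) ∧ IsPGroup p V}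

/-- The data of a split BN-pair in `G`: the subgroups `B`, `N`, the normal complement `U` of `B ∩ N`
in `B`, and a set `S` of elements of `N` that represent the distinguished generators of the Weyl
group `N / (B ∩ N)`. -/
structure BNData (G : Type v) [Group G] where
  B : Subgroup G
  N : Subgroup G
  U : Subgroup G
  S : Set G

namespace BNData

variable {G : Type v} [Group G]

/-- The torus `T = B ∩ N`. -/
def T (D : BNData G) : Subgroup G := D.B ⊓ D.N

/-- `D` is a split BN-pair of characteristic `p` (for a finite group `G`). -/
structure IsSplitBNPair (D : BNData G) (p : ℕ) : Prop where
  generates : D.B ⊔ D.N = ⊤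
  torus_normal : ∀ n ∈ D.N, conjSub n D.T = D.T
  S_subset : ∀ s ∈ D.S, s ∈ D.N
  S_sq : ∀ s ∈ D.S, s * s ∈ D.T
  S_generates : Subgroup.closure ((D.T : Set G) ∪ D.S) = D.N
  /-- `s B n ⊆ B s n B ∪ B n B` -/
  exchange : ∀ s ∈ D.S, ∀ n ∈ D.N, ∀ b ∈ D.B,
    s * b * n ∈ DoubleCoset.doubleCoset (s * n) (D.B : Set G) (D.B : Set G) ∪
      DoubleCoset.doubleCoset n (D.B : Set G) (D.B : Set G)
  not_normalize : ∀ s ∈ D.S, conjSub s D.B ≠ D.B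
  U_le : D.U ≤ D.B
  U_normal : ∀ b ∈ D.B, conjSub b D.U = D.U
  U_pGroup : IsPGroup p D.U
  U_sup_T : D.U ⊔ D.T = D.B
  U_inf_T : D.U ⊓ D.T = ⊥
  torus_comm : ∀ s ∈ D.T, ∀ t ∈ D.T, s * t = t * s
  torus_coprime : Nat.Coprime p (Nat.card D.T)
  saturated : ⨅ n ∈ D.N, conjSub n D.B = D.T

/-- The half-space of the simple root `α_s`, as a `T`-stable subset of `N`: the set of all
`n ∈ N` with image `w` in the Weyl group such that `s B n ⊆ B s n B`, that is, such that `s w` is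
longer than `w`, that is, such that `w⁻¹ α_s` is a positive root. -/
def simpleRoot (D : BNData G) (s : G) : Set G :=
  {n | n ∈ D.N ∧ ∀ b ∈ D.B,
    s * b * n ∈ DoubleCoset.doubleCoset (s * n) (D.B : Set G) (D.B : Set G)}

/-- The roots `u α_s`, for `u` in the Weyl group and `s` a distinguished generator. A root `α` is
represented by its half-space `{n ∈ N | n⁻¹ α is positive}`; the negative `-α` is represented by the
complement in `N`. -/
def roots (D : BNData G) : Set (Set G) :=
  {a | ∃ n ∈ D.N, ∃ s ∈ D.S, a = n • D.simpleRoot s}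

/-- The root subgroup `X_α`: the intersection of the conjugates `n U n⁻¹` over all `n ∈ N`
such that `n⁻¹ α` is positive. -/
def rootSubgroup (D : BNData G) (a : Set G) : Subgroup G :=
  ⨅ n ∈ a, conjSub n D.U

/-- The commutator relations: `[X_α, X_β]` is contained in the subgroup generated by the `X_γ`, where
`γ` runs over the roots of the form `i α + j β` with positive (real) `i`, `j`, for all roots `α`, `β`
with `β ≠ ± α`. In terms of half-spaces, a root `γ` other than `α` and `β` has this form if and only
if it contains the intersection of `α` and `β`. -/
def CommutatorRelations (D : BNData G) : Prop :=
  ∀ a ∈ D.roots, ∀ b ∈ D.roots, b ≠ a → b ≠ (D.N : Set G) \ a →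
    ∀ x ∈ D.rootSubgroup a, ∀ y ∈ D.rootSubgroup b,
      x * y * x⁻¹ * y⁻¹ ∈ ⨆ c ∈ {c | c ∈ D.roots ∧ c ≠ a ∧ c ≠ b ∧ a ∩ b ⊆ c}, D.rootSubgroup c

/-- The preimage in `N` of the parabolic subgroup of the Weyl group generated by `J ⊆ S`. -/
def stdN (D : BNData G) (J : Set G) : Subgroup G :=
  Subgroup.closure ((D.T : Set G) ∪ J)

/-- The standard Levi subgroup `L_J`, generated by `T` and the root subgroups `X_α`, for `α` in the
parabolic subsystem spanned by the simple roots `α_s`, `s ∈ J`. -/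
def stdLevi (D : BNData G) (J : Set G) : Subgroup G :=
  D.T ⊔ ⨆ n ∈ D.stdN J, ⨆ s ∈ J, D.rootSubgroup (n • D.simpleRoot s)

/-- For `J ⊆ I ⊆ S`, the standard parabolic subgroup of type `J` of the standard Levi subgroup `L_I`
(with its BN-pair `B ∩ L_I`, `N ∩ L_I`): it is generated by `B ∩ L_I` and `J`. -/
def stdParabolic (D : BNData G) (I J : Set G) : Subgroup G :=
  Subgroup.closure (((D.B ⊓ D.stdLevi I : Subgroup G) : Set G) ∪ J)

/-- The set of all Levi subgroups: the `N`-conjugates of the standard Levi subgroups. -/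
def levis (D : BNData G) : Set (Subgroup G) :=
  {L | ∃ n ∈ D.N, ∃ I ⊆ D.S, L = conjSub n (D.stdLevi I)}

/-- A parabolic subgroup `Q` of the Levi subgroup `M` with Levi complement `L`:
up to simultaneous conjugation by an element of `N`, the group `M` is a standard Levi
subgroup `L_I`, and `Q` and `L` are its standard parabolic subgroup of type `J` and the
standard Levi complement `L_J`, for some `J ⊆ I`. Taking for `M` the whole group `⊤` gives the
parabolic subgroups of `G`. -/
structure Parabolic (D : BNData G) (M L : Subgroup G) where
  Q : Subgroup G
  isParabolic : ∃ n ∈ D.N, ∃ I ⊆ D.S, ∃ J ⊆ I, M = conjSub n (D.stdLevi I) ∧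
    L = conjSub n (D.stdLevi J) ∧ Q = conjSub n (D.stdParabolic I J)

/-- The unipotent radical `O_p(Q)`. -/
def Parabolic.radical {D : BNData G} {M L : Subgroup G} (P : D.Parabolic M L) (p : ℕ) :
    Subgroup G :=
  pRadical p P.Q

/-- A set of Levi subgroups as it is used to define weak cuspidality: it is stable under conjugation
by `N`, contains `G` and `T`, and is closed under the intersections `L ∩ x M x⁻¹`, `x ∈ N`. -/
structure IsAdmissible (D : BNData G) (𝓛 : Set (Subgroup G)) : Prop where
  subset : 𝓛 ⊆ D.levis
  stable : ∀ L ∈ 𝓛, ∀ x ∈ D.N, conjSub x L ∈ 𝓛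
  top_mem : ⊤ ∈ 𝓛
  torus_mem : D.T ∈ 𝓛
  inter_mem : ∀ L ∈ 𝓛, ∀ M ∈ 𝓛, ∀ x ∈ D.N, L ⊓ conjSub x M ∈ 𝓛

/-! The Levi complement of a parabolic subgroup normalizes the unipotent radical. -/

theorem conjSub_mono {g : G} {H K : Subgroup G} (h : H ≤ K) : conjSub g H ≤ conjSub g K :=
  Subgroup.map_mono h

theorem conj_mem_conjSub {g h : G} {H : Subgroup G} (hh : h ∈ H) : g * h * g⁻¹ ∈ conjSub g H :=
  ⟨h, hh, rfl⟩

theorem mem_conjSub {g x : G} {H : Subgroup G} : x ∈ conjSub g H ↔ g⁻¹ * x * g ∈ H := by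
  constructor
  · rintro ⟨h, hh, rfl⟩
    simpa [mul_assoc] using hh
  · intro h
    exact ⟨_, h, by simp [mul_assoc]⟩

theorem rootSubgroup_smul_le (D : BNData G) (g : G) (a : Set G) :
    D.rootSubgroup (g • a) ≤ conjSub g (D.rootSubgroup a) := by
  intro x hx
  rw [mem_conjSub]
  simp only [rootSubgroup, Subgroup.mem_iInf, mem_conjSub] at hx ⊢
  intro n hn
  simpa [mul_assoc] using hx (g * n) (Set.smul_mem_smul_set hn)

theorem rootSubgroup_simpleRoot_le (D : BNData G) (s : G) :
    D.rootSubgroup (D.simpleRoot s) ≤ D.U := by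
  intro x hx
  simp only [rootSubgroup, Subgroup.mem_iInf, mem_conjSub] at hx
  have h1 : (1 : G) ∈ D.simpleRoot s :=
    ⟨D.N.one_mem, fun b hb => DoubleCoset.mem_doubleCoset.2
      ⟨1, D.B.one_mem, b, hb, by simp⟩⟩
  simpa using hx 1 h1

theorem stdLevi_le_stdParabolic (D : BNData G) (hU : D.U ≤ D.B) {I J : Set G} (hJ : J ⊆ I) :
    D.stdLevi J ≤ D.stdParabolic I J := by
  have hT : D.T ≤ D.stdParabolic I J := fun t ht =>
    Subgroup.subset_closure (Or.inl ⟨ht.1, (le_sup_left : D.T ≤ D.stdLevi I) ht⟩)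
  have hN : D.stdN J ≤ D.stdParabolic I J := by
    rw [stdN, Subgroup.closure_le]
    rintro x (hx | hx)
    · exact hT hx
    · exact Subgroup.subset_closure (Or.inr hx)
  refine sup_le hT (iSup₂_le fun n hn => iSup₂_le fun s hs => ?_)
  intro x hx
  have hy := D.rootSubgroup_smul_le n _ hx
  obtain ⟨y, hy, rfl⟩ := hy
  have hyL : y ∈ D.stdLevi I := by
    have h2 : D.rootSubgroup ((1 : G) • D.simpleRoot s) ≤ D.stdLevi I :=
      le_sup_of_le_right (le_iSup₂_of_le 1 (D.stdN I).one_mem (le_iSup₂_of_le s (hJ hs) le_rfl))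
    rw [one_smul] at h2
    exact h2 hy
  have hyP : y ∈ D.stdParabolic I J :=
    Subgroup.subset_closure (Or.inl ⟨hU (D.rootSubgroup_simpleRoot_le s hy), hyL⟩)
  exact mul_mem (mul_mem (hN hn) hyP) (inv_mem (hN hn))

theorem Parabolic.levi_le {D : BNData G} {M L : Subgroup G} (P : D.Parabolic M L)
    (hU : D.U ≤ D.B) : L ≤ P.Q := by
  obtain ⟨n, -, I, -, J, hJ, -, hL, hQ⟩ := P.isParabolic
  exact hL.le.trans ((conjSub_mono (D.stdLevi_le_stdParabolic hU hJ)).trans hQ.ge)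

theorem conj_mem_pRadical {p : ℕ} {Q : Subgroup G} {q x : G} (hq : q ∈ Q)
    (hx : x ∈ pRadical p Q) : q * x * q⁻¹ ∈ pRadical p Q := by
  have h : pRadical p Q ≤ conjSub q⁻¹ (pRadical p Q) := by
    refine sSup_le fun V hV y hy => ?_
    rw [mem_conjSub]
    have : q * y * q⁻¹ ∈ V := hV.2.1 q hq (conj_mem_conjSub hy)
    rw [inv_inv]
    exact (le_sSup hV : V ≤ pRadical p Q) this
  simpa [mem_conjSub] using h hx

theorem Parabolic.conj_mem {D : BNData G} {p : ℕ} (hD : D.IsSplitBNPair p) {M L : Subgroup G}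
    (P : D.Parabolic M L) (l : L) (x : G) (hx : x ∈ P.radical p) :
    L.subtype l * x * (L.subtype l)⁻¹ ∈ P.radical p :=
  conj_mem_pRadical (P.levi_le hD.U_le l.2) hx

theorem Parabolic.conj_mem_subgroupOf {D : BNData G} {p : ℕ} (hD : D.IsSplitBNPair p)
    {M L : Subgroup G} (hLM : L ≤ M) (P : D.Parabolic M L) (l : L) (x : M)
    (hx : x ∈ (P.radical p).subgroupOf M) :
    Subgroup.inclusion hLM l * x * (Subgroup.inclusion hLM l)⁻¹ ∈ (P.radical p).subgroupOf M :=
  conj_mem_pRadical (P.levi_le hD.U_le l.2) hx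

end BNData

/-! ### Modules over group algebras: Harish-Chandra induction and restriction -/

section Modules

variable (k : Type u) [Field k]

/-- `k` is a splitting field for the finite group `H`: the endomorphisms of every simple `kH`-module
are the scalars. -/
def IsSplittingField (H : Type v) [Group H] : Prop :=
  ∀ (V : Type (max u v)) [AddCommGroup V] [Module k V] [Module (MonoidAlgebra k H) V]
    [IsScalarTower k (MonoidAlgebra k H) V] [IsSimpleModule (MonoidAlgebra k H) V]
    (f : V →ₗ[MonoidAlgebra k H] V), ∃ c : k, ∀ x, f x = c • x

variable {L M : Type v} [Group L] [Group M] (j : L →* M) (U : Subgroup M)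

section Induction

variable (X : Type w) [AddCommGroup X] [Module k X] [Module (MonoidAlgebra k L) X]
  [IsScalarTower k (MonoidAlgebra k L) X]

/-- The relations `u l ⊗ x = 1 ⊗ l x`, for `u ∈ U`, `l ∈ L`. -/
def indRelations : Submodule (MonoidAlgebra k M) (MonoidAlgebra k M ⊗[k] X) :=
  Submodule.span (MonoidAlgebra k M)
    {z | ∃ u ∈ U, ∃ (l : L) (x : X), z = MonoidAlgebra.of k M (u * j l) ⊗ₜ[k] x -
      (1 : MonoidAlgebra k M) ⊗ₜ[k] (MonoidAlgebra.of k L l • x)}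

/-- Harish-Chandra induction `kM ⊗_{kQ} Infl(X)`, where `Q = U L`, and where `Infl(X)` is the
`kL`-module `X`, viewed as a `kQ`-module with trivial action of `U`: the quotient of
`kM ⊗_k X` by the relations `u l ⊗ x = 1 ⊗ l x`, for `u ∈ U`, `l ∈ L`. -/
abbrev HCInd : Type _ := (MonoidAlgebra k M ⊗[k] X) ⧸ indRelations k j U X

/-- `1 ⊗ f` on `kM ⊗_k X`. -/
def tensorMap (f : Module.End (MonoidAlgebra k L) X) :
    (MonoidAlgebra k M ⊗[k] X) →ₗ[MonoidAlgebra k M] (MonoidAlgebra k M ⊗[k] X) :=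
  TensorProduct.AlgebraTensorModule.map LinearMap.id (f.restrictScalars k)

@[simp] theorem tensorMap_tmul (f : Module.End (MonoidAlgebra k L) X) (a : MonoidAlgebra k M)
    (x : X) : tensorMap k (M := M) X f (a ⊗ₜ[k] x) = a ⊗ₜ[k] f x := rfl

theorem indRelations_le_comap (f : Module.End (MonoidAlgebra k L) X) :
    indRelations k j U X ≤ (indRelations k j U X).comap (tensorMap k (M := M) X f) := by
  rw [indRelations, Submodule.span_le]
  rintro _ ⟨u, hu, l, x, rfl⟩
  refine Submodule.subset_span ⟨u, hu, l, f x, ?_⟩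
  rw [map_sub, tensorMap_tmul, tensorMap_tmul, map_smul]

/-- Functoriality of Harish-Chandra induction on endomorphisms, `f ↦ 1 ⊗ f`. -/
def indEnd : Module.End (MonoidAlgebra k L) X →+* Module.End (MonoidAlgebra k M) (HCInd k j U X) where
  toFun f := Submodule.mapQ _ _ (tensorMap k (M := M) X f) (indRelations_le_comap k j U X f)
  map_one' := by
    refine Submodule.linearMap_qext _ (TensorProduct.AlgebraTensorModule.ext fun a x => ?_)
    simp
  map_mul' f g := by
    refine Submodule.linearMap_qext _ (TensorProduct.AlgebraTensorModule.ext fun a x => ?_)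
    simp
  map_zero' := by
    refine Submodule.linearMap_qext _ (TensorProduct.AlgebraTensorModule.ext fun a x => ?_)
    simp
  map_add' f g := by
    refine Submodule.linearMap_qext _ (TensorProduct.AlgebraTensorModule.ext fun a x => ?_)
    simp [TensorProduct.tmul_add]

end Induction

section Restriction

variable (V : Type w) [AddCommGroup V] [Module k V] [Module (MonoidAlgebra k M) V]
  [IsScalarTower k (MonoidAlgebra k M) V]

/-- The `kM`-module `V`, restricted to a `kL`-module along `j`. -/
@[nolint unusedArguments]
def ResAlong (_ : L →* M) (V : Type w) : Type w := V

instance : AddCommGroup (ResAlong j V) := inferInstanceAs (AddCommGroup V)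

instance : Module k (ResAlong j V) := inferInstanceAs (Module k V)

instance : Module (MonoidAlgebra k L) (ResAlong j V) :=
  Module.compHom V (MonoidAlgebra.mapDomainRingHom k j)

instance : IsScalarTower k (MonoidAlgebra k L) (ResAlong j V) where
  smul_assoc c a x := by
    have h : MonoidAlgebra.mapDomainRingHom k j (c • a)
        = c • MonoidAlgebra.mapDomainRingHom k j a :=
      map_smul (MonoidAlgebra.mapDomainAlgHom k k j) c a
    have h2 : ∀ v : V, MonoidAlgebra.mapDomainRingHom k j (c • a) • v
        = c • (MonoidAlgebra.mapDomainRingHom k j a • v) := fun v => by rw [h, smul_assoc]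
    exact h2 x

theorem fixed_smul (hU : ∀ (l : L), ∀ x ∈ U, j l * x * (j l)⁻¹ ∈ U) (a : MonoidAlgebra k L) (v : V)
    (hv : ∀ y ∈ U, MonoidAlgebra.of k M y • v = v) :
    ∀ y ∈ U, MonoidAlgebra.of k M y • (MonoidAlgebra.mapDomainRingHom k j a • v) =
      MonoidAlgebra.mapDomainRingHom k j a • v := by
  intro y hy
  induction a using MonoidAlgebra.induction_on with
  | of l =>
    have h1 : MonoidAlgebra.mapDomainRingHom k j (MonoidAlgebra.of k L l)
        = MonoidAlgebra.of k M (j l) := by simp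
    have h3 := hv _ (hU l⁻¹ y hy)
    rw [h1]
    conv_rhs => rw [← h3]
    rw [smul_smul, smul_smul, ← map_mul, ← map_mul]
    congr 2
    simp [mul_assoc]
  | add a b ha hb => rw [map_add, add_smul, smul_add, ha, hb]
  | smul c a ha =>
    have h : MonoidAlgebra.mapDomainRingHom k j (c • a)
        = c • MonoidAlgebra.mapDomainRingHom k j a :=
      map_smul (MonoidAlgebra.mapDomainAlgHom k k j) c a
    rw [h, smul_assoc, smul_comm, ha]

/-- Harish-Chandra restriction: the `kL`-submodule `Fix_U(V)` of the fixed points of `U` on the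
`kM`-module `V`, where `L` normalizes `U`. -/
def HCResSubmodule (hU : ∀ (l : L), ∀ x ∈ U, j l * x * (j l)⁻¹ ∈ U) :
    Submodule (MonoidAlgebra k L) (ResAlong j V) where
  carrier := {x : V | ∀ y ∈ U, MonoidAlgebra.of k M y • x = x}
  zero_mem' := fun y _ => smul_zero (A := V) (MonoidAlgebra.of k M y)
  add_mem' := by
    intro x x' hx hx' y hy
    have h := smul_add (A := V) (MonoidAlgebra.of k M y) x x'
    rw [hx y hy, hx' y hy] at h
    exact h
  smul_mem' := fun a x hx => fixed_smul k j U V hU a x hx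

/-- Harish-Chandra restriction as a `kL`-module. -/
abbrev HCRes (hU : ∀ (l : L), ∀ x ∈ U, j l * x * (j l)⁻¹ ∈ U) : Type _ :=
  HCResSubmodule k j U V hU

end Restriction

end Modules

/-! ### The covariant Hom-functor -/

section HomFunctor

/-- `V` is a quotient and a submodule of a finite direct sum of copies of the `A`-module `Y`. -/
def InModCat (A : Type u) [Ring A] (Y : Type v) (V : Type w) [AddCommGroup Y] [Module A Y]
    [AddCommGroup V] [Module A V] : Prop :=
  ∃ n : ℕ, (∃ f : (Fin n → Y) →ₗ[A] V, Function.Surjective f) ∧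
    ∃ g : V →ₗ[A] (Fin n → Y), Function.Injective g

/-- `H` is self-injective: `H` is injective as a right `H`-module. -/
def IsSelfInjective (H : Type u) [Ring H] : Prop := Module.Injective Hᵐᵒᵖ H

variable (k : Type*) [Field k] (A : Type*) [Ring A] [Algebra k A]
  (Y : Type*) [AddCommGroup Y] [Module A Y]
  (V : Type*) [AddCommGroup V] [Module k V] [Module A V] [IsScalarTower k A V]

/-- `F_Y(V) = Hom_A(Y, V)`, a right module over `End_A(Y)` by composition of maps. -/
def HomF : Type _ := Y →ₗ[A] V

instance : AddCommGroup (HomF A Y V) := inferInstanceAs (AddCommGroup (Y →ₗ[A] V))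

instance : Module k (HomF A Y V) := inferInstanceAs (Module k (Y →ₗ[A] V))

/-- `f · h = f ∘ h` -/
instance : Module (Module.End A Y)ᵐᵒᵖ (HomF A Y V) where
  smul h f := LinearMap.comp (show Y →ₗ[A] V from f) (MulOpposite.unop h)
  one_smul f := LinearMap.comp_id (show Y →ₗ[A] V from f)
  mul_smul _ _ _ := rfl
  smul_zero _ := LinearMap.zero_comp _
  smul_add _ _ _ := LinearMap.add_comp _ _ _
  add_smul _ _ f := LinearMap.comp_add _ _ (show Y →ₗ[A] V from f)
  zero_smul f := LinearMap.comp_zero (show Y →ₗ[A] V from f)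

instance : SMulCommClass (Module.End A Y)ᵐᵒᵖ k (HomF A Y V) where
  smul_comm _ _ _ := rfl

end HomFunctor

section RightRestriction

variable (k : Type*) [Field k] {R S : Type*} [Ring R] [Ring S] (i : R →+* S)
  (W : Type*) [AddCommGroup W] [Module k W] [Module Sᵐᵒᵖ W] [SMulCommClass Sᵐᵒᵖ k W]

/-- The restriction of a right `S`-module to a right `R`-module along a homomorphism `i : R → S`. -/
@[nolint unusedArguments]
def ResRight {R S : Type*} [Ring R] [Ring S] (_ : R →+* S) (W : Type*) : Type _ := W

instance : AddCommGroup (ResRight i W) := inferInstanceAs (AddCommGroup W)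

instance : Module k (ResRight i W) := inferInstanceAs (Module k W)

instance : Module Rᵐᵒᵖ (ResRight i W) := Module.compHom W (RingHom.op i)

instance : SMulCommClass Rᵐᵒᵖ k (ResRight i W) where
  smul_comm a c x := smul_comm (RingHom.op i a) c (show W from x)

end RightRestriction

/-! ### The functors for Levi subgroups -/

section Levi

variable (k : Type u) [Field k] {G : Type v} [Group G] {D : BNData G} (p : ℕ)

/-- `R_L^M(X)`, for Levi subgroups `L ≤ M`, defined by the parabolic subgroup `P` of `M`. -/
abbrev IndLevi {L M : Subgroup G} (hLM : L ≤ M) (P : D.Parabolic M L)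
    (X : Type w) [AddCommGroup X] [Module k X] [Module (MonoidAlgebra k L) X]
    [IsScalarTower k (MonoidAlgebra k L) X] : Type _ :=
  HCInd k (Subgroup.inclusion hLM) ((P.radical p).subgroupOf M) X

/-- `R_L^G(X)`, for a Levi subgroup `L`, defined by the parabolic subgroup `P` of `G`. -/
abbrev IndG {L : Subgroup G} (P : D.Parabolic ⊤ L)
    (X : Type w) [AddCommGroup X] [Module k X] [Module (MonoidAlgebra k L) X]
    [IsScalarTower k (MonoidAlgebra k L) X] : Type _ :=
  HCInd k L.subtype (P.radical p) X

variable {p}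

/-- `*R_L^M(V)`, for Levi subgroups `L ≤ M`, defined by the parabolic subgroup `P` of `M`. -/
abbrev ResLevi (hD : D.IsSplitBNPair p) {L M : Subgroup G} (hLM : L ≤ M) (P : D.Parabolic M L)
    (V : Type w) [AddCommGroup V] [Module k V] [Module (MonoidAlgebra k M) V]
    [IsScalarTower k (MonoidAlgebra k M) V] : Type _ :=
  HCRes k (Subgroup.inclusion hLM) ((P.radical p).subgroupOf M) V (P.conj_mem_subgroupOf hD hLM)

/-- `*R_L^G(V)`, for a Levi subgroup `L`, defined by the parabolic subgroup `P` of `G`. -/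
abbrev ResG (hD : D.IsSplitBNPair p) {L : Subgroup G} (P : D.Parabolic ⊤ L)
    (V : Type w) [AddCommGroup V] [Module k V] [Module (MonoidAlgebra k G) V]
    [IsScalarTower k (MonoidAlgebra k G) V] : Type _ :=
  HCRes k L.subtype (P.radical p) V (P.conj_mem hD)

/-- The simple `kL`-module `X` is weakly cuspidal with respect to the Levi subgroups in `𝓛` that are
contained in `L`. -/
def IsWeaklyCuspidal (hD : D.IsSplitBNPair p) (𝓛 : Set (Subgroup G)) (L : Subgroup G)
    (X : Type w) [AddCommGroup X] [Module k X] [Module (MonoidAlgebra k L) X]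
    [IsScalarTower k (MonoidAlgebra k L) X] : Prop :=
  IsSimpleModule (MonoidAlgebra k L) X ∧
    ∀ K ∈ 𝓛, ∀ hKL : K ≤ L, K ≠ L → ∀ P : D.Parabolic L K, Subsingleton (ResLevi k hD hKL P X)

/-- The homomorphism `End_{kM}(Z) → End_{kG}(R_M^G(Z)) ≅ End_{kG}(Y)` that comes from
functoriality and an isomorphism `R_M^G(Z) ≅ Y`. -/
def endEmbedding {M : Subgroup G} (Q : D.Parabolic ⊤ M)
    {Z : Type w} [AddCommGroup Z] [Module k Z] [Module (MonoidAlgebra k M) Z]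
    [IsScalarTower k (MonoidAlgebra k M) Z] {Y : Type*} [AddCommGroup Y]
    [Module (MonoidAlgebra k G) Y] (φ : IndG k p Q Z ≃ₗ[MonoidAlgebra k G] Y) :
    Module.End (MonoidAlgebra k M) Z →+* Module.End (MonoidAlgebra k G) Y :=
  (φ.conjRingEquiv : Module.End (MonoidAlgebra k G) (IndG k p Q Z) →+*
    Module.End (MonoidAlgebra k G) Y).comp (indEnd k M.subtype (Q.radical p) Z)

end Levi

end HarishChandra

end

open scoped TensorProduct Pointwise


noncomputable section

set_option linter.unusedSectionVars false
set_option linter.unusedVariables false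

namespace HarishChandra
namespace BNData

/-! ### Double cosets of the Borel subgroup and the half-spaces of simple roots -/

section Bruhat

variable {G : Type v} [Group G] {D : BNData G} {p : ℕ}

/-! By the adjunction between `R_M^G` and `*R_M^G`, the restriction of `F_Y(T')` to `H_M` is
`F_Z(W)` with `W = *R_M^G(T')`. So the claim is that `F_Z` maps `Hom(S, W)` bijectively to
`Hom_{H_M}(F_Z(S), F_Z(W))` (`nonempty_equiv_hom`). Injectivity holds because `S` is a quotient of
some `Z^n`. For surjectivity, an `H_M`-map `α` from `F_Z(S)` to `F_Z(W)` has to respect all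
relations between values of maps `Z → S`. If `W` were a submodule of some `Z^m`, self-injectivity
would give this: `F_Z(S)` lies in `H_M^n`, so a map from it to `H_M` extends to `H_M^n` and is
induced by a map `S → Z` (`exists_hom_of_selfInjective`). In general it is enough to test vanishing
in `W` by subgroups, each of which contains either all values of maps `Z → W` or the kernel of a map
`W → Z` (`exists_hom_of_tests`).

The tests come from a Mackey decomposition (`IsLeviPair.test`). The module `T'` lies in some `Y^n`,
and `Y` is the sum of its parts supported on the double cosets of a parabolic subgroup with Levi
complement `M` and one with Levi complement `L`. A map `Z → *R_M^G(Y)` with a nonzero part on such a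
double coset comes from an `L`-map from `X` to the fixed points of a unipotent radical, which has a
nonzero coefficient at some `n ∈ N` in that double coset. Weak cuspidality forces `n` to normalize
`L` (`IsLeviPair.conjSub_eq`). The coefficient map is then surjective, since `X` is simple, and
defines an automorphism of `Y` (`IsLeviPair.exists_translate`). This automorphism carries the
obvious copy of `Z` in `Y` to a subspace that contains the part of `*R_M^G(Y)` on the double coset
(`IsLeviPair.indProj_mem`). Hence this part embeds into `Z`.

Both the automorphism and the isomorphism `R_M^G(Z) ≅ Y` rest on one fact: if two parabolic
subgroups have the same Levi complement, the average over the unipotent radical of the second is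
injective on the fixed points of that of the first (`IsSplitBNPair.indep`). Its proof is geometric.
The chambers are the elements of `N` modulo `T`, roots are half-spaces, and faces are residues.
Parabolic subgroups correspond to faces, a Levi subgroup to the set of roots that cut a face, and
two parabolic subgroups with the same Levi complement to parallel faces. Parallel faces are joined
by a chain in which neighbours are opposite in a face of rank one more; for neighbours a product of
averages is computed, by induction on the number of roots that cut the face.

The group theory needed for this is derived from the axioms: groups `U_A` that depend only on the
convex hull of a set `A` of chambers (`IsSplitBNPair.rootSubgroup_le`), rank one
(`IsSplitBNPair.rank_one`), the Bruhat decomposition of Levi subgroups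
(`IsSplitBNPair.levi_bruhat`), their intersections (`IsSplitBNPair.levi_inf_levi`), and the radicals
of parabolic subgroups (`IsSplitBNPair.pRadical_stdParabolic`). -/

theorem T_le_B : D.T ≤ D.B := inf_le_left

theorem T_le_N : D.T ≤ D.N := inf_le_right

theorem conjSub_mul (g h : G) (H : Subgroup G) : conjSub (g * h) H = conjSub g (conjSub h H) := by
  ext x
  simp [mem_conjSub, mul_assoc]

theorem conjSub_one (H : Subgroup G) : conjSub 1 H = H := by
  ext x
  simp [mem_conjSub]

theorem IsSplitBNPair.conj_torus (hD : D.IsSplitBNPair p) {n t : G} (hn : n ∈ D.N)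
    (ht : t ∈ D.T) : n * t * n⁻¹ ∈ D.T := by
  have := hD.torus_normal n hn
  rw [← this]
  exact conj_mem_conjSub ht

theorem IsSplitBNPair.inv_conj_torus (hD : D.IsSplitBNPair p) {n t : G} (hn : n ∈ D.N)
    (ht : t ∈ D.T) : n⁻¹ * t * n ∈ D.T := by
  simpa using hD.conj_torus (inv_mem hn) ht

/-- Two elements of `N` that represent the same chamber. -/
def Eqv (D : BNData G) (x y : G) : Prop := x⁻¹ * y ∈ D.T

theorem Eqv.refl (x : G) : D.Eqv x x := by simp [Eqv, D.T.one_mem]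

theorem Eqv.symm {x y : G} (h : D.Eqv x y) : D.Eqv y x := by
  simpa [Eqv] using inv_mem (show x⁻¹ * y ∈ D.T from h)

theorem Eqv.trans {x y z : G} (h : D.Eqv x y) (h' : D.Eqv y z) : D.Eqv x z := by
  have := mul_mem (show x⁻¹ * y ∈ D.T from h) (show y⁻¹ * z ∈ D.T from h')
  simpa [Eqv, mul_assoc] using this

theorem Eqv.mul_left {x y : G} (z : G) (h : D.Eqv x y) : D.Eqv (z * x) (z * y) := by
  have : x⁻¹ * y ∈ D.T := h
  simpa [Eqv, mul_assoc] using this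

theorem Eqv.of_mul_left {x y z : G} (h : D.Eqv (z * x) (z * y)) : D.Eqv x y := by
  have := h.mul_left z⁻¹
  simpa using this

theorem Eqv.mul_torus (x : G) {t : G} (ht : t ∈ D.T) : D.Eqv x (x * t) := by
  simpa [Eqv] using ht

theorem Eqv.mul_right (hD : D.IsSplitBNPair p) {x y n : G} (hn : n ∈ D.N) (h : D.Eqv x y) :
    D.Eqv (x * n) (y * n) := by
  have := hD.inv_conj_torus hn (show x⁻¹ * y ∈ D.T from h)
  simpa [Eqv, mul_assoc] using this

theorem Eqv.torus_mul (hD : D.IsSplitBNPair p) {x t : G} (hx : x ∈ D.N) (ht : t ∈ D.T) :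
    D.Eqv x (t * x) := by
  have := hD.inv_conj_torus hx ht
  simpa [Eqv, mul_assoc] using this

theorem Eqv.mem_N {x y : G} (hx : x ∈ D.N) (h : D.Eqv x y) : y ∈ D.N := by
  have := mul_mem hx (T_le_N (show x⁻¹ * y ∈ D.T from h))
  simpa using this

/-- `g ∈ B n B` -/
def InDC (D : BNData G) (n g : G) : Prop := ∃ b ∈ D.B, ∃ b' ∈ D.B, g = b * n * b'

theorem inDC_iff {n g : G} :
    g ∈ DoubleCoset.doubleCoset n (D.B : Set G) (D.B : Set G) ↔ D.InDC n g := by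
  rw [DoubleCoset.mem_doubleCoset]
  rfl

theorem InDC.self (n : G) : D.InDC n n := ⟨1, D.B.one_mem, 1, D.B.one_mem, by simp⟩

theorem InDC.mul_left {n g b : G} (hb : b ∈ D.B) (h : D.InDC n g) : D.InDC n (b * g) := by
  obtain ⟨c, hc, c', hc', rfl⟩ := h
  exact ⟨b * c, mul_mem hb hc, c', hc', by group⟩

theorem InDC.mul_right {n g b : G} (hb : b ∈ D.B) (h : D.InDC n g) : D.InDC n (g * b) := by
  obtain ⟨c, hc, c', hc', rfl⟩ := h
  exact ⟨c, hc, c' * b, mul_mem hc' hb, by group⟩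

theorem InDC.symm {n g : G} (h : D.InDC n g) : D.InDC g n := by
  obtain ⟨c, hc, c', hc', rfl⟩ := h
  exact ⟨c⁻¹, inv_mem hc, c'⁻¹, inv_mem hc', by group⟩

theorem InDC.trans {n m g : G} (h : D.InDC n m) (h' : D.InDC m g) : D.InDC n g := by
  obtain ⟨c, hc, c', hc', rfl⟩ := h'
  exact (h.mul_left hc).mul_right hc'

theorem InDC.inv {n g : G} (h : D.InDC n g) : D.InDC n⁻¹ g⁻¹ := by
  obtain ⟨c, hc, c', hc', rfl⟩ := h
  exact ⟨c'⁻¹, inv_mem hc', c⁻¹, inv_mem hc, by group⟩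

theorem Eqv.inDC {x y : G} (h : D.Eqv x y) : D.InDC x y :=
  ⟨1, D.B.one_mem, x⁻¹ * y, T_le_B h, by group⟩

theorem InDC.mem_B {n g : G} (h : D.InDC n g) (hn : n ∈ D.B) : g ∈ D.B := by
  obtain ⟨c, hc, c', hc', rfl⟩ := h
  exact mul_mem (mul_mem hc hn) hc'

theorem IsSplitBNPair.exchange_left (hD : D.IsSplitBNPair p) {s n g : G} (hs : s ∈ D.S)
    (hn : n ∈ D.N) (hg : D.InDC n g) : D.InDC (s * n) (s * g) ∨ D.InDC n (s * g) := by
  obtain ⟨c, hc, c', hc', rfl⟩ := hg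
  rcases hD.exchange s hs n hn c hc with h | h
  · left
    have := (inDC_iff.1 h).mul_right hc'
    simpa [mul_assoc] using this
  · right
    have := (inDC_iff.1 h).mul_right hc'
    simpa [mul_assoc] using this

theorem IsSplitBNPair.S_inv (hD : D.IsSplitBNPair p) {s : G} (hs : s ∈ D.S) : D.Eqv s s⁻¹ := by
  have := inv_mem (hD.S_sq s hs)
  simpa [Eqv] using this

theorem IsSplitBNPair.inDC_S_inv_mul (hD : D.IsSplitBNPair p) {s n g : G} (hs : s ∈ D.S)
    (hn : n ∈ D.N) : D.InDC (s * n) g ↔ D.InDC (s⁻¹ * n) g := by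
  have h := (Eqv.mul_right hD hn (hD.S_inv hs))
  exact ⟨fun h' => h.symm.inDC.trans h', fun h' => h.inDC.trans h'⟩

theorem IsSplitBNPair.exchange_right (hD : D.IsSplitBNPair p) {s n g : G} (hs : s ∈ D.S)
    (hn : n ∈ D.N) (hg : D.InDC n g) : D.InDC (n * s) (g * s) ∨ D.InDC n (g * s) := by
  have hsN := hD.S_subset s hs
  have h1 : D.InDC (s⁻¹ * n⁻¹) (s⁻¹ * g⁻¹) ∨ D.InDC n⁻¹ (s⁻¹ * g⁻¹) := by
    have hss : s⁻¹ * s⁻¹ ∈ D.B := T_le_B (by simpa using inv_mem (hD.S_sq s hs))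
    have h2 := hD.exchange_left hs (inv_mem hn) (hg.inv.mul_left hss)
    rw [hD.inDC_S_inv_mul hs (inv_mem hn)] at h2
    simpa [mul_assoc] using h2
  rcases h1 with h | h
  · left; simpa using h.inv
  · right; simpa using h.inv

/-- In this form the condition applies to every element of `BnB`, not only to those of the form `b
n`. -/
theorem IsSplitBNPair.mem_simpleRoot (hD : D.IsSplitBNPair p) {s n : G} :
    n ∈ D.simpleRoot s ↔ n ∈ D.N ∧ ∀ g, D.InDC n g → D.InDC (s * n) (s * g) := by
  constructor
  · rintro ⟨hn, h⟩
    refine ⟨hn, ?_⟩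
    rintro _ ⟨c, hc, c', hc', rfl⟩
    have := (inDC_iff.1 (h c hc)).mul_right hc'
    simpa [mul_assoc] using this
  · rintro ⟨hn, h⟩
    refine ⟨hn, fun b hb => inDC_iff.2 ?_⟩
    have := h (b * n) ((InDC.self n).mul_left hb)
    simpa [mul_assoc] using this

/-! ### Word length -/

theorem IsSplitBNPair.stdN_le (hD : D.IsSplitBNPair p) {J : Set G} (hJ : J ⊆ D.S) : D.stdN J ≤ D.N := by
  rw [stdN, Subgroup.closure_le]
  rintro x (hx | hx)
  · exact T_le_N hx
  · exact hD.S_subset x (hJ hx)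

theorem T_le_stdN (J : Set G) : D.T ≤ D.stdN J := fun _ ht =>
  Subgroup.subset_closure (Or.inl ht)

theorem subset_stdN (J : Set G) : J ⊆ D.stdN J := fun _ ht =>
  Subgroup.subset_closure (Or.inr ht)

theorem stdN_mono {J I : Set G} (h : J ⊆ I) : D.stdN J ≤ D.stdN I :=
  Subgroup.closure_mono (Set.union_subset_union_right _ h)

theorem stdN_S (hD : D.IsSplitBNPair p) : D.stdN D.S = D.N := hD.S_generates

theorem prod_mem_stdN {J : Set G} {l : List G} (hl : ∀ s ∈ l, s ∈ J) : l.prod ∈ D.stdN J :=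
  Subgroup.list_prod_mem _ fun s hs => subset_stdN J (hl s hs)

theorem IsSplitBNPair.exists_word (hD : D.IsSplitBNPair p) {J : Set G} (hJ : J ⊆ D.S) {n : G}
    (hn : n ∈ D.stdN J) : ∃ l : List G, (∀ s ∈ l, s ∈ J) ∧ D.Eqv l.prod n := by
  have key : ∀ s ∈ J, ∀ y, (∃ l : List G, (∀ s ∈ l, s ∈ J) ∧ D.Eqv l.prod y) →
      ∃ l : List G, (∀ s ∈ l, s ∈ J) ∧ D.Eqv l.prod (s * y) := by
    rintro s hs y ⟨l, hl, h⟩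
    refine ⟨s :: l, by simpa using ⟨hs, hl⟩, ?_⟩
    simpa using h.mul_left s
  have keyT : ∀ t ∈ D.T, ∀ y, (∃ l : List G, (∀ s ∈ l, s ∈ J) ∧ D.Eqv l.prod y) →
      ∃ l : List G, (∀ s ∈ l, s ∈ J) ∧ D.Eqv l.prod (t * y) := by
    rintro t ht y ⟨l, hl, h⟩
    exact ⟨l, hl, h.trans (Eqv.torus_mul hD
      (h.mem_N (hD.stdN_le hJ (prod_mem_stdN hl))) ht)⟩
  induction hn using Subgroup.closure_induction_left with
  | one => exact ⟨[], by simp, by simpa using Eqv.refl 1⟩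
  | mul_left x hx y hy ih =>
    rcases hx with hx | hx
    · exact keyT x hx y ih
    · exact key x hx y ih
  | inv_mul_cancel x hx y hy ih =>
    rcases hx with hx | hx
    · exact keyT _ (inv_mem hx) y ih
    -- `x⁻¹ = x (x x)⁻¹`, and `x x` lies in the torus.
    · have := key x hx _ (keyT _ (inv_mem (hD.S_sq x (hJ hx))) y ih)
      simpa [mul_assoc] using this

/-- The word length of (the image in the Weyl group of) `n` with respect to `J`. -/
def len (D : BNData G) (J : Set G) (n : G) : ℕ :=
  sInf {m | ∃ l : List G, (∀ s ∈ l, s ∈ J) ∧ D.Eqv l.prod n ∧ l.length = m}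

theorem IsSplitBNPair.exists_reduced (hD : D.IsSplitBNPair p) {J : Set G} (hJ : J ⊆ D.S) {n : G}
    (hn : n ∈ D.stdN J) :
    ∃ l : List G, (∀ s ∈ l, s ∈ J) ∧ D.Eqv l.prod n ∧ l.length = D.len J n := by
  obtain ⟨l, hl, h⟩ := hD.exists_word hJ hn
  exact Nat.sInf_mem (s := {m | ∃ l : List G, (∀ s ∈ l, s ∈ J) ∧ D.Eqv l.prod n ∧ l.length = m})
    ⟨_, l, hl, h, rfl⟩

theorem len_le {J : Set G} {n : G} {l : List G} (hl : ∀ s ∈ l, s ∈ J) (h : D.Eqv l.prod n) :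
    D.len J n ≤ l.length := Nat.sInf_le ⟨l, hl, h, rfl⟩

theorem len_congr {J : Set G} {n m : G} (h : D.Eqv n m) : D.len J n = D.len J m := by
  unfold len
  congr 1
  ext k
  constructor
  · rintro ⟨l, hl, h', rfl⟩
    exact ⟨l, hl, h'.trans h, rfl⟩
  · rintro ⟨l, hl, h', rfl⟩
    exact ⟨l, hl, h'.trans h.symm, rfl⟩

theorem IsSplitBNPair.len_mul_le (hD : D.IsSplitBNPair p) {s n : G} (hs : s ∈ D.S)
    (hn : n ∈ D.N) : D.len D.S (s * n) ≤ D.len D.S n + 1 := by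
  obtain ⟨l, hl, h, h'⟩ := hD.exists_reduced le_rfl ((stdN_S hD).symm ▸ hn)
  have := len_le (D := D) (J := D.S) (n := s * n) (l := s :: l) (by simpa using ⟨hs, hl⟩)
    (by simpa using h.mul_left s)
  simpa [h'] using this

theorem IsSplitBNPair.S_mul_S_mul (hD : D.IsSplitBNPair p) {s n : G} (hs : s ∈ D.S)
    (hn : n ∈ D.N) : D.Eqv n (s * (s * n)) := by
  rw [← mul_assoc]
  exact Eqv.torus_mul hD hn (hD.S_sq s hs)

theorem IsSplitBNPair.len_le_mul (hD : D.IsSplitBNPair p) {s n : G} (hs : s ∈ D.S)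
    (hn : n ∈ D.N) : D.len D.S n ≤ D.len D.S (s * n) + 1 := by
  rw [len_congr (hD.S_mul_S_mul hs hn)]
  exact hD.len_mul_le hs (mul_mem (hD.S_subset s hs) hn)

theorem IsSplitBNPair.exists_left_factor (hD : D.IsSplitBNPair p) {n : G} (hn : n ∈ D.N)
    (h0 : D.len D.S n ≠ 0) :
    ∃ s ∈ D.S, ∃ m ∈ D.N, D.Eqv (s * m) n ∧ D.len D.S m + 1 = D.len D.S n := by
  obtain ⟨l, hl, h, h'⟩ := hD.exists_reduced le_rfl ((stdN_S hD).symm ▸ hn)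
  cases l with
  | nil => exact absurd h'.symm (by simpa using h0)
  | cons s l =>
    have hs : s ∈ D.S := hl s (by simp)
    have hl' : ∀ x ∈ l, x ∈ D.S := fun x hx => hl x (by simp [hx])
    have hm : l.prod ∈ D.N := (stdN_S hD) ▸ prod_mem_stdN hl'
    refine ⟨s, hs, l.prod, hm, by simpa using h, ?_⟩
    have h1 := len_le (D := D) hl' (Eqv.refl _)
    have h2 := hD.len_mul_le hs hm
    rw [len_congr (show D.Eqv (s * l.prod) n by simpa using h)] at h2
    simp at h'
    omega

theorem IsSplitBNPair.exists_right_factor (hD : D.IsSplitBNPair p) {n : G} (hn : n ∈ D.N)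
    (h0 : D.len D.S n ≠ 0) :
    ∃ s ∈ D.S, ∃ m ∈ D.N, D.Eqv (m * s) n ∧ D.len D.S m + 1 ≤ D.len D.S n := by
  obtain ⟨l, hl, h, h'⟩ := hD.exists_reduced le_rfl ((stdN_S hD).symm ▸ hn)
  induction l using List.reverseRecOn with
  | nil => exact absurd h'.symm (by simpa using h0)
  | append_singleton l s _ =>
    have hs : s ∈ D.S := hl s (by simp)
    have hl' : ∀ x ∈ l, x ∈ D.S := fun x hx => hl x (by simp [hx])
    have hm : l.prod ∈ D.N := (stdN_S hD) ▸ prod_mem_stdN hl'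
    refine ⟨s, hs, l.prod, hm, by simpa using h, ?_⟩
    have h1 := len_le (D := D) hl' (Eqv.refl _)
    simp at h'
    omega

theorem eqv_one_of_len_eq_zero (hD : D.IsSplitBNPair p) {n : G} (hn : n ∈ D.N)
    (h0 : D.len D.S n = 0) : n ∈ D.T := by
  obtain ⟨l, hl, h, h'⟩ := hD.exists_reduced le_rfl ((stdN_S hD).symm ▸ hn)
  rw [h0, List.length_eq_zero_iff] at h'
  subst h'
  simpa [Eqv] using h

/-- Uniqueness in the Bruhat decomposition. -/
theorem IsSplitBNPair.eqv_of_inDC (hD : D.IsSplitBNPair p) {n m : G} (hn : n ∈ D.N)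
    (hm : m ∈ D.N) (h : D.InDC n m) : D.Eqv n m := by
  suffices H : ∀ k, ∀ n ∈ D.N, ∀ m ∈ D.N, D.InDC n m → D.len D.S n = k → k ≤ D.len D.S m →
      D.Eqv n m by
    rcases le_total (D.len D.S n) (D.len D.S m) with h' | h'
    · exact H _ n hn m hm h rfl h'
    · exact (H _ m hm n hn h.symm rfl h').symm
  intro k
  induction k with
  | zero =>
    intro n hn m hm h hk _
    have hnT := eqv_one_of_len_eq_zero hD hn hk
    have : m ∈ D.T := ⟨h.mem_B (T_le_B hnT), hm⟩
    exact mul_mem (inv_mem hnT) this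
  | succ k ih =>
    intro n hn m hm h hk hkm
    -- A first letter `s` is removed from the shorter element. The exchange condition then puts `n₁`
    -- into the double coset of `s m` or of `m`; the latter is excluded by length.
    obtain ⟨s, hs, n1, hn1, he, hl⟩ := hD.exists_left_factor hn (by omega)
    have hsN := hD.S_subset s hs
    have hl1 : D.len D.S n1 = k := by omega
    -- `s m` lies in `B n₁ B` or ...
    have h1 : D.InDC m (s * n1) := h.symm.trans he.symm.inDC
    have h2 := hD.exchange_left hs hm h1
    have h3 : D.InDC (s * (s * n1)) n1 := (hD.S_mul_S_mul hs hn1).symm.inDC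
    rcases h2 with h2 | h2
    · have h4 : D.Eqv n1 (s * m) := by
        refine ih n1 hn1 (s * m) (mul_mem hsN hm) (h2.trans h3).symm hl1 ?_
        have := hD.len_le_mul hs hm
        omega
      exact he.symm.trans ((h4.mul_left s).trans (hD.S_mul_S_mul hs hm).symm)
    · have h4 : D.Eqv n1 m := ih n1 hn1 m hm (h2.trans h3).symm hl1 (by omega)
      have := len_congr (J := D.S) h4
      omega

theorem IsSplitBNPair.S_notMem_B (hD : D.IsSplitBNPair p) {s : G} (hs : s ∈ D.S) : s ∉ D.B := by
  intro h
  refine hD.not_normalize s hs ?_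
  ext x
  rw [mem_conjSub]
  constructor
  · intro hx
    have := mul_mem (mul_mem h hx) (inv_mem h)
    simpa [mul_assoc] using this
  · intro hx
    exact mul_mem (mul_mem (inv_mem h) hx) h

theorem IsSplitBNPair.not_eqv_S_mul (hD : D.IsSplitBNPair p) {s n : G} (hs : s ∈ D.S)
    (hn : n ∈ D.N) : ¬ D.Eqv n (s * n) := by
  intro h
  have := hD.conj_torus hn (show n⁻¹ * (s * n) ∈ D.T from h)
  exact hD.S_notMem_B hs (T_le_B (by simpa [mul_assoc] using this))

/-- Induction on the length, with `n ~ m r` and `m` shorter. If `s g` lay in `BnB`, then removing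
`r` on the right and using the claim for `m` would produce an element of `BnB` that also lies in
`BsmrB` or `BsmB`. Uniqueness in the Bruhat decomposition then gives `s n ~ n` or `s n ~ m`, and the
latter contradicts the assumption on lengths. -/
theorem IsSplitBNPair.mem_simpleRoot_of_len (hD : D.IsSplitBNPair p) {s : G} (hs : s ∈ D.S)
    {n : G} (hn : n ∈ D.N) (h : D.len D.S n ≤ D.len D.S (s * n)) : n ∈ D.simpleRoot s := by
  have hsN := hD.S_subset s hs
  induction hk : D.len D.S n using Nat.strong_induction_on generalizing n with
  | _ k ih =>
  rw [hD.mem_simpleRoot]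
  refine ⟨hn, fun g hg => ?_⟩
  rcases Nat.eq_zero_or_pos k with h0 | h0
  · have hnT := eqv_one_of_len_eq_zero hD hn (hk.trans h0)
    have hgB := hg.mem_B (T_le_B hnT)
    exact ⟨1, D.B.one_mem, n⁻¹ * g, mul_mem (inv_mem (T_le_B hnT)) hgB, by group⟩
  · obtain ⟨r, hr, m, hm, he, hl⟩ := hD.exists_right_factor hn (by omega)
    have hrN := hD.S_subset r hr
    rcases hD.exchange_left hs hn hg with h1 | h1
    · exact h1
    exfalso
    have hsn := hD.len_mul_le hs hm
    have hlow : ∀ x ∈ D.N, D.len D.S (x * r) ≤ D.len D.S x + 1 := by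
      intro x hx
      obtain ⟨l, hl, h, h'⟩ := hD.exists_reduced le_rfl ((stdN_S hD).symm ▸ hx)
      have := len_le (D := D) (J := D.S) (n := x * r) (l := l ++ [r])
        (by
          intro y hy
          simp at hy
          rcases hy with hy | rfl
          · exact hl y hy
          · exact hr)
        (by simpa using Eqv.mul_right hD hrN h)
      simpa [h'] using this
    have h2 := hlow m hm
    rw [len_congr he] at h2
    have h3 := hlow (s * m) (mul_mem hsN hm)
    rw [mul_assoc, len_congr (he.mul_left s)] at h3
    have hmem := ih (D.len D.S m) (by omega) hm (by omega) rfl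
    rw [hD.mem_simpleRoot] at hmem
    -- `g = x r b` with `x ∈ B m B`
    obtain ⟨c, hc, c', hc', rfl⟩ := he.inDC.trans hg
    have h4 := hmem.2 (c * m) ((InDC.self m).mul_left hc)
    have h5 := hD.exchange_right hr (mul_mem hsN hm) h4
    have h6 : D.InDC n (s * (c * m) * r) := by
      have := h1.mul_right (inv_mem hc')
      simpa [mul_assoc] using this
    rcases h5 with h5 | h5
    · have h7 := hD.eqv_of_inDC (mul_mem (mul_mem hsN hm) hrN) hn (h5.trans h6.symm)
      rw [mul_assoc] at h7
      exact hD.not_eqv_S_mul hs hn (h7.symm.trans (he.mul_left s))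
    · have h7 := hD.eqv_of_inDC (mul_mem hsN hm) hn (h5.trans h6.symm)
      have h8 := len_congr (J := D.S) ((hD.S_mul_S_mul hs hm).trans (h7.mul_left s))
      omega

theorem simpleRoot_subset_N {s : G} : D.simpleRoot s ⊆ D.N := fun _ h => h.1

theorem IsSplitBNPair.mem_simpleRoot_or (hD : D.IsSplitBNPair p) {s : G} (hs : s ∈ D.S)
    {n : G} (hn : n ∈ D.N) : n ∈ D.simpleRoot s ∨ s * n ∈ D.simpleRoot s := by
  have hsN := hD.S_subset s hs
  rcases le_total (D.len D.S n) (D.len D.S (s * n)) with h | h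
  · exact Or.inl (hD.mem_simpleRoot_of_len hs hn h)
  · right
    refine hD.mem_simpleRoot_of_len hs (mul_mem hsN hn) ?_
    rwa [← len_congr (hD.S_mul_S_mul hs hn)]

theorem one_mem_simpleRoot (s : G) : (1 : G) ∈ D.simpleRoot s :=
  ⟨D.N.one_mem, fun b hb => inDC_iff.2 ⟨1, D.B.one_mem, b, hb, by simp⟩⟩

variable [Finite G]

theorem conjSub_eq_of_le {g : G} {H : Subgroup G} (h : conjSub g H ≤ H) : conjSub g H = H := by
  refine Subgroup.eq_of_le_of_card_ge h ?_
  rw [conjSub]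
  exact (Nat.card_congr (H.equivMapOfInjective _ (MulAut.conj g).injective).toEquiv).le

/-- As `s` does not normalize `B`, some `s b s` lies in `BsB`. The element `s b s n` would lie in
`BsnB` when read as `(s b s) n`, and in `BnB` when read as `s (b s n)`. -/
theorem IsSplitBNPair.not_mem_simpleRoot_and (hD : D.IsSplitBNPair p) {s : G} (hs : s ∈ D.S)
    {n : G} (h1 : n ∈ D.simpleRoot s) (h2 : s * n ∈ D.simpleRoot s) : False := by
  have hsN := hD.S_subset s hs
  have hn := h1.1
  rw [hD.mem_simpleRoot] at h1 h2
  -- there is `b` with `s b s ∈ B s B`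
  obtain ⟨b, hb, hbs⟩ : ∃ b ∈ D.B, D.InDC s (s * (b * s)) := by
    by_contra hcon
    push Not at hcon
    refine hD.not_normalize s hs (conjSub_eq_of_le ?_)
    intro x hx
    rw [mem_conjSub] at hx
    have h := hD.exchange_left hs hsN ((InDC.self s).mul_left hx)
    rcases h with h | h
    · have h' := h.mem_B (T_le_B (hD.S_sq s hs))
      have hss := inv_mem (T_le_B (hD.S_sq s hs))
      have := mul_mem h' hss
      simpa [mul_assoc] using this
    · exact absurd h (hcon _ hx)
  obtain ⟨c, hc, c', hc', he⟩ := hbs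
  have h3 : D.InDC (s * n) (s * (b * s) * n) := by
    rw [he]
    have := (h1.2 (c' * n) ((InDC.self n).mul_left hc')).mul_left hc
    simpa [mul_assoc] using this
  have h4 : D.InDC n (s * (b * s) * n) := by
    have := h2.2 (b * (s * n)) ((InDC.self _).mul_left hb)
    have := (hD.S_mul_S_mul hs hn).inDC.trans this
    simpa [mul_assoc] using this
  exact hD.not_eqv_S_mul hs hn (hD.eqv_of_inDC hn (mul_mem hsN hn) (h4.trans h3.symm))

theorem IsSplitBNPair.mul_mem_simpleRoot_iff (hD : D.IsSplitBNPair p) {s : G} (hs : s ∈ D.S)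
    {n : G} (hn : n ∈ D.N) : s * n ∈ D.simpleRoot s ↔ n ∉ D.simpleRoot s :=
  ⟨fun h h' => hD.not_mem_simpleRoot_and hs h' h, fun h => (hD.mem_simpleRoot_or hs hn).resolve_left h⟩

theorem IsSplitBNPair.simpleRoot_congr (hD : D.IsSplitBNPair p) {s x y : G}
    (h : D.Eqv x y) : x ∈ D.simpleRoot s ↔ y ∈ D.simpleRoot s := by
  suffices H : ∀ x y, D.Eqv x y → x ∈ D.simpleRoot s → y ∈ D.simpleRoot s from
    ⟨H x y h, H y x h.symm⟩
  intro x y h hx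
  rw [hD.mem_simpleRoot] at hx ⊢
  exact ⟨h.mem_N hx.1, fun g hg => (h.mul_left s).symm.inDC.trans (hx.2 g (h.inDC.trans hg))⟩

/-- If passing from `n` to the adjacent chamber `n q` leaves the half-space of `α_r`, then
the reflection `r` interchanges the two chambers. -/
theorem IsSplitBNPair.eqv_of_leaves (hD : D.IsSplitBNPair p) {r q n : G} (hr : r ∈ D.S)
    (hq : q ∈ D.S) (h1 : n ∈ D.simpleRoot r) (h2 : n * q ∉ D.simpleRoot r) :
    D.Eqv (r * n) (n * q) := by
  have hn := h1.1
  have hrN := hD.S_subset r hr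
  have hqN := hD.S_subset q hq
  have hnq := mul_mem hn hqN
  rw [hD.mem_simpleRoot] at h1
  obtain ⟨g, hg, hg'⟩ : ∃ g, D.InDC (n * q) g ∧ D.InDC (n * q) (r * g) := by
    by_contra hcon
    push Not at hcon
    exact h2 (hD.mem_simpleRoot.2 ⟨hnq, fun g hg =>
      (hD.exchange_left hr hnq hg).resolve_right (hcon g hg)⟩)
  obtain ⟨c, hc, c', hc', rfl⟩ := hg
  have h3 := h1.2 (c * n) ((InDC.self n).mul_left hc)
  have h4 := hD.exchange_right hq (mul_mem hrN hn) h3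
  have h5 : D.InDC (n * q) (r * (c * n) * q) := by
    have := hg'.mul_right (inv_mem hc')
    simpa [mul_assoc] using this
  rcases h4 with h4 | h4
  · have := hD.eqv_of_inDC hnq (mul_mem (mul_mem hrN hn) hqN) (h5.trans h4.symm)
    rw [mul_assoc] at this
    exact absurd this (hD.not_eqv_S_mul hr hnq)
  · exact hD.eqv_of_inDC (mul_mem hrN hn) hnq (h4.trans h5.symm)

end Bruhat

end BNData
end HarishChandra

namespace HarishChandra
namespace BNData

/-! ### Roots, reflections and the separation distance -/

section Roots

variable {G : Type v} [Group G] {D : BNData G} {p : ℕ}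

theorem mem_smul_set {x y : G} {a : Set G} : y ∈ x • a ↔ x⁻¹ * y ∈ a := by
  rw [Set.mem_smul_set_iff_inv_smul_mem, smul_eq_mul]

theorem smul_simpleRoot_mem_roots {x s : G} (hx : x ∈ D.N) (hs : s ∈ D.S) :
    x • D.simpleRoot s ∈ D.roots := ⟨x, hx, s, hs, rfl⟩

theorem smul_mem_roots {x : G} {a : Set G} (hx : x ∈ D.N) (ha : a ∈ D.roots) :
    x • a ∈ D.roots := by
  obtain ⟨y, hy, s, hs, rfl⟩ := ha
  exact ⟨x * y, mul_mem hx hy, s, hs, by rw [smul_smul]⟩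

theorem root_subset_N {a : Set G} (ha : a ∈ D.roots) : a ⊆ D.N := by
  obtain ⟨y, hy, s, hs, rfl⟩ := ha
  intro x hx
  rw [mem_smul_set] at hx
  simpa using mul_mem hy (simpleRoot_subset_N hx)

theorem self_mem_smul_simpleRoot (x s : G) : x ∈ x • D.simpleRoot s := by
  rw [mem_smul_set]
  simpa using one_mem_simpleRoot s

variable [Finite G]

theorem IsSplitBNPair.root_congr (hD : D.IsSplitBNPair p) {a : Set G} (ha : a ∈ D.roots) {x y : G}
    (h : D.Eqv x y) : x ∈ a ↔ y ∈ a := by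
  obtain ⟨z, hz, s, hs, rfl⟩ := ha
  rw [mem_smul_set, mem_smul_set]
  exact hD.simpleRoot_congr (h.mul_left _)

theorem IsSplitBNPair.refl_mul_mem_iff (hD : D.IsSplitBNPair p) {x s y : G} (hx : x ∈ D.N)
    (hs : s ∈ D.S) (hy : y ∈ D.N) :
    x * s * x⁻¹ * y ∈ x • D.simpleRoot s ↔ y ∉ x • D.simpleRoot s := by
  rw [mem_smul_set, mem_smul_set, ← hD.mul_mem_simpleRoot_iff hs (mul_mem (inv_mem hx) hy)]
  simp [mul_assoc]

theorem IsSplitBNPair.S_notMem_simpleRoot (hD : D.IsSplitBNPair p) {s : G} (hs : s ∈ D.S) :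
    s ∉ D.simpleRoot s := by
  have := (hD.mul_mem_simpleRoot_iff hs D.N.one_mem).not
  rw [mul_one, not_not] at this
  exact this.2 (one_mem_simpleRoot s)

theorem IsSplitBNPair.mul_notMem (hD : D.IsSplitBNPair p) {x s : G}
    (hs : s ∈ D.S) : x * s ∉ x • D.simpleRoot s := by
  rw [mem_smul_set]
  simpa using hD.S_notMem_simpleRoot hs

theorem IsSplitBNPair.refl_mem (hD : D.IsSplitBNPair p) {x s : G} (hx : x ∈ D.N) (hs : s ∈ D.S) :
    x * s * x⁻¹ ∈ D.N := mul_mem (mul_mem hx (hD.S_subset s hs)) (inv_mem hx)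

theorem IsSplitBNPair.refl_refl (hD : D.IsSplitBNPair p) {x s y : G} (hx : x ∈ D.N) (hs : s ∈ D.S)
    (hy : y ∈ D.N) : D.Eqv y (x * s * x⁻¹ * (x * s * x⁻¹ * y)) := by
  have := Eqv.torus_mul hD hy (hD.conj_torus hx (hD.S_sq s hs))
  convert this using 1
  group

/-- Makes negatives of roots into roots, so that a statement about one side of a wall can be applied
to the other side from the adjacent chamber `x s`. -/
theorem IsSplitBNPair.compl_root_aux (hD : D.IsSplitBNPair p) {x s : G} (hx : x ∈ D.N)
    (hs : s ∈ D.S) : (D.N : Set G) \ (x • D.simpleRoot s) = (x * s) • D.simpleRoot s := by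
  have hsN := hD.S_subset s hs
  ext y
  rw [Set.mem_sdiff, mem_smul_set]
  by_cases hy : y ∈ D.N
  · have hxy := mul_mem (inv_mem hx) hy
    have h1 : D.Eqv (s * (x⁻¹ * y)) ((x * s)⁻¹ * y) := by
      have := Eqv.mul_right hD hxy (hD.S_inv hs)
      convert this using 1
      group
    rw [mem_smul_set, ← hD.simpleRoot_congr h1, hD.mul_mem_simpleRoot_iff hs hxy]
    simp [hy]
  · refine iff_of_false (fun h => hy h.1) fun h => hy ?_
    exact root_subset_N (smul_simpleRoot_mem_roots (mul_mem hx hsN) hs) h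

theorem IsSplitBNPair.compl_mem_roots (hD : D.IsSplitBNPair p) {a : Set G} (ha : a ∈ D.roots) :
    (D.N : Set G) \ a ∈ D.roots := by
  obtain ⟨x, hx, s, hs, rfl⟩ := ha
  rw [hD.compl_root_aux hx hs]
  exact smul_simpleRoot_mem_roots (mul_mem hx (hD.S_subset s hs)) hs

theorem IsSplitBNPair.refl_eqv_of_leaves (hD : D.IsSplitBNPair p) {x s y q : G} (hx : x ∈ D.N)
    (hs : s ∈ D.S) (hq : q ∈ D.S) (h1 : y ∈ x • D.simpleRoot s)
    (h2 : y * q ∉ x • D.simpleRoot s) : D.Eqv (x * s * x⁻¹ * y) (y * q) := by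
  rw [mem_smul_set] at h1 h2
  have := (hD.eqv_of_leaves hs hq h1 (by rwa [mul_assoc])).mul_left x
  simpa [mul_assoc] using this

theorem IsSplitBNPair.refl_eqv (hD : D.IsSplitBNPair p) {x s y q : G} (hx : x ∈ D.N)
    (hs : s ∈ D.S) (hy : y ∈ D.N) (hq : q ∈ D.S)
    (h : ¬ (y ∈ x • D.simpleRoot s ↔ y * q ∈ x • D.simpleRoot s)) :
    D.Eqv (x * s * x⁻¹ * y) (y * q) := by
  by_cases h1 : y ∈ x • D.simpleRoot s
  · exact hD.refl_eqv_of_leaves hx hs hq h1 (fun h2 => h (by simp [h1, h2]))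
  · have h2 : y * q ∈ x • D.simpleRoot s := by
      by_contra h2
      exact h (by simp [h1, h2])
    have hr := smul_simpleRoot_mem_roots (D := D) hx hs
    have h3 : y * q * q ∉ x • D.simpleRoot s := by
      rw [← hD.root_congr hr (by
        rw [mul_assoc]; exact Eqv.mul_torus y (hD.S_sq q hq))]
      exact h1
    have h4 := hD.refl_eqv_of_leaves hx hs hq h2 h3
    have h5 : D.Eqv (x * s * x⁻¹ * (y * q)) y := h4.trans (by
      rw [mul_assoc]; exact (Eqv.mul_torus y (hD.S_sq q hq)).symm)
    have h6 := h5.mul_left (x * s * x⁻¹)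
    exact (((hD.refl_refl hx hs (mul_mem hy (hD.S_subset q hq)))).trans h6).symm

/-- The Weyl group acts freely on the chambers: two elements that agree on one chamber agree on all
of them. -/
theorem IsSplitBNPair.smul_eqv_of_eqv (hD : D.IsSplitBNPair p) {t t' y z : G} (hy : y ∈ D.N)
    (hz : z ∈ D.N) (h : D.Eqv (t * y) (t' * y)) : D.Eqv (t * z) (t' * z) := by
  have := Eqv.mul_right hD (mul_mem (inv_mem hy) hz) h
  simpa [mul_assoc] using this

/-- A root is determined by any pair of adjacent chambers that it separates. -/
theorem IsSplitBNPair.root_eq (hD : D.IsSplitBNPair p) {a : Set G} (ha : a ∈ D.roots) {y q : G}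
    (hq : q ∈ D.S) (h1 : y ∈ a) (h2 : y * q ∉ a) : a = y • D.simpleRoot q := by
  have hy : y ∈ D.N := root_subset_N ha h1
  obtain ⟨x, hx, s, hs, rfl⟩ := ha
  have hr := smul_simpleRoot_mem_roots (D := D) hx hs
  have hr' := smul_simpleRoot_mem_roots (D := D) hy hq
  -- Both reflections exchange the chambers `y` and `y q`, so they are the same element of the Weyl
  -- group.
  have htt : ∀ z ∈ D.N, D.Eqv (x * s * x⁻¹ * z) (y * q * y⁻¹ * z) := fun z hz =>
    hD.smul_eqv_of_eqv hy hz (by simpa using hD.refl_eqv_of_leaves hx hs hq h1 h2)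
  -- Along a gallery, both half-spaces are left or entered at the same steps: a step crosses either
  -- wall only if the common reflection exchanges its two chambers, and then it crosses both.
  have key : ∀ l : List G, (∀ r ∈ l, r ∈ D.S) → ∀ z ∈ D.N,
      (z ∈ x • D.simpleRoot s ↔ z ∈ y • D.simpleRoot q) →
      (z * l.prod ∈ x • D.simpleRoot s ↔ z * l.prod ∈ y • D.simpleRoot q) := by
    intro l
    induction l with
    | nil => intro _ z _ h; simpa using h
    | cons r l ih =>
      intro hl z hz h
      have hrS := hl r (by simp)
      have hzr := mul_mem hz (hD.S_subset r hrS)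
      have := ih (fun x hx => hl x (by simp [hx])) (z * r) hzr ?_
      · simpa [mul_assoc] using this
      by_cases hc : z ∈ x • D.simpleRoot s ↔ z * r ∈ x • D.simpleRoot s
      · by_cases hc' : z ∈ y • D.simpleRoot q ↔ z * r ∈ y • D.simpleRoot q
        · rw [← hc, ← hc', h]
        · have e := (htt z hz).trans (hD.refl_eqv hy hq hz hrS hc').symm.symm
          have e' := hD.root_congr hr e
          rw [hD.refl_mul_mem_iff hx hs hz, ← hc] at e'
          exact absurd e' (by tauto)
      · have e := hD.refl_eqv hx hs hz hrS hc
        have e1 := hD.root_congr hr e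
        have e2 := hD.root_congr hr' ((htt z hz).symm.trans e)
        rw [hD.refl_mul_mem_iff hx hs hz] at e1
        rw [hD.refl_mul_mem_iff hy hq hz] at e2
        rw [← e1, ← e2, h]
  ext z
  have main : ∀ z ∈ D.N, (z ∈ x • D.simpleRoot s ↔ z ∈ y • D.simpleRoot q) := by
    intro z hz
    obtain ⟨l, hl, he⟩ := hD.exists_word (J := D.S) le_rfl (n := y⁻¹ * z)
      ((stdN_S hD).symm ▸ mul_mem (inv_mem hy) hz)
    have he' : D.Eqv (y * l.prod) z := by simpa using he.mul_left y
    rw [← hD.root_congr hr he', ← hD.root_congr hr' he']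
    exact key l hl y hy (by simp [h1, self_mem_smul_simpleRoot])
  exact ⟨fun h => (main z (root_subset_N hr h)).1 h, fun h => (main z (root_subset_N hr' h)).2 h⟩

/-- Two different chambers of a residue are separated by a wall of the first chamber. -/
theorem IsSplitBNPair.exists_step (hD : D.IsSplitBNPair p) {J : Set G} (hJ : J ⊆ D.S) {x y : G}
    (hxy : x⁻¹ * y ∈ D.stdN J) (h : ¬ D.Eqv x y) : ∃ s ∈ J, y ∉ x • D.simpleRoot s := by
  obtain ⟨l, hl, he, hlen⟩ := hD.exists_reduced hJ hxy
  cases l with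
  | nil => exact absurd (by simpa [Eqv] using he) h
  | cons s l =>
    have hsJ := hl s (by simp)
    have hs := hJ hsJ
    have hsN := hD.S_subset s hs
    refine ⟨s, hsJ, fun hy => ?_⟩
    rw [mem_smul_set, ← hD.simpleRoot_congr he] at hy
    -- If `y` were on the side of `x`, the gallery of the reduced word `s :: l` would cross the wall
    -- at its first step and cross it back later. Deleting these two letters gives a shorter word
    -- for the same chamber.
    have cross : ∀ l : List G, (∀ r ∈ l, r ∈ J) → ∀ m ∈ D.N, m ∉ D.simpleRoot s →
        m * l.prod ∈ D.simpleRoot s → ∃ l1 q l2, l = l1 ++ q :: l2 ∧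
          D.Eqv (s * (m * l1.prod)) (m * l1.prod * q) := by
      intro l
      induction l with
      | nil => intro _ m _ h1 h2; simp at h2; exact absurd h2 h1
      | cons r l ih =>
        intro hl m hm h1 h2
        have hrS := hJ (hl r (by simp))
        have hmr := mul_mem hm (hD.S_subset r hrS)
        by_cases h3 : m * r ∈ D.simpleRoot s
        · refine ⟨[], r, l, rfl, ?_⟩
          have := hD.refl_eqv (x := 1) (D.N.one_mem) hs hm hrS (by simp [h1, h3])
          simpa using this
        · obtain ⟨l1, q, l2, rfl, e⟩ := ih (fun x hx => hl x (by simp [hx])) (m * r) hmr h3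
            (by simpa [mul_assoc] using h2)
          exact ⟨r :: l1, q, l2, rfl, by simpa [mul_assoc] using e⟩
    obtain ⟨l1, q, l2, rfl, e⟩ := cross l (fun x hx => hl x (by simp [hx])) s hsN
      (hD.S_notMem_simpleRoot hs) (by simpa using hy)
    have hl1 : ∀ r ∈ l1, r ∈ J := fun r hr => hl r (by simp [hr])
    have hl2 : ∀ r ∈ l2, r ∈ J := fun r hr => hl r (by simp [hr])
    have hN1 := hD.stdN_le hJ (prod_mem_stdN hl1)
    have hN2 := hD.stdN_le hJ (prod_mem_stdN hl2)
    have e2 : D.Eqv l1.prod (s * l1.prod * q) := (hD.S_mul_S_mul hs hN1).trans e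
    have e3 := Eqv.mul_right hD hN2 e2
    have e4 : D.Eqv (l1 ++ l2).prod (x⁻¹ * y) := by
      refine Eqv.trans ?_ he
      simpa [mul_assoc] using e3
    have := len_le (D := D) (J := J) (l := l1 ++ l2) (by
      intro r hr
      rcases List.mem_append.1 hr with hr | hr
      · exact hl1 r hr
      · exact hl2 r hr) e4
    simp at this hlen
    omega

/-- The roots that contain `x` but not `y`. -/
def sep (D : BNData G) (x y : G) : Set (Set G) := {a | a ∈ D.roots ∧ x ∈ a ∧ y ∉ a}

/-- The gallery distance of two chambers: the number of roots that contain the first one but not the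
second one. -/
def dist (D : BNData G) (x y : G) : ℕ := (D.sep x y).ncard

theorem IsSplitBNPair.sep_congr (hD : D.IsSplitBNPair p) {x x' y y' : G} (h : D.Eqv x x')
    (h' : D.Eqv y y') : D.sep x y = D.sep x' y' := by
  ext a
  refine and_congr_right fun ha => ?_
  rw [hD.root_congr ha h, hD.root_congr ha h']

theorem IsSplitBNPair.dist_congr (hD : D.IsSplitBNPair p) {x x' y y' : G} (h : D.Eqv x x')
    (h' : D.Eqv y y') : D.dist x y = D.dist x' y' := by
  rw [dist, hD.sep_congr h h', dist]

theorem dist_triangle (x y z : G) : D.dist x z ≤ D.dist x y + D.dist y z := by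
  refine (Set.ncard_le_ncard ?_ (Set.toFinite _)).trans (Set.ncard_union_le _ _)
  rintro a ⟨ha, h1, h2⟩
  by_cases h : y ∈ a
  · exact Or.inr ⟨ha, h, h2⟩
  · exact Or.inl ⟨ha, h1, h⟩

theorem dist_smul {n : G} (hn : n ∈ D.N) (x y : G) : D.dist (n * x) (n * y) = D.dist x y := by
  have : D.sep (n * x) (n * y) = (fun a : Set G => n • a) '' D.sep x y := by
    ext a
    constructor
    · rintro ⟨ha, h1, h2⟩
      refine ⟨n⁻¹ • a, ⟨smul_mem_roots (inv_mem hn) ha, ?_, ?_⟩, by simp⟩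
      · rw [mem_smul_set]; simpa using h1
      · rw [mem_smul_set]; simpa using h2
    · rintro ⟨a, ⟨ha, h1, h2⟩, rfl⟩
      refine ⟨smul_mem_roots hn ha, ?_, ?_⟩
      · rw [mem_smul_set]; simpa using h1
      · rw [mem_smul_set]; simpa using h2
  rw [dist, this, Set.ncard_image_of_injective _ (MulAction.injective n), dist]

theorem IsSplitBNPair.dist_comm (hD : D.IsSplitBNPair p) {x y : G} (hx : x ∈ D.N) (hy : y ∈ D.N) :
    D.dist x y = D.dist y x := by
  have H : ∀ x ∈ D.N, ∀ y ∈ D.N, D.dist x y ≤ D.dist y x := by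
    intro x hx y hy
    refine Set.ncard_le_ncard_of_injOn (fun a => (D.N : Set G) \ a) ?_ ?_ (Set.toFinite _)
    · rintro a ⟨ha, h1, h2⟩
      exact ⟨hD.compl_mem_roots ha, ⟨hy, h2⟩, fun h => h.2 h1⟩
    · rintro a ⟨ha, -⟩ b ⟨hb, -⟩ h
      simp only at h
      rw [← Set.sdiff_sdiff_cancel_left (root_subset_N ha), h,
        Set.sdiff_sdiff_cancel_left (root_subset_N hb)]
  exact le_antisymm (H x hx y hy) (H y hy x hx)

theorem IsSplitBNPair.sep_mul (hD : D.IsSplitBNPair p) {x s : G} (hx : x ∈ D.N) (hs : s ∈ D.S) :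
    D.sep x (x * s) = {x • D.simpleRoot s} := by
  ext a
  constructor
  · rintro ⟨ha, h1, h2⟩
    exact hD.root_eq ha hs h1 h2
  · rintro rfl
    exact ⟨smul_simpleRoot_mem_roots hx hs, self_mem_smul_simpleRoot x s, hD.mul_notMem hs⟩

theorem IsSplitBNPair.dist_mul (hD : D.IsSplitBNPair p) {x s : G} (hx : x ∈ D.N) (hs : s ∈ D.S) :
    D.dist x (x * s) = 1 := by
  rw [dist, hD.sep_mul hx hs, Set.ncard_singleton]

theorem IsSplitBNPair.dist_step (hD : D.IsSplitBNPair p) {x s y : G} (hx : x ∈ D.N) (hy : y ∈ D.N)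
    (hs : s ∈ D.S)
    (h : y ∉ x • D.simpleRoot s) : D.dist (x * s) y < D.dist x y := by
  refine Set.ncard_lt_ncard ⟨?_, fun h' => ?_⟩ (Set.toFinite _)
  · rintro a ⟨ha, h1, h2⟩
    refine ⟨ha, ?_, h2⟩
    by_contra h3
    -- then the complement of `a` is the root of the edge
    have h4 := hD.root_eq (hD.compl_mem_roots ha) hs (y := x) ⟨hx, h3⟩ (fun h => h.2 h1)
    exact h (h4 ▸ ⟨hy, h2⟩)
  · have h1 : x • D.simpleRoot s ∈ D.sep x y :=
      ⟨smul_simpleRoot_mem_roots hx hs, self_mem_smul_simpleRoot x s, h⟩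
    exact hD.mul_notMem hs (h' h1).2.1

end Roots

end BNData
end HarishChandra

namespace HarishChandra
namespace BNData

/-! ### Faces -/

section Faces

variable {G : Type v} [Group G] {D : BNData G} {p : ℕ} [Finite G]

theorem IsSplitBNPair.dist_self_of_eqv (hD : D.IsSplitBNPair p) {x y : G} (h : D.Eqv x y) :
    D.dist x y = 0 := by
  rw [hD.dist_congr h (Eqv.refl y), dist, Set.ncard_eq_zero (Set.toFinite _)]
  ext a
  simp only [sep, Set.mem_ofPred_eq, Set.mem_empty_iff_false, iff_false]
  tauto

/-- Folding along a wall decreases distances. -/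
theorem IsSplitBNPair.dist_refl_lt (hD : D.IsSplitBNPair p) {z s : G} (hz : z ∈ D.N) (hs : s ∈ D.S)
    {x y : G} (hx : x ∈ z • D.simpleRoot s) (hy : y ∈ D.N) (hy' : y ∉ z • D.simpleRoot s) :
    D.dist x (z * s * z⁻¹ * y) < D.dist x y := by
  have hr := smul_simpleRoot_mem_roots (D := D) hz hs
  have ht := hD.refl_mem hz hs
  induction hk : D.dist x y using Nat.strong_induction_on generalizing x with
  | _ k ih =>
  have hxN := root_subset_N hr hx
  have hne : ¬ D.Eqv x y := fun h => hy' ((hD.root_congr hr h).1 hx)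
  -- A step from `x` towards `y` either stays in the half-space, where induction applies, or crosses
  -- the wall. In the second case `x q` is the mirror image of `x`, and reflecting the rest of the
  -- way gives the claim.
  obtain ⟨q, hq, hstep⟩ := hD.exists_step (J := D.S) le_rfl (x := x) (y := y)
    ((stdN_S hD).symm ▸ mul_mem (inv_mem hxN) hy) hne
  have hlt := hD.dist_step hxN hy hq hstep
  have hxq := mul_mem hxN (hD.S_subset q hq)
  by_cases h : x * q ∈ z • D.simpleRoot s
  · have h1 := ih _ (hk ▸ hlt) h rfl
    have h2 := dist_triangle (D := D) x (x * q) (z * s * z⁻¹ * y)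
    rw [hD.dist_mul hxN hq] at h2
    omega
  · have h1 := hD.refl_eqv_of_leaves hz hs hq hx h
    have h2 : D.dist x (z * s * z⁻¹ * y) = D.dist (x * q) y := by
      rw [← dist_smul ht, hD.dist_congr h1 (hD.refl_refl hz hs hy).symm]
    omega

theorem IsSplitBNPair.dist_refl_lt_compl (hD : D.IsSplitBNPair p) {z s : G} (hz : z ∈ D.N)
    (hs : s ∈ D.S) {x y : G} (hx : x ∈ D.N) (hx' : x ∉ z • D.simpleRoot s)
    (hy : y ∈ z • D.simpleRoot s) :
    D.dist x (z * s * z⁻¹ * y) < D.dist x y := by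
  have hr := smul_simpleRoot_mem_roots (D := D) hz hs
  have h := hD.dist_refl_lt (mul_mem hz (hD.S_subset s hs)) hs (x := x) (y := y)
    (by rw [← hD.compl_root_aux hz hs]; exact ⟨hx, hx'⟩) (root_subset_N hr hy)
    (by rw [← hD.compl_root_aux hz hs]; exact fun h => h.2 hy)
  simpa [mul_assoc] using h

/-- The residue of type `J` that contains the chamber `c`. -/
def face (D : BNData G) (c : G) (J : Set G) : Set G := {x | c⁻¹ * x ∈ D.stdN J}

/-- The wall of the root `a` cuts the face `F`. -/
def Cuts (a F : Set G) : Prop := (a ∩ F).Nonempty ∧ (F \ a).Nonempty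

theorem mem_face {c x : G} {J : Set G} : x ∈ D.face c J ↔ c⁻¹ * x ∈ D.stdN J := Iff.rfl

theorem self_mem_face (c : G) (J : Set G) : c ∈ D.face c J := by
  simp [mem_face, one_mem]

theorem face_eq {c x : G} {J : Set G} (h : x ∈ D.face c J) : D.face x J = D.face c J := by
  ext y
  rw [mem_face] at *
  rw [mem_face, show x⁻¹ * y = (c⁻¹ * x)⁻¹ * (c⁻¹ * y) by group]
  exact Subgroup.mul_mem_cancel_left _ (inv_mem h)

theorem face_mono {c : G} {J I : Set G} (h : J ⊆ I) : D.face c J ⊆ D.face c I :=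
  fun _ hx => stdN_mono h hx

theorem IsSplitBNPair.face_subset_N (hD : D.IsSplitBNPair p) {c : G} {J : Set G} (hc : c ∈ D.N)
    (hJ : J ⊆ D.S) : D.face c J ⊆ D.N := by
  intro x hx
  simpa using mul_mem hc (hD.stdN_le hJ hx)

theorem smul_face (n c : G) (J : Set G) : n • D.face c J = D.face (n * c) J := by
  ext x
  rw [mem_smul_set, mem_face, mem_face]
  simp [mul_assoc]

theorem mul_mem_face {c x s : G} {J : Set G} (hx : x ∈ D.face c J) (hs : s ∈ J) :
    x * s ∈ D.face c J := by
  rw [mem_face, ← mul_assoc]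
  exact mul_mem hx (subset_stdN J hs)

theorem eqv_mem_face {c x y : G} {J : Set G} (hx : x ∈ D.face c J) (h : D.Eqv x y) :
    y ∈ D.face c J := by
  have := mul_mem (show c⁻¹ * x ∈ D.stdN J from hx) (T_le_stdN J (show x⁻¹ * y ∈ D.T from h))
  simpa [mem_face, mul_assoc] using this

theorem face_singleton_S (hD : D.IsSplitBNPair p) {c : G} (hc : c ∈ D.N) :
    D.face c D.S = D.N := by
  ext x
  rw [mem_face, stdN_S hD]
  exact Subgroup.mul_mem_cancel_left _ (inv_mem hc)

theorem cuts_smul {n : G} {a F : Set G} : Cuts (n • a) (n • F) ↔ Cuts a F := by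
  rw [Cuts, ← Set.smul_set_inter, ← Set.smul_set_sdiff]
  simp [Cuts]

theorem Cuts.mono {a F E : Set G} (h : Cuts a F) (hFE : F ⊆ E) : Cuts a E :=
  ⟨h.1.mono (Set.inter_subset_inter_right _ hFE), h.2.mono (Set.sdiff_subset_sdiff_left hFE)⟩

theorem IsSplitBNPair.cuts_compl (hD : D.IsSplitBNPair p) {a F : Set G} (ha : a ∈ D.roots)
    (hF : F ⊆ D.N) : Cuts ((D.N : Set G) \ a) F ↔ Cuts a F := by
  have h1 : ((D.N : Set G) \ a) ∩ F = F \ a := by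
    ext x
    exact ⟨fun h => ⟨h.2, h.1.2⟩, fun h => ⟨⟨hF h.1, h.2⟩, h.1⟩⟩
  have h2 : F \ ((D.N : Set G) \ a) = a ∩ F := by
    ext x
    refine ⟨fun h => ⟨by_contra fun h' => h.2 ⟨hF h.1, h'⟩, h.1⟩, fun h => ⟨h.2, fun h' => h'.2 h.1⟩⟩
  rw [Cuts, h1, h2, Cuts, and_comm]

theorem subset_of_not_cuts {a F : Set G} {x : G} (h : ¬ Cuts a F) (hx : x ∈ F) (hxa : x ∈ a) :
    F ⊆ a := by
  intro y hy
  by_contra hya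
  exact h ⟨⟨x, hxa, hx⟩, ⟨y, hy, hya⟩⟩

theorem mem_iff_of_not_cuts {a F : Set G} {x y : G} (h : ¬ Cuts a F) (hx : x ∈ F) (hy : y ∈ F) :
    x ∈ a ↔ y ∈ a :=
  ⟨fun hxa => subset_of_not_cuts h hx hxa hy, fun hya => subset_of_not_cuts h hy hya hx⟩

theorem IsSplitBNPair.cuts_self (hD : D.IsSplitBNPair p) {c s : G} {J : Set G}
    (hs : s ∈ D.S) (hsJ : s ∈ J) : Cuts (c • D.simpleRoot s) (D.face c J) :=
  ⟨⟨c, self_mem_smul_simpleRoot c s, self_mem_face c J⟩,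
    ⟨c * s, mul_mem_face (self_mem_face c J) hsJ, hD.mul_notMem hs⟩⟩

/-- A root that cuts a face is the root of an edge of the face. -/
theorem IsSplitBNPair.exists_edge (hD : D.IsSplitBNPair p) {c : G} {J a : Set G} (hc : c ∈ D.N)
    (hJ : J ⊆ D.S) (ha : a ∈ D.roots) (h : Cuts a (D.face c J)) :
    ∃ z ∈ D.face c J, ∃ s ∈ J, z ∈ a ∧ z * s ∉ a ∧ a = z • D.simpleRoot s := by
  by_contra hcon
  push Not at hcon
  have key : ∀ l : List G, (∀ r ∈ l, r ∈ J) → ∀ z ∈ D.face c J, z ∈ a → z * l.prod ∈ a := by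
    intro l
    induction l with
    | nil => intro _ z _ h; simpa using h
    | cons r l ih =>
      intro hl z hz hza
      have hr := hl r (by simp)
      have : z * r ∈ a := by
        by_contra h'
        exact hcon z hz r hr hza h' (hD.root_eq ha (hJ hr) hza h')
      have := ih (fun x hx => hl x (by simp [hx])) (z * r) (mul_mem_face hz hr) this
      simpa [mul_assoc] using this
  obtain ⟨⟨x, hxa, hx⟩, ⟨y, hy, hya⟩⟩ := h
  obtain ⟨l, hl, he⟩ := hD.exists_word hJ (n := x⁻¹ * y) (by
    rw [← face_eq hx] at hy; exact hy)
  have h1 := key l hl x hx hxa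
  rw [hD.root_congr ha (by simpa using he.mul_left x)] at h1
  exact hya h1

/-- The reflection of a root that cuts a face stabilizes the face. -/
theorem IsSplitBNPair.refl_smul_face (hD : D.IsSplitBNPair p) {c x s : G} {J : Set G}
    (hc : c ∈ D.N) (hJ : J ⊆ D.S) (hx : x ∈ D.N) (hs : s ∈ D.S)
    (h : Cuts (x • D.simpleRoot s) (D.face c J)) :
    (x * s * x⁻¹) • D.face c J = D.face c J := by
  obtain ⟨z, hz, q, hq, hza, hzq, -⟩ := hD.exists_edge hc hJ (smul_simpleRoot_mem_roots hx hs) h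
  rw [← face_eq hz, smul_face]
  refine face_eq ?_
  have h1 := hD.refl_eqv_of_leaves hx hs (hJ hq) hza hzq
  exact eqv_mem_face (mul_mem_face (self_mem_face z J) hq) h1.symm

/-- The chambers of a face are determined by the roots that cut the face. -/
theorem IsSplitBNPair.eqv_of_face (hD : D.IsSplitBNPair p) {c x y : G} {J : Set G}
    (hc : c ∈ D.N) (hJ : J ⊆ D.S) (hx : x ∈ D.face c J) (hy : y ∈ D.face c J)
    (h : ∀ a ∈ D.roots, Cuts a (D.face c J) → x ∈ a → y ∈ a) : D.Eqv x y := by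
  by_contra hne
  have hxN := hD.face_subset_N hc hJ hx
  rw [← face_eq hx] at hy
  obtain ⟨s, hs, h'⟩ := hD.exists_step hJ hy hne
  refine h' (h _ (smul_simpleRoot_mem_roots hxN (hJ hs)) ?_ (self_mem_smul_simpleRoot x s))
  rw [← face_eq hx]
  exact hD.cuts_self (hJ hs) hs

theorem IsSplitBNPair.eqv_of_roots (hD : D.IsSplitBNPair p) {x y : G}
    (hx : x ∈ D.N) (hy : y ∈ D.N) (h : ∀ a ∈ D.roots, x ∈ a → y ∈ a) : D.Eqv x y := by
  have hf := face_singleton_S hD D.N.one_mem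
  exact hD.eqv_of_face D.N.one_mem le_rfl (hf.symm ▸ hx) (hf.symm ▸ hy) fun a ha _ => h a ha

/-- The projection of a chamber to a face. -/
theorem IsSplitBNPair.exists_proj (hD : D.IsSplitBNPair p) {c : G} {J : Set G} (hc : c ∈ D.N)
    (hJ : J ⊆ D.S) {x : G} (hx : x ∈ D.N) :
    ∃ y ∈ D.face c J, ∀ a ∈ D.roots, Cuts a (D.face c J) → (x ∈ a ↔ y ∈ a) := by
  -- The projection is a chamber of the face closest to `x`: if a root that cuts the face separated
  -- the two, the mirror image of `y` would lie in the face and be closer.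
  obtain ⟨y, hy, hmin⟩ := Set.exists_min_image (D.face c J) (D.dist x) (Set.toFinite _)
    ⟨c, self_mem_face c J⟩
  refine ⟨y, hy, fun a ha hcut => ?_⟩
  have hyN := hD.face_subset_N hc hJ hy
  obtain ⟨z, hz, s, hs, -, -, rfl⟩ := hD.exists_edge hc hJ ha hcut
  have hzN := hD.face_subset_N hc hJ hz
  have hst := hD.refl_smul_face hc hJ hzN (hJ hs) hcut
  have hty : z * s * z⁻¹ * y ∈ D.face c J := by
    rw [← hst]
    exact Set.smul_mem_smul_set hy
  have hle := hmin _ hty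
  by_cases h1 : x ∈ z • D.simpleRoot s <;> by_cases h2 : y ∈ z • D.simpleRoot s
  · simp [h1, h2]
  · exact absurd (hD.dist_refl_lt hzN (hJ hs) h1 hyN h2) (by omega)
  · exact absurd (hD.dist_refl_lt_compl hzN (hJ hs) hx h1 h2) (by omega)
  · simp [h1, h2]

/-- A chamber that is separated from the chamber `c` of a face by all walls of `c` in the face is
separated from `c` by all roots that cut the face. -/
theorem IsSplitBNPair.notMem_of_walls (hD : D.IsSplitBNPair p) {c d : G} {J : Set G}
    (hc : c ∈ D.N) (hJ : J ⊆ D.S) (hd : d ∈ D.N) (h : ∀ s ∈ J, d ∉ c • D.simpleRoot s)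
    {a : Set G} (ha : a ∈ D.roots) (hcut : Cuts a (D.face c J)) (hca : c ∈ a) : d ∉ a := by
  obtain ⟨e, he, hside⟩ := hD.exists_proj hc hJ hd
  rw [hside a ha hcut]
  have h' : ∀ s ∈ J, e ∉ c • D.simpleRoot s := fun s hs => by
    rw [← hside _ (smul_simpleRoot_mem_roots hc (hJ hs)) (hD.cuts_self (hJ hs) hs)]
    exact h s hs
  have heN := hD.face_subset_N hc hJ he
  -- Every chamber `u` of the face lies on a shortest gallery from `c` to the projection `e` of `d`.
  -- For the induction, `u` is reflected at a wall of `c`, which brings it closer to `c`.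
  have key : ∀ k, ∀ u ∈ D.face c J, D.dist c u = k → D.dist c u + D.dist u e ≤ D.dist c e := by
    intro k
    induction k using Nat.strong_induction_on with
    | _ k ih =>
    intro u hu hk
    have huN := hD.face_subset_N hc hJ hu
    by_cases hcu : D.Eqv c u
    · rw [hD.dist_self_of_eqv hcu, hD.dist_congr hcu (Eqv.refl e), zero_add]
    obtain ⟨s, hs, hsu⟩ := hD.exists_step hJ hu hcu
    have hsS := hJ hs
    have ht := hD.refl_mem hc hsS
    have hu' : c * s * c⁻¹ * u ∈ c • D.simpleRoot s := (hD.refl_mul_mem_iff hc hsS huN).2 hsu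
    have hu'F : c * s * c⁻¹ * u ∈ D.face c J := by
      rw [← hD.refl_smul_face hc hJ hc hsS (hD.cuts_self hsS hs)]
      exact Set.smul_mem_smul_set hu
    have h1 := hD.dist_refl_lt hc hsS (self_mem_smul_simpleRoot c s) huN hsu
    have h2 := ih _ (hk ▸ h1) _ hu'F rfl
    have h3 := hD.dist_refl_lt_compl hc hsS heN (h' s hs) hu'
    rw [← hD.dist_congr (Eqv.refl e) (hD.refl_refl hc hsS huN),
      hD.dist_comm heN huN, hD.dist_comm heN (hD.face_subset_N hc hJ hu'F)] at h3
    have h4 := dist_triangle (D := D) (c * s) c (c * s * c⁻¹ * u)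
    rw [hD.dist_comm (mul_mem hc (hD.S_subset s hsS)) hc, hD.dist_mul hc hsS] at h4
    have h5 : D.dist (c * s) (c * s * c⁻¹ * u) = D.dist c u := by
      rw [← dist_smul ht c u]
      congr 1
      group
    omega
  intro hea
  -- If `e` were in `a`, then `a` would count for the distance from `c` to `u` but not for that from
  -- `c` to `e`; so `u` could not lie on a shortest gallery.
  obtain ⟨u, hu, hua⟩ := hcut.2
  have h1 := key _ u hu rfl
  have h2 : D.dist c e ≤ (D.sep c u \ {a}).ncard + D.dist u e := by
    refine (Set.ncard_le_ncard ?_ (Set.toFinite _)).trans (Set.ncard_union_le _ _)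
    rintro b ⟨hb, h1, h2⟩
    by_cases h : u ∈ b
    · exact Or.inr ⟨hb, h, h2⟩
    · exact Or.inl ⟨⟨hb, h1, h⟩, fun hba => h2 (by rw [Set.mem_singleton_iff.1 hba]; exact hea)⟩
  have h3 : (D.sep c u \ {a}).ncard < D.dist c u :=
    Set.ncard_sdiff_singleton_lt_of_mem ⟨ha, hca, hua⟩ (Set.toFinite _)
  omega

/-- The chamber of a face opposite to a given one. -/
theorem IsSplitBNPair.exists_opp (hD : D.IsSplitBNPair p) {c : G} {J : Set G} (hc : c ∈ D.N)
    (hJ : J ⊆ D.S) :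
    ∃ y ∈ D.face c J, ∀ a ∈ D.roots, Cuts a (D.face c J) → (c ∈ a ↔ y ∉ a) := by
  -- A chamber at maximal distance from `c` lies beyond every wall of `c` in the face, since
  -- otherwise its mirror image would be farther away.
  obtain ⟨y, hy, hmax⟩ := Set.exists_max_image (D.face c J) (D.dist c) (Set.toFinite _)
    ⟨c, self_mem_face c J⟩
  have hyN := hD.face_subset_N hc hJ hy
  have hw : ∀ s ∈ J, y ∉ c • D.simpleRoot s := by
    intro s hs hys
    have hsS := hJ hs
    have hty : c * s * c⁻¹ * y ∈ D.face c J := by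
      rw [← hD.refl_smul_face hc hJ hc hsS (hD.cuts_self hsS hs)]
      exact Set.smul_mem_smul_set hy
    have h1 := hD.dist_refl_lt hc hsS (self_mem_smul_simpleRoot c s)
      (hD.face_subset_N hc hJ hty) (fun h => (hD.refl_mul_mem_iff hc hsS hyN).1 h hys)
    rw [← hD.dist_congr (Eqv.refl c) (hD.refl_refl hc hsS hyN)] at h1
    have := hmax _ hty
    omega
  have key : ∀ a ∈ D.roots, Cuts a (D.face c J) → c ∈ a → y ∉ a := fun a ha hcut hca =>
    hD.notMem_of_walls hc hJ hyN hw ha hcut hca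
  refine ⟨y, hy, fun a ha hcut => ⟨key a ha hcut, fun h => ?_⟩⟩
  by_contra hca
  have := key _ (hD.compl_mem_roots ha)
    ((hD.cuts_compl ha (hD.face_subset_N hc hJ)).2 hcut) ⟨hc, hca⟩
  exact this ⟨hyN, h⟩

theorem IsSplitBNPair.cuts_N (hD : D.IsSplitBNPair p) {a : Set G} (ha : a ∈ D.roots) :
    Cuts a D.N := by
  obtain ⟨x, hx, s, hs, rfl⟩ := ha
  rw [← face_singleton_S hD hx]
  exact hD.cuts_self hs hs

theorem IsSplitBNPair.exists_opp_N (hD : D.IsSplitBNPair p) {c : G} (hc : c ∈ D.N) :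
    ∃ y ∈ D.N, ∀ a ∈ D.roots, c ∈ a ↔ y ∉ a := by
  obtain ⟨y, hy, h⟩ := hD.exists_opp hc (J := D.S) le_rfl
  rw [face_singleton_S hD hc] at hy h
  exact ⟨y, hy, fun a ha => h a ha (hD.cuts_N ha)⟩

/-- The reflection exchanges the two halves of the face. -/
theorem IsSplitBNPair.ncard_inter_face (hD : D.IsSplitBNPair p) {c : G} {J a : Set G}
    (hc : c ∈ D.N) (hJ : J ⊆ D.S) (ha : a ∈ D.roots) (h : Cuts a (D.face c J)) :
    2 * (a ∩ D.face c J).ncard = (D.face c J).ncard := by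
  have hsub := hD.face_subset_N hc hJ
  obtain ⟨x, hx, s, hs, rfl⟩ := ha
  have hst := hD.refl_smul_face hc hJ hx hs h
  have hmem : ∀ y ∈ D.face c J, x * s * x⁻¹ * y ∈ D.face c J := fun y hy => by
    rw [← hst]; exact Set.smul_mem_smul_set hy
  have h1 : (x • D.simpleRoot s ∩ D.face c J).ncard = (D.face c J \ (x • D.simpleRoot s)).ncard := by
    apply le_antisymm
    · refine Set.ncard_le_ncard_of_injOn (fun y => x * s * x⁻¹ * y) ?_
        (fun _ _ _ _ h => mul_left_cancel h) (Set.toFinite _)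
      rintro y ⟨hy, hyF⟩
      exact ⟨hmem y hyF, fun h' => (hD.refl_mul_mem_iff hx hs (hsub hyF)).1 h' hy⟩
    · refine Set.ncard_le_ncard_of_injOn (fun y => x * s * x⁻¹ * y) ?_
        (fun _ _ _ _ h => mul_left_cancel h) (Set.toFinite _)
      rintro y ⟨hyF, hy⟩
      exact ⟨(hD.refl_mul_mem_iff hx hs (hsub hyF)).2 hy, hmem y hyF⟩
  have h2 := Set.ncard_inter_add_ncard_sdiff_eq_ncard (D.face c J) (x • D.simpleRoot s)
    (Set.toFinite _)
  rw [Set.inter_comm] at h2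
  omega

/-- A root that contains the half of a face that is cut off by another root contains the face. -/
theorem IsSplitBNPair.face_subset_of_half (hD : D.IsSplitBNPair p) {c : G} {J a b : Set G}
    (hc : c ∈ D.N) (hJ : J ⊆ D.S) (ha : a ∈ D.roots) (hb : b ∈ D.roots)
    (hcut : Cuts b (D.face c J)) (hne : a ≠ b) (h : b ∩ D.face c J ⊆ a) : D.face c J ⊆ a := by
  obtain ⟨z, hz, s, hs, hzb, hzs, he⟩ := hD.exists_edge hc hJ hb hcut
  by_contra hcon
  have hcut' : Cuts a (D.face c J) := by
    by_contra h'
    exact hcon (subset_of_not_cuts h' hz (h ⟨hzb, hz⟩))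
  have h1 := hD.ncard_inter_face hc hJ ha hcut'
  have h2 := hD.ncard_inter_face hc hJ hb hcut
  -- Both halves have the same size and one contains the other. So the two roots separate the same
  -- adjacent pair of chambers, which determines them.
  have h3 : b ∩ D.face c J = a ∩ D.face c J :=
    Set.eq_of_subset_of_ncard_le (fun x hx => ⟨h hx, hx.2⟩) (by omega) (Set.toFinite _)
  have hzs' : z * s ∉ a := fun h' =>
    hzs (h3 ▸ (⟨h', mul_mem_face hz hs⟩ : z * s ∈ a ∩ D.face c J) :
      z * s ∈ b ∩ D.face c J).1
  exact hne ((hD.root_eq ha (hJ hs) (h ⟨hzb, hz⟩) hzs').trans he.symm)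

end Faces

end BNData
end HarishChandra

namespace HarishChandra
namespace BNData

/-! ### Projections of faces and parallel faces -/

section Parallel

variable {G : Type v} [Group G] {D : BNData G} {p : ℕ} [Finite G]

theorem IsSplitBNPair.torus_smul_face (hD : D.IsSplitBNPair p) {c t : G} {J : Set G}
    (hc : c ∈ D.N) (hJ : J ⊆ D.S) (ht : t ∈ D.T) : t • D.face c J = D.face c J := by
  rw [smul_face]
  exact face_eq (eqv_mem_face (self_mem_face c J) (Eqv.torus_mul hD hc ht))

/-- The projection of a face `E` to a face `F`. -/
theorem IsSplitBNPair.exists_proj_face (hD : D.IsSplitBNPair p) {c e : G} {J I : Set G}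
    (hc : c ∈ D.N) (hJ : J ⊆ D.S) (he : e ∈ D.N) (hI : I ⊆ D.S) :
    ∃ f ∈ D.face c J, ∃ J' ⊆ J,
      (∀ a ∈ D.roots, Cuts a (D.face c J) → (e ∈ a ↔ f ∈ a)) ∧
      (∀ a ∈ D.roots, Cuts a (D.face f J') ↔ Cuts a (D.face c J) ∧ Cuts a (D.face e I)) ∧
      (∀ a ∈ D.roots, Cuts a (D.face c J) → (D.face f J' ⊆ a ↔ D.face e I ⊆ a)) ∧
      ∀ e' ∈ D.face e I, ∃ f' ∈ D.face f J', ∀ a ∈ D.roots, Cuts a (D.face c J) →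
        (e' ∈ a ↔ f' ∈ a) := by
  obtain ⟨f, hf, hside⟩ := hD.exists_proj hc hJ he
  have hfN := hD.face_subset_N hc hJ hf
  -- The projection consists of the chambers that are reached from `f` through those walls in the
  -- target face that also cut the face of `e`.
  set J' : Set G := {s | s ∈ J ∧ Cuts (f • D.simpleRoot s) (D.face e I)} with hJ'
  have hJJ : J' ⊆ J := fun s hs => hs.1
  have hJS : J' ⊆ D.S := hJJ.trans hJ
  have hFsub : D.face f J' ⊆ D.face c J := (face_mono hJJ).trans (face_eq hf).le
  have hcN := hD.face_subset_N hc hJ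
  have heN := hD.face_subset_N he hI
  -- Modulo conjugation by `f`, the generators are torus elements and reflections at walls that cut
  -- the face of `e`.
  have hstab : ∀ w ∈ D.stdN J', (f * w * f⁻¹) • D.face e I = D.face e I := by
    have : D.stdN J' ≤ (MulAction.stabilizer G (D.face e I)).comap (MulAut.conj f).toMonoidHom := by
      rw [stdN, Subgroup.closure_le]
      rintro x (hx | hx)
      · exact hD.torus_smul_face he hI (hD.conj_torus hfN hx)
      · exact hD.refl_smul_face he hI hfN (hJ hx.1) hx.2
    exact fun w hw => this hw
  have hcutE : ∀ a ∈ D.roots, Cuts a (D.face f J') → Cuts a (D.face e I) := by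
    intro a ha hcut
    obtain ⟨x, hx, s, hs, -, -, rfl⟩ := hD.exists_edge hfN hJS ha hcut
    have h1 := cuts_smul (n := f * (f⁻¹ * x) * f⁻¹) |>.2 hs.2
    rw [hstab _ hx, smul_smul] at h1
    simpa [mul_assoc] using h1
  have hproj : ∀ e' ∈ D.face e I, ∃ f' ∈ D.face f J', ∀ a ∈ D.roots, Cuts a (D.face c J) →
        (e' ∈ a ↔ f' ∈ a) := by
    -- The projection is followed along a gallery in the face of `e`. It is unchanged by a step
    -- across a wall that does not cut the target face; a step across one that does moves it, by the
    -- same reflection, to an adjacent chamber across a wall in `J'`.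
    have key : ∀ l : List G, (∀ r ∈ l, r ∈ I) → ∀ y ∈ D.face e I,
        (∃ f' ∈ D.face f J', ∀ a ∈ D.roots, Cuts a (D.face c J) → (y ∈ a ↔ f' ∈ a)) →
        ∃ f' ∈ D.face f J', ∀ a ∈ D.roots, Cuts a (D.face c J) →
          (y * l.prod ∈ a ↔ f' ∈ a) := by
      intro l
      induction l with
      | nil => intro _ y _ h; simpa using h
      | cons r l ih =>
        rintro hl y hy ⟨f', hf', hs'⟩
        have hr := hl r (by simp)
        have hrS := hI hr
        have hyN := heN hy
        have hyr := mul_mem_face hy hr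
        have := ih (fun x hx => hl x (by simp [hx])) (y * r) hyr ?_
        · simpa [mul_assoc] using this
        have hb := smul_simpleRoot_mem_roots hyN hrS
        by_cases hbF : Cuts (y • D.simpleRoot r) (D.face c J)
        · -- reflect
          set t := y * r * y⁻¹ with ht
          have htN : t ∈ D.N := hD.refl_mem hyN hrS
          have htF : t • D.face c J = D.face c J := hD.refl_smul_face hc hJ hyN hrS hbF
          have hf'c := hFsub hf'
          have hf'N := hcN hf'c
          have htf : t * f' ∈ D.face c J := by
            rw [← htF]; exact Set.smul_mem_smul_set hf'c
          have hsides : ∀ a ∈ D.roots, Cuts a (D.face c J) → (y * r ∈ a ↔ t * f' ∈ a) := by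
            intro a ha hcut
            have h1 : Cuts (t⁻¹ • a) (D.face c J) := by
              have := (cuts_smul (n := t⁻¹)).2 hcut
              rwa [show t⁻¹ • D.face c J = D.face c J by
                conv_lhs => rw [← htF]
                simp] at this
            have h2 := hs' _ (smul_mem_roots (inv_mem htN) ha) h1
            rw [mem_smul_set, mem_smul_set, inv_inv] at h2
            rwa [show t * y = y * r by simp [ht]] at h2
          refine ⟨t * f', ?_, hsides⟩
          have hf'b : f' ∈ y • D.simpleRoot r := (hs' _ hb hbF).1 (self_mem_smul_simpleRoot y r)
          have htb : t * f' ∉ y • D.simpleRoot r := fun h =>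
            (hD.refl_mul_mem_iff hyN hrS hf'N).1 h hf'b
          have hne : ¬ D.Eqv f' (t * f') := fun h => htb ((hD.root_congr hb h).1 hf'b)
          have htf' := htf
          rw [← face_eq hf'c] at htf'
          obtain ⟨s, hs, hstep⟩ := hD.exists_step hJ htf' hne
          have hsS := hJ hs
          have hcuts : Cuts (f' • D.simpleRoot s) (D.face c J) := by
            rw [← face_eq hf'c]; exact hD.cuts_self hsS hs
          have hrt := smul_simpleRoot_mem_roots hf'N hsS
          have h1 : y ∈ f' • D.simpleRoot s :=
            (hs' _ hrt hcuts).2 (self_mem_smul_simpleRoot f' s)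
          have h2 : y * r ∉ f' • D.simpleRoot s := fun h => hstep ((hsides _ hrt hcuts).1 h)
          -- The wall of `f'` that separates it from `t f'` is crossed by the step from `y` to `y
          -- r`. Hence `t` is the reflection at this wall, and `t f'` is adjacent to `f'`.
          have h3 := hD.root_eq hrt hrS h1 h2
          have h4 : D.Eqv (t * f') (f' * s) := hD.refl_eqv_of_leaves hyN hrS hsS hf'b
            (by rw [← h3]; exact hD.mul_notMem hsS)
          have hsJ' : s ∈ J' := by
            refine ⟨hs, ?_⟩
            have h5 : Cuts (f' • D.simpleRoot s) (D.face e I) := by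
              rw [h3, ← face_eq hy]; exact hD.cuts_self hrS hr
            have h6 := (cuts_smul (n := (f * (f⁻¹ * f')⁻¹ * f⁻¹))).2 h5
            rw [hstab _ (inv_mem hf'), smul_smul] at h6
            simpa [mul_assoc] using h6
          exact eqv_mem_face (mul_mem_face hf' hsJ') h4.symm
        · refine ⟨f', hf', fun a ha hcut => ?_⟩
          rw [← hs' a ha hcut]
          by_contra hne
          apply hbF
          by_cases hya : y ∈ a
          · rw [← hD.root_eq ha hrS hya (fun h => hne (by simp [hya, h]))]
            exact hcut
          · have hyra : y * r ∈ a := by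
              by_contra h
              exact hne (by simp [hya, h])
            rw [← hD.root_eq (hD.compl_mem_roots ha) hrS ⟨hyN, hya⟩ (fun h => h.2 hyra)]
            exact (hD.cuts_compl ha hcN).2 hcut
    intro e' he'
    obtain ⟨l, hl, hel⟩ := hD.exists_word hI he'
    obtain ⟨f', hf', h⟩ := key l hl e (self_mem_face e I) ⟨f, self_mem_face f J', hside⟩
    refine ⟨f', hf', fun a ha hcut => ?_⟩
    have h1 : D.Eqv (e * l.prod) e' := by simpa using hel.mul_left e
    rw [← h a ha hcut, hD.root_congr ha h1]
  have hiff : ∀ a ∈ D.roots, Cuts a (D.face f J') ↔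
      Cuts a (D.face c J) ∧ Cuts a (D.face e I) := by
    intro a ha
    refine ⟨fun h => ⟨h.mono hFsub, hcutE a ha h⟩, ?_⟩
    rintro ⟨hcut, ⟨x, hxa, hx⟩, ⟨y, hy, hya⟩⟩
    obtain ⟨x', hx', h1⟩ := hproj x hx
    obtain ⟨y', hy', h2⟩ := hproj y hy
    exact ⟨⟨x', (h1 a ha hcut).1 hxa, hx'⟩, ⟨y', hy', fun h => hya ((h2 a ha hcut).2 h)⟩⟩
  refine ⟨f, hf, J', hJJ, hside, hiff, fun a ha hcut => ⟨fun h e' he' => ?_, fun h => ?_⟩, hproj⟩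
  · obtain ⟨f', hf', h1⟩ := hproj e' he'
    exact (h1 a ha hcut).2 (h hf')
  · refine subset_of_not_cuts (fun h' => ?_) (self_mem_face f J')
      ((hside a ha hcut).1 (h (self_mem_face e I)))
    obtain ⟨y, hy, hya⟩ := (hcutE a ha h').2
    exact hya (h hy)

/-- Two faces are parallel if they are cut by the same roots. -/
def Parallel (D : BNData G) (F E : Set G) : Prop := ∀ a ∈ D.roots, Cuts a F ↔ Cuts a E

/-- Two parallel faces with a common chamber agree. -/
theorem IsSplitBNPair.face_eq_of_parallel (hD : D.IsSplitBNPair p) {c : G} {J I : Set G}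
    (hc : c ∈ D.N) (hJ : J ⊆ D.S) (hI : I ⊆ D.S) (h : D.Parallel (D.face c J) (D.face c I)) :
    D.face c J = D.face c I := by
  have key : ∀ J I : Set G, J ⊆ D.S → I ⊆ D.S → D.Parallel (D.face c J) (D.face c I) →
      D.face c J ⊆ D.face c I := by
    intro J I hJ hI h x hx
    have hxN := hD.face_subset_N hc hJ hx
    obtain ⟨y, hy, hside⟩ := hD.exists_proj hc hI hxN
    refine eqv_mem_face hy (hD.eqv_of_roots (hD.face_subset_N hc hI hy) hxN fun a ha hya => ?_)
    by_cases hcut : Cuts a (D.face c I)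
    · exact (hside a ha hcut).2 hya
    · rw [mem_iff_of_not_cuts (mt (h a ha).1 hcut) hx (self_mem_face c J)]
      rwa [mem_iff_of_not_cuts hcut (self_mem_face c I) hy]
  exact (key J I hJ hI h).antisymm (key I J hI hJ fun a ha => (h a ha).symm)

/-- One step in a chain of parallel faces: the face opposite to `face f₁ J` in the face of rank
one more. -/
theorem IsSplitBNPair.exists_adjacent_face (hD : D.IsSplitBNPair p) {f₁ f₂ s : G} {J J₂ : Set G}
    (hf₁ : f₁ ∈ D.N) (hJ : J ⊆ D.S) (hf₂ : f₂ ∈ D.N) (hJ₂ : J₂ ⊆ D.S) (hs : s ∈ D.S)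
    (hpar : D.Parallel (D.face f₁ J) (D.face f₂ J₂))
    (hside : ∀ a ∈ D.roots, Cuts a (D.face f₁ J) → (f₁ ∈ a ↔ f₂ ∈ a))
    (hstep : f₂ ∉ f₁ • D.simpleRoot s) :
    ∃ f' ∈ D.face f₁ (insert s J), ∃ J' ⊆ insert s J,
      D.Parallel (D.face f' J') (D.face f₁ J) ∧
      (∀ a ∈ D.roots, Cuts a (D.face f₁ (insert s J)) → (f₂ ∈ a ↔ f' ∈ a)) ∧
      ∀ a ∈ D.roots, Cuts a (D.face f₁ (insert s J)) → ¬ Cuts a (D.face f₁ J) → f₁ ∈ a →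
        f' ∉ a := by
  have hK : insert s J ⊆ D.S := Set.insert_subset hs hJ
  obtain ⟨f', hf', J', hJ', h1, h2, -, -⟩ := hD.exists_proj_face hf₁ hK hf₂ hJ₂
  have hsub : D.face f₁ J ⊆ D.face f₁ (insert s J) := face_mono (Set.subset_insert s J)
  refine ⟨f', hf', J', hJ', fun a ha => ?_, h1, fun a ha hK' hF hfa => ?_⟩
  · rw [h2 a ha, hpar a ha]
    exact ⟨fun h => h.2, fun h => ⟨((hpar a ha).2 h).mono hsub, h⟩⟩
  · rw [← h1 a ha hK']
    -- The chamber `g` opposite to `f₂` in its own face lies beyond all walls of `f₁` in the larger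
    -- face: by opposition if the wall cuts the small faces, and otherwise because the wall is that
    -- of `s`, beyond which `f₂` lies. Roots that do not cut the small faces do not separate `g`
    -- from `f₂`.
    obtain ⟨g, hg, hopp⟩ := hD.exists_opp hf₂ hJ₂
    have hgN := hD.face_subset_N hf₂ hJ₂ hg
    have hw : ∀ r ∈ insert s J, g ∉ f₁ • D.simpleRoot r := by
      intro r hr hgr
      have hrS := hK hr
      have hroot := smul_simpleRoot_mem_roots (D := D) hf₁ hrS
      by_cases hcut : Cuts (f₁ • D.simpleRoot r) (D.face f₁ J)
      · exact (hopp _ hroot ((hpar _ hroot).1 hcut)).1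
          ((hside _ hroot hcut).1 (self_mem_smul_simpleRoot f₁ r)) hgr
      · rcases hr with rfl | hr
        · exact hstep ((mem_iff_of_not_cuts (mt (hpar _ hroot).2 hcut) hg
            (self_mem_face f₂ J₂)).1 hgr)
        · exact hcut (hD.cuts_self hrS hr)
    have := hD.notMem_of_walls hf₁ hK hgN hw ha hK' hfa
    rwa [mem_iff_of_not_cuts (mt (hpar a ha).2 hF) hg (self_mem_face f₂ J₂)] at this

/-- In a face of rank one more, there are only two faces parallel to a given one. -/
theorem IsSplitBNPair.eq_or_eq_of_parallel (hD : D.IsSplitBNPair p) {f₁ f' s g : G}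
    {J J' I : Set G} (hf₁ : f₁ ∈ D.N) (hJ : J ⊆ D.S) (hs : s ∈ D.S) (hJ' : J' ⊆ D.S)
    (hI : I ⊆ D.S)
    (hf' : f' ∈ D.face f₁ (insert s J)) (hpar' : D.Parallel (D.face f' J') (D.face f₁ J))
    (hside : ∀ a ∈ D.roots, Cuts a (D.face f₁ J) → (f₁ ∈ a ↔ f' ∈ a))
    (hopp : ∀ a ∈ D.roots, Cuts a (D.face f₁ (insert s J)) → ¬ Cuts a (D.face f₁ J) → f₁ ∈ a →
        f' ∉ a)
    (hg : g ∈ D.face f₁ (insert s J)) (hpar : D.Parallel (D.face g I) (D.face f₁ J)) :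
    D.face g I = D.face f₁ J ∨ D.face g I = D.face f' J' := by
  have hK : insert s J ⊆ D.S := Set.insert_subset hs hJ
  have hgN := hD.face_subset_N hf₁ hK hg
  have hf'N := hD.face_subset_N hf₁ hK hf'
  have hsub : D.face f₁ J ⊆ D.face f₁ (insert s J) := face_mono (Set.subset_insert s J)
  -- The chamber of the given face that corresponds to `f₁`. It turns out to be `f₁` or `f'`,
  -- depending on its side of the `s`-wall.
  obtain ⟨h, hh, hhside⟩ := hD.exists_proj hgN hI hf₁
  have hhN := hD.face_subset_N hgN hI hh
  rw [← face_eq hh] at hpar hhside ⊢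
  -- `h` lies in the large face
  have hhK : h ∈ D.face f₁ (insert s J) := by
    obtain ⟨y, hy, hys⟩ := hD.exists_proj hf₁ hK hhN
    refine eqv_mem_face hy (hD.eqv_of_roots (hD.face_subset_N hf₁ hK hy) hhN fun a ha hya => ?_)
    by_cases hcut : Cuts a (D.face f₁ (insert s J))
    · exact (hys a ha hcut).2 hya
    · rw [mem_iff_of_not_cuts hcut hy hg] at hya
      have h3 : ¬ Cuts a (D.face h I) := fun h' => hcut (((hpar a ha).1 h').mono hsub)
      rwa [mem_iff_of_not_cuts h3 (self_mem_face h I) (by rw [face_eq hh]; exact self_mem_face g I)]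
  have hhside' : ∀ a ∈ D.roots, Cuts a (D.face f₁ J) → (f₁ ∈ a ↔ h ∈ a) := fun a ha hcut =>
    hhside a ha ((hpar a ha).2 hcut)
  by_cases hstep : h ∈ f₁ • D.simpleRoot s
  · left
    have he : D.Eqv f₁ h := by
      by_contra hne
      obtain ⟨q, hq, hqh⟩ := hD.exists_step hK hhK hne
      rcases hq with rfl | hq
      · exact hqh hstep
      · exact hqh ((hhside' _ (smul_simpleRoot_mem_roots hf₁ (hJ hq))
          (hD.cuts_self (hJ hq) hq)).1 (self_mem_smul_simpleRoot f₁ q))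
    have he' := face_eq (eqv_mem_face (self_mem_face f₁ J) he)
    rw [← he'] at hpar ⊢
    exact hD.face_eq_of_parallel hhN hI hJ hpar
  · right
    obtain ⟨k, hk, I', hI', hp, hks, hko⟩ := hD.exists_adjacent_face hf₁ hJ hhN hI hs
      (fun a ha => (hpar a ha).symm) hhside' hstep
    have hno : ∀ a ∈ D.roots, Cuts a (D.face f₁ (insert s J)) → ¬ Cuts a (D.face f₁ J) →
        f₁ ∈ a → h ∉ a := fun a ha hK' hF hfa => by
      rw [hks a ha hK']; exact hko a ha hK' hF hfa
    have he : D.Eqv f' h := by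
      refine hD.eqv_of_face hf₁ hK hf' hhK fun a ha hcut hfa => ?_
      by_cases hF : Cuts a (D.face f₁ J)
      · rwa [← hhside' a ha hF, hside a ha hF]
      · by_cases h1 : f₁ ∈ a
        · exact absurd hfa (hopp a ha hcut hF h1)
        · by_contra h2
          have hc := hD.compl_mem_roots ha
          have hFN := hD.face_subset_N hf₁ hJ
          exact hno _ hc ((hD.cuts_compl ha (hD.face_subset_N hf₁ hK)).2 hcut)
            (mt (hD.cuts_compl ha hFN).1 hF) ⟨hf₁, h1⟩ ⟨hhN, h2⟩
    have he' := face_eq (eqv_mem_face (self_mem_face f' J') he)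
    rw [← he'] at hpar' ⊢
    exact hD.face_eq_of_parallel hhN hI hJ' fun a ha => (hpar a ha).trans (hpar' a ha).symm

end Parallel

end BNData
end HarishChandra

namespace HarishChandra
namespace BNData

/-! ### Intersections of conjugates of `U` -/

section RootSubgroups

variable {G : Type v} [Group G] {D : BNData G} {p : ℕ} [Finite G]

theorem mem_rootSubgroup {A : Set G} {x : G} :
    x ∈ D.rootSubgroup A ↔ ∀ n ∈ A, n⁻¹ * x * n ∈ D.U := by
  simp only [rootSubgroup, Subgroup.mem_iInf, mem_conjSub]

theorem rootSubgroup_anti {A A' : Set G} (h : A ⊆ A') : D.rootSubgroup A' ≤ D.rootSubgroup A := by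
  intro x hx
  rw [mem_rootSubgroup] at *
  exact fun n hn => hx n (h hn)

theorem mem_rootSubgroup_insert {A : Set G} {c x : G} :
    x ∈ D.rootSubgroup (insert c A) ↔ c⁻¹ * x * c ∈ D.U ∧ x ∈ D.rootSubgroup A := by
  simp [mem_rootSubgroup]

theorem mem_rootSubgroup_singleton {c x : G} :
    x ∈ D.rootSubgroup {c} ↔ c⁻¹ * x * c ∈ D.U := by
  simp [mem_rootSubgroup]

theorem rootSubgroup_smul (g : G) (A : Set G) :
    D.rootSubgroup (g • A) = conjSub g (D.rootSubgroup A) := by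
  refine le_antisymm (D.rootSubgroup_smul_le g A) fun x hx => ?_
  rw [mem_conjSub, mem_rootSubgroup] at hx
  rw [mem_rootSubgroup]
  intro n hn
  rw [mem_smul_set] at hn
  simpa [mul_assoc] using hx _ hn

/-- Products of subgroups one of which normalizes the other. -/
theorem exists_mul_of_mem_sup {H K : Subgroup G} (h : K ≤ Subgroup.normalizer (H : Set G)) {x : G} (hx : x ∈ H ⊔ K) :
    ∃ a ∈ H, ∃ b ∈ K, x = a * b := by
  have h1 : x ∈ ((H ⊔ K : Subgroup G) : Set G) := hx
  rw [Subgroup.coe_mul_of_right_le_normalizer_left _ _ h] at h1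
  obtain ⟨a, ha, b, hb, rfl⟩ := h1
  exact ⟨a, ha, b, hb, rfl⟩

theorem le_normalizer_iff {H K : Subgroup G} :
    K ≤ Subgroup.normalizer (H : Set G) ↔ ∀ g ∈ K, ∀ x ∈ H, g * x * g⁻¹ ∈ H := by
  constructor
  · intro h g hg x hx
    exact (Subgroup.mem_normalizer_iff.1 (h hg) x).1 hx
  · intro h g hg
    rw [Subgroup.mem_normalizer_iff]
    refine fun x => ⟨h g hg x, fun hx => ?_⟩
    have := h _ (inv_mem hg) _ hx
    simpa [mul_assoc] using this

theorem IsSplitBNPair.B_le_normalizer (hD : D.IsSplitBNPair p) : D.B ≤ Subgroup.normalizer (D.U : Set G) := by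
  rw [le_normalizer_iff]
  intro b hb x hx
  rw [← hD.U_normal b hb]
  exact conj_mem_conjSub hx

theorem IsSplitBNPair.exists_mul_of_mem_B (hD : D.IsSplitBNPair p) {b : G} (hb : b ∈ D.B) :
    ∃ u ∈ D.U, ∃ t ∈ D.T, b = u * t := by
  rw [← hD.U_sup_T] at hb
  exact exists_mul_of_mem_sup (T_le_B.trans hD.B_le_normalizer) hb

/-- `B / U` is an image of `T`, so its order is prime to `p` and the image of a `p`-element is
trivial. -/
theorem IsSplitBNPair.mem_U_of_pow (hD : D.IsSplitBNPair p) {x : G} (hx : x ∈ D.B) {k : ℕ}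
    (h : x ^ p ^ k = 1) : x ∈ D.U := by
  obtain ⟨u, hu, t, ht, rfl⟩ := hD.exists_mul_of_mem_B hx
  have hn : (D.U.subgroupOf D.B).Normal := by
    constructor
    intro y hy b
    exact (le_normalizer_iff.1 hD.B_le_normalizer) b b.2 y hy
  let q := QuotientGroup.mk' (D.U.subgroupOf D.B)
  let x' : D.B := ⟨u * t, hx⟩
  let t' : D.B := ⟨t, T_le_B ht⟩
  have h1 : q x' = q t' := by
    have : x' = ⟨u, hD.U_le hu⟩ * t' := rfl
    have h0 : q ⟨u, hD.U_le hu⟩ = 1 := (QuotientGroup.eq_one_iff _).2 hu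
    rw [this, map_mul, h0, one_mul]
  have h2 : q x' ^ p ^ k = 1 := by
    rw [← map_pow, show x' ^ p ^ k = 1 from Subtype.ext h, map_one]
  have h3 : q x' ^ Nat.card D.T = 1 := by
    rw [h1, ← map_pow, show t' ^ Nat.card D.T = 1 from Subtype.ext ?_, map_one]
    exact congrArg (fun y : D.T => (y : G)) (pow_card_eq_one' (x := (⟨t, ht⟩ : D.T)))
  have h4 : orderOf (q x') ∣ 1 := by
    rw [← (Nat.Coprime.pow_left k hD.torus_coprime)]
    exact Nat.dvd_gcd (orderOf_dvd_of_pow_eq_one h2) (orderOf_dvd_of_pow_eq_one h3)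
  have h5 : q x' = 1 := orderOf_eq_one_iff.1 (Nat.dvd_one.1 h4)
  exact (QuotientGroup.eq_one_iff (N := D.U.subgroupOf D.B) _).1 h5

/-- An element of a conjugate of `U` has `p`-power order. So, for such elements, it is enough to
keep track of the chambers they stabilize; lying in `U` rather than in `B` is automatic. -/
theorem IsSplitBNPair.mem_U_of_conj (hD : D.IsSplitBNPair p) {x c d : G}
    (hx : c⁻¹ * x * c ∈ D.U) (h : d⁻¹ * x * d ∈ D.B) : d⁻¹ * x * d ∈ D.U := by
  obtain ⟨k, hk⟩ := hD.U_pGroup ⟨_, hx⟩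
  have hk' : (c⁻¹ * x * c) ^ p ^ k = 1 := congrArg Subtype.val hk
  have h1 : x ^ p ^ k = 1 := by
    have := conj_pow (a := c⁻¹) (b := x) (i := p ^ k)
    rw [inv_inv, hk'] at this
    have := congrArg (fun y => c * y * c⁻¹) this
    simpa [mul_assoc] using this.symm
  refine hD.mem_U_of_pow h (k := k) ?_
  have := conj_pow (a := d⁻¹) (b := x) (i := p ^ k)
  rw [inv_inv] at this
  rw [this, h1]
  simp

theorem IsSplitBNPair.mem_B_of_eqv (hD : D.IsSplitBNPair p) {c d x : G} (h : D.Eqv c d) :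
    c⁻¹ * x * c ∈ D.B ↔ d⁻¹ * x * d ∈ D.B := by
  have h1 : c⁻¹ * d ∈ D.B := T_le_B h
  have h2 : d⁻¹ * x * d = (c⁻¹ * d)⁻¹ * (c⁻¹ * x * c) * (c⁻¹ * d) := by group
  rw [h2, Subgroup.mul_mem_cancel_right _ h1, Subgroup.mul_mem_cancel_left _ (inv_mem h1)]

theorem IsSplitBNPair.mem_U_of_eqv (hD : D.IsSplitBNPair p) {c d x : G} (h : D.Eqv c d)
    (hx : c⁻¹ * x * c ∈ D.U) : d⁻¹ * x * d ∈ D.U :=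
  hD.mem_U_of_conj hx ((hD.mem_B_of_eqv h).1 (hD.U_le hx))

/-- An element that stabilizes a panel and a chamber stabilizes the projection of the chamber. -/
theorem IsSplitBNPair.mem_B_of_panel (hD : D.IsSplitBNPair p) {s d g : G} (hs : s ∈ D.S)
    (hd : d ∈ D.simpleRoot s) (hg : g ∈ D.B ∨ D.InDC s g) (h : d⁻¹ * g * d ∈ D.B) : g ∈ D.B := by
  refine hg.resolve_right fun hg => ?_
  have hdN := hd.1
  rw [hD.mem_simpleRoot] at hd
  obtain ⟨b, hb, b', hb', rfl⟩ := hg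
  have h1 := (hd.2 (b' * d) ((InDC.self d).mul_left hb')).mul_left hb
  have h2 := (InDC.self d).mul_right h
  have h3 : D.InDC d (b * (s * (b' * d))) := by
    convert h2 using 1
    group
  exact hD.not_eqv_S_mul hs hdN (hD.eqv_of_inDC hdN (mul_mem (hD.S_subset s hs) hdN)
    (h3.trans h1.symm))

theorem IsSplitBNPair.mem_panel (hD : D.IsSplitBNPair p) {s g : G} (hs : s ∈ D.S)
    (h : s⁻¹ * g * s ∈ D.B) : g ∈ D.B ∨ D.InDC s g := by
  have hsN := hD.S_subset s hs
  have h1 := hD.exchange_left hs (inv_mem hsN) ((InDC.self s⁻¹).mul_left h)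
  have h2 : s * (s⁻¹ * g * s * s⁻¹) = g := by group
  rw [h2, mul_inv_cancel] at h1
  rcases h1 with h1 | h1
  · exact Or.inl (h1.mem_B D.B.one_mem)
  · exact Or.inr ((hD.S_inv hs).inDC.trans h1)

/-- The element stabilizes the panel of `c s`, hence also the projection of `d` to this panel, which
is `c`. -/
theorem IsSplitBNPair.mem_B_of_step (hD : D.IsSplitBNPair p) {c s d g : G} (hs : s ∈ D.S)
    (hd : d ∈ c • D.simpleRoot s) (h : (c * s)⁻¹ * g * (c * s) ∈ D.B) (h' : d⁻¹ * g * d ∈ D.B) :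
    c⁻¹ * g * c ∈ D.B := by
  rw [mem_smul_set] at hd
  refine hD.mem_B_of_panel hs hd (hD.mem_panel hs ?_) ?_
  · convert h using 1; group
  · convert h' using 1; group

/-- The group `U_A` depends only on the convex hull of `A`. -/
theorem IsSplitBNPair.rootSubgroup_le_of_hull (hD : D.IsSplitBNPair p) {A : Set G} (hA : A ⊆ D.N)
    (hne : A.Nonempty) {d : G} (hd : d ∈ D.N) (h : ∀ a ∈ D.roots, A ⊆ a → d ∈ a) {x : G}
    (hx : x ∈ D.rootSubgroup A) : d⁻¹ * x * d ∈ D.U := by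
  rw [mem_rootSubgroup] at hx
  obtain ⟨c₀, hc₀⟩ := hne
  -- Among the chambers at which `x` is unipotent, one closest to `d`. If it is not `d`, the hull
  -- condition gives a chamber of `A` beyond the wall towards `d`, and this shows that `x`
  -- stabilizes the next chamber `c s` as well.
  obtain ⟨c, ⟨hcN, hc⟩, hmin⟩ := Set.exists_min_image {c | c ∈ D.N ∧ c⁻¹ * x * c ∈ D.U}
    (fun c => D.dist c d) (Set.toFinite _) ⟨c₀, hA hc₀, hx c₀ hc₀⟩
  by_cases he : D.Eqv c d
  · exact hD.mem_U_of_eqv he hc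
  exfalso
  obtain ⟨s, hs, hstep⟩ := hD.exists_step (J := D.S) le_rfl (x := c) (y := d)
    ((stdN_S hD).symm ▸ mul_mem (inv_mem hcN) hd) he
  have hlt := hD.dist_step hcN hd hs hstep
  have hcs := mul_mem hcN (hD.S_subset s hs)
  have hroot := smul_simpleRoot_mem_roots (D := D) hcN hs
  have hnot : ¬ A ⊆ c • D.simpleRoot s := fun h' => hstep (h _ hroot h')
  obtain ⟨c', hc', hcc⟩ := Set.not_subset.1 hnot
  have h1 : c' ∈ (c * s) • D.simpleRoot s := by
    rw [← hD.compl_root_aux hcN hs]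
    exact ⟨hA hc', hcc⟩
  have h2 : D.Eqv c (c * s * s) := by
    rw [mul_assoc]; exact Eqv.mul_torus c (hD.S_sq s hs)
  have h3 := hD.mem_B_of_step hs h1 ((hD.mem_B_of_eqv h2).1 (hD.U_le hc))
    (hD.U_le (hx c' hc'))
  have := hmin (c * s) ⟨hcs, hD.mem_U_of_conj hc h3⟩
  omega

theorem IsSplitBNPair.rootSubgroup_le (hD : D.IsSplitBNPair p) {A A' : Set G} (hA : A ⊆ D.N)
    (hne : A.Nonempty) (hA' : A' ⊆ D.N) (h : ∀ a ∈ D.roots, A ⊆ a → A' ⊆ a) :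
    D.rootSubgroup A ≤ D.rootSubgroup A' := by
  intro x hx
  rw [mem_rootSubgroup]
  exact fun n hn => hD.rootSubgroup_le_of_hull hA hne (hA' hn) (fun a ha h' => h a ha h' hn) hx

/-- The convex hull is the set of all chambers. So the group lies in every conjugate of `U`, hence
in `T` by saturation, and `U ∩ T = 1`. This is the source of all triviality statements below. -/
theorem IsSplitBNPair.rootSubgroup_eq_bot (hD : D.IsSplitBNPair p) {A : Set G} (hA : A ⊆ D.N)
    (hne : A.Nonempty) (h : ∀ a ∈ D.roots, ¬ A ⊆ a) : D.rootSubgroup A = ⊥ := by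
  rw [eq_bot_iff]
  intro x hx
  have h1 : ∀ n ∈ D.N, n⁻¹ * x * n ∈ D.U := fun n hn =>
    hD.rootSubgroup_le_of_hull hA hne hn (fun a ha h' => absurd h' (h a ha)) hx
  rw [← hD.U_inf_T, Subgroup.mem_inf]
  refine ⟨by simpa using h1 1 D.N.one_mem, ?_⟩
  rw [← hD.saturated]
  simp only [Subgroup.mem_iInf, mem_conjSub]
  exact fun n hn => hD.U_le (h1 n hn)

/-- `U = X_s (U ∩ s U s⁻¹)` -/
theorem IsSplitBNPair.exists_mul_of_mem_U (hD : D.IsSplitBNPair p) {s y : G} (hs : s ∈ D.S)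
    (hy : y ∈ D.U) : ∃ x ∈ D.rootSubgroup (D.simpleRoot s), ∃ u ∈ D.U, s⁻¹ * u * s ∈ D.U ∧
      y = x * u := by
  have hsN := hD.S_subset s hs
  -- With `d` opposite to `s`, a root that contains `1` and `d` omits `s` and is therefore `α_s`. So
  -- `X_s` is the group attached to the two chambers `1` and `d`.
  obtain ⟨d, hd, hopp⟩ := hD.exists_opp_N hsN
  have hroot : D.simpleRoot s ∈ D.roots := by
    simpa using smul_simpleRoot_mem_roots (D := D) D.N.one_mem hs
  have hds : d ∈ D.simpleRoot s := by
    by_contra h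
    exact hD.S_notMem_simpleRoot hs ((hopp _ hroot).2 h)
  have hyB := hD.U_le hy
  -- Since `d` lies in the half-space of `α_s`, this gives `y = b₂ b₁`, where `b₂` stabilizes the
  -- chamber `d` and `b₁` the chamber `s`. A torus factor is then moved from `b₂` to `b₁` to reach
  -- `U`.
  have h1 := (hD.mem_simpleRoot.1 hds).2 (y⁻¹ * d) ((InDC.self d).mul_left (inv_mem hyB))
  obtain ⟨b, hb, b', hb', he⟩ := h1
  set b₂ := d * b'⁻¹ * d⁻¹ with hb₂
  set b₁ := s⁻¹ * b⁻¹ * s with hb₁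
  have hb₁s : s⁻¹ * (s * b₁ * s⁻¹) * s = b₁ := by group
  have hy12 : y = b₂ * b₁ := by
    have h2 : y⁻¹ = s⁻¹ * b * s * (d * b' * d⁻¹) := by
      have h3 := eq_mul_inv_of_mul_eq (eq_inv_mul_of_mul_eq he)
      rw [h3]
      group
    rw [← inv_inv y, h2, hb₂, hb₁]
    group
  have hpan : b₁⁻¹ ∈ D.B ∨ D.InDC s b₁⁻¹ := by
    have h3 : s⁻¹⁻¹ * b₁⁻¹ * s⁻¹ ∈ D.B := by
      have : s⁻¹⁻¹ * b₁⁻¹ * s⁻¹ = b := by rw [hb₁]; group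
      rwa [this]
    refine hD.mem_panel hs ?_
    have e := (hD.mem_B_of_eqv (x := b₁⁻¹) (hD.S_inv hs)).2 h3
    exact e
  have hb₂B : b₂ ∈ D.B := by
    have h4 : b₂ = y * b₁⁻¹ := by rw [hy12]; group
    refine hD.mem_B_of_panel hs hds ?_ ?_
    · rw [h4]
      rcases hpan with h | h
      · exact Or.inl (mul_mem hyB h)
      · exact Or.inr (h.mul_left hyB)
    · have : d⁻¹ * b₂ * d = b'⁻¹ := by rw [hb₂]; group
      rw [this]
      exact inv_mem hb'
  obtain ⟨u₂, hu₂, t, ht, hut⟩ := hD.exists_mul_of_mem_B hb₂B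
  have hdB : d⁻¹ * u₂ * d ∈ D.B := by
    have : d⁻¹ * u₂ * d = b'⁻¹ * (d⁻¹ * t⁻¹ * d) := by
      rw [eq_mul_inv_of_mul_eq hut.symm, hb₂]; group
    rw [this]
    exact mul_mem (inv_mem hb') (T_le_B (hD.inv_conj_torus hd (inv_mem ht)))
  have hu₂1 : (1 : G)⁻¹ * u₂ * 1 ∈ D.U := by simpa using hu₂
  have hdU := hD.mem_U_of_conj hu₂1 hdB
  refine ⟨u₂, ?_, t * b₁, ?_, ?_, ?_⟩
  · have h5 : u₂ ∈ D.rootSubgroup {1, d} := by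
      rw [mem_rootSubgroup_insert, mem_rootSubgroup_singleton]
      exact ⟨hu₂1, hdU⟩
    refine hD.rootSubgroup_le ?_ ⟨1, by simp⟩ (root_subset_N hroot) ?_ h5
    · rintro x (rfl | rfl)
      · exact D.N.one_mem
      · exact hd
    · intro a ha hsub
      have h6 : s ∉ a := fun h => (hopp a ha).1 h (hsub (by simp))
      have h7 := hD.root_eq ha hs (y := 1) (hsub (by simp)) (by simpa using h6)
      rw [h7, one_smul]
  · have : t * b₁ = u₂⁻¹ * y := by rw [hy12, hut]; group
    rw [this]
    exact mul_mem (inv_mem hu₂) hy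
  · have hU : t * b₁ ∈ D.U := by
      have : t * b₁ = u₂⁻¹ * y := by rw [hy12, hut]; group
      rw [this]
      exact mul_mem (inv_mem hu₂) hy
    refine hD.mem_U_of_conj (c := 1) (by simpa using hU) ?_
    rw [hD.mem_B_of_eqv (hD.S_inv hs)]
    have : s⁻¹⁻¹ * (t * b₁) * s⁻¹ = (s * t * s⁻¹) * b⁻¹ := by rw [hb₁]; group
    rw [this]
    exact mul_mem (T_le_B (hD.conj_torus hsN ht)) (inv_mem hb)
  · rw [hy12, hut]; group

theorem IsSplitBNPair.exists_mul_of_mem_rootSubgroup (hD : D.IsSplitBNPair p) {A : Set G}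
    {c s y : G} (hs : s ∈ D.S) (hc : c ∈ A) (hA : A ⊆ c • D.simpleRoot s)
    (hy : y ∈ D.rootSubgroup A) :
    ∃ x ∈ D.rootSubgroup (c • D.simpleRoot s), ∃ u ∈ D.rootSubgroup (insert (c * s) A),
      y = x * u := by
  obtain ⟨x, hx, u, hu, hsu, he⟩ := hD.exists_mul_of_mem_U hs (mem_rootSubgroup.1 hy c hc)
  have hx' : c * x * c⁻¹ ∈ D.rootSubgroup (c • D.simpleRoot s) := by
    rw [rootSubgroup_smul]
    exact conj_mem_conjSub hx
  have he' : y = c * x * c⁻¹ * (c * u * c⁻¹) := by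
    have := congrArg (fun z => c * z * c⁻¹) he
    convert this using 1 <;> group
  refine ⟨c * x * c⁻¹, hx', c * u * c⁻¹, ?_, he'⟩
  rw [mem_rootSubgroup_insert]
  refine ⟨by convert hsu using 1; group, ?_⟩
  rw [show c * u * c⁻¹ = (c * x * c⁻¹)⁻¹ * y by rw [he']; group]
  exact mul_mem (inv_mem (rootSubgroup_anti hA hx')) hy

/-- Factorization of `U_A` into the root subgroups for the roots that do not contain a given chamber
`d`, and the stabilizer of `d`. -/
theorem IsSplitBNPair.exists_mul_insert (hD : D.IsSplitBNPair p) {A : Set G} (hA : A ⊆ D.N)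
    (hne : A.Nonempty) {d : G} (hd : d ∈ D.N) {H : Subgroup G}
    (hH : ∀ a ∈ D.roots, A ⊆ a → d ∉ a → D.rootSubgroup a ≤ H) {y : G}
    (hy : y ∈ D.rootSubgroup A) :
    ∃ h ∈ H, ∃ u ∈ D.rootSubgroup (insert d A), y = h * u := by
  obtain ⟨c₀, hc₀⟩ := hne
  suffices key : ∀ k, ∀ A ⊆ (D.N : Set G), A.Nonempty → ∀ c ∈ D.N,
      (∀ a ∈ D.roots, A ⊆ a → c ∈ a) →
      (∀ a ∈ D.roots, A ⊆ a → d ∉ a → D.rootSubgroup a ≤ H) → D.dist c d = k →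
      ∀ y ∈ D.rootSubgroup A, ∃ h ∈ H, ∃ u ∈ D.rootSubgroup (insert d A), y = h * u from
    key _ A hA ⟨c₀, hc₀⟩ c₀ (hA hc₀) (fun a _ h => h hc₀) hH rfl y hy
  clear hy y hH hc₀ c₀ hA A
  intro k
  induction k using Nat.strong_induction_on with
  | _ k ih =>
  intro A hA hne c hc hull hH hk y hy
  have hyc := hD.rootSubgroup_le_of_hull hA hne hc hull hy
  by_cases he : D.Eqv c d
  · exact ⟨1, one_mem _, y, mem_rootSubgroup_insert.2 ⟨hD.mem_U_of_eqv he hyc, hy⟩, by simp⟩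
  obtain ⟨s, hs, hstep⟩ := hD.exists_step (J := D.S) le_rfl (x := c) (y := d)
    ((stdN_S hD).symm ▸ mul_mem (inv_mem hc) hd) he
  have hlt := hD.dist_step hc hd hs hstep
  have hcs := mul_mem hc (hD.S_subset s hs)
  have hroot := smul_simpleRoot_mem_roots (D := D) hc hs
  -- If the root of the step from `c` towards `d` contains `A`, its root subgroup splits off and
  -- lies in `H`. Otherwise `c s` is still in the convex hull of `A`.
  by_cases hsub : A ⊆ c • D.simpleRoot s
  · obtain ⟨x, hx, u, hu, rfl⟩ := hD.exists_mul_of_mem_rootSubgroup (A := insert c A) hs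
      (Set.mem_insert c A)
      (Set.insert_subset (self_mem_smul_simpleRoot c s) hsub)
      (mem_rootSubgroup_insert.2 ⟨hyc, hy⟩)
    have hsubset : A ⊆ insert (c * s) (insert c A) := fun z hz => by simp [hz]
    obtain ⟨h, hh, u', hu', rfl⟩ := ih _ (hk ▸ hlt) (insert (c * s) (insert c A))
      (Set.insert_subset hcs (Set.insert_subset hc hA)) ⟨c, by simp⟩ (c * s) hcs
      (fun a _ h => h (by simp)) (fun a ha h => hH a ha (hsubset.trans h)) rfl u hu
    exact ⟨x * h, mul_mem (hH _ hroot hsub hstep hx) hh, u',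
      rootSubgroup_anti (Set.insert_subset_insert hsubset) hu', by group⟩
  · refine ih _ (hk ▸ hlt) A hA hne (c * s) hcs (fun a ha h => ?_) hH rfl y hy
    by_contra h'
    exact hsub (hD.root_eq ha hs (hull a ha h) h' ▸ h)

/-- Factoring with respect to a chamber opposite to one of `A` leaves no remainder, since no root
contains two opposite chambers. -/
theorem IsSplitBNPair.rootSubgroup_eq_iSup (hD : D.IsSplitBNPair p) {A : Set G} (hA : A ⊆ D.N)
    (hne : A.Nonempty) :
    D.rootSubgroup A = ⨆ a ∈ {a | a ∈ D.roots ∧ A ⊆ a}, D.rootSubgroup a := by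
  refine le_antisymm (fun y hy => ?_) (iSup₂_le fun a ha => rootSubgroup_anti ha.2)
  obtain ⟨c, hc⟩ := hne
  obtain ⟨d, hd, hopp⟩ := hD.exists_opp_N (hA hc)
  obtain ⟨h, hh, u, hu, rfl⟩ := hD.exists_mul_insert hA ⟨c, hc⟩ hd
    (H := ⨆ a ∈ {a | a ∈ D.roots ∧ A ⊆ a}, D.rootSubgroup a)
    (fun a ha hAa _ => le_iSup₂_of_le a ⟨ha, hAa⟩ le_rfl) hy
  rw [hD.rootSubgroup_eq_bot (Set.insert_subset hd hA) ⟨d, by simp⟩ (fun a ha h => ?_)] at hu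
  · rw [Subgroup.mem_bot.1 hu, mul_one]
    exact hh
  · exact (hopp a ha).1 (h (by simp [hc])) (h (by simp))

/-- A subgroup contains `U_A` as soon as it contains the root subgroups. -/
theorem IsSplitBNPair.rootSubgroup_le_of_forall (hD : D.IsSplitBNPair p) {A : Set G}
    (hA : A ⊆ D.N) (hne : A.Nonempty) {H : Subgroup G}
    (h : ∀ a ∈ D.roots, A ⊆ a → D.rootSubgroup a ≤ H) : D.rootSubgroup A ≤ H := by
  rw [hD.rootSubgroup_eq_iSup hA hne]
  exact iSup₂_le fun a ha => h a ha.1 ha.2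

end RootSubgroups

end BNData
end HarishChandra

namespace HarishChandra
namespace BNData

/-! ### Levi subgroups of faces -/

section Levis

variable {G : Type v} [Group G] {D : BNData G} {p : ℕ} [Finite G]

/-- The Levi subgroup of a face. -/
def levi (D : BNData G) (F : Set G) : Subgroup G :=
  D.T ⊔ ⨆ a ∈ {a | a ∈ D.roots ∧ Cuts a F}, D.rootSubgroup a

theorem T_le_levi (F : Set G) : D.T ≤ D.levi F := le_sup_left

theorem rootSubgroup_le_levi {F a : Set G} (ha : a ∈ D.roots) (h : Cuts a F) :
    D.rootSubgroup a ≤ D.levi F := le_sup_of_le_right (le_iSup₂_of_le a ⟨ha, h⟩ le_rfl)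

theorem levi_le {F : Set G} {H : Subgroup G} (hT : D.T ≤ H)
    (h : ∀ a ∈ D.roots, Cuts a F → D.rootSubgroup a ≤ H) : D.levi F ≤ H :=
  sup_le hT (iSup₂_le fun a ha => h a ha.1 ha.2)

theorem levi_mono {F E : Set G} (h : ∀ a ∈ D.roots, Cuts a F → Cuts a E) : D.levi F ≤ D.levi E :=
  levi_le (T_le_levi E) fun a ha hc => rootSubgroup_le_levi ha (h a ha hc)

theorem Parallel.levi_eq {F E : Set G} (h : D.Parallel F E) : D.levi F = D.levi E :=
  le_antisymm (levi_mono fun a ha => (h a ha).1) (levi_mono fun a ha => (h a ha).2)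

theorem IsSplitBNPair.levi_smul_le (hD : D.IsSplitBNPair p) {n : G} (hn : n ∈ D.N) (F : Set G) :
    D.levi (n • F) ≤ conjSub n (D.levi F) := by
  refine levi_le ?_ fun a ha h => ?_
  · rw [← hD.torus_normal n hn]
    exact conjSub_mono (T_le_levi F)
  · have h1 : Cuts (n⁻¹ • a) F := by
      have := (cuts_smul (n := n⁻¹)).2 h
      rwa [inv_smul_smul] at this
    have h2 := rootSubgroup_le_levi (smul_mem_roots (inv_mem hn) ha) h1
    have h3 := conjSub_mono (g := n) h2
    rwa [← rootSubgroup_smul, smul_inv_smul] at h3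

theorem IsSplitBNPair.levi_smul (hD : D.IsSplitBNPair p) {n : G} (hn : n ∈ D.N) (F : Set G) :
    D.levi (n • F) = conjSub n (D.levi F) := by
  refine le_antisymm (hD.levi_smul_le hn F) ?_
  have h := conjSub_mono (g := n) (hD.levi_smul_le (inv_mem hn) (n • F))
  rwa [inv_smul_smul, ← conjSub_mul, mul_inv_cancel, conjSub_one] at h

theorem IsSplitBNPair.T_le_normalizer (hD : D.IsSplitBNPair p) {A : Set G} (hA : A ⊆ D.N) :
    D.T ≤ Subgroup.normalizer (D.rootSubgroup A : Set G) := by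
  rw [le_normalizer_iff]
  intro t ht x hx
  rw [mem_rootSubgroup] at hx ⊢
  intro n hn
  have h1 := le_normalizer_iff.1 hD.B_le_normalizer _ (T_le_B (hD.inv_conj_torus (hA hn) ht)) _
    (hx n hn)
  convert h1 using 1
  group

/-- The Levi subgroup of a face normalizes the unipotent radical; this is where the commutator
relations are used. -/
theorem IsSplitBNPair.levi_le_normalizer (hD : D.IsSplitBNPair p) (hcomm : D.CommutatorRelations)
    {c : G} {J : Set G} (hc : c ∈ D.N) (hJ : J ⊆ D.S) :
    D.levi (D.face c J) ≤ Subgroup.normalizer (D.rootSubgroup (D.face c J) : Set G) := by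
  have hFN := hD.face_subset_N hc hJ
  refine levi_le (hD.T_le_normalizer hFN) fun b hb hcut => ?_
  rw [le_normalizer_iff]
  intro y hy
  suffices h : D.rootSubgroup (D.face c J) ≤ conjSub y⁻¹ (D.rootSubgroup (D.face c J)) by
    intro x hx
    simpa [mem_conjSub] using h hx
  refine hD.rootSubgroup_le_of_forall hFN ⟨c, self_mem_face c J⟩ fun a ha hFa x hx => ?_
  rw [mem_conjSub, inv_inv]
  obtain ⟨⟨e, heb, he⟩, ⟨e', he', heb'⟩⟩ := hcut
  have h1 := hcomm a ha b hb (fun h => heb' (h ▸ hFa he')) (fun h => (h ▸ heb).2 (hFa he))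
    x⁻¹ (inv_mem hx) y hy
  -- The roots in the commutator relation contain the half of the face in `b` and differ from `b`,
  -- so they contain the whole face.
  have h2 : (⨆ c ∈ {c | c ∈ D.roots ∧ c ≠ a ∧ c ≠ b ∧ a ∩ b ⊆ c}, D.rootSubgroup c)
      ≤ D.rootSubgroup (D.face c J) := by
    refine iSup₂_le fun r hr => rootSubgroup_anti ?_
    exact hD.face_subset_of_half hc hJ hr.1 hb ⟨⟨e, heb, he⟩, ⟨e', he', heb'⟩⟩ hr.2.2.1
      fun z hz => hr.2.2.2 ⟨hFa hz.2, hz.1⟩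
  have h3 := mul_mem (rootSubgroup_anti hFa hx) (h2 h1)
  convert h3 using 1
  group

/-! ### Rank one -/

/-- The cell `BsB` written with root subgroups, up to a remainder `r` in the unipotent radical of
the panel. In `rank_one` the remainder is shown to vanish. -/
theorem IsSplitBNPair.panel_factor_one (hD : D.IsSplitBNPair p) {s y : G} (hs : s ∈ D.S)
    (h : s⁻¹ * y * s ∈ D.B) (hy : y ∉ D.B) :
    ∃ x₁ ∈ D.rootSubgroup (D.simpleRoot s), ∃ t ∈ D.T, ∃ x₂ ∈ D.rootSubgroup (D.simpleRoot s),
      ∃ r ∈ D.rootSubgroup {1, s}, y = x₁ * s * t * x₂ * r := by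
  have hsN := hD.S_subset s hs
  obtain ⟨b, hb, b', hb', rfl⟩ := (hD.mem_panel hs h).resolve_left hy
  obtain ⟨u, hu, t₀, ht₀, rfl⟩ := hD.exists_mul_of_mem_B hb
  obtain ⟨x₁, hx₁, u₁, hu₁, hsu₁, rfl⟩ := hD.exists_mul_of_mem_U hs hu
  have hB : s⁻¹ * u₁ * s * (s⁻¹ * t₀ * s) * b' ∈ D.B :=
    mul_mem (mul_mem (hD.U_le hsu₁) (T_le_B (hD.inv_conj_torus hsN ht₀))) hb'
  obtain ⟨u₂, hu₂, t, ht, he⟩ := hD.exists_mul_of_mem_B (inv_mem hB)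
  obtain ⟨x₂, hx₂, r, hr, hsr, he₂⟩ := hD.exists_mul_of_mem_U hs (inv_mem hu₂)
  refine ⟨x₁, hx₁, t⁻¹, inv_mem ht, x₂, hx₂, r, ?_, ?_⟩
  · rw [mem_rootSubgroup_insert, mem_rootSubgroup_singleton]
    exact ⟨by simpa using hr, hsr⟩
  · have h1 : s⁻¹ * u₁ * s * (s⁻¹ * t₀ * s) * b' = t⁻¹ * x₂ * r := by
      rw [← inv_inv (s⁻¹ * u₁ * s * (s⁻¹ * t₀ * s) * b'), he, mul_inv_rev, he₂, mul_assoc]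
    calc x₁ * u₁ * t₀ * s * b' = x₁ * s * (s⁻¹ * u₁ * s * (s⁻¹ * t₀ * s) * b') := by group
      _ = x₁ * s * t⁻¹ * x₂ * r := by rw [h1]; group

theorem IsSplitBNPair.panel_factor (hD : D.IsSplitBNPair p) {c s y : G} (hc : c ∈ D.N)
    (hs : s ∈ D.S) (h : (c * s)⁻¹ * y * (c * s) ∈ D.B) (hy : c⁻¹ * y * c ∉ D.B) :
    ∃ x₁ ∈ D.rootSubgroup (c • D.simpleRoot s), ∃ t ∈ D.T,
      ∃ x₂ ∈ D.rootSubgroup (c • D.simpleRoot s), ∃ r ∈ D.rootSubgroup {c, c * s},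
      y = x₁ * (c * s * c⁻¹) * t * x₂ * r := by
  obtain ⟨x₁, hx₁, t, ht, x₂, hx₂, r, hr, he⟩ := hD.panel_factor_one (y := c⁻¹ * y * c) hs
    (by convert h using 1; group) hy
  refine ⟨c * x₁ * c⁻¹, ?_, c * t * c⁻¹, hD.conj_torus hc ht, c * x₂ * c⁻¹, ?_, c * r * c⁻¹, ?_, ?_⟩
  · rw [rootSubgroup_smul]; exact conj_mem_conjSub hx₁
  · rw [rootSubgroup_smul]; exact conj_mem_conjSub hx₂
  · have : ({c, c * s} : Set G) = c • ({1, s} : Set G) := by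
      simp [Set.smul_set_insert]
    rw [this, rootSubgroup_smul]; exact conj_mem_conjSub hr
  · have := congrArg (fun z => c * z * c⁻¹) he
    convert this using 1 <;> group

/-- The convex hull of the two chambers is the panel, because every root that cuts the panel
separates them. -/
theorem IsSplitBNPair.rootSubgroup_panel_le (hD : D.IsSplitBNPair p) {c s : G} (hc : c ∈ D.N)
    (hs : s ∈ D.S) : D.rootSubgroup {c, c * s} ≤ D.rootSubgroup (D.face c {s}) := by
  have hJ : ({s} : Set G) ⊆ D.S := by simpa using hs
  have hcs := mul_mem hc (hD.S_subset s hs)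
  refine hD.rootSubgroup_le ?_ ⟨c, by simp⟩ (hD.face_subset_N hc hJ) fun a ha h => ?_
  · rintro x (rfl | rfl)
    · exact hc
    · exact hcs
  · refine subset_of_not_cuts (fun hcut => ?_) (self_mem_face c {s}) (h (by simp))
    refine hD.notMem_of_walls hc hJ hcs ?_ ha hcut (h (by simp)) (h (by simp))
    rintro q rfl
    exact hD.mul_notMem hs

/-- In rank one: every nontrivial element of `X_{-α}` lies in `X_α s T X_α`. -/
theorem IsSplitBNPair.rank_one (hD : D.IsSplitBNPair p) (hcomm : D.CommutatorRelations) {s y : G}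
    (hs : s ∈ D.S) (hy : y ∈ D.rootSubgroup (s • D.simpleRoot s)) (hy1 : y ≠ 1) :
    ∃ x₁ ∈ D.rootSubgroup (D.simpleRoot s), ∃ t ∈ D.T, ∃ x₂ ∈ D.rootSubgroup (D.simpleRoot s),
      y = x₁ * s * t * x₂ := by
  have hsN := hD.S_subset s hs
  have h1N := D.N.one_mem
  have hα : D.simpleRoot s ∈ D.roots := by
    simpa using smul_simpleRoot_mem_roots (D := D) D.N.one_mem hs
  have hsα : s • D.simpleRoot s ∈ D.roots := smul_simpleRoot_mem_roots hsN hs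
  have hαN := root_subset_N hα
  have hsαN := root_subset_N hsα
  have hcompl : (D.N : Set G) \ D.simpleRoot s = s • D.simpleRoot s := by
    simpa using hD.compl_root_aux h1N hs
  have hssα : s ∈ s • D.simpleRoot s := self_mem_smul_simpleRoot s s
  obtain ⟨w, hw, hopp⟩ := hD.exists_opp_N h1N
  have hwα : w ∉ D.simpleRoot s := (hopp _ hα).1 (one_mem_simpleRoot s)
  have hwsα : w ∈ s • D.simpleRoot s := hcompl ▸ ⟨hw, hwα⟩
  -- As `w` is opposite to `1`, the chamber `c` is opposite to `s`. The panel of `c` and `w` lies at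
  -- the other end of the wall that contains the panel of `1` and `s`.
  set c := s * w with hcdef
  have hc : c ∈ D.N := mul_mem hsN hw
  have hcα : c ∈ D.simpleRoot s := (hD.mul_mem_simpleRoot_iff hs hw).2 hwα
  have hoppc : ∀ a ∈ D.roots, s ∈ a ↔ c ∉ a := by
    intro a ha
    have := hopp _ (smul_mem_roots (inv_mem hsN) ha)
    rw [mem_smul_set, mem_smul_set] at this
    simpa using this
  have hyw : w⁻¹ * y * w ∈ D.U := mem_rootSubgroup.1 hy w hwsα
  have hys : s⁻¹ * y * s ∈ D.U := mem_rootSubgroup.1 hy s hssα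
  -- `y` does not stabilize the chambers `1` and `c`
  have hyB : y ∉ D.B := by
    intro h
    have hyU : (1 : G)⁻¹ * y * 1 ∈ D.U := hD.mem_U_of_conj hys (by simpa using h)
    have h1 : y ∈ D.rootSubgroup (insert 1 (s • D.simpleRoot s)) :=
      mem_rootSubgroup_insert.2 ⟨hyU, hy⟩
    rw [hD.rootSubgroup_eq_bot (Set.insert_subset h1N hsαN) ⟨1, by simp⟩
      (fun a ha h => (hopp a ha).1 (h (by simp)) (h (by simp [hwsα])))] at h1
    exact hy1 (Subgroup.mem_bot.1 h1)
  have hyc : c⁻¹ * y * c ∉ D.B := by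
    intro h
    have hyU : c⁻¹ * y * c ∈ D.U := hD.mem_U_of_conj hys h
    have h1 : y ∈ D.rootSubgroup (insert c (s • D.simpleRoot s)) :=
      mem_rootSubgroup_insert.2 ⟨hyU, hy⟩
    rw [hD.rootSubgroup_eq_bot (Set.insert_subset hc hsαN) ⟨c, by simp⟩
      (fun a ha h => (hoppc a ha).1 (h (by simp [hssα])) (h (by simp)))] at h1
    exact hy1 (Subgroup.mem_bot.1 h1)
  -- the panel of `c` in the wall of `α`
  have hcw : ¬ D.Eqv c w := fun h => hwα ((hD.root_congr hα h).1 hcα)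
  obtain ⟨q, hq, hqw⟩ := hD.exists_step (J := D.S) le_rfl (x := c) (y := w)
    ((stdN_S hD).symm ▸ mul_mem (inv_mem hc) hw) hcw
  have hqN := hD.S_subset q hq
  have hroot := smul_simpleRoot_mem_roots (D := D) hc hq
  have hcq : c • D.simpleRoot q = D.simpleRoot s := by
    have h1 : (1 : G) ∈ c • D.simpleRoot q := (hopp _ hroot).2 hqw
    have h2 : (1 : G) * s ∉ c • D.simpleRoot q := by
      rw [one_mul, hoppc _ hroot, not_not]
      exact self_mem_smul_simpleRoot c q
    simpa using hD.root_eq hroot hs h1 h2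
  have hrefl : D.Eqv (s * c) (c * q) := by
    have := hD.refl_eqv_of_leaves (x := 1) h1N hs hq (y := c) (by simpa using hcα)
      (by rw [one_smul, ← hcq]; exact hD.mul_notMem hq)
    simpa using this
  have hcqw : D.Eqv w (c * q) := (hD.S_mul_S_mul hs hw).trans hrefl
  -- Each of the two panels gives a factorization of `y`. Moved past `x₂` and `x₂'`, the remainders
  -- become elements `ρ` and `ρ'` of the radicals of the two panels, and comparing the
  -- factorizations makes `ρ` trivial.
  obtain ⟨x₁, hx₁, t, ht, x₂, hx₂, r, hr, he⟩ := hD.panel_factor_one hs (hD.U_le hys) hyB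
  obtain ⟨x₁', hx₁', t', ht', x₂', hx₂', r', hr', he'⟩ := hD.panel_factor hc hq
    ((hD.mem_B_of_eqv hcqw).1 (hD.U_le hyw)) hyc
  rw [hcq] at hx₁' hx₂'
  obtain ⟨t₁, ht₁, hcqt⟩ : ∃ t₁ ∈ D.T, c * q * c⁻¹ = s * t₁ := by
    refine ⟨s⁻¹ * (c * q * c⁻¹), ?_, by group⟩
    have := hD.conj_torus hc (show (s * c)⁻¹ * (c * q) ∈ D.T from hrefl)
    convert this using 1
    group
  rw [hcqt] at he'
  -- commutation with the radicals
  have hJs : ({s} : Set G) ⊆ D.S := by simpa using hs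
  have hJq : ({q} : Set G) ⊆ D.S := by simpa using hq
  have hρ : x₂ * r * x₂⁻¹ ∈ D.rootSubgroup (D.face 1 {s}) := by
    refine le_normalizer_iff.1 (hD.levi_le_normalizer hcomm h1N hJs) _
      (rootSubgroup_le_levi hα ?_ hx₂) _ (hD.rootSubgroup_panel_le h1N hs ?_)
    · simpa using hD.cuts_self (c := 1) hs (Set.mem_singleton s)
    · simpa using hr
  have hρ' : x₂' * r' * x₂'⁻¹ ∈ D.rootSubgroup (D.face c {q}) := by
    refine le_normalizer_iff.1 (hD.levi_le_normalizer hcomm hc hJq) _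
      (rootSubgroup_le_levi hα ?_ hx₂') _ (hD.rootSubgroup_panel_le hc hq hr')
    rw [← hcq]
    exact hD.cuts_self (c := c) hq (Set.mem_singleton q)
  set ρ := x₂ * r * x₂⁻¹ with hρdef
  set ρ' := x₂' * r' * x₂'⁻¹ with hρ'def
  have hz : s⁻¹ * (x₁⁻¹ * x₁') * s ∈ D.rootSubgroup (s • D.simpleRoot s) := by
    have h1 : s⁻¹ * (x₁⁻¹ * x₁') * s ∈ D.rootSubgroup (s⁻¹ • D.simpleRoot s) := by
      rw [rootSubgroup_smul, mem_conjSub]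
      convert mul_mem (inv_mem hx₁) hx₁' using 1
      group
    refine rootSubgroup_anti ?_ h1
    intro z hz
    have hzN := hsαN hz
    rw [mem_smul_set] at hz ⊢
    rw [inv_inv]
    exact (hD.simpleRoot_congr (Eqv.mul_right hD hzN (hD.S_inv hs))).2 hz
  set z := s⁻¹ * (x₁⁻¹ * x₁') * s with hzdef
  have hkey : ρ * x₂ * x₂'⁻¹ = t⁻¹ * z * (t₁ * t') * ρ' := by
    have h1 : x₁ * s * t * x₂ * r = x₁' * (s * t₁) * t' * x₂' * r' := he.symm.trans he'
    have h2 : t * ρ * x₂ = z * (t₁ * t') * ρ' * x₂' := by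
      have h3 := congrArg (fun y => s⁻¹ * x₁⁻¹ * y) h1
      rw [hρdef, hρ'def, hzdef]
      convert h3 using 1 <;> group
    calc ρ * x₂ * x₂'⁻¹ = t⁻¹ * (t * ρ * x₂) * x₂'⁻¹ := by group
      _ = t⁻¹ * (z * (t₁ * t') * ρ' * x₂') * x₂'⁻¹ := by rw [h2]
      _ = _ := by group
  have hα1 : ∀ x ∈ D.rootSubgroup (D.simpleRoot s), x ∈ D.U := fun x hx => by
    simpa using mem_rootSubgroup.1 hx 1 (one_mem_simpleRoot s)
  have hρU : ρ ∈ D.U := by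
    simpa using mem_rootSubgroup.1 hρ 1 (self_mem_face 1 {s})
  have hg1 : ρ * x₂ * x₂'⁻¹ ∈ D.U := mul_mem (mul_mem hρU (hα1 _ hx₂)) (inv_mem (hα1 _ hx₂'))
  have hg2 : w⁻¹ * (ρ * x₂ * x₂'⁻¹) * w ∈ D.B := by
    rw [hkey]
    have hT : ∀ t ∈ D.T, w⁻¹ * t * w ∈ D.B := fun t ht => T_le_B (hD.inv_conj_torus hw ht)
    have h1 : w⁻¹ * ρ' * w ∈ D.B := by
      rw [hD.mem_B_of_eqv hcqw]
      exact hD.U_le (mem_rootSubgroup.1 hρ' _ (mul_mem_face (self_mem_face c {q}) rfl))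
    have h2 : w⁻¹ * z * w ∈ D.B := hD.U_le (mem_rootSubgroup.1 hz w hwsα)
    have h3 := mul_mem (mul_mem (mul_mem (hT _ (inv_mem ht)) h2) (hT _ (mul_mem ht₁ ht'))) h1
    convert h3 using 1
    group
  -- The left side of `hkey` is unipotent at the chamber `1`, and the right side stabilizes the
  -- opposite chamber `w`.
  have hg : ρ * x₂ * x₂'⁻¹ = 1 := by
    have h1 : ρ * x₂ * x₂'⁻¹ ∈ D.rootSubgroup {1, w} := by
      rw [mem_rootSubgroup_insert, mem_rootSubgroup_singleton]
      exact ⟨by simpa using hg1, hD.mem_U_of_conj (c := 1) (by simpa using hg1) hg2⟩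
    rw [hD.rootSubgroup_eq_bot ?_ ⟨1, by simp⟩
      (fun a ha h => (hopp a ha).1 (h (by simp)) (h (by simp)))] at h1
    · exact Subgroup.mem_bot.1 h1
    · rintro x (rfl | rfl)
      · exact h1N
      · exact hw
  -- Now `ρ` lies in `X_α`, so it is unipotent at `c`, and as an element of the radical it is so at
  -- the opposite chamber `s`.
  have hρ1 : ρ = 1 := by
    have h1 : ρ = x₂' * x₂⁻¹ := by
      rw [eq_mul_inv_of_mul_eq (mul_inv_eq_one.1 hg)]
    have h2 : ρ ∈ D.rootSubgroup (insert s (D.simpleRoot s)) := by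
      rw [mem_rootSubgroup_insert]
      refine ⟨mem_rootSubgroup.1 hρ s ?_, h1 ▸ mul_mem hx₂' (inv_mem hx₂)⟩
      simpa using mul_mem_face (self_mem_face (1 : G) {s}) (D := D) (Set.mem_singleton s)
    rw [hD.rootSubgroup_eq_bot (Set.insert_subset hsN hαN) ⟨s, by simp⟩
      (fun a ha h => (hoppc a ha).1 (h (by simp)) (h (by simp [hcα])))] at h2
    exact Subgroup.mem_bot.1 h2
  have hr1 : r = 1 := by
    have : x₂ * r * x₂⁻¹ = 1 := hρ1
    simpa using this
  exact ⟨x₁, hx₁, t, ht, x₂, hx₂, by rw [he, hr1, mul_one]⟩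

/-- Otherwise the factorization of `U` would give `s⁻¹ B s ≤ B`, but `s` does not normalize `B`. -/
theorem IsSplitBNPair.rootSubgroup_simpleRoot_ne_bot (hD : D.IsSplitBNPair p) {s : G}
    (hs : s ∈ D.S) : D.rootSubgroup (D.simpleRoot s) ≠ ⊥ := by
  intro hbot
  have hsN := hD.S_subset s hs
  refine hD.not_normalize s hs ?_
  have h1 : conjSub s⁻¹ D.B ≤ D.B := by
    intro x hx
    rw [mem_conjSub, inv_inv] at hx
    obtain ⟨u, hu, t, ht, he⟩ := hD.exists_mul_of_mem_B hx
    obtain ⟨y, hy, v, hv, hsv, rfl⟩ := hD.exists_mul_of_mem_U hs hu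
    rw [hbot, Subgroup.mem_bot] at hy
    subst hy
    have : x = s⁻¹ * v * s * (s⁻¹ * t * s) := by
      have := congrArg (fun z => s⁻¹ * z * s) he
      convert this using 1 <;> group
    rw [this]
    exact mul_mem (hD.U_le hsv) (T_le_B (hD.inv_conj_torus hsN ht))
  have h2 := conjSub_eq_of_le h1
  rw [← h2, ← conjSub_mul, mul_inv_cancel, conjSub_one, h2]

end Levis

end BNData
end HarishChandra

namespace HarishChandra
namespace BNData

/-! ### The Bruhat decomposition of a Levi subgroup -/

section LeviBruhat

variable {G : Type v} [Group G] {D : BNData G} {p : ℕ} [Finite G]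

/-- The intersection of the half-spaces that contain `c`, for the roots that cut `F`. -/
def cone (D : BNData G) (c : G) (F : Set G) : Set G :=
  {x | x ∈ D.N ∧ ∀ a ∈ D.roots, c ∈ a → Cuts a F → x ∈ a}

theorem cone_subset_N (c : G) (F : Set G) : D.cone c F ⊆ D.N := fun _ h => h.1

theorem self_mem_cone {c : G} (hc : c ∈ D.N) (F : Set G) : c ∈ D.cone c F :=
  ⟨hc, fun _ _ h _ => h⟩

theorem smul_cone {n : G} (hn : n ∈ D.N) (c : G) (F : Set G) :
    n • D.cone c F = D.cone (n * c) (n • F) := by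
  ext x
  rw [mem_smul_set]
  constructor
  · rintro ⟨h1, h2⟩
    refine ⟨by simpa using mul_mem hn h1, fun a ha hca hcut => ?_⟩
    have := h2 (n⁻¹ • a) (smul_mem_roots (inv_mem hn) ha) (by rw [mem_smul_set]; simpa using hca)
      (by simpa using (cuts_smul (n := n⁻¹)).2 hcut)
    rw [mem_smul_set] at this
    simpa using this
  · rintro ⟨h1, h2⟩
    refine ⟨mul_mem (inv_mem hn) h1, fun a ha hca hcut => ?_⟩
    have := h2 (n • a) (smul_mem_roots hn ha) (by rw [mem_smul_set]; simpa using hca)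
      (cuts_smul.2 hcut)
    rwa [mem_smul_set] at this

/-- The cone lies in no half-spaces other than those that define it. Indeed, let `y` be opposite to
`c` in the face and `d` opposite to `y` among all chambers. Then `d` is in the cone, and a root that
contains `c` and `d` omits `y`, so it cuts the face. -/
theorem IsSplitBNPair.cone_subset_iff (hD : D.IsSplitBNPair p) {c : G} {J a : Set G}
    (hc : c ∈ D.N) (hJ : J ⊆ D.S) (ha : a ∈ D.roots) :
    D.cone c (D.face c J) ⊆ a ↔ c ∈ a ∧ Cuts a (D.face c J) := by
  refine ⟨fun h => ?_, fun h x hx => hx.2 a ha h.1 h.2⟩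
  have hca := h (self_mem_cone hc _)
  refine ⟨hca, ?_⟩
  obtain ⟨y, hy, hopp⟩ := hD.exists_opp hc hJ
  obtain ⟨d, hd, hopp'⟩ := hD.exists_opp_N (hD.face_subset_N hc hJ hy)
  have hdc : d ∈ D.cone c (D.face c J) := by
    refine ⟨hd, fun b hb hcb hcut => ?_⟩
    by_contra hdb
    exact (hopp b hb hcut).1 hcb ((hopp' b hb).2 hdb)
  exact ⟨⟨c, hca, self_mem_face c J⟩, ⟨y, hy, fun hya => (hopp' a ha).1 hya (h hdc)⟩⟩

/-- The maximal unipotent subgroup of the Levi subgroup of the face `F` for the chamber `c`. -/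
def leviUnip (D : BNData G) (c : G) (J : Set G) : Subgroup G :=
  D.rootSubgroup (D.cone c (D.face c J))

theorem IsSplitBNPair.leviUnip_le_levi (hD : D.IsSplitBNPair p) {c : G} {J : Set G}
    (hc : c ∈ D.N) (hJ : J ⊆ D.S) : D.leviUnip c J ≤ D.levi (D.face c J) :=
  hD.rootSubgroup_le_of_forall (cone_subset_N _ _) ⟨c, self_mem_cone hc _⟩ fun _ ha h =>
    rootSubgroup_le_levi ha ((hD.cone_subset_iff hc hJ ha).1 h).2

theorem conj_mem_U_of_mem_leviUnip {c x : G} {J : Set G} (hc : c ∈ D.N)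
    (hx : x ∈ D.leviUnip c J) : c⁻¹ * x * c ∈ D.U :=
  mem_rootSubgroup.1 hx c (self_mem_cone hc _)

theorem IsSplitBNPair.rootSubgroup_le_leviUnip (hD : D.IsSplitBNPair p) {c : G} {J a : Set G}
    (hc : c ∈ D.N) (hJ : J ⊆ D.S) (ha : a ∈ D.roots) (hca : c ∈ a)
    (hcut : Cuts a (D.face c J)) : D.rootSubgroup a ≤ D.leviUnip c J :=
  rootSubgroup_anti ((hD.cone_subset_iff hc hJ ha).2 ⟨hca, hcut⟩)

/-- The Borel subgroup of the Levi subgroup of the standard face of type `J`. -/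
def leviBorel (D : BNData G) (c : G) (J : Set G) : Subgroup G := D.leviUnip c J ⊔ D.T

theorem IsSplitBNPair.exists_mul_of_mem_leviBorel (hD : D.IsSplitBNPair p) {c x : G} {J : Set G}
    (hx : x ∈ D.leviBorel c J) : ∃ u ∈ D.leviUnip c J, ∃ t ∈ D.T, x = u * t :=
  exists_mul_of_mem_sup (hD.T_le_normalizer (cone_subset_N _ _)) hx

theorem IsSplitBNPair.leviBorel_le_levi (hD : D.IsSplitBNPair p) {c : G} {J : Set G}
    (hc : c ∈ D.N) (hJ : J ⊆ D.S) : D.leviBorel c J ≤ D.levi (D.face c J) :=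
  sup_le (hD.leviUnip_le_levi hc hJ) (T_le_levi _)

theorem leviUnip_le_leviBorel (c : G) (J : Set G) : D.leviUnip c J ≤ D.leviBorel c J := le_sup_left

theorem T_le_leviBorel (c : G) (J : Set G) : D.T ≤ D.leviBorel c J := le_sup_right

theorem IsSplitBNPair.conj_mem_B_of_mem_leviBorel (hD : D.IsSplitBNPair p) {c x : G} {J : Set G}
    (hc : c ∈ D.N) (hx : x ∈ D.leviBorel c J) : c⁻¹ * x * c ∈ D.B := by
  obtain ⟨u, hu, t, ht, rfl⟩ := hD.exists_mul_of_mem_leviBorel hx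
  have h := mul_mem (hD.U_le (conj_mem_U_of_mem_leviUnip hc hu))
    (T_le_B (hD.inv_conj_torus hc ht))
  convert h using 1
  group

theorem leviUnip_smul {n c : G} {J : Set G} (hn : n ∈ D.N) :
    D.leviUnip (n * c) J = conjSub n (D.leviUnip c J) := by
  rw [leviUnip, ← smul_face, ← smul_cone hn, rootSubgroup_smul, leviUnip]

theorem IsSplitBNPair.leviBorel_smul (hD : D.IsSplitBNPair p) {n c : G} {J : Set G} (hn : n ∈ D.N) :
    D.leviBorel (n * c) J = conjSub n (D.leviBorel c J) := by
  rw [leviBorel, leviUnip_smul hn, ← hD.torus_normal n hn, leviBorel, conjSub, conjSub, conjSub,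
    Subgroup.map_sup]

theorem mem_face_one {x : G} {J : Set G} : x ∈ D.face 1 J ↔ x ∈ D.stdN J := by
  simp [mem_face]

theorem smul_face_one {n : G} {J : Set G} (hn : n ∈ D.stdN J) : n • D.face 1 J = D.face 1 J := by
  rw [smul_face, mul_one]
  exact face_eq (mem_face_one.2 hn)

theorem IsSplitBNPair.conj_mem_leviUnip (hD : D.IsSplitBNPair p) {s n x : G} {J : Set G}
    (hJ : J ⊆ D.S) (hs : s ∈ J) (hn : n ∈ D.stdN J) (hns : n ∈ D.simpleRoot s)
    (hx : x ∈ D.rootSubgroup (D.simpleRoot s)) : n⁻¹ * x * n ∈ D.leviUnip 1 J := by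
  have hnN := hD.stdN_le hJ hn
  have hα : D.simpleRoot s ∈ D.roots := by
    simpa using smul_simpleRoot_mem_roots (D := D) D.N.one_mem (hJ hs)
  refine hD.rootSubgroup_le_leviUnip D.N.one_mem hJ (smul_mem_roots (inv_mem hnN) hα) ?_ ?_ ?_
  · rw [mem_smul_set]; simpa using hns
  · have h1 : Cuts (D.simpleRoot s) (D.face 1 J) := by
      simpa using hD.cuts_self (c := 1) (hJ hs) hs
    have h2 := (cuts_smul (n := n⁻¹)).2 h1
    rwa [smul_face_one (inv_mem hn)] at h2
  · rw [rootSubgroup_smul]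
    have := conj_mem_conjSub (g := n⁻¹) hx
    rwa [inv_inv] at this

/-- The exchange axiom for the Levi subgroup with its Borel subgroup. A factor `x⁻¹` with `x ∈ X_s`
is split off from `h`; conjugation by `s` keeps the rest in the Borel subgroup. If `n` is in the
half-space of `s`, then `x⁻¹` moves past `n`; otherwise `rank_one` rewrites `s x⁻¹ s⁻¹`. -/
theorem IsSplitBNPair.levi_exchange (hD : D.IsSplitBNPair p) (hcomm : D.CommutatorRelations)
    {s n h : G} {J : Set G} (hJ : J ⊆ D.S) (hs : s ∈ J) (hn : n ∈ D.stdN J)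
    (hh : h ∈ D.leviBorel 1 J) :
    ∃ m ∈ D.stdN J, ∃ b ∈ D.leviBorel 1 J, ∃ b' ∈ D.leviBorel 1 J, s * (h * n) = b * m * b' := by
  have hsS := hJ hs
  have hsN := hD.S_subset s hsS
  have hnN := hD.stdN_le hJ hn
  have h1N := D.N.one_mem
  have hsJ := subset_stdN (D := D) J hs
  have hα : D.simpleRoot s ∈ D.roots := by
    simpa using smul_simpleRoot_mem_roots (D := D) D.N.one_mem hsS
  have hαcut : Cuts (D.simpleRoot s) (D.face 1 J) := by
    simpa using hD.cuts_self (c := 1) hsS hs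
  have hcone := (hD.cone_subset_iff h1N hJ hα).2 ⟨one_mem_simpleRoot s, hαcut⟩
  have hXle := hD.rootSubgroup_le_leviUnip h1N hJ hα (one_mem_simpleRoot s) hαcut
  obtain ⟨u, hu, t, ht, hut⟩ := hD.exists_mul_of_mem_leviBorel (inv_mem hh)
  obtain ⟨x, hx, v, hv, rfl⟩ := hD.exists_mul_of_mem_rootSubgroup (c := 1) hsS
    (self_mem_cone h1N _) (by simpa using hcone) hu
  rw [one_smul] at hx
  rw [one_mul] at hv
  have hh' : h = t⁻¹ * v⁻¹ * x⁻¹ := by rw [← inv_inv h, hut]; group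
  -- the first part of `h` can be moved past `s`
  have hfirst : s * (t⁻¹ * v⁻¹) * s⁻¹ ∈ D.leviBorel 1 J := by
    have h1 : s * t⁻¹ * s⁻¹ ∈ D.leviBorel 1 J :=
      T_le_leviBorel 1 J (hD.conj_torus hsN (inv_mem ht))
    have h2 : s * v⁻¹ * s⁻¹ ∈ D.leviUnip 1 J := by
      have h3 : s * v⁻¹ * s⁻¹ ∈ D.rootSubgroup (s • insert s (D.cone 1 (D.face 1 J))) := by
        rw [rootSubgroup_smul]; exact conj_mem_conjSub (inv_mem hv)
      have hsub : s • insert s (D.cone 1 (D.face 1 J)) ⊆ D.N := by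
        intro z hz
        rw [mem_smul_set] at hz
        have : s⁻¹ * z ∈ D.N := by
          rcases hz with hz | hz
          · rw [hz]; exact hsN
          · exact hz.1
        simpa using mul_mem hsN this
      refine hD.rootSubgroup_le hsub
        ⟨s * s, by rw [mem_smul_set]; simp⟩ (cone_subset_N _ _) (fun a ha ha' => ?_) h3
      rw [hD.cone_subset_iff h1N hJ ha]
      have h4 : D.cone 1 (D.face 1 J) ⊆ s⁻¹ • a := by
        intro z hz
        have := ha' (show s * z ∈ _ by rw [mem_smul_set]; simp [hz])
        rw [mem_smul_set]
        simpa using this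
      have h5 := (hD.cone_subset_iff h1N hJ (smul_mem_roots (inv_mem hsN) ha)).1 h4
      constructor
      · rw [hD.root_congr ha (show D.Eqv 1 (s * s) by simpa [Eqv] using hD.S_sq s hsS)]
        exact ha' (show s * s ∈ _ by rw [mem_smul_set]; simp)
      · have := (cuts_smul (n := s)).2 h5.2
        rwa [smul_inv_smul, smul_face_one hsJ] at this
    have h3 := mul_mem h1 (leviUnip_le_leviBorel 1 J h2)
    convert h3 using 1
    group
  by_cases hns : n ∈ D.simpleRoot s
  · refine ⟨s * n, mul_mem hsJ hn, _, hfirst, n⁻¹ * x⁻¹ * n,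
      leviUnip_le_leviBorel 1 J (hD.conj_mem_leviUnip hJ hs hn hns (inv_mem hx)), ?_⟩
    rw [hh']; group
  by_cases hx1 : x = 1
  · refine ⟨s * n, mul_mem hsJ hn, _, hfirst, 1, one_mem _, ?_⟩
    rw [hh', hx1]; group
  have hy : s * x⁻¹ * s⁻¹ ∈ D.rootSubgroup (s • D.simpleRoot s) := by
    rw [rootSubgroup_smul]; exact conj_mem_conjSub (inv_mem hx)
  obtain ⟨x₁, hx₁, t₂, ht₂, x₂, hx₂, he⟩ := hD.rank_one hcomm hsS hy (by
    intro h1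
    apply hx1
    have h2 := congrArg (fun z => s⁻¹ * z * s) h1
    simpa [mul_assoc] using h2)
  -- After `s x⁻¹ s⁻¹` is replaced by `x₁ s t₂ x₂`, the factor `x₂` moves past `s n`, which is in
  -- the half-space, and the two letters `s` combine to a torus element.
  have hsn : s * n ∈ D.simpleRoot s := (hD.mul_mem_simpleRoot_iff hsS hnN).2 hns
  refine ⟨n, hn, s * (t⁻¹ * v⁻¹) * s⁻¹ * (x₁ * ((s * t₂ * s⁻¹) * (s * s))), ?_,
    (s * n)⁻¹ * x₂ * (s * n), leviUnip_le_leviBorel 1 J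
      (hD.conj_mem_leviUnip hJ hs (mul_mem hsJ hn) hsn hx₂), ?_⟩
  · refine mul_mem hfirst (mul_mem (leviUnip_le_leviBorel 1 J (hXle hx₁)) ?_)
    exact T_le_leviBorel 1 J (mul_mem (hD.conj_torus hsN ht₂) (hD.S_sq s hsS))
  · have h1 : s * x⁻¹ * n = s * x⁻¹ * s⁻¹ * (s * n) := by group
    calc s * (h * n) = s * (t⁻¹ * v⁻¹) * s⁻¹ * (s * x⁻¹ * n) := by rw [hh']; group
      _ = s * (t⁻¹ * v⁻¹) * s⁻¹ * (x₁ * s * t₂ * x₂ * (s * n)) := by rw [h1, he]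
      _ = _ := by group

/-- By `rank_one`, a nontrivial element of the opposite root subgroup is `x₁ s t x₂`, and this can
be solved for `s`. -/
theorem IsSplitBNPair.stdN_le_levi (hD : D.IsSplitBNPair p) (hcomm : D.CommutatorRelations)
    {J : Set G} (hJ : J ⊆ D.S) : D.stdN J ≤ D.levi (D.face 1 J) := by
  rw [stdN, Subgroup.closure_le]
  rintro s (hs | hs)
  · exact T_le_levi _ hs
  have hsS := hJ hs
  have hsN := hD.S_subset s hsS
  obtain ⟨⟨x, hx⟩, hx1⟩ := Subgroup.ne_bot_iff_exists_ne_one.1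
    (hD.rootSubgroup_simpleRoot_ne_bot hsS)
  replace hx1 : x ≠ 1 := fun h => hx1 (Subtype.ext h)
  have hα : D.simpleRoot s ∈ D.roots := by
    simpa using smul_simpleRoot_mem_roots (D := D) D.N.one_mem hsS
  have hαcut : Cuts (D.simpleRoot s) (D.face 1 J) := by
    simpa using hD.cuts_self (c := 1) hsS hs
  have hcut' : Cuts (s • D.simpleRoot s) (D.face 1 J) := by
    rw [← smul_face_one (subset_stdN (D := D) J hs), cuts_smul]
    exact hαcut
  have hy : s * x * s⁻¹ ∈ D.rootSubgroup (s • D.simpleRoot s) := by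
    rw [rootSubgroup_smul]; exact conj_mem_conjSub hx
  obtain ⟨x₁, hx₁, t, ht, x₂, hx₂, he⟩ := hD.rank_one hcomm hsS hy (by
    intro h1
    apply hx1
    have h2 := congrArg (fun z => s⁻¹ * z * s) h1
    simpa [mul_assoc] using h2)
  have h1 : s = x₁⁻¹ * (s * x * s⁻¹) * x₂⁻¹ * t⁻¹ := by
    rw [he]; group
  have hX := rootSubgroup_le_levi hα hαcut
  have hX' := rootSubgroup_le_levi (smul_mem_roots hsN hα) hcut'
  show s ∈ D.levi (D.face 1 J)
  rw [h1]
  exact mul_mem (mul_mem (mul_mem (inv_mem (hX hx₁)) (hX' hy)) (inv_mem (hX hx₂)))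
    (inv_mem (T_le_levi _ ht))

/-- The products `b n b'` are stable under left multiplication by generators of the Levi subgroup;
for those in `J` this is `levi_exchange`. -/
theorem IsSplitBNPair.levi_bruhat_one (hD : D.IsSplitBNPair p) (hcomm : D.CommutatorRelations)
    {J : Set G} (hJ : J ⊆ D.S) {g : G} (hg : g ∈ D.levi (D.face 1 J)) :
    ∃ n ∈ D.stdN J, ∃ b ∈ D.leviBorel 1 J, ∃ b' ∈ D.leviBorel 1 J, g = b * n * b' := by
  have h1N := D.N.one_mem
  have hle : D.levi (D.face 1 J) ≤ Subgroup.closure ((D.leviBorel 1 J : Set G) ∪ J) := by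
    have hH : D.leviBorel 1 J ≤ Subgroup.closure ((D.leviBorel 1 J : Set G) ∪ J) := fun x hx =>
      Subgroup.subset_closure (Or.inl hx)
    have hN : D.stdN J ≤ Subgroup.closure ((D.leviBorel 1 J : Set G) ∪ J) := by
      rw [stdN, Subgroup.closure_le]
      rintro x (hx | hx)
      · exact hH (T_le_leviBorel 1 J hx)
      · exact Subgroup.subset_closure (Or.inr hx)
    refine levi_le ((T_le_leviBorel 1 J).trans hH) fun a ha hcut => ?_
    obtain ⟨z, hz, s, hs, -, -, rfl⟩ := hD.exists_edge h1N hJ ha hcut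
    rw [rootSubgroup_smul]
    have hα : D.simpleRoot s ∈ D.roots := by
      simpa using smul_simpleRoot_mem_roots (D := D) D.N.one_mem (hJ hs)
    have hXle := hD.rootSubgroup_le_leviUnip h1N hJ hα (one_mem_simpleRoot s)
      (by simpa using hD.cuts_self (c := 1) (hJ hs) hs)
    rintro _ ⟨x, hx, rfl⟩
    have hz' := hN (mem_face_one.1 hz)
    exact mul_mem (mul_mem hz' (hH (leviUnip_le_leviBorel 1 J (hXle hx)))) (inv_mem hz')
  have hg' := hle hg
  clear hg
  have key : ∀ s ∈ J, ∀ y, (∃ n ∈ D.stdN J, ∃ b ∈ D.leviBorel 1 J, ∃ b' ∈ D.leviBorel 1 J,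
      y = b * n * b') → ∃ n ∈ D.stdN J, ∃ b ∈ D.leviBorel 1 J, ∃ b' ∈ D.leviBorel 1 J,
      s * y = b * n * b' := by
    rintro s hs _ ⟨n, hn, b, hb, b', hb', rfl⟩
    obtain ⟨m, hm, c, hc, c', hc', he⟩ := hD.levi_exchange hcomm hJ hs hn hb
    exact ⟨m, hm, c, hc, c' * b', mul_mem hc' hb', by rw [← mul_assoc s, he]; group⟩
  have keyH : ∀ h ∈ D.leviBorel 1 J, ∀ y, (∃ n ∈ D.stdN J, ∃ b ∈ D.leviBorel 1 J,
      ∃ b' ∈ D.leviBorel 1 J, y = b * n * b') → ∃ n ∈ D.stdN J, ∃ b ∈ D.leviBorel 1 J,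
      ∃ b' ∈ D.leviBorel 1 J, h * y = b * n * b' := by
    rintro h hh _ ⟨n, hn, b, hb, b', hb', rfl⟩
    exact ⟨n, hn, h * b, mul_mem hh hb, b', hb', by group⟩
  induction hg' using Subgroup.closure_induction_left with
  | one => exact ⟨1, one_mem _, 1, one_mem _, 1, one_mem _, by simp⟩
  | mul_left x hx y hy ih =>
    rcases hx with hx | hx
    · exact keyH x hx y ih
    · exact key x hx y ih
  | inv_mul_cancel x hx y hy ih =>
    rcases hx with hx | hx
    · exact keyH _ (inv_mem hx) y ih
    · have h1 := key x hx _ (keyH _ (T_le_leviBorel 1 J (inv_mem (hD.S_sq x (hJ hx)))) y ih)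
      simpa [mul_assoc] using h1

end LeviBruhat

end BNData
end HarishChandra

namespace HarishChandra
namespace BNData

/-! ### Intersections of Levi subgroups and unipotent subgroups -/

section LeviIntersections

variable {G : Type v} [Group G] {D : BNData G} {p : ℕ} [Finite G]

theorem smul_face_eq_iff {c r : G} {J : Set G} :
    r • D.face c J = D.face c J ↔ c⁻¹ * r * c ∈ D.stdN J := by
  rw [smul_face, mul_assoc]
  constructor
  · intro h
    have := self_mem_face (D := D) (r * c) J
    rw [h, mem_face] at this
    exact this
  · intro h
    exact face_eq (mem_face.2 h)

theorem IsSplitBNPair.levi_face (hD : D.IsSplitBNPair p) {c : G} (hc : c ∈ D.N) (J : Set G) :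
    D.levi (D.face c J) = conjSub c (D.levi (D.face 1 J)) := by
  rw [← hD.levi_smul hc, smul_face, mul_one]

theorem IsSplitBNPair.leviBorel_eq (hD : D.IsSplitBNPair p) {c : G} (hc : c ∈ D.N) (J : Set G) :
    D.leviBorel c J = conjSub c (D.leviBorel 1 J) := by
  rw [← hD.leviBorel_smul hc, mul_one]

theorem IsSplitBNPair.mem_levi_of_smul_face (hD : D.IsSplitBNPair p)
    (hcomm : D.CommutatorRelations) {c r : G} {J : Set G} (hc : c ∈ D.N) (hJ : J ⊆ D.S)
    (h : r • D.face c J = D.face c J) : r ∈ D.levi (D.face c J) := by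
  rw [hD.levi_face hc, mem_conjSub]
  exact hD.stdN_le_levi hcomm hJ (smul_face_eq_iff.1 h)

/-- The Bruhat decomposition of a Levi subgroup. -/
theorem IsSplitBNPair.levi_bruhat (hD : D.IsSplitBNPair p) (hcomm : D.CommutatorRelations)
    {c g : G} {J : Set G} (hc : c ∈ D.N) (hJ : J ⊆ D.S) (hg : g ∈ D.levi (D.face c J)) :
    ∃ r ∈ D.N, r • D.face c J = D.face c J ∧
      ∃ b ∈ D.leviBorel c J, ∃ b' ∈ D.leviBorel c J, g = b * r * b' := by
  rw [hD.levi_face hc, mem_conjSub] at hg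
  obtain ⟨n, hn, b, hb, b', hb', h⟩ := hD.levi_bruhat_one hcomm hJ hg
  refine ⟨c * n * c⁻¹, mul_mem (mul_mem hc (hD.stdN_le hJ hn)) (inv_mem hc), ?_, c * b * c⁻¹, ?_,
    c * b' * c⁻¹, ?_, ?_⟩
  · rw [smul_face_eq_iff]; simpa [mul_assoc] using hn
  · rw [hD.leviBorel_eq hc]; exact conj_mem_conjSub hb
  · rw [hD.leviBorel_eq hc]; exact conj_mem_conjSub hb'
  · have : g = c * (c⁻¹ * g * c) * c⁻¹ := by group
    rw [this, h]; group

/-- If `g = b r b'` with `b, b'` in the Borel subgroup of the chamber `c`, then the relative position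
of the chambers `c` and `g c` is that of `c` and `r c`. -/
theorem inDC_conj {c g r b b' : G} (hb : c⁻¹ * b * c ∈ D.B) (hb' : c⁻¹ * b' * c ∈ D.B)
    (h : g = b * r * b') : D.InDC (c⁻¹ * r * c) (c⁻¹ * g * c) := by
  have h1 := ((InDC.self (D := D) (c⁻¹ * r * c)).mul_left hb).mul_right hb'
  convert h1 using 1
  rw [h]; group

theorem IsSplitBNPair.smul_face_of_inDC (hD : D.IsSplitBNPair p) {c r r' : G} {J : Set G}
    (hc : c ∈ D.N) (hJ : J ⊆ D.S) (hr : r ∈ D.N) (hr' : r' ∈ D.N)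
    (h : D.InDC (c⁻¹ * r * c) (c⁻¹ * r' * c)) (hF : r • D.face c J = D.face c J) :
    r' • D.face c J = D.face c J := by
  rw [smul_face_eq_iff] at hF ⊢
  have h1 := hD.eqv_of_inDC (mul_mem (mul_mem (inv_mem hc) hr) hc)
    (mul_mem (mul_mem (inv_mem hc) hr') hc) h
  have := mul_mem hF (T_le_stdN J h1)
  rwa [mul_inv_cancel_left] at this

theorem IsSplitBNPair.smul_face_of_mem_levi (hD : D.IsSplitBNPair p)
    (hcomm : D.CommutatorRelations) {c r : G} {J : Set G} (hc : c ∈ D.N) (hJ : J ⊆ D.S)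
    (hr : r ∈ D.N) (h : r ∈ D.levi (D.face c J)) : r • D.face c J = D.face c J := by
  obtain ⟨r', hr', hF, b, hb, b', hb', he⟩ := hD.levi_bruhat hcomm hc hJ h
  exact hD.smul_face_of_inDC hc hJ hr' hr (inDC_conj (hD.conj_mem_B_of_mem_leviBorel hc hb)
    (hD.conj_mem_B_of_mem_leviBorel hc hb') he) hF

/-- The middle factor of the Bruhat decomposition stabilizes `c`, so it lies in the torus. -/
theorem IsSplitBNPair.mem_leviBorel (hD : D.IsSplitBNPair p) (hcomm : D.CommutatorRelations)
    {c g : G} {J : Set G} (hc : c ∈ D.N) (hJ : J ⊆ D.S) (h : g ∈ D.levi (D.face c J))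
    (hB : c⁻¹ * g * c ∈ D.B) : g ∈ D.leviBorel c J := by
  obtain ⟨r', hr', hF, b, hb, b', hb', he⟩ := hD.levi_bruhat hcomm hc hJ h
  have h1 := (inDC_conj (hD.conj_mem_B_of_mem_leviBorel hc hb)
    (hD.conj_mem_B_of_mem_leviBorel hc hb') he).symm.mem_B hB
  have h2 : c⁻¹ * r' * c ∈ D.T :=
    Subgroup.mem_inf.2 ⟨h1, mul_mem (mul_mem (inv_mem hc) hr') hc⟩
  have h3 : r' ∈ D.T := by
    have := hD.conj_torus hc h2
    simpa [mul_assoc] using this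
  rw [he]
  exact mul_mem (mul_mem hb (T_le_leviBorel c J h3)) hb'

theorem IsSplitBNPair.mem_leviUnip (hD : D.IsSplitBNPair p) (hcomm : D.CommutatorRelations)
    {c g : G} {J : Set G} (hc : c ∈ D.N) (hJ : J ⊆ D.S) (h : g ∈ D.levi (D.face c J))
    (hU : c⁻¹ * g * c ∈ D.U) : g ∈ D.leviUnip c J := by
  obtain ⟨u, hu, t, ht, rfl⟩ := hD.exists_mul_of_mem_leviBorel
    (hD.mem_leviBorel hcomm hc hJ h (hD.U_le hU))
  have h1 := mul_mem (inv_mem (conj_mem_U_of_mem_leviUnip hc hu)) hU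
  have h2 : c⁻¹ * t * c ∈ D.U ⊓ D.T := by
    refine Subgroup.mem_inf.2 ⟨?_, hD.inv_conj_torus hc ht⟩
    convert h1 using 1
    group
  rw [hD.U_inf_T, Subgroup.mem_bot] at h2
  have h3 : t = 1 := by
    have := congrArg (fun z => c * z * c⁻¹) h2
    simpa [mul_assoc] using this
  rw [h3, mul_one]
  exact hu

theorem mem_rootSubgroup_union {A A' : Set G} {x : G} :
    x ∈ D.rootSubgroup (A ∪ A') ↔ x ∈ D.rootSubgroup A ∧ x ∈ D.rootSubgroup A' := by
  simp only [mem_rootSubgroup, Set.mem_union, or_imp, forall_and]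

/-- Elements of the Levi subgroup that are unipotent at `c` lie in `leviUnip c J`. The intersection
thus becomes a group of the form `U_A` again, and the results on convex hulls apply to it. -/
theorem IsSplitBNPair.inf_levi_eq (hD : D.IsSplitBNPair p) (hcomm : D.CommutatorRelations)
    {c : G} {A J : Set G} (hc : c ∈ D.N) (hJ : J ⊆ D.S) (hcA : c ∈ A) :
    D.rootSubgroup A ⊓ D.levi (D.face c J) = D.rootSubgroup (A ∪ D.cone c (D.face c J)) := by
  ext x
  rw [mem_rootSubgroup_union]
  refine ⟨fun h => ⟨h.1, ?_⟩, fun h => ⟨h.1, hD.leviUnip_le_levi hc hJ h.2⟩⟩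
  exact hD.mem_leviUnip hcomm hc hJ h.2 (mem_rootSubgroup.1 h.1 c hcA)

/-- `U_A ∩ levi F` is generated by the root subgroups that it contains. -/
theorem IsSplitBNPair.inf_levi_le (hD : D.IsSplitBNPair p) (hcomm : D.CommutatorRelations)
    {c : G} {A J : Set G} (hc : c ∈ D.N) (hJ : J ⊆ D.S) (hA : A ⊆ D.N) (hcA : c ∈ A)
    {H : Subgroup G}
    (h : ∀ a ∈ D.roots, A ⊆ a → Cuts a (D.face c J) → D.rootSubgroup a ≤ H) :
    D.rootSubgroup A ⊓ D.levi (D.face c J) ≤ H := by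
  rw [hD.inf_levi_eq hcomm hc hJ hcA]
  refine hD.rootSubgroup_le_of_forall (Set.union_subset hA (cone_subset_N _ _))
    ⟨c, Or.inl hcA⟩ fun a ha h1 => ?_
  obtain ⟨h2, h3⟩ := Set.union_subset_iff.1 h1
  exact h a ha h2 ((hD.cone_subset_iff hc hJ ha).1 h3).2

theorem IsSplitBNPair.rootSubgroup_face_inf_levi (hD : D.IsSplitBNPair p)
    (hcomm : D.CommutatorRelations) {c : G} {J : Set G} (hc : c ∈ D.N) (hJ : J ⊆ D.S) :
    D.rootSubgroup (D.face c J) ⊓ D.levi (D.face c J) = ⊥ := by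
  rw [eq_bot_iff]
  refine hD.inf_levi_le hcomm hc hJ (hD.face_subset_N hc hJ) (self_mem_face c J)
    fun a ha h1 h2 => ?_
  obtain ⟨y, hy, hya⟩ := h2.2
  exact absurd (h1 hy) hya

/-- For a chamber `c` in `A` and a face `F` of `c`: `U_A = (U_A ∩ U_F) (U_A ∩ levi F)`. -/
theorem IsSplitBNPair.exists_mul_face (hD : D.IsSplitBNPair p) (hcomm : D.CommutatorRelations)
    {c x : G} {A J : Set G} (hc : c ∈ D.N) (hJ : J ⊆ D.S) (hA : A ⊆ D.N) (hcA : c ∈ A)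
    (hx : x ∈ D.rootSubgroup A) :
    ∃ y ∈ D.rootSubgroup A ⊓ D.rootSubgroup (D.face c J),
      ∃ l ∈ D.rootSubgroup A ⊓ D.levi (D.face c J), x = y * l := by
  have hnorm : D.rootSubgroup A ⊓ D.levi (D.face c J) ≤
      Subgroup.normalizer ((D.rootSubgroup A ⊓ D.rootSubgroup (D.face c J) : Subgroup G) : Set G) := by
    rw [le_normalizer_iff]
    intro g hg y hy
    exact Subgroup.mem_inf.2 ⟨mul_mem (mul_mem hg.1 hy.1) (inv_mem hg.1),
      le_normalizer_iff.1 (hD.levi_le_normalizer hcomm hc hJ) g hg.2 y hy.2⟩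
  refine exists_mul_of_mem_sup hnorm ((hD.rootSubgroup_le_of_forall hA ⟨c, hcA⟩ ?_) hx)
  intro a ha hAa
  by_cases hcut : Cuts a (D.face c J)
  · exact le_sup_of_le_right (le_inf (rootSubgroup_anti hAa) (rootSubgroup_le_levi ha hcut))
  · exact le_sup_of_le_left (le_inf (rootSubgroup_anti hAa)
      (rootSubgroup_anti (subset_of_not_cuts hcut (self_mem_face c J) (hAa hcA))))

theorem IsSplitBNPair.conjSub_stdLevi (hD : D.IsSplitBNPair p) {n : G} {J : Set G} (hn : n ∈ D.N)
    (hJ : J ⊆ D.S) : conjSub n (D.stdLevi J) = D.levi (D.face n J) := by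
  rw [hD.levi_face hn]
  congr 1
  apply le_antisymm
  · refine sup_le (T_le_levi _) (iSup₂_le fun m hm => iSup₂_le fun s hs => ?_)
    have hmN := hD.stdN_le hJ hm
    refine rootSubgroup_le_levi (smul_simpleRoot_mem_roots hmN (hJ hs)) ?_
    rw [← face_eq (mem_face_one.2 hm)]
    exact hD.cuts_self (hJ hs) hs
  · refine levi_le le_sup_left fun a ha hcut => ?_
    obtain ⟨z, hz, s, hs, -, -, rfl⟩ := hD.exists_edge D.N.one_mem hJ ha hcut
    exact le_sup_of_le_right (le_iSup₂_of_le z (mem_face_one.1 hz) (le_iSup₂_of_le s hs le_rfl))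

/-- The reflection of a root that cuts the first face lies in both Levi subgroups. Elements of `N`
in a Levi subgroup stabilize its face, so the reflection maps `e` to a chamber of the second face on
the other side of the wall. -/
theorem IsSplitBNPair.cuts_of_levi_le (hD : D.IsSplitBNPair p) (hcomm : D.CommutatorRelations)
    {c e : G} {J I : Set G} (hc : c ∈ D.N) (hJ : J ⊆ D.S) (he : e ∈ D.N) (hI : I ⊆ D.S)
    (h : D.levi (D.face c J) ≤ D.levi (D.face e I)) {a : Set G} (ha : a ∈ D.roots)
    (hcut : Cuts a (D.face c J)) : Cuts a (D.face e I) := by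
  obtain ⟨z, hz, s, hs, -, -, rfl⟩ := hD.exists_edge hc hJ ha hcut
  have hzN := hD.face_subset_N hc hJ hz
  have hr := hD.refl_mem hzN (hJ hs)
  have h1 := h (hD.mem_levi_of_smul_face hcomm hc hJ (hD.refl_smul_face hc hJ hzN (hJ hs) hcut))
  have h2 := hD.smul_face_of_mem_levi hcomm he hI hr h1
  have h3 : z * s * z⁻¹ * e ∈ D.face e I := by
    rw [← h2]; exact Set.smul_mem_smul_set (self_mem_face e I)
  have h4 := hD.refl_mul_mem_iff hzN (hJ hs) he
  by_cases hea : e ∈ z • D.simpleRoot s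
  · exact ⟨⟨e, hea, self_mem_face e I⟩, ⟨_, h3, fun h' => h4.1 h' hea⟩⟩
  · exact ⟨⟨_, h4.2 hea, h3⟩, ⟨e, self_mem_face e I, hea⟩⟩

theorem IsSplitBNPair.levi_eq_iff (hD : D.IsSplitBNPair p) (hcomm : D.CommutatorRelations)
    {c e : G} {J I : Set G} (hc : c ∈ D.N) (hJ : J ⊆ D.S) (he : e ∈ D.N) (hI : I ⊆ D.S) :
    D.levi (D.face c J) = D.levi (D.face e I) ↔ D.Parallel (D.face c J) (D.face e I) :=
  ⟨fun h a ha => ⟨hD.cuts_of_levi_le hcomm hc hJ he hI h.le ha,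
    hD.cuts_of_levi_le hcomm he hI hc hJ h.ge ha⟩, fun h => h.levi_eq⟩

/-- The hypotheses are those that `exists_proj_face` supplies for the projection of the face of `e`.
For `x` in both groups, the Bruhat decomposition `b r b'` in the first one has `b` and `b'`
stabilizing `e`; hence `r` stabilizes both faces and the projection. Up to the Levi subgroup of the
projection, `x` is then a unipotent element of `U_E ∩ levi E`, where `E` is the face of `e`, and
this intersection is trivial. -/
theorem IsSplitBNPair.levi_inf_levi (hD : D.IsSplitBNPair p) (hcomm : D.CommutatorRelations)
    {c e f : G} {J I J' : Set G} (hc : c ∈ D.N) (hJ : J ⊆ D.S) (he : e ∈ D.N) (hI : I ⊆ D.S)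
    (hf : f ∈ D.face c J) (hJ' : J' ⊆ J)
    (hside : ∀ a ∈ D.roots, Cuts a (D.face c J) → (e ∈ a ↔ f ∈ a))
    (hcuts : ∀ a ∈ D.roots, Cuts a (D.face f J') ↔ Cuts a (D.face c J) ∧ Cuts a (D.face e I))
    (hsub : ∀ a ∈ D.roots, Cuts a (D.face c J) → (D.face f J' ⊆ a ↔ D.face e I ⊆ a))
    (hproj : ∀ e' ∈ D.face e I, ∃ f' ∈ D.face f J', ∀ a ∈ D.roots, Cuts a (D.face c J) →
      (e' ∈ a ↔ f' ∈ a)) :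
    D.levi (D.face c J) ⊓ D.levi (D.face e I) = D.levi (D.face f J') := by
  have hle1 : D.levi (D.face f J') ≤ D.levi (D.face c J) :=
    levi_mono fun a ha h => ((hcuts a ha).1 h).1
  have hle2 : D.levi (D.face f J') ≤ D.levi (D.face e I) :=
    levi_mono fun a ha h => ((hcuts a ha).1 h).2
  refine le_antisymm ?_ (le_inf hle1 hle2)
  intro x hx0
  obtain ⟨hxF, hxE⟩ := Subgroup.mem_inf.1 hx0
  have hfN := hD.face_subset_N hc hJ hf
  have hJ'S := hJ'.trans hJ
  have hFf : D.face f J = D.face c J := face_eq hf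
  rw [← hFf] at hxF hside hcuts hsub hproj hle1
  obtain ⟨r, hr, hrF, b, hb, b', hb', hx⟩ := hD.levi_bruhat hcomm hfN hJ hxF
  have hecone : e ∈ D.cone f (D.face f J) := ⟨he, fun a ha hfa hcut => (hside a ha hcut).2 hfa⟩
  have hBe : ∀ y ∈ D.leviBorel f J, e⁻¹ * y * e ∈ D.B := by
    intro y hy
    obtain ⟨u, hu, t, ht, rfl⟩ := hD.exists_mul_of_mem_leviBorel hy
    have h1 := mul_mem (hD.U_le (mem_rootSubgroup.1 hu e hecone)) (T_le_B (hD.inv_conj_torus he ht))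
    convert h1 using 1
    group
  obtain ⟨r', hr', hrE, d, hd, d', hd', hx'⟩ := hD.levi_bruhat hcomm he hI hxE
  have hrE : r • D.face e I = D.face e I :=
    hD.smul_face_of_inDC he hI hr' hr ((inDC_conj (hD.conj_mem_B_of_mem_leviBorel he hd)
      (hD.conj_mem_B_of_mem_leviBorel he hd') hx').trans
        (inDC_conj (hBe b hb) (hBe b' hb') hx).symm) hrE
  have hr3 : r • D.face f J' = D.face f J' := by
    have h1 : r * e ∈ D.face e I := by
      rw [← hrE]; exact Set.smul_mem_smul_set (self_mem_face e I)
    obtain ⟨f', hf', h2⟩ := hproj _ h1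
    have h3 : D.Eqv f' (r * f) := by
      refine hD.eqv_of_face hfN hJ (face_mono hJ' hf') ?_ fun a ha hcut hfa => ?_
      · rw [← hrF]; exact Set.smul_mem_smul_set (self_mem_face f J)
      · have h4 : r⁻¹ • a ∈ D.roots := smul_mem_roots (inv_mem hr) ha
        have h5 : Cuts (r⁻¹ • a) (D.face f J) := by
          rw [← hrF, ← cuts_smul (n := r⁻¹), inv_smul_smul] at hcut
          exact hcut
        have h6 := hside _ h4 h5
        rw [mem_smul_set, mem_smul_set, inv_inv] at h6
        exact h6.1 ((h2 a ha hcut).2 hfa)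
    rw [smul_face]
    exact face_eq (eqv_mem_face hf' h3)
  have hr3L := hD.mem_levi_of_smul_face hcomm hfN hJ'S hr3
  have hfactor : ∀ y ∈ D.leviBorel f J, ∃ z ∈ D.rootSubgroup (D.face f J') ⊓ D.levi (D.face f J),
      ∃ l ∈ D.levi (D.face f J'), y = z * l := by
    intro y hy
    obtain ⟨u, hu, t, ht, rfl⟩ := hD.exists_mul_of_mem_leviBorel hy
    obtain ⟨z, hz, l, hl, rfl⟩ := hD.exists_mul_face hcomm hfN hJ'S (cone_subset_N _ _)
      (self_mem_cone hfN _) hu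
    exact ⟨z, ⟨hz.2, hD.leviUnip_le_levi hfN hJ hz.1⟩, l * t, mul_mem hl.2 (T_le_levi _ ht),
      by group⟩
  obtain ⟨z, hz, l, hl, rfl⟩ := hfactor b hb
  obtain ⟨z', hz', l', hl', rfl⟩ := hfactor b' hb'
  have hlam : l * r ∈ D.levi (D.face f J') := mul_mem hl hr3L
  have hz'' : z * ((l * r) * z' * (l * r)⁻¹) ∈
      D.rootSubgroup (D.face f J') ⊓ D.levi (D.face f J) := by
    refine mul_mem hz (Subgroup.mem_inf.2 ⟨le_normalizer_iff.1 (hD.levi_le_normalizer hcomm hfN hJ'S) _ hlam _ hz'.1, ?_⟩)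
    exact mul_mem (mul_mem (hle1 hlam) hz'.2) (inv_mem (hle1 hlam))
  have hxe : x = z * ((l * r) * z' * (l * r)⁻¹) * (l * r * l') := by rw [hx]; group
  have hlam' : l * r * l' ∈ D.levi (D.face f J') := mul_mem hlam hl'
  -- A root that contains the projection and cuts the first face contains the second face, which
  -- gives membership in its unipotent group. Dividing `x` by its Levi part gives membership in its
  -- Levi subgroup.
  have h1 : z * ((l * r) * z' * (l * r)⁻¹) ∈
      D.rootSubgroup (D.face e I) ⊓ D.levi (D.face e I) := by
    refine Subgroup.mem_inf.2 ⟨?_, ?_⟩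
    · refine hD.inf_levi_le hcomm hfN hJ (hD.face_subset_N hfN hJ'S) (self_mem_face f J')
        (fun a ha h1 h2 => ?_) hz''
      exact rootSubgroup_anti ((hsub a ha h2).1 h1)
    · have := mul_mem hxE (inv_mem (hle2 hlam'))
      rwa [hxe, mul_inv_cancel_right] at this
  rw [hD.rootSubgroup_face_inf_levi hcomm he hI, Subgroup.mem_bot] at h1
  rw [hxe, h1, one_mul]
  exact hlam'

theorem IsSplitBNPair.levi_N (hD : D.IsSplitBNPair p) (hcomm : D.CommutatorRelations) :
    D.levi (D.N : Set G) = ⊤ := by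
  have h1 := face_singleton_S hD (D.N.one_mem)
  rw [eq_top_iff, ← hD.generates, ← hD.U_sup_T]
  refine sup_le (sup_le ?_ (T_le_levi _)) ?_
  · intro x hx
    refine hD.rootSubgroup_le_of_forall (A := {1}) (by simp) ⟨1, rfl⟩
      (fun a ha _ => rootSubgroup_le_levi ha (hD.cuts_N ha)) ?_
    rw [mem_rootSubgroup_singleton]
    simpa using hx
  · have := hD.stdN_le_levi hcomm (J := D.S) le_rfl
    rwa [h1, stdN_S hD] at this

end LeviIntersections

end BNData
end HarishChandra

namespace HarishChandra
namespace BNData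

/-! ### Parabolic subgroups and their unipotent radicals -/

section Radicals

variable {G : Type v} [Group G] {D : BNData G} {p : ℕ} [Finite G]

/-- Normalizers grow in a `p`-group, as it is nilpotent. -/
theorem exists_normalizing_of_isPGroup (hp : p.Prime) {W P : Subgroup G} (hP : IsPGroup p P)
    (hWP : W ≤ P) (h : ¬ P ≤ W) : ∃ g ∈ P, g ∉ W ∧ ∀ x ∈ W, g * x * g⁻¹ ∈ W := by
  have : Fact p.Prime := ⟨hp⟩
  have := hP.isNilpotent
  have h1 : W.subgroupOf P < ⊤ := by
    rw [lt_top_iff_ne_top, Ne, Subgroup.subgroupOf_eq_top]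
    exact h
  have h2 := Group.normalizerCondition_of_isNilpotent (G := P) _ h1
  obtain ⟨g, hg, hgW⟩ := SetLike.exists_of_lt h2
  refine ⟨g, g.2, hgW, fun x hx => ?_⟩
  exact (Subgroup.mem_normalizer_iff.1 hg ⟨x, hWP hx⟩).1 hx

theorem IsSplitBNPair.root_eq_of_subset (hD : D.IsSplitBNPair p) {a b : Set G}
    (ha : a ∈ D.roots) (hb : b ∈ D.roots) (h : b ⊆ a) : b = a := by
  by_contra hne
  have h1 := face_singleton_S hD D.N.one_mem
  have h2 := hD.face_subset_of_half D.N.one_mem le_rfl ha hb (by rw [h1]; exact hD.cuts_N hb)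
    (fun h' => hne h'.symm) (Set.inter_subset_left.trans h)
  rw [h1] at h2
  obtain ⟨y, hy, hya⟩ := (hD.cuts_N ha).2
  exact hya (h2 hy)

theorem IsSplitBNPair.rootSubgroup_insert_eq_bot (hD : D.IsSplitBNPair p) {a : Set G}
    (ha : a ∈ D.roots) {d : G} (hd : d ∈ D.N) (hda : d ∉ a) :
    D.rootSubgroup (insert d a) = ⊥ := by
  refine hD.rootSubgroup_eq_bot (Set.insert_subset hd (root_subset_N ha)) ⟨d, Set.mem_insert _ _⟩
    fun b hb h => ?_
  have h1 := hD.root_eq_of_subset hb ha ((Set.subset_insert _ _).trans h)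
  rw [h1] at hda
  exact hda (h (Set.mem_insert _ _))

theorem IsSplitBNPair.rootSubgroup_ne_bot (hD : D.IsSplitBNPair p) {a : Set G}
    (ha : a ∈ D.roots) : D.rootSubgroup a ≠ ⊥ := by
  obtain ⟨n, hn, s, hs, rfl⟩ := ha
  rw [rootSubgroup_smul]
  intro h
  apply hD.rootSubgroup_simpleRoot_ne_bot hs
  rwa [conjSub, (Subgroup.map_eq_bot_iff_of_injective _ (MulAut.conj n).injective)] at h

/-- A `p`-subgroup of a Levi subgroup that contains a maximal unipotent subgroup is equal to it. -/
theorem IsSplitBNPair.le_leviUnip_of_isPGroup (hp : p.Prime) (hD : D.IsSplitBNPair p)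
    (hcomm : D.CommutatorRelations) {c : G} {I : Set G} (hc : c ∈ D.N) (hI : I ⊆ D.S)
    {P : Subgroup G} (hP : IsPGroup p P) (hPE : P ≤ D.levi (D.face c I))
    (hle : D.leviUnip c I ≤ P) : P ≤ D.leviUnip c I := by
  by_contra hcon
  obtain ⟨g, hgP, hgW, hnorm⟩ := exists_normalizing_of_isPGroup hp hP hle hcon
  obtain ⟨r, hr, hrE, b, hb, b', hb', hg⟩ := hD.levi_bruhat hcomm hc hI (hPE hgP)
  have hBnorm : ∀ b ∈ D.leviBorel c I, ∀ x ∈ D.leviUnip c I, b * x * b⁻¹ ∈ D.leviUnip c I := by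
    rw [← le_normalizer_iff]
    exact sup_le Subgroup.le_normalizer (hD.T_le_normalizer (cone_subset_N _ _))
  have hrnorm : ∀ x ∈ D.leviUnip c I, r * x * r⁻¹ ∈ D.leviUnip c I := by
    intro x hx
    have h1 := hBnorm _ (inv_mem hb) _ (hnorm _ (hBnorm _ (inv_mem hb') x hx))
    rw [hg] at h1
    convert h1 using 1
    group
  -- If `r`, which normalizes `leviUnip c I`, moved the chamber `c`, then some root of `c` would
  -- omit `r c`. Its root subgroup would be unipotent at `r c` too, and therefore trivial.
  have hrT : D.Eqv c (r * c) := by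
    by_contra hne
    have h1 : c⁻¹ * (r * c) ∈ D.stdN I := by
      rw [← mul_assoc]; exact smul_face_eq_iff.1 hrE
    obtain ⟨s, hs, hsr⟩ := hD.exists_step hI h1 hne
    have ha : c • D.simpleRoot s ∈ D.roots := smul_simpleRoot_mem_roots hc (hI hs)
    have h2 : D.rootSubgroup (c • D.simpleRoot s) ≤
        D.rootSubgroup (insert (r * c) (c • D.simpleRoot s)) := by
      intro x hx
      rw [mem_rootSubgroup_insert]
      refine ⟨?_, hx⟩
      have h3 := hD.rootSubgroup_le_leviUnip hc hI ha (self_mem_smul_simpleRoot c s)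
        (hD.cuts_self (hI hs) hs) hx
      have hfin : conjSub r (D.leviUnip c I) = D.leviUnip c I := conjSub_eq_of_le (by
        rintro _ ⟨y, hy, rfl⟩
        exact hrnorm y hy)
      rw [← hfin, mem_conjSub] at h3
      have h4 := conj_mem_U_of_mem_leviUnip hc h3
      convert h4 using 1
      group
    rw [hD.rootSubgroup_insert_eq_bot ha (mul_mem hr hc) hsr, le_bot_iff] at h2
    exact hD.rootSubgroup_ne_bot ha h2
  have hrT' : r ∈ D.T := by
    have := hD.conj_torus hc hrT
    simpa [mul_assoc] using this
  have hgB : g ∈ D.leviBorel c I := by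
    rw [hg]; exact mul_mem (mul_mem hb (T_le_leviBorel c I hrT')) hb'
  apply hgW
  refine hD.mem_leviUnip hcomm hc hI (hPE hgP) ?_
  obtain ⟨k, hk⟩ := hP ⟨g, hgP⟩
  have hk' : g ^ p ^ k = 1 := congrArg Subtype.val hk
  refine hD.mem_U_of_pow (hD.conj_mem_B_of_mem_leviBorel hc hgB) (k := k) ?_
  have h5 : c⁻¹ * g * c = MulAut.conj c⁻¹ g := by simp
  rw [h5, ← map_pow, hk', map_one]

theorem IsSplitBNPair.isPGroup_rootSubgroup (hD : D.IsSplitBNPair p) {A : Set G} {c : G}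
    (hc : c ∈ A) : IsPGroup p (D.rootSubgroup A) := by
  have h1 : D.rootSubgroup A ≤ conjSub c D.U := fun x hx =>
    mem_conjSub.2 (mem_rootSubgroup.1 hx c hc)
  exact (hD.U_pGroup.map _).to_le h1

/-- The Levi decomposition of a parabolic subgroup; Borel elements are split by `exists_mul_face`.
-/
theorem IsSplitBNPair.stdParabolic_conj (hD : D.IsSplitBNPair p)
    (hcomm : D.CommutatorRelations) {c : G} {I J : Set G} (hc : c ∈ D.N) (hI : I ⊆ D.S)
    (hJ : J ⊆ I) : conjSub c (D.stdParabolic I J) =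
      (D.rootSubgroup (D.face c J) ⊓ D.levi (D.face c I)) ⊔ D.levi (D.face c J) := by
  have hJS := hJ.trans hI
  apply le_antisymm
  · rw [conjSub, Subgroup.map_le_iff_le_comap, stdParabolic, Subgroup.closure_le]
    rintro x (hx | hx)
    · obtain ⟨hxB, hxI⟩ := Subgroup.mem_inf.1 hx
      have h1 : c * x * c⁻¹ ∈ D.levi (D.face c I) := by
        rw [← hD.conjSub_stdLevi hc hI]; exact conj_mem_conjSub hxI
      have h2 := hD.mem_leviBorel hcomm hc hI h1 (by simpa [mul_assoc] using hxB)
      obtain ⟨u, hu, t, ht, h3⟩ := hD.exists_mul_of_mem_leviBorel h2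
      obtain ⟨y, hy, l, hl, rfl⟩ := hD.exists_mul_face hcomm hc hJS (cone_subset_N _ _)
        (self_mem_cone hc _) hu
      show c * x * c⁻¹ ∈
        (D.rootSubgroup (D.face c J) ⊓ D.levi (D.face c I)) ⊔ D.levi (D.face c J)
      rw [h3, mul_assoc]
      refine Subgroup.mul_mem_sup ?_ (mul_mem hl.2 (T_le_levi _ ht))
      exact ⟨hy.2, hD.leviUnip_le_levi hc hI hy.1⟩
    · show c * x * c⁻¹ ∈
        (D.rootSubgroup (D.face c J) ⊓ D.levi (D.face c I)) ⊔ D.levi (D.face c J)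
      refine le_sup_right (a := D.rootSubgroup (D.face c J) ⊓ D.levi (D.face c I))
        (hD.mem_levi_of_smul_face hcomm hc hJS ?_)
      rw [smul_face_eq_iff]
      simpa [mul_assoc] using subset_stdN J hx
  · refine sup_le ?_ ?_
    · intro x hx
      rw [mem_conjSub]
      refine Subgroup.subset_closure (Or.inl (Subgroup.mem_inf.2 ⟨?_, ?_⟩))
      · exact hD.U_le (mem_rootSubgroup.1 hx.1 c (self_mem_face c J))
      · rw [← mem_conjSub, hD.conjSub_stdLevi hc hI]
        exact hx.2
    · rw [← hD.conjSub_stdLevi hc hJS]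
      exact conjSub_mono (D.stdLevi_le_stdParabolic hD.U_le hJ)

/-- A normal `p`-subgroup generates a `p`-group together with the maximal `p`-subgroup `leviUnip c
I`, so it lies in the latter. Since the parabolic subgroup contains elements of `N` that move `c` to
every chamber of its face, normality makes the subgroup unipotent at all of these chambers. -/
theorem IsSplitBNPair.pRadical_stdParabolic (hp : p.Prime) (hD : D.IsSplitBNPair p)
    (hcomm : D.CommutatorRelations) {c : G} {I J : Set G} (hc : c ∈ D.N) (hI : I ⊆ D.S)
    (hJ : J ⊆ I) : pRadical p (conjSub c (D.stdParabolic I J)) =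
      D.rootSubgroup (D.face c J) ⊓ D.levi (D.face c I) := by
  have hJS := hJ.trans hI
  have hQ := hD.stdParabolic_conj hcomm hc hI hJ
  have hLE : D.levi (D.face c J) ≤ D.levi (D.face c I) :=
    levi_mono fun a ha h => h.mono (face_mono hJ)
  have hQE : conjSub c (D.stdParabolic I J) ≤ D.levi (D.face c I) := by
    rw [hQ]; exact sup_le inf_le_right hLE
  have hnorm : D.levi (D.face c J) ≤ Subgroup.normalizer
      ((D.rootSubgroup (D.face c J) ⊓ D.levi (D.face c I) : Subgroup G) : Set G) := by
    rw [le_normalizer_iff]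
    intro g hg x hx
    exact Subgroup.mem_inf.2 ⟨le_normalizer_iff.1 (hD.levi_le_normalizer hcomm hc hJS) g hg x hx.1,
      mul_mem (mul_mem (hLE hg) (Subgroup.mem_inf.1 hx).2) (inv_mem (hLE hg))⟩
  apply le_antisymm
  · refine sSup_le ?_
    rintro A ⟨hAQ, hAnorm, hAp⟩
    have hW : D.leviUnip c I ≤ conjSub c (D.stdParabolic I J) := by
      intro x hx
      rw [mem_conjSub]
      refine Subgroup.subset_closure (Or.inl (Subgroup.mem_inf.2 ⟨?_, ?_⟩))
      · exact hD.U_le (conj_mem_U_of_mem_leviUnip hc hx)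
      · rw [← mem_conjSub, hD.conjSub_stdLevi hc hI]
        exact hD.leviUnip_le_levi hc hI hx
    have hWA : D.leviUnip c I ≤ Subgroup.normalizer (A : Set G) := by
      rw [le_normalizer_iff]
      intro g hg x hx
      exact hAnorm g (hW hg) (conj_mem_conjSub hx)
    have h1 := IsPGroup.to_sup_of_normal_right'
      (hD.isPGroup_rootSubgroup (self_mem_cone hc (D.face c I))) hAp hWA
    have hAW : A ≤ D.leviUnip c I := le_sup_right.trans
      (hD.le_leviUnip_of_isPGroup hp hcomm hc hI h1 (sup_le (hW.trans hQE) (hAQ.trans hQE))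
        le_sup_left)
    refine le_inf (fun x hx => ?_) (hAQ.trans hQE)
    rw [mem_rootSubgroup]
    intro n hn
    have h2 : (n * c⁻¹) ∈ D.levi (D.face c J) := by
      refine hD.mem_levi_of_smul_face hcomm hc hJS ?_
      rw [smul_face_eq_iff]
      simpa [mul_assoc] using mem_face.1 hn
    have h3 : (n * c⁻¹)⁻¹ ∈ conjSub c (D.stdParabolic I J) := by
      rw [hQ]; exact inv_mem (le_sup_right (a := _ ⊓ D.levi (D.face c I)) h2)
    have h4 := conj_mem_U_of_mem_leviUnip hc (hAW (hAnorm _ h3 (conj_mem_conjSub hx)))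
    convert h4 using 1
    group
  · refine le_sSup ⟨?_, ?_, ?_⟩
    · rw [hQ]; exact le_sup_left
    · intro q hq
      rw [hQ] at hq
      have h1 := sup_le Subgroup.le_normalizer hnorm hq
      rintro _ ⟨x, hx, rfl⟩
      exact (Subgroup.mem_normalizer_iff.1 h1 x).1 hx
    · exact (hD.isPGroup_rootSubgroup (self_mem_face c J)).to_le inf_le_left

/-- The geometric description of a parabolic subgroup of a Levi subgroup. -/
theorem Parabolic.exists_faces (hp : p.Prime) (hD : D.IsSplitBNPair p)
    (hcomm : D.CommutatorRelations) {M L : Subgroup G} (P : D.Parabolic M L) :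
    ∃ c ∈ D.N, ∃ I ⊆ D.S, ∃ J ⊆ I, M = D.levi (D.face c I) ∧ L = D.levi (D.face c J) ∧
      P.radical p = D.rootSubgroup (D.face c J) ⊓ D.levi (D.face c I) := by
  obtain ⟨n, hn, I, hI, J, hJ, hM, hL, hQ⟩ := P.isParabolic
  refine ⟨n, hn, I, hI, J, hJ, by rw [hM, hD.conjSub_stdLevi hn hI],
    by rw [hL, hD.conjSub_stdLevi hn (hJ.trans hI)], ?_⟩
  rw [Parabolic.radical, hQ, hD.pRadical_stdParabolic hp hcomm hn hI hJ]

theorem IsSplitBNPair.exists_parabolic (hp : p.Prime) (hD : D.IsSplitBNPair p)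
    (hcomm : D.CommutatorRelations) {c : G} {I J : Set G} (hc : c ∈ D.N) (hI : I ⊆ D.S)
    (hJ : J ⊆ I) {M L : Subgroup G} (hM : M = D.levi (D.face c I))
    (hL : L = D.levi (D.face c J)) : ∃ P : D.Parabolic M L,
      P.radical p = D.rootSubgroup (D.face c J) ⊓ D.levi (D.face c I) :=
  ⟨⟨conjSub c (D.stdParabolic I J), c, hc, I, hI, J, hJ,
    by rw [hM, hD.conjSub_stdLevi hc hI], by rw [hL, hD.conjSub_stdLevi hc (hJ.trans hI)], rfl⟩,
    hD.pRadical_stdParabolic hp hcomm hc hI hJ⟩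

end Radicals

end BNData
end HarishChandra

namespace HarishChandra

/-! ### Averages over finite subgroups -/

section Average

variable {G : Type v} [Group G] [Finite G] {k : Type u} [Field k] {W : Type w} [AddCommGroup W]
  [Module k W]

/-- `ρ` is a representation of the subgroup `H` on `W`. -/
structure IsRepOn (ρ : G → Module.End k W) (H : Subgroup G) : Prop where
  one : ∀ w, ρ 1 w = w
  mul : ∀ x ∈ H, ∀ y ∈ H, ∀ w, ρ (x * y) w = ρ x (ρ y w)

/-- The elements of a subgroup of a finite group, as a finite set. -/
def elems (A : Subgroup G) : Finset G := (Set.toFinite (A : Set G)).toFinset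

theorem mem_elems {A : Subgroup G} {x : G} : x ∈ elems A ↔ x ∈ A := by simp [elems]

theorem card_elems (A : Subgroup G) : (elems A).card = Nat.card A := by
  rw [elems, ← Set.ncard_eq_toFinset_card]
  rfl

/-- The idempotent `e_A` that averages over `A`. -/
def avg (ρ : G → Module.End k W) (A : Subgroup G) (w : W) : W :=
  (Nat.card A : k)⁻¹ • ∑ a ∈ elems A, ρ a w

variable {ρ : G → Module.End k W} {H A A' : Subgroup G}

theorem avg_zero : avg ρ A 0 = 0 := by simp [avg]

theorem avg_eq_self (hA : (Nat.card A : k) ≠ 0) {w : W} (h : ∀ a ∈ A, ρ a w = w) :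
    avg ρ A w = w := by
  rw [avg, Finset.sum_congr rfl fun a ha => h a (mem_elems.1 ha), Finset.sum_const, card_elems,
    ← Nat.cast_smul_eq_nsmul k, smul_smul, inv_mul_cancel₀ hA, one_smul]

theorem IsRepOn.apply_avg (hρ : IsRepOn ρ H) (hA : A ≤ H) {x : G} (hx : x ∈ A) (w : W) :
    ρ x (avg ρ A w) = avg ρ A w := by
  rw [avg, map_smul, map_sum]
  congr 1
  refine Finset.sum_equiv (Equiv.mulLeft x) (fun a => ?_) fun a ha => ?_
  · simp only [mem_elems, Equiv.coe_mulLeft]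
    exact (Subgroup.mul_mem_cancel_left A hx).symm
  · exact (hρ.mul x (hA hx) a (hA (mem_elems.1 ha)) w).symm

theorem IsRepOn.avg_apply (hρ : IsRepOn ρ H) (hA : A ≤ H) {x : G} (hx : x ∈ A) (w : W) :
    avg ρ A (ρ x w) = avg ρ A w := by
  rw [avg, avg]
  congr 1
  refine Finset.sum_equiv (Equiv.mulRight x) (fun a => ?_) fun a ha => ?_
  · simp only [mem_elems, Equiv.coe_mulRight]
    exact (Subgroup.mul_mem_cancel_right A hx).symm
  · exact (hρ.mul a (hA (mem_elems.1 ha)) x (hA hx) w).symm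

theorem avg_sum {ι : Type*} (s : Finset ι) (f : ι → W) :
    avg ρ A (∑ i ∈ s, f i) = ∑ i ∈ s, avg ρ A (f i) := by
  simp only [avg, map_sum]
  rw [Finset.sum_comm, Finset.smul_sum]

theorem avg_smul (c : k) (w : W) : avg ρ A (c • w) = c • avg ρ A w := by
  simp only [avg, map_smul, ← Finset.smul_sum]
  exact smul_comm _ _ _

theorem avg_avg (w : W) :
    avg ρ A' (avg ρ A w) = (Nat.card A : k)⁻¹ • ∑ a ∈ elems A, avg ρ A' (ρ a w) := by
  conv_lhs => rw [avg.eq_def ρ A, avg_smul, avg_sum]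

theorem IsRepOn.avg_avg_of_le (hρ : IsRepOn ρ H) (hA' : A' ≤ H) (h : A ≤ A')
    (hA : (Nat.card A : k) ≠ 0) (w : W) : avg ρ A' (avg ρ A w) = avg ρ A' w := by
  rw [avg_avg, Finset.sum_congr rfl fun a ha => hρ.avg_apply hA' (h (mem_elems.1 ha)) w,
    Finset.sum_const, card_elems, ← Nat.cast_smul_eq_nsmul k, smul_smul, inv_mul_cancel₀ hA,
    one_smul]

theorem IsRepOn.apply_avg_conj (hρ : IsRepOn ρ H) (hA : A ≤ H) {g : G} (hg : g ∈ H) (w : W) :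
    ρ g (avg ρ A w) = avg ρ (conjSub g A) (ρ g w) := by
  have hc : Nat.card (conjSub g A) = Nat.card A :=
    (Nat.card_congr (A.equivMapOfInjective _ (MulAut.conj g).injective).toEquiv).symm
  rw [avg, avg, map_smul, map_sum, hc]
  congr 1
  refine Finset.sum_equiv (MulAut.conj g).toEquiv (fun a => ?_) fun a ha => ?_
  · rw [mem_elems, mem_elems, BNData.mem_conjSub]
    simp [mul_assoc]
  · have haH := hA (mem_elems.1 ha)
    rw [← hρ.mul g hg a haH]
    have h1 : (MulAut.conj g).toEquiv a = g * a * g⁻¹ := by simp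
    rw [h1, ← hρ.mul _ (mul_mem (mul_mem hg haH) (inv_mem hg)) g hg]
    congr 2
    group

theorem natCast_card_ne_zero {p : ℕ} (hp : p.Prime) (hk : (p : k) ≠ 0) (hA : IsPGroup p A) :
    (Nat.card A : k) ≠ 0 := by
  have : Fact p.Prime := ⟨hp⟩
  obtain ⟨n, hn⟩ := IsPGroup.iff_card.1 hA
  rw [hn, Nat.cast_pow]
  exact pow_ne_zero _ hk

end Average

namespace BNData

/-! ### Independence of the parabolic subgroup -/

section Independence

variable {G : Type v} [Group G] {D : BNData G} {p : ℕ} [Finite G]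

/-- The unipotent subgroup of the face `F` in the Levi subgroup of the face `E`. -/
def unip (D : BNData G) (F E : Set G) : Subgroup G := D.rootSubgroup F ⊓ D.levi E

theorem unip_le (F E : Set G) : D.unip F E ≤ D.levi E := inf_le_right

theorem IsSplitBNPair.unip_smul (hD : D.IsSplitBNPair p) {n : G} (hn : n ∈ D.N) (F E : Set G) :
    D.unip (n • F) (n • E) = conjSub n (D.unip F E) := by
  rw [unip, rootSubgroup_smul, hD.levi_smul hn, unip, conjSub, conjSub, conjSub,
    Subgroup.map_inf _ _ _ (MulAut.conj n).injective]

theorem unip_anti {F F' E : Set G} (h : F ⊆ F') : D.unip F' E ≤ D.unip F E :=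
  inf_le_inf_right _ (rootSubgroup_anti h)

theorem IsSplitBNPair.isPGroup_unip (hD : D.IsSplitBNPair p) {F E : Set G} {c : G} (hc : c ∈ F) :
    IsPGroup p (D.unip F E) := (hD.isPGroup_rootSubgroup hc).to_le inf_le_left

/-- The roots that cut `F`. -/
def cutSet (D : BNData G) (F : Set G) : Set (Set G) := {a | a ∈ D.roots ∧ Cuts a F}

theorem ncard_cutSet_smul {n : G} (hn : n ∈ D.N) (F : Set G) :
    (D.cutSet (n • F)).ncard = (D.cutSet F).ncard := by
  have h : D.cutSet (n • F) = (fun a => n • a) '' D.cutSet F := by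
    ext a
    constructor
    · rintro ⟨ha, hc⟩
      refine ⟨n⁻¹ • a, ⟨smul_mem_roots (inv_mem hn) ha, ?_⟩, smul_inv_smul _ _⟩
      rwa [← cuts_smul (n := n), smul_inv_smul]
    · rintro ⟨a, ⟨ha, hc⟩, rfl⟩
      exact ⟨smul_mem_roots hn ha, cuts_smul.2 hc⟩
  rw [h, Set.ncard_image_of_injective _ (MulAction.injective n)]

theorem Parallel.cutSet_eq {F E : Set G} (h : D.Parallel F E) : D.cutSet F = D.cutSet E := by
  ext a
  exact ⟨fun ha => ⟨ha.1, (h a ha.1).1 ha.2⟩, fun ha => ⟨ha.1, (h a ha.1).2 ha.2⟩⟩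

theorem IsSplitBNPair.exists_mul_unip (hD : D.IsSplitBNPair p) (hcomm : D.CommutatorRelations)
    {c x : G} {A I J : Set G} (hc : c ∈ D.N) (hJ : J ⊆ D.S) (hI : I ⊆ D.S) (hA : A ⊆ D.N)
    (hcA : c ∈ A) (hx : x ∈ D.unip A (D.face c I)) :
    ∃ y ∈ D.unip A (D.face c I) ⊓ D.unip (D.face c J) (D.face c I),
      ∃ l ∈ D.unip A (D.face c I) ⊓ D.levi (D.face c J), x = y * l := by
  have h1 := hD.inf_levi_eq hcomm hc hI hcA
  rw [unip, h1] at hx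
  obtain ⟨y, hy, l, hl, rfl⟩ := hD.exists_mul_face hcomm hc hJ
    (Set.union_subset hA (cone_subset_N _ _)) (Or.inl hcA) hx
  rw [← h1] at hy hl
  exact ⟨y, ⟨hy.1, hy.2, hy.1.2⟩, l, hl, rfl⟩

theorem IsSplitBNPair.exists_mul_leviBorel (hD : D.IsSplitBNPair p) (hcomm : D.CommutatorRelations)
    {c b : G} {I J : Set G} (hc : c ∈ D.N) (hJ : J ⊆ I) (hI : I ⊆ D.S)
    (hb : b ∈ D.leviBorel c I) :
    ∃ y ∈ D.unip (D.face c J) (D.face c I), ∃ l ∈ D.leviBorel c J, b = y * l := by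
  obtain ⟨u, hu, t, ht, rfl⟩ := hD.exists_mul_of_mem_leviBorel hb
  obtain ⟨y, hy, l, hl, rfl⟩ := hD.exists_mul_face hcomm hc (hJ.trans hI) (cone_subset_N _ _)
    (self_mem_cone hc _) hu
  refine ⟨y, ⟨hy.2, hD.leviUnip_le_levi hc hI hy.1⟩, l * t, mul_mem ?_ (T_le_leviBorel _ _ ht),
    by group⟩
  exact hD.mem_leviBorel hcomm hc (hJ.trans hI) hl.2
    (hD.U_le (mem_rootSubgroup.1 hl.1 c (self_mem_cone hc _)))

theorem IsSplitBNPair.levi_conj_mem_unip (hD : D.IsSplitBNPair p) (hcomm : D.CommutatorRelations)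
    {c : G} {J E : Set G} (hc : c ∈ D.N) (hJ : J ⊆ D.S)
    (hE : D.levi (D.face c J) ≤ D.levi E) {l x : G} (hl : l ∈ D.levi (D.face c J))
    (hx : x ∈ D.unip (D.face c J) E) : l * x * l⁻¹ ∈ D.unip (D.face c J) E :=
  Subgroup.mem_inf.2 ⟨le_normalizer_iff.1 (hD.levi_le_normalizer hcomm hc hJ) l hl x hx.1,
    mul_mem (mul_mem (hE hl) (Subgroup.mem_inf.1 hx).2) (inv_mem (hE hl))⟩

variable {k : Type u} [Field k] {W : Type w} [AddCommGroup W] [Module k W]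
  {ρ : G → Module.End k W}

/-- A vector fixed by the unipotent group of `F₁` whose average over that of `F₂` is `0` is `0`. -/
def Indep (D : BNData G) (ρ : G → Module.End k W) (E F₁ F₂ : Set G) : Prop :=
  ∀ w, (∀ x ∈ D.unip F₁ E, ρ x w = w) → avg ρ (D.unip F₂ E) w = 0 → w = 0

/-- Handles the faces in `avg_apply_eq_zero` that are not parallel to `F₁ = face f₁ J`. The
projection of the face of `g` to `F₁` is cut by fewer roots. With `Y` its unipotent group in `levi
F₁`, the induction hypothesis gives `avg Y v = 0`, and `Y` lies in the group over which the average
is taken. -/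
theorem IsSplitBNPair.avg_eq_zero_of_not_cuts (hp : p.Prime) (hD : D.IsSplitBNPair p)
    (hcomm : D.CommutatorRelations) (hpk : (p : k) ≠ 0) {e : G} {I : Set G} (he : e ∈ D.N)
    (hI : I ⊆ D.S) (hρ : IsRepOn ρ (D.levi (D.face e I)))
    {f₁ f' g : G} {J J' J₃ : Set G} (hf₁ : f₁ ∈ D.face e I) (hJ : J ⊆ I)
    (hf' : f' ∈ D.face e I) (hJ' : J' ⊆ I) (hg : g ∈ D.face e I) (hJ₃ : J₃ ⊆ I)
    (hpar : D.Parallel (D.face f' J') (D.face f₁ J))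
    (IH : ∀ g₁ ∈ D.face e I, ∀ K₁ ⊆ I, ∀ g₂ ∈ D.face e I, ∀ K₂ ⊆ I,
      D.Parallel (D.face g₁ K₁) (D.face g₂ K₂) →
      (D.cutSet (D.face g₁ K₁)).ncard < (D.cutSet (D.face f₁ J)).ncard →
      D.Indep ρ (D.face e I) (D.face g₁ K₁) (D.face g₂ K₂))
    {v : W} (hv : ∀ x ∈ D.unip (D.face f₁ J) (D.face e I), ρ x v = v)
    (hv' : avg ρ (D.unip (D.face f' J') (D.face e I)) v = 0)
    (hnot : ∃ a ∈ D.roots, Cuts a (D.face f₁ J) ∧ ¬ Cuts a (D.face g J₃)) :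
    avg ρ (D.unip (D.face g J₃) (D.face e I)) v = 0 := by
  have hEN := hD.face_subset_N he hI
  have hf₁N := hEN hf₁
  have hJS := hJ.trans hI
  have hE1 : D.face f₁ I = D.face e I := face_eq hf₁
  have hcutE : ∀ a, Cuts a (D.face f₁ J) → Cuts a (D.face e I) := fun a h => by
    rw [← hE1]; exact h.mono (face_mono hJ)
  have hLE : D.levi (D.face f₁ J) ≤ D.levi (D.face e I) := levi_mono fun a _ h => hcutE a h
  obtain ⟨f, hf, J'', hJ'', -, hcuts, hsub, -⟩ :=
    hD.exists_proj_face hf₁N hJS (hEN hg) (hJ₃.trans hI)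
  have hfN := hD.face_subset_N hf₁N hJS hf
  have hJ''S := hJ''.trans hJS
  have hfE : f ∈ D.face e I := by rw [← hE1]; exact face_mono hJ hf
  have hF3 : D.face f J = D.face f₁ J := face_eq hf
  have hlt : (D.cutSet (D.face f J'')).ncard < (D.cutSet (D.face f₁ J)).ncard := by
    refine Set.ncard_lt_ncard ⟨fun a ha => ⟨ha.1, ((hcuts a ha.1).1 ha.2).1⟩, fun h => ?_⟩
      (Set.toFinite _)
    obtain ⟨a, ha, h1, h2⟩ := hnot
    exact h2 ((hcuts a ha).1 (h ⟨ha, h1⟩).2).2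
  obtain ⟨f₃, hf₃, J₃', hJ₃', -, hcuts', hsub', -⟩ :=
    hD.exists_proj_face (hEN hf') (hJ'.trans hI) hfN hJ''S
  have hpar3 : D.Parallel (D.face f J'') (D.face f₃ J₃') := by
    intro a ha
    rw [hcuts' a ha]
    exact ⟨fun h => ⟨(hpar a ha).2 ((hcuts a ha).1 h).1, h⟩, fun h => h.2⟩
  have hf₃E : f₃ ∈ D.face e I := by
    rw [← face_eq hf']; exact face_mono hJ' hf₃
  -- the average over the unipotent group of the smaller face vanishes
  set Y := D.unip (D.face f J'') (D.face f₁ J) with hY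
  have hYc : (Nat.card Y : k) ≠ 0 :=
    natCast_card_ne_zero hp hpk (hD.isPGroup_unip (self_mem_face f J''))
  have hYE : Y ≤ D.levi (D.face e I) := (unip_le _ _).trans hLE
  have hYle : ∀ {A : Subgroup G}, (∀ a ∈ D.roots, D.face f J'' ⊆ a → Cuts a (D.face f₁ J) →
      D.rootSubgroup a ≤ A) → Y ≤ A := by
    intro A h
    rw [hY, unip, ← hF3] at *
    exact hD.inf_levi_le hcomm hfN hJS (hD.face_subset_N hfN hJ''S) (self_mem_face f J'') h
  have hv3 : avg ρ Y v = 0 := by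
    -- The induction hypothesis is applied to the projection and its parallel copy inside `face f'
    -- J'`. The unipotent group of the copy contains both `Y` and that of `face f' J'`, so its
    -- average kills `avg Y v` because of `hv'`.
    refine IH f hfE J'' (hJ''.trans hJ) f₃ hf₃E J₃' (hJ₃'.trans hJ') hpar3 hlt _ ?_ ?_
    · intro x hx
      have hEf : D.face f I = D.face e I := face_eq hfE
      rw [← hEf] at hx
      obtain ⟨y, hy, l, hl, rfl⟩ := hD.exists_mul_unip hcomm hfN hJS hI
        (hD.face_subset_N hfN hJ''S) (self_mem_face f J'') hx
      obtain ⟨-, hy⟩ := Subgroup.mem_inf.1 hy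
      obtain ⟨hl1, hl2⟩ := Subgroup.mem_inf.1 hl
      rw [hF3, hEf] at hy
      rw [hF3] at hl2
      have hlY : l ∈ Y := Subgroup.mem_inf.2 ⟨(Subgroup.mem_inf.1 hl1).1, hl2⟩
      rw [hρ.mul y (unip_le _ _ hy) l (hYE hlY), hρ.apply_avg hYE hlY]
      rw [avg, map_smul, map_sum]
      congr 1
      refine Finset.sum_congr rfl fun a ha => ?_
      have haL : a ∈ D.levi (D.face f₁ J) := unip_le _ _ (mem_elems.1 ha)
      have h1 := hD.levi_conj_mem_unip hcomm hf₁N hJS hLE (inv_mem haL) hy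
      rw [inv_inv] at h1
      rw [← hρ.mul y (unip_le _ _ hy) a (hLE haL)]
      have h2 : y * a = a * (a⁻¹ * y * a) := by group
      rw [h2, hρ.mul a (hLE haL) _ (unip_le _ _ h1), hv _ h1]
    · have h1 : Y ≤ D.unip (D.face f₃ J₃') (D.face e I) := by
        refine hYle fun a ha h1 h2 => le_inf (rootSubgroup_anti ?_) (rootSubgroup_le_levi ha (hcutE a h2))
        exact (hsub' a ha ((hpar a ha).2 h2)).2 h1
      have h2 : D.unip (D.face f' J') (D.face e I) ≤ D.unip (D.face f₃ J₃') (D.face e I) := by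
        refine unip_anti ?_
        rw [← face_eq hf₃]
        exact face_mono hJ₃'
      rw [hρ.avg_avg_of_le (unip_le _ _) h1 hYc, ← hρ.avg_avg_of_le (unip_le _ _) h2
        (natCast_card_ne_zero hp hpk (hD.isPGroup_unip (self_mem_face f' J'))), hv', avg_zero]
  have h1 : Y ≤ D.unip (D.face g J₃) (D.face e I) :=
    hYle fun a ha h1 h2 => le_inf (rootSubgroup_anti ((hsub a ha h2).1 h1))
      (rootSubgroup_le_levi ha (hcutE a h2))
  rw [← hρ.avg_avg_of_le (unip_le _ _) h1 hYc, hv3, avg_zero]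

end Independence

end BNData
end HarishChandra

namespace HarishChandra
namespace BNData

/-! ### Averages over the unipotent groups of opposite and of parallel faces -/

section Independence

variable {G : Type v} [Group G] {D : BNData G} {p : ℕ} [Finite G]

/-- The unipotent groups of two opposite faces `F₁`, `F'` of `K` do not meet `U_{F₁} levi F₁`. -/
theorem IsSplitBNPair.eq_one_of_opposite (hD : D.IsSplitBNPair p) (hcomm : D.CommutatorRelations)
    {f₁ f' s r y : G} {J J' : Set G} (hf₁ : f₁ ∈ D.N) (hs : s ∈ D.S) (hJ : J ⊆ D.S)
    (hf' : f' ∈ D.face f₁ (insert s J)) (hJ' : J' ⊆ insert s J)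
    (hpar : D.Parallel (D.face f' J') (D.face f₁ J))
    (hside : ∀ a ∈ D.roots, Cuts a (D.face f₁ J) → (f₁ ∈ a ↔ f' ∈ a))
    (hopp : ∀ a ∈ D.roots, Cuts a (D.face f₁ (insert s J)) → ¬ Cuts a (D.face f₁ J) → f₁ ∈ a →
      f' ∉ a)
    (hr : r ∈ D.N) (hrF : r • D.face f₁ J = D.face f₁ J)
    {u l l' : G} (hu : u ∈ D.unip (D.face f₁ J) (D.face f₁ (insert s J)))
    (hl : l ∈ D.leviBorel f₁ J) (hl' : l' ∈ D.leviBorel f₁ J)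
    (hy : y ∈ D.unip (D.face f' J') (D.face f₁ (insert s J))) (he : y = u * (l * r * l')) :
    y = 1 := by
  have hK : insert s J ⊆ D.S := Set.insert_subset hs hJ
  have hf'N := hD.face_subset_N hf₁ hK hf'
  have hcone : f' ∈ D.cone f₁ (D.face f₁ J) :=
    ⟨hf'N, fun a ha h1 h2 => (hside a ha h2).1 h1⟩
  have hB1 : ∀ z ∈ D.leviBorel f₁ J, f₁⁻¹ * z * f₁ ∈ D.B := fun z hz =>
    hD.conj_mem_B_of_mem_leviBorel hf₁ hz
  have hB2 : ∀ z ∈ D.leviBorel f₁ J, f'⁻¹ * z * f' ∈ D.B := by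
    intro z hz
    obtain ⟨x, hx, t, ht, rfl⟩ := hD.exists_mul_of_mem_leviBorel hz
    have h1 := mul_mem (hD.U_le (mem_rootSubgroup.1 hx f' hcone))
      (T_le_B (hD.inv_conj_torus hf'N ht))
    convert h1 using 1
    group
  have huB : f₁⁻¹ * u * f₁ ∈ D.B := hD.U_le (mem_rootSubgroup.1 hu.1 f₁ (self_mem_face f₁ J))
  have hyB : f'⁻¹ * y * f' ∈ D.B := hD.U_le (mem_rootSubgroup.1 hy.1 f' (self_mem_face f' J'))
  -- Here `y` stabilizes `f'`, `u` stabilizes `f₁`, and `l`, `l'` stabilize both. So `f'` and `r f'`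
  -- have the same position relative to `f₁`, which puts `r` into the torus.
  have h1 : D.InDC (f₁⁻¹ * f') (f₁⁻¹ * (r * f')) := by
    have h2 : D.InDC (f₁⁻¹ * f') (f₁⁻¹ * (l * r * l') * f') := by
      have h3 := ((InDC.self (D := D) (f₁⁻¹ * f')).mul_right hyB).mul_left (inv_mem huB)
      convert h3 using 1
      rw [he]; group
    refine h2.trans ?_
    have h3 := ((InDC.self (D := D) (f₁⁻¹ * (l * r * l') * f')).mul_left
      (inv_mem (hB1 l hl))).mul_right (inv_mem (hB2 l' hl'))
    convert h3 using 1
    group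
  have h2 := (hD.eqv_of_inDC (mul_mem (inv_mem hf₁) hf'N)
    (mul_mem (inv_mem hf₁) (mul_mem hr hf'N)) h1).of_mul_left
  have hrT : r ∈ D.T := by
    have := hD.conj_torus hf'N h2
    simpa [mul_assoc] using this
  have hlam : l * r * l' ∈ D.leviBorel f₁ J :=
    mul_mem (mul_mem hl (T_le_leviBorel f₁ J hrT)) hl'
  have hyB1 : f₁⁻¹ * y * f₁ ∈ D.B := by
    have h3 := mul_mem huB (hB1 _ hlam)
    rw [he]
    convert h3 using 1
    group
  have hyU := hD.mem_U_of_conj (mem_rootSubgroup.1 hy.1 f' (self_mem_face f' J')) hyB1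
  have hyK := hy
  rw [unip, ← face_eq hf', hD.inf_levi_eq hcomm hf'N hK (self_mem_face f' J'), face_eq hf'] at hyK
  have h3 := mem_rootSubgroup_insert.2 ⟨hyU, hyK⟩
  have hJ'S := hJ'.trans hK
  -- Now `y` is unipotent at `f₁` and on the whole face of `f'`. A root that contains these chambers
  -- and the cone cuts the large face but not `F₁`, against `hopp`.
  rw [hD.rootSubgroup_eq_bot (Set.insert_subset hf₁ (Set.union_subset
    (hD.face_subset_N hf'N hJ'S) (cone_subset_N _ _))) ⟨f₁, Set.mem_insert _ _⟩ ?_] at h3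
  · exact h3
  · intro a ha hsub
    obtain ⟨ha1, ha2⟩ := Set.insert_subset_iff.1 hsub
    obtain ⟨ha2, ha3⟩ := Set.union_subset_iff.1 ha2
    rw [← face_eq hf', hD.cone_subset_iff hf'N hK ha, face_eq hf'] at ha3
    refine hopp a ha ha3.2 (fun h => ?_) ha1 ha3.1
    obtain ⟨z, hz, hza⟩ := ((hpar a ha).2 h).2
    exact hza (ha2 hz)

variable {k : Type u} [Field k] {W : Type w} [AddCommGroup W] [Module k W]
  {ρ : G → Module.End k W}

/-- A Bruhat decomposition of `y` with middle factor `r` reduces the claim to the average of a Levi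
translate of `v` over the unipotent group of `r⁻¹ F₁`. If this face is not parallel to `F₁`, the
average vanishes by induction. Otherwise it is `F₁` or `F'` by `eq_or_eq_of_parallel`; the first
would imply `y = 1`, and in the second case the hypothesis applies. -/
theorem IsSplitBNPair.avg_apply_eq_zero (hp : p.Prime) (hD : D.IsSplitBNPair p)
    (hcomm : D.CommutatorRelations) (hpk : (p : k) ≠ 0) {e : G} {I : Set G} (he : e ∈ D.N)
    (hI : I ⊆ D.S) (hρ : IsRepOn ρ (D.levi (D.face e I)))
    {f₁ f' s : G} {J J' : Set G} (hf₁ : f₁ ∈ D.face e I) (hsI : s ∈ I) (hJ : J ⊆ I)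
    (hf' : f' ∈ D.face f₁ (insert s J)) (hJ' : J' ⊆ insert s J)
    (hpar : D.Parallel (D.face f' J') (D.face f₁ J))
    (hside : ∀ a ∈ D.roots, Cuts a (D.face f₁ J) → (f₁ ∈ a ↔ f' ∈ a))
    (hopp : ∀ a ∈ D.roots, Cuts a (D.face f₁ (insert s J)) → ¬ Cuts a (D.face f₁ J) → f₁ ∈ a →
      f' ∉ a)
    (IH : ∀ g₁ ∈ D.face e I, ∀ K₁ ⊆ I, ∀ g₂ ∈ D.face e I, ∀ K₂ ⊆ I,
      D.Parallel (D.face g₁ K₁) (D.face g₂ K₂) →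
      (D.cutSet (D.face g₁ K₁)).ncard < (D.cutSet (D.face f₁ J)).ncard →
      D.Indep ρ (D.face e I) (D.face g₁ K₁) (D.face g₂ K₂))
    {v : W} (hv : ∀ x ∈ D.unip (D.face f₁ J) (D.face e I), ρ x v = v)
    (hv' : avg ρ (D.unip (D.face f' J') (D.face e I)) v = 0) {y : G}
    (hy : y ∈ D.unip (D.face f' J') (D.face f₁ (insert s J))) (hy1 : y ≠ 1) :
    avg ρ (D.unip (D.face f₁ J) (D.face e I)) (ρ y v) = 0 := by
  have hEN := hD.face_subset_N he hI
  have hf₁N := hEN hf₁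
  have hJS := hJ.trans hI
  have hKI : insert s J ⊆ I := Set.insert_subset hsI hJ
  have hKS := hKI.trans hI
  have hE1 : D.face f₁ I = D.face e I := face_eq hf₁
  have hKE : D.face f₁ (insert s J) ⊆ D.face e I := by rw [← hE1]; exact face_mono hKI
  have hcutE : ∀ a, Cuts a (D.face f₁ J) → Cuts a (D.face e I) := fun a h => by
    rw [← hE1]; exact h.mono (face_mono hJ)
  have hLE : D.levi (D.face f₁ J) ≤ D.levi (D.face e I) := levi_mono fun a _ h => hcutE a h
  have hKLE : D.levi (D.face f₁ (insert s J)) ≤ D.levi (D.face e I) :=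
    levi_mono fun a _ h => h.mono hKE
  have hf'N := hEN (hKE hf')
  have hunip : D.unip (D.face f₁ J) (D.face f₁ (insert s J)) ≤
      D.unip (D.face f₁ J) (D.face e I) := inf_le_inf_left _ hKLE
  obtain ⟨r, hr, hrK, b, hb, b', hb', hyb⟩ := hD.levi_bruhat hcomm hf₁N hKS (unip_le _ _ hy)
  obtain ⟨u, hu, l, hl, rfl⟩ := hD.exists_mul_leviBorel hcomm hf₁N (Set.subset_insert s J) hKS hb
  obtain ⟨u', hu', l', hl', hb'e⟩ :=
    hD.exists_mul_leviBorel hcomm hf₁N (Set.subset_insert s J) hKS (inv_mem hb')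
  have hlL := hD.leviBorel_le_levi hf₁N hJS hl
  have hl'L := hD.leviBorel_le_levi hf₁N hJS (inv_mem hl')
  have hb'e : b' = l'⁻¹ * u'⁻¹ := by rw [← inv_inv b', hb'e]; group
  have hrL : r ∈ D.levi (D.face f₁ (insert s J)) := hD.mem_levi_of_smul_face hcomm hf₁N hKS hrK
  have hrE : r • D.face e I = D.face e I := by
    rw [← hE1, smul_face_eq_iff]
    exact stdN_mono hKI (smul_face_eq_iff.1 hrK)
  -- the translate of `v` by an element of the Levi subgroup has the same properties
  have hv1 : ∀ x ∈ D.unip (D.face f₁ J) (D.face e I), ρ x (ρ l'⁻¹ v) = ρ l'⁻¹ v := by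
    intro x hx
    have h1 := hD.levi_conj_mem_unip hcomm hf₁N hJS hLE (inv_mem hl'L) hx
    rw [inv_inv] at h1
    rw [← hρ.mul x (unip_le _ _ hx) _ (hLE hl'L)]
    have h2 : x * l'⁻¹ = l'⁻¹ * (l' * x * l'⁻¹) := by group
    rw [h2, hρ.mul _ (hLE hl'L) _ (unip_le _ _ h1), hv _ h1]
  have hJ'S := hJ'.trans hKS
  have hL' : D.levi (D.face f' J') = D.levi (D.face f₁ J) := hpar.levi_eq
  have hv1' : avg ρ (D.unip (D.face f' J') (D.face e I)) (ρ l'⁻¹ v) = 0 := by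
    have hl'' : l'⁻¹ ∈ D.levi (D.face f' J') := by rw [hL']; exact hl'L
    have h1 : conjSub l'⁻¹ (D.unip (D.face f' J') (D.face e I)) =
        D.unip (D.face f' J') (D.face e I) := conjSub_eq_of_le (by
      rintro _ ⟨x, hx, rfl⟩
      exact hD.levi_conj_mem_unip hcomm hf'N hJ'S (by rw [hL']; exact hLE) hl'' hx)
    rw [← h1, ← hρ.apply_avg_conj (unip_le _ _) (hLE hl'L), hv', map_zero]
  have hstep : avg ρ (D.unip (D.face f₁ J) (D.face e I)) (ρ y v) =
      ρ l (avg ρ (D.unip (D.face f₁ J) (D.face e I)) (ρ r (ρ l'⁻¹ v))) := by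
    have h0 : conjSub l (D.unip (D.face f₁ J) (D.face e I)) =
        D.unip (D.face f₁ J) (D.face e I) := conjSub_eq_of_le (by
      rintro _ ⟨x, hx, rfl⟩
      exact hD.levi_conj_mem_unip hcomm hf₁N hJS hLE hlL hx)
    have huE := hKLE (unip_le _ _ hu)
    have hu'E := hKLE (unip_le _ _ (inv_mem hu'))
    have hrE := hKLE hrL
    rw [hρ.apply_avg_conj (unip_le _ _) (hLE hlL), h0, hyb, hb'e]
    have h1 : u * l * r * (l'⁻¹ * u'⁻¹) = u * (l * (r * (l'⁻¹ * u'⁻¹))) := by group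
    rw [h1, hρ.mul u huE _ (mul_mem (hLE hlL) (mul_mem hrE (mul_mem (hLE hl'L) hu'E))),
      hρ.avg_apply (unip_le _ _) (hunip hu), hρ.mul l (hLE hlL) _ (mul_mem hrE (mul_mem (hLE hl'L) hu'E)),
      hρ.mul r hrE _ (mul_mem (hLE hl'L) hu'E), hρ.mul _ (hLE hl'L) _ hu'E,
      hv _ (hunip (inv_mem hu'))]
  have hG : r⁻¹ • D.face f₁ J = D.face (r⁻¹ * f₁) J := smul_face _ _ _
  have hrev : avg ρ (D.unip (D.face (r⁻¹ * f₁) J) (D.face e I)) (ρ l'⁻¹ v) = 0 →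
      avg ρ (D.unip (D.face f₁ J) (D.face e I)) (ρ y v) = 0 := by
    intro h
    have h1 : D.unip (D.face f₁ J) (D.face e I) =
        conjSub r (D.unip (D.face (r⁻¹ * f₁) J) (D.face e I)) := by
      rw [← hD.unip_smul hr, hrE, ← hG, smul_inv_smul]
    rw [hstep, h1, ← hρ.apply_avg_conj (unip_le _ _) (hKLE hrL), h, map_zero, map_zero]
  have hgK : r⁻¹ * f₁ ∈ D.face f₁ (insert s J) := by
    have h1 : r⁻¹ • D.face f₁ (insert s J) = D.face f₁ (insert s J) := by
      rw [inv_smul_eq_iff, hrK]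
    rw [← h1]
    exact Set.smul_mem_smul_set (self_mem_face _ _)
  by_cases hnot : ∃ a ∈ D.roots, Cuts a (D.face f₁ J) ∧ ¬ Cuts a (D.face (r⁻¹ * f₁) J)
  · exact hrev (hD.avg_eq_zero_of_not_cuts hp hcomm hpk he hI hρ hf₁ hJ (hKE hf')
      (hJ'.trans hKI) (hKE hgK) hJ hpar IH hv1 hv1' hnot)
  push Not at hnot
  have hcs : D.cutSet (D.face f₁ J) = D.cutSet (D.face (r⁻¹ * f₁) J) := by
    refine Set.eq_of_subset_of_ncard_le (fun a ha => ⟨ha.1, hnot a ha.1 ha.2⟩) ?_ (Set.toFinite _)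
    rw [← hG, ncard_cutSet_smul (inv_mem hr)]
  have hparG : D.Parallel (D.face (r⁻¹ * f₁) J) (D.face f₁ J) := by
    intro a ha
    refine ⟨fun h => ?_, hnot a ha⟩
    have h1 : a ∈ D.cutSet (D.face (r⁻¹ * f₁) J) := ⟨ha, h⟩
    rw [← hcs] at h1
    exact h1.2
  rcases hD.eq_or_eq_of_parallel hf₁N hJS (hI hsI) hJ'S hJS hf' hpar hside hopp hgK hparG with h | h
  · exfalso
    apply hy1
    have hrF : r • D.face f₁ J = D.face f₁ J := by
      rw [← hG, inv_smul_eq_iff] at h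
      exact h.symm
    have hrL1 := hD.mem_levi_of_smul_face hcomm hf₁N hJS hrF
    have hlam : l * r * l'⁻¹ ∈ D.levi (D.face f₁ J) := mul_mem (mul_mem hlL hrL1) hl'L
    refine hD.eq_one_of_opposite hcomm hf₁N (hI hsI) hJS hf' hJ' hpar hside hopp hr hrF
      (u := u * ((l * r * l'⁻¹) * u'⁻¹ * (l * r * l'⁻¹)⁻¹)) (mul_mem hu ?_) hl (inv_mem hl') hy ?_
    · exact hD.levi_conj_mem_unip hcomm hf₁N hJS
        (levi_mono fun a _ h => h.mono (face_mono (Set.subset_insert s J))) hlam (inv_mem hu')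
    · rw [hyb, hb'e]; group
  · apply hrev
    rw [h]
    exact hv1'

/-- In `avg V (avg V' w)`, elements of `V'` in the radical `UK` of the large face contribute `w`,
and all others contribute zero. So the result is `w` times `|V' ∩ UK| / |V'|`, a quotient of powers
of `p` and thus nonzero in `k`. -/
theorem IsSplitBNPair.indep_of_opposite (hp : p.Prime) (hD : D.IsSplitBNPair p)
    (hcomm : D.CommutatorRelations) (hpk : (p : k) ≠ 0) {e : G} {I : Set G} (he : e ∈ D.N)
    (hI : I ⊆ D.S) (hρ : IsRepOn ρ (D.levi (D.face e I)))
    {f₁ f' s : G} {J J' : Set G} (hf₁ : f₁ ∈ D.face e I) (hsI : s ∈ I) (hJ : J ⊆ I)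
    (hf' : f' ∈ D.face f₁ (insert s J)) (hJ' : J' ⊆ insert s J)
    (hpar : D.Parallel (D.face f' J') (D.face f₁ J))
    (hside : ∀ a ∈ D.roots, Cuts a (D.face f₁ J) → (f₁ ∈ a ↔ f' ∈ a))
    (hopp : ∀ a ∈ D.roots, Cuts a (D.face f₁ (insert s J)) → ¬ Cuts a (D.face f₁ J) → f₁ ∈ a →
      f' ∉ a)
    (IH : ∀ g₁ ∈ D.face e I, ∀ K₁ ⊆ I, ∀ g₂ ∈ D.face e I, ∀ K₂ ⊆ I,
      D.Parallel (D.face g₁ K₁) (D.face g₂ K₂) →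
      (D.cutSet (D.face g₁ K₁)).ncard < (D.cutSet (D.face f₁ J)).ncard →
      D.Indep ρ (D.face e I) (D.face g₁ K₁) (D.face g₂ K₂)) :
    D.Indep ρ (D.face e I) (D.face f₁ J) (D.face f' J') := by
  classical
  intro w hw hw'
  have hEN := hD.face_subset_N he hI
  have hf₁N := hEN hf₁
  have hJS := hJ.trans hI
  have hKI : insert s J ⊆ I := Set.insert_subset hsI hJ
  have hKS := hKI.trans hI
  have hE1 : D.face f₁ I = D.face e I := face_eq hf₁
  have hKE : D.face f₁ (insert s J) ⊆ D.face e I := by rw [← hE1]; exact face_mono hKI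
  have hf'N := hEN (hKE hf')
  set V := D.unip (D.face f₁ J) (D.face e I) with hV
  set V' := D.unip (D.face f' J') (D.face e I) with hV'
  set UK := D.rootSubgroup (D.face f₁ (insert s J)) with hUK
  have hVc : (Nat.card V : k) ≠ 0 :=
    natCast_card_ne_zero hp hpk (hD.isPGroup_unip (self_mem_face f₁ J))
  have hUV : ∀ x, x ∈ V' → x ∈ UK → x ∈ V := fun x h1 h2 =>
    Subgroup.mem_inf.2 ⟨rootSubgroup_anti (face_mono (Set.subset_insert s J)) h2, unip_le _ _ h1⟩
  have hterm : ∀ x ∈ elems V', avg ρ V (ρ x w) = if x ∈ elems UK then w else 0 := by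
    intro x hx
    rw [mem_elems] at hx
    by_cases hxU : x ∈ UK
    · rw [if_pos (mem_elems.2 hxU), hw x (hUV x hx hxU), avg_eq_self hVc hw]
    · rw [if_neg (by rwa [mem_elems])]
      have hx' := hx
      have hEf : D.face f' I = D.face e I := face_eq (hKE hf')
      rw [hV', ← hEf] at hx'
      obtain ⟨u, hu, y, hy, rfl⟩ := hD.exists_mul_unip hcomm hf'N hKS hI
        (hD.face_subset_N hf'N (hJ'.trans hKS)) (self_mem_face f' J') hx'
      obtain ⟨hu1, hu2⟩ := Subgroup.mem_inf.1 hu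
      obtain ⟨hy1, hy2⟩ := Subgroup.mem_inf.1 hy
      rw [hEf] at hu1 hy1
      rw [face_eq hf'] at hu2 hy2
      have huU : u ∈ UK := (Subgroup.mem_inf.1 hu2).1
      rw [hρ.mul u (unip_le _ _ hu1) y (unip_le _ _ hy1),
        hρ.avg_apply (unip_le _ _) (hUV u hu1 huU)]
      refine hD.avg_apply_eq_zero hp hcomm hpk he hI hρ hf₁ hsI hJ hf' hJ' hpar hside hopp IH hw
        hw' (Subgroup.mem_inf.2 ⟨(Subgroup.mem_inf.1 hy1).1, hy2⟩) ?_
      rintro rfl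
      exact hxU (by rwa [mul_one])
  have h1 : avg ρ V (avg ρ V' w) = 0 := by rw [hw', avg_zero]
  rw [avg_avg, Finset.sum_congr rfl hterm, ← Finset.sum_filter, Finset.sum_const,
    ← Nat.cast_smul_eq_nsmul k, smul_smul] at h1
  have h2 : ((elems V').filter fun x => x ∈ elems UK) = elems (V' ⊓ UK) := by
    ext x; simp [mem_elems, Subgroup.mem_inf]
  rw [h2, card_elems] at h1
  refine (smul_eq_zero.1 h1).resolve_left (mul_ne_zero (inv_ne_zero ?_) ?_)
  · exact natCast_card_ne_zero hp hpk (hD.isPGroup_unip (self_mem_face f' J'))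
  · exact natCast_card_ne_zero hp hpk
      ((hD.isPGroup_unip (self_mem_face f' J')).to_le inf_le_left)

/-- Induction on the distance. By `indep_of_opposite` it is enough to show that the average of `w`
over the unipotent group of the opposite face `F'` vanishes. This average is fixed by that group,
and `F'` is closer to the second face, so the induction hypothesis applies once the average over the
second group is shown to kill it. -/
theorem IsSplitBNPair.indep_aux (hp : p.Prime) (hD : D.IsSplitBNPair p)
    (hcomm : D.CommutatorRelations) (hpk : (p : k) ≠ 0) {e : G} {I : Set G} (he : e ∈ D.N)
    (hI : I ⊆ D.S) (hρ : IsRepOn ρ (D.levi (D.face e I))) (m : ℕ)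
    (IH : ∀ g₁ ∈ D.face e I, ∀ K₁ ⊆ I, ∀ g₂ ∈ D.face e I, ∀ K₂ ⊆ I,
      D.Parallel (D.face g₁ K₁) (D.face g₂ K₂) → (D.cutSet (D.face g₁ K₁)).ncard < m →
      D.Indep ρ (D.face e I) (D.face g₁ K₁) (D.face g₂ K₂)) (d : ℕ) :
    ∀ f₁ ∈ D.face e I, ∀ J₁ ⊆ I, ∀ f₂ ∈ D.face e I, ∀ J₂ ⊆ I,
      D.Parallel (D.face f₁ J₁) (D.face f₂ J₂) → (D.cutSet (D.face f₁ J₁)).ncard = m →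
      (∀ a ∈ D.roots, Cuts a (D.face f₁ J₁) → (f₁ ∈ a ↔ f₂ ∈ a)) → D.dist f₁ f₂ = d →
      D.Indep ρ (D.face e I) (D.face f₁ J₁) (D.face f₂ J₂) := by
  induction d using Nat.strong_induction_on with
  | _ d ih =>
  intro f₁ hf₁ J hJ f₂ hf₂ J₂ hJ₂ hpar hm hside hd w hw hw'
  have hEN := hD.face_subset_N he hI
  have hf₁N := hEN hf₁
  have hf₂N := hEN hf₂
  have hJS := hJ.trans hI
  have hJ₂S := hJ₂.trans hI
  by_cases heq : D.Eqv f₁ f₂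
  · have h1 : D.face f₁ J₂ = D.face f₂ J₂ := face_eq (eqv_mem_face (self_mem_face f₂ J₂) heq.symm)
    rw [← h1] at hpar hw'
    rw [← hD.face_eq_of_parallel hf₁N hJS hJ₂S hpar, avg_eq_self
      (natCast_card_ne_zero hp hpk (hD.isPGroup_unip (self_mem_face f₁ J))) hw] at hw'
    exact hw'
  have hE1 : D.face f₁ I = D.face e I := face_eq hf₁
  obtain ⟨s, hsI, hstep⟩ := hD.exists_step hI (mem_face.1 (hE1.symm ▸ hf₂)) heq
  obtain ⟨f', hf', J', hJ', hpar', hside', hopp⟩ :=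
    hD.exists_adjacent_face hf₁N hJS hf₂N hJ₂S (hI hsI) hpar hside hstep
  have hKI : insert s J ⊆ I := Set.insert_subset hsI hJ
  have hKE : D.face f₁ (insert s J) ⊆ D.face e I := by rw [← hE1]; exact face_mono hKI
  have hcutK : ∀ a, Cuts a (D.face f₁ J) → Cuts a (D.face f₁ (insert s J)) := fun a h =>
    h.mono (face_mono (Set.subset_insert s J))
  have hf'E := hKE hf'
  have hf'N := hEN hf'E
  have hJ'S := (hJ'.trans hKI).trans hI
  have hopp1 : D.Indep ρ (D.face e I) (D.face f₁ J) (D.face f' J') :=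
    hD.indep_of_opposite hp hcomm hpk he hI hρ hf₁ hsI hJ hf' hJ' hpar'
      (fun a ha h => (hside a ha h).trans (hside' a ha (hcutK a h))) hopp (by rw [hm]; exact IH)
  apply hopp1 w hw
  have hdist : D.dist f' f₂ < d := by
    rw [← hd]
    refine Set.ncard_lt_ncard ⟨?_, fun h => ?_⟩ (Set.toFinite _)
    · rintro a ⟨ha, h1, h2⟩
      refine ⟨ha, ?_, h2⟩
      have h3 : ¬ Cuts a (D.face f₁ (insert s J)) := fun h => h2 ((hside' a ha h).2 h1)
      exact (mem_iff_of_not_cuts h3 (self_mem_face _ _) hf').2 h1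
    · have h1 : f₁ • D.simpleRoot s ∈ D.sep f₁ f₂ :=
        ⟨smul_simpleRoot_mem_roots hf₁N (hI hsI), self_mem_smul_simpleRoot _ _, hstep⟩
      have h2 := h h1
      exact h2.2.2 ((hside' _ h2.1 (hD.cuts_self (hI hsI) (Set.mem_insert s J))).2 h2.2.1)
  refine ih _ hdist f' hf'E J' (hJ'.trans hKI) f₂ hf₂ J₂ hJ₂
    (fun a ha => (hpar' a ha).trans (hpar a ha)) (by rw [hpar'.cutSet_eq, hm])
    (fun a ha h => (hside' a ha (hcutK a ((hpar' a ha).1 h))).symm) rfl _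
    (fun x hx => hρ.apply_avg (unip_le _ _) hx w) ?_
  rw [avg_avg, Finset.sum_eq_zero, smul_zero]
  intro x hx
  rw [mem_elems] at hx
  have hx' := hx
  have hEf : D.face f' I = D.face e I := face_eq hf'E
  have hA : D.face f' J' ∪ D.cone f' (D.face e I) ⊆ D.N :=
    Set.union_subset (hD.face_subset_N hf'N hJ'S) (cone_subset_N _ _)
  have hroot : ∀ a ∈ D.roots, D.face f' J' ∪ D.cone f' (D.face e I) ⊆ a →
      D.face f' J' ⊆ a ∧ f' ∈ a ∧ Cuts a (D.face e I) := by
    intro a ha h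
    obtain ⟨h1, h2⟩ := Set.union_subset_iff.1 h
    rw [← hEf, hD.cone_subset_iff hf'N hI ha, hEf] at h2
    exact ⟨h1, h2⟩
  have hncut : ∀ a ∈ D.roots, D.face f' J' ⊆ a → ¬ Cuts a (D.face f₁ J) := by
    intro a ha h1 h2
    obtain ⟨z, hz, hza⟩ := ((hpar' a ha).2 h2).2
    exact hza (h1 hz)
  rw [unip, ← hEf, hD.inf_levi_eq hcomm hf'N hI (self_mem_face f' J'), hEf] at hx'
  -- Each element of the unipotent group of `F'` is a product of one for the second face and one for
  -- the first, since the relevant roots that omit `f₁` contain the second face. The factor `u`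
  -- fixes `w`, and `h` is absorbed by the average.
  obtain ⟨h, hh, u, hu, rfl⟩ := hD.exists_mul_insert hA ⟨f', Or.inl (self_mem_face _ _)⟩ hf₁N
    (H := D.unip (D.face f₂ J₂) (D.face e I)) (fun a ha hsub hf₁a => by
      obtain ⟨h1, h2, h3⟩ := hroot a ha hsub
      refine le_inf (rootSubgroup_anti ?_) (rootSubgroup_le_levi ha h3)
      refine subset_of_not_cuts (fun h => hncut a ha h1 ((hpar a ha).2 h)) (self_mem_face _ _) ?_
      refine (hside' a ha ?_).2 h2
      exact ⟨⟨f', h2, hf'⟩, ⟨f₁, self_mem_face _ _, hf₁a⟩⟩) hx'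
  have hu1 : u ∈ D.unip (D.face f₁ J) (D.face e I) := by
    rw [unip, ← hE1, hD.inf_levi_eq hcomm hf₁N hI (self_mem_face f₁ J), hE1]
    refine hD.rootSubgroup_le (Set.insert_subset hf₁N hA) ⟨f₁, Set.mem_insert _ _⟩
      (Set.union_subset (hD.face_subset_N hf₁N hJS) (cone_subset_N _ _)) (fun a ha hsub => ?_) hu
    obtain ⟨ha1, ha2⟩ := Set.insert_subset_iff.1 hsub
    obtain ⟨h1, h2, h3⟩ := hroot a ha ha2
    refine Set.union_subset (subset_of_not_cuts (hncut a ha h1) (self_mem_face _ _) ha1) ?_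
    rw [← hE1, hD.cone_subset_iff hf₁N hI ha, hE1]
    exact ⟨ha1, h3⟩
  rw [hρ.mul h (unip_le _ _ hh) u (unip_le _ _ hu1), hw u hu1, hρ.avg_apply (unip_le _ _) hh, hw']

/-- For parallel faces `F₁`, `F₂` of `E`, a vector of a representation of `levi E` that is fixed by
the unipotent group of `F₁` and killed by the average over that of `F₂` is zero. -/
theorem IsSplitBNPair.indep (hp : p.Prime) (hD : D.IsSplitBNPair p)
    (hcomm : D.CommutatorRelations) (hpk : (p : k) ≠ 0) {e : G} {I : Set G} (he : e ∈ D.N)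
    (hI : I ⊆ D.S) (hρ : IsRepOn ρ (D.levi (D.face e I)))
    {f₁ f₂ : G} {J₁ J₂ : Set G} (hf₁ : f₁ ∈ D.face e I) (hJ₁ : J₁ ⊆ I) (hf₂ : f₂ ∈ D.face e I)
    (hJ₂ : J₂ ⊆ I) (hpar : D.Parallel (D.face f₁ J₁) (D.face f₂ J₂)) :
    D.Indep ρ (D.face e I) (D.face f₁ J₁) (D.face f₂ J₂) := by
  have key : ∀ m, ∀ g₁ ∈ D.face e I, ∀ K₁ ⊆ I, ∀ g₂ ∈ D.face e I, ∀ K₂ ⊆ I,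
      D.Parallel (D.face g₁ K₁) (D.face g₂ K₂) → (D.cutSet (D.face g₁ K₁)).ncard = m →
      D.Indep ρ (D.face e I) (D.face g₁ K₁) (D.face g₂ K₂) := by
    intro m
    induction m using Nat.strong_induction_on with
    | _ m ih =>
    intro g₁ hg₁ K₁ hK₁ g₂ hg₂ K₂ hK₂ hpar hm
    have hEN := hD.face_subset_N he hI
    -- The second face is written with the projection of `g₁` as its base chamber, since `indep_aux`
    -- compares corresponding chambers.
    obtain ⟨g, hg, h1⟩ := hD.exists_proj (hEN hg₂) (hK₂.trans hI) (hEN hg₁)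
    have hgE : g ∈ D.face e I := by rw [← face_eq hg₂]; exact face_mono hK₂ hg
    rw [← face_eq hg] at hpar ⊢
    refine hD.indep_aux hp hcomm hpk he hI hρ m
      (fun a ha b hb c hc d hd h h' => ih _ h' a ha b hb c hc d hd h rfl) _ g₁ hg₁ K₁ hK₁ g hgE K₂
      hK₂ hpar hm (fun a ha h => h1 a ha ?_) rfl
    rw [← face_eq hg]
    exact (hpar a ha).1 h
  exact key _ f₁ hf₁ J₁ hJ₁ f₂ hf₂ J₂ hJ₂ hpar rfl

end Independence

end BNData
end HarishChandra

namespace HarishChandra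

/-! ### Harish-Chandra induction: generators, maps and coefficients -/

section Induction

variable {k : Type u} [Field k] {L M : Type v} [Group L] [Group M] {j : L →* M} {U : Subgroup M}
  {X : Type w} [AddCommGroup X] [Module k X] [Module (MonoidAlgebra k L) X]
  [IsScalarTower k (MonoidAlgebra k L) X]

variable (k j U) in
/-- The element `g ⊗ x` of the induced module. -/
def indMk (g : M) : X →ₗ[k] HCInd k j U X :=
  (indRelations k j U X).mkQ.restrictScalars k ∘ₗ
    TensorProduct.mk k (MonoidAlgebra k M) X (MonoidAlgebra.of k M g)

theorem indMk_eq (g : M) (x : X) : indMk k j U g x =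
    Submodule.Quotient.mk (MonoidAlgebra.of k M g ⊗ₜ[k] x) := rfl

@[simp] theorem smul_indMk (h g : M) (x : X) :
    MonoidAlgebra.of k M h • indMk k j U g x = indMk k j U (h * g) x := by
  rw [indMk_eq, indMk_eq, ← Submodule.Quotient.mk_smul, TensorProduct.smul_tmul', smul_eq_mul,
    ← map_mul]

theorem indMk_mul_mul (g : M) {y : M} (hy : y ∈ U) (l : L) (x : X) :
    indMk k j U (g * (y * j l)) x = indMk k j U g (MonoidAlgebra.of k L l • x) := by
  have h : indMk k j U (y * j l) x = indMk k j U 1 (MonoidAlgebra.of k L l • x) := by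
    rw [indMk_eq, indMk_eq, Submodule.Quotient.eq]
    refine Submodule.subset_span ⟨y, hy, l, x, ?_⟩
    rw [map_one]
  have h2 := congrArg (fun z => MonoidAlgebra.of k M g • z) h
  simpa only [smul_indMk, mul_one] using h2

theorem indMk_mul_right (g : M) {y : M} (hy : y ∈ U) (x : X) :
    indMk k j U (g * y) x = indMk k j U g x := by
  have h := indMk_mul_mul (k := k) (j := j) g hy 1 x
  simpa only [map_one, mul_one, one_smul] using h

theorem indMk_mul_map (g : M) (l : L) (x : X) :
    indMk k j U (g * j l) x = indMk k j U g (MonoidAlgebra.of k L l • x) := by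
  have h := indMk_mul_mul (k := k) (j := j) g U.one_mem l x
  simpa only [one_mul] using h

/-- The elements `g ⊗ x` generate additively, because scalars can be moved into `X`. -/
theorem ind_induction {motive : HCInd k j U X → Prop} (mk : ∀ g x, motive (indMk k j U g x))
    (add : ∀ y z, motive y → motive z → motive (y + z)) (y : HCInd k j U X) : motive y := by
  obtain ⟨z, rfl⟩ := Submodule.Quotient.mk_surjective _ y
  have h0 : motive 0 := by simpa using mk 1 0
  induction z with
  | zero => exact h0
  | add a b ha hb => exact add _ _ ha hb
  | tmul a x =>
    induction a using MonoidAlgebra.induction_on generalizing x with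
    | of g => exact mk g x
    | add a b ha hb =>
      rw [TensorProduct.add_tmul]
      exact add _ _ (ha x) (hb x)
    | smul c a ha =>
      rw [TensorProduct.smul_tmul]
      exact ha _

section Lift

variable {W : Type*} [AddCommGroup W] [Module k W]

/-- The `k`-linear map on `kM ⊗ X` that maps `g ⊗ x` to `Ψ g x`. -/
def tensorLiftK (Ψ : M → X →ₗ[k] W) : (MonoidAlgebra k M ⊗[k] X) →ₗ[k] W :=
  TensorProduct.lift ((MonoidAlgebra.basis M k).constr k Ψ)

theorem tensorLiftK_of (Ψ : M → X →ₗ[k] W) (g : M) (x : X) :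
    tensorLiftK Ψ (MonoidAlgebra.of k M g ⊗ₜ[k] x) = Ψ g x := by
  have h := (MonoidAlgebra.basis M k).constr_basis k Ψ g
  rw [MonoidAlgebra.basis_apply] at h
  rw [tensorLiftK, TensorProduct.lift.tmul, MonoidAlgebra.of_apply, h]

/-- The `k`-linear map on the induced module that maps `g ⊗ x` to `Ψ g x`. -/
def indLiftK (Ψ : M → X →ₗ[k] W)
    (h : ∀ g, ∀ y ∈ U, ∀ l x, Ψ (g * (y * j l)) x = Ψ g (MonoidAlgebra.of k L l • x)) :
    HCInd k j U X →ₗ[k] W :=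
  (((indRelations k j U X).restrictScalars k).liftQ (tensorLiftK Ψ) (by
    -- The relations span a `kM`-submodule but the map is only `k`-linear, so vanishing is proved
    -- for all multiples `a • z` at once.
    have key : ∀ z ∈ indRelations k j U X, ∀ a : MonoidAlgebra k M,
        tensorLiftK Ψ (a • z) = 0 := by
      intro z hz
      induction hz using Submodule.span_induction with
      | zero => intro a; rw [smul_zero, map_zero]
      | add y z _ _ hy hz => intro a; rw [smul_add, map_add, hy, hz, add_zero]
      | smul b z _ hz => intro a; rw [smul_smul]; exact hz _
      | mem z hz =>
        obtain ⟨y, hy, l, x, rfl⟩ := hz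
        intro a
        induction a using MonoidAlgebra.induction_on with
        | add a b ha hb => rw [add_smul, map_add, ha, hb, add_zero]
        | smul c a ha => rw [smul_assoc, map_smul, ha, smul_zero]
        | of g =>
          rw [smul_sub, TensorProduct.smul_tmul', TensorProduct.smul_tmul', smul_eq_mul,
            smul_eq_mul, mul_one, ← map_mul, map_sub, tensorLiftK_of, tensorLiftK_of,
            h g y hy l x, sub_self]
    intro z hz
    have := key z hz 1
    rwa [one_smul] at this)) ∘ₗ
    (Submodule.Quotient.restrictScalarsEquiv k (indRelations k j U X)).symm.toLinearMap

@[simp] theorem indLiftK_mk (Ψ : M → X →ₗ[k] W)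
    (h : ∀ g, ∀ y ∈ U, ∀ l x, Ψ (g * (y * j l)) x = Ψ g (MonoidAlgebra.of k L l • x))
    (g : M) (x : X) : indLiftK Ψ h (indMk k j U g x) = Ψ g x :=
  tensorLiftK_of Ψ g x

variable [Module (MonoidAlgebra k M) W] [IsScalarTower k (MonoidAlgebra k M) W]

theorem lsmul_comp_mul_mul (b : X →ₗ[k] W) (hU : ∀ y ∈ U, ∀ x, MonoidAlgebra.of k M y • b x = b x)
    (hL : ∀ l x, MonoidAlgebra.of k M (j l) • b x = b (MonoidAlgebra.of k L l • x)) (g : M) :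
    ∀ y ∈ U, ∀ (l : L) (x : X),
      (Algebra.lsmul k k W (MonoidAlgebra.of k M (g * (y * j l))) ∘ₗ b) x =
        (Algebra.lsmul k k W (MonoidAlgebra.of k M g) ∘ₗ b) (MonoidAlgebra.of k L l • x) := by
  intro y hy l x
  simp only [LinearMap.comp_apply, Algebra.lsmul_coe]
  rw [map_mul, map_mul, mul_smul, mul_smul, hL, hU y hy]

/-- The universal property of the induced module. -/
def indLift (b : X →ₗ[k] W) (hU : ∀ y ∈ U, ∀ x, MonoidAlgebra.of k M y • b x = b x)
    (hL : ∀ l x, MonoidAlgebra.of k M (j l) • b x = b (MonoidAlgebra.of k L l • x)) :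
    HCInd k j U X →ₗ[MonoidAlgebra k M] W :=
  MonoidAlgebra.equivariantOfLinearOfComm
    (indLiftK (fun g => Algebra.lsmul k k W (MonoidAlgebra.of k M g) ∘ₗ b)
      (lsmul_comp_mul_mul b hU hL))
    (by
      intro g y
      show _ = MonoidAlgebra.of k M g • _
      change indLiftK _ (lsmul_comp_mul_mul b hU hL) (MonoidAlgebra.of k M g • y) = _
      induction y using ind_induction with
      | add y z hy hz => rw [smul_add, map_add, map_add, hy, hz, smul_add]
      | mk h x =>
        rw [smul_indMk, indLiftK_mk, indLiftK_mk]
        simp only [LinearMap.comp_apply, Algebra.lsmul_coe]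
        rw [map_mul, mul_smul])

@[simp] theorem indLift_mk (b : X →ₗ[k] W) (hU : ∀ y ∈ U, ∀ x, MonoidAlgebra.of k M y • b x = b x)
    (hL : ∀ l x, MonoidAlgebra.of k M (j l) • b x = b (MonoidAlgebra.of k L l • x)) (g : M) (x : X) :
    indLift b hU hL (indMk k j U g x) = MonoidAlgebra.of k M g • b x :=
  indLiftK_mk _ (lsmul_comp_mul_mul b hU hL) g x

end Lift

/-! ### Coefficients -/

variable [Finite M]

variable (j U) in
/-- `U` is normalized by the image of `L` and meets it trivially. -/
structure IsSemidirect : Prop where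
  conj : ∀ l, ∀ x ∈ U, j l * x * (j l)⁻¹ ∈ U
  disjoint : ∀ l, j l ∈ U → l = 1

theorem IsSemidirect.eq (h : IsSemidirect j U) {y y' : M} (hy : y ∈ U) (hy' : y' ∈ U) {l l' : L}
    (he : y * j l = y' * j l') : l = l' := by
  have h1 : j (l * l'⁻¹) ∈ U := by
    have h2 : j (l * l'⁻¹) = y⁻¹ * y' := by
      rw [map_mul, map_inv, mul_inv_eq_iff_eq_mul, mul_assoc, ← he]; group
    rw [h2]; exact mul_mem (inv_mem hy) hy'
  exact mul_inv_eq_one.1 (h.disjoint _ h1)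

theorem IsSemidirect.exists_mul (h : IsSemidirect j U) {g : M} (hg : g ∈ U ⊔ j.range) :
    ∃ y ∈ U, ∃ l, g = y * j l := by
  obtain ⟨y, hy, _, ⟨l, rfl⟩, he⟩ := BNData.exists_mul_of_mem_sup (BNData.le_normalizer_iff.2
    (by rintro _ ⟨l, rfl⟩ x hx; exact h.conj l x hx)) hg
  exact ⟨y, hy, l, he⟩

theorem mul_map_mem_sup {y : M} (hy : y ∈ U) (l : L) : y * j l ∈ U ⊔ j.range :=
  Subgroup.mul_mem_sup hy ⟨l, rfl⟩

open Classical in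
/-- The coefficient of `1` in the induced module, viewed as a direct sum over cosets. -/
def coef (h : IsSemidirect j U) : HCInd k j U X →ₗ[k] X :=
  indLiftK (fun g => if hg : g ∈ U ⊔ j.range then
      Algebra.lsmul k k X (MonoidAlgebra.of k L (h.exists_mul hg).choose_spec.2.choose) else 0) (by
    intro g y hy l x
    by_cases hg : g ∈ U ⊔ j.range
    · have hg' : g * (y * j l) ∈ U ⊔ j.range := mul_mem hg (mul_map_mem_sup hy l)
      rw [dif_pos hg, dif_pos hg']
      obtain ⟨hy1, h1⟩ := And.intro (h.exists_mul hg).choose_spec.1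
        (h.exists_mul hg).choose_spec.2.choose_spec
      obtain ⟨hy2, h2⟩ := And.intro (h.exists_mul hg').choose_spec.1
        (h.exists_mul hg').choose_spec.2.choose_spec
      generalize (h.exists_mul hg).choose_spec.2.choose = l₁ at *
      generalize (h.exists_mul hg').choose_spec.2.choose = l₂ at *
      generalize (h.exists_mul hg).choose = y₁ at *
      generalize (h.exists_mul hg').choose = y₂ at *
      have h3 : l₂ = l₁ * l := by
        refine h.eq hy2 (mul_mem hy1 (h.conj l₁ y hy)) ?_
        rw [← h2, h1, map_mul]; group
      simp only [Algebra.lsmul_coe]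
      rw [h3, map_mul, mul_smul]
    · have hg' : g * (y * j l) ∉ U ⊔ j.range := fun h' =>
        hg ((Subgroup.mul_mem_cancel_right _ (mul_map_mem_sup hy l)).1 h')
      rw [dif_neg hg, dif_neg hg']
      rfl)

theorem coef_mk_mul (h : IsSemidirect j U) {y : M} (hy : y ∈ U) (l : L) (x : X) :
    coef h (indMk k j U (y * j l) x) = MonoidAlgebra.of k L l • x := by
  have hg := mul_map_mem_sup (j := j) hy l
  rw [coef, indLiftK_mk, dif_pos hg]
  have h1 := h.eq (h.exists_mul hg).choose_spec.1 hy
    (h.exists_mul hg).choose_spec.2.choose_spec.symm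
  rw [h1]
  rfl

theorem coef_mk_of_notMem (h : IsSemidirect j U) {g : M} (hg : g ∉ U ⊔ j.range) (x : X) :
    coef h (indMk k j U g x) = 0 := by
  rw [coef, indLiftK_mk, dif_neg hg]
  rfl

theorem coef_smul (h : IsSemidirect j U) {y : M} (hy : y ∈ U) (l : L) (z : HCInd k j U X) :
    coef h (MonoidAlgebra.of k M (y * j l) • z) = MonoidAlgebra.of k L l • coef h z := by
  induction z using ind_induction with
  | add a b ha hb => rw [smul_add, map_add, map_add, ha, hb, smul_add]
  | mk g x =>
    rw [smul_indMk]
    by_cases hg : g ∈ U ⊔ j.range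
    · obtain ⟨y', hy', l', rfl⟩ := h.exists_mul hg
      have h1 : y * j l * (y' * j l') = y * (j l * y' * (j l)⁻¹) * j (l * l') := by
        rw [map_mul]; group
      rw [h1, coef_mk_mul h (mul_mem hy (h.conj l y' hy')), coef_mk_mul h hy', map_mul, mul_smul]
    · rw [coef_mk_of_notMem h hg, coef_mk_of_notMem h, smul_zero]
      exact fun h' => hg ((Subgroup.mul_mem_cancel_left _ (mul_map_mem_sup hy l)).1 h')

theorem indMk_coef (h : IsSemidirect j U) {g a : M} (hg : a⁻¹ * g ∈ U ⊔ j.range) (x : X) :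
    indMk k j U a (coef h (MonoidAlgebra.of k M a⁻¹ • indMk k j U g x)) = indMk k j U g x := by
  obtain ⟨y, hy, l, he⟩ := h.exists_mul hg
  rw [smul_indMk, he, coef_mk_mul h hy, ← indMk_mul_mul a hy l, ← he, mul_inv_cancel_left]

theorem eq_sum_coef [Fintype (M ⧸ (U ⊔ j.range))] (h : IsSemidirect j U) (z : HCInd k j U X) :
    z = ∑ c : M ⧸ (U ⊔ j.range),
      indMk k j U c.out (coef h (MonoidAlgebra.of k M c.out⁻¹ • z)) := by
  induction z using ind_induction with
  | add a b ha hb =>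
    conv_lhs => rw [ha, hb]
    rw [← Finset.sum_add_distrib]
    exact Finset.sum_congr rfl fun c _ => by rw [smul_add, map_add, map_add]
  | mk g x =>
    rw [Finset.sum_eq_single (g : M ⧸ (U ⊔ j.range))]
    · rw [indMk_coef]
      exact QuotientGroup.eq.1 (QuotientGroup.out_eq' _)
    · intro c _ hc
      rw [smul_indMk, coef_mk_of_notMem, map_zero]
      intro h'
      apply hc
      rw [← QuotientGroup.out_eq' c]
      exact QuotientGroup.eq.2 h'
    · intro h'
      exact absurd (Finset.mem_univ _) h'

theorem eq_zero_of_coef (h : IsSemidirect j U) {z : HCInd k j U X}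
    (hz : ∀ g, coef h (MonoidAlgebra.of k M g • z) = 0) : z = 0 := by
  have := Fintype.ofFinite (M ⧸ (U ⊔ j.range))
  rw [eq_sum_coef h z]
  exact Finset.sum_eq_zero fun c _ => by rw [hz, map_zero]

/-! ### The part of the induced module that is supported on a union of cosets -/

open Classical in
/-- The projection onto the part of the induced module that is supported on `C`. -/
def indProj (C : Set M) (hC : ∀ g, ∀ y ∈ U, ∀ l, g * (y * j l) ∈ C ↔ g ∈ C) :
    HCInd k j U X →ₗ[k] HCInd k j U X :=
  indLiftK (fun g => if g ∈ C then indMk k j U g else 0) (by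
    intro g y hy l x
    simp only [hC g y hy l]
    split_ifs
    · exact indMk_mul_mul g hy l x
    · rfl)

variable {C : Set M} (hC : ∀ g, ∀ y ∈ U, ∀ l, g * (y * j l) ∈ C ↔ g ∈ C)

theorem indProj_mk_of_mem {g : M} (hg : g ∈ C) (x : X) :
    indProj C hC (indMk k j U g x) = indMk k j U g x := by
  rw [indProj, indLiftK_mk, if_pos hg]

theorem indProj_mk_of_notMem {g : M} (hg : g ∉ C) (x : X) :
    indProj C hC (indMk k j U g x) = 0 := by
  rw [indProj, indLiftK_mk, if_neg hg]
  rfl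

theorem indProj_smul {q : M} (hq : ∀ g, q * g ∈ C ↔ g ∈ C) (z : HCInd k j U X) :
    indProj C hC (MonoidAlgebra.of k M q • z) = MonoidAlgebra.of k M q • indProj C hC z := by
  induction z using ind_induction with
  | add a b ha hb => rw [smul_add, map_add, map_add, ha, hb, smul_add]
  | mk g x =>
    rw [smul_indMk]
    by_cases hg : g ∈ C
    · rw [indProj_mk_of_mem hC hg, indProj_mk_of_mem hC ((hq g).2 hg), smul_indMk]
    · rw [indProj_mk_of_notMem hC hg, indProj_mk_of_notMem hC (fun h => hg ((hq g).1 h)),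
        smul_zero]

theorem indProj_eq_zero (h : IsSemidirect j U) {z : HCInd k j U X}
    (hz : ∀ g ∈ C, coef h (MonoidAlgebra.of k M g⁻¹ • z) = 0) : indProj C hC z = 0 := by
  have := Fintype.ofFinite (M ⧸ (U ⊔ j.range))
  rw [eq_sum_coef h z, map_sum]
  refine Finset.sum_eq_zero fun c _ => ?_
  by_cases hc : c.out ∈ C
  · rw [hz _ hc, map_zero, map_zero]
  · rw [indProj_mk_of_notMem hC hc]

end Induction

/-! ### The adjunction of induction and restriction -/

section Adjunction

variable {k : Type u} [Field k] {L M : Type v} [Group L] [Group M] {j : L →* M} {U : Subgroup M}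

theorem of_smul_resAlong {V : Type w} [AddCommGroup V] [Module k V] [Module (MonoidAlgebra k M) V]
    [IsScalarTower k (MonoidAlgebra k M) V] (l : L) (x : V) :
    MonoidAlgebra.of k L l • (show ResAlong j V from x) =
      (show ResAlong j V from (MonoidAlgebra.of k M (j l) • x : V)) := by
  have h : MonoidAlgebra.mapDomainRingHom k j (MonoidAlgebra.of k L l) =
      MonoidAlgebra.of k M (j l) := by simp
  have h2 : MonoidAlgebra.mapDomainRingHom k j (MonoidAlgebra.of k L l) • x =
      MonoidAlgebra.of k M (j l) • x := by rw [h]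
  exact h2

variable {X : Type w} [AddCommGroup X] [Module k X] [Module (MonoidAlgebra k L) X]
  [IsScalarTower k (MonoidAlgebra k L) X]
  {V : Type*} [AddCommGroup V] [Module k V] [Module (MonoidAlgebra k M) V]
  [IsScalarTower k (MonoidAlgebra k M) V] {hU : ∀ (l : L), ∀ x ∈ U, j l * x * (j l)⁻¹ ∈ U}

/-- The underlying vector of an element of the Harish-Chandra restriction. -/
def resVal : HCRes k j U V hU →ₗ[k] V where
  toFun v := v.1
  map_add' _ _ := rfl
  map_smul' _ _ := rfl

theorem resVal_injective : Function.Injective (resVal : HCRes k j U V hU →ₗ[k] V) :=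
  fun _ _ h => Subtype.ext h

theorem resVal_fixed (v : HCRes k j U V hU) {y : M} (hy : y ∈ U) :
    MonoidAlgebra.of k M y • resVal v = resVal v := v.2 y hy

theorem resVal_smul (l : L) (v : HCRes k j U V hU) :
    resVal (MonoidAlgebra.of k L l • v) = MonoidAlgebra.of k M (j l) • resVal v :=
  of_smul_resAlong (k := k) (j := j) (V := V) l v.1

/-- The element of the Harish-Chandra restriction given by a vector fixed by `U`. -/
def resMk (v : V) (hv : ∀ y ∈ U, MonoidAlgebra.of k M y • v = v) : HCRes k j U V hU := ⟨v, hv⟩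

@[simp] theorem resVal_resMk (v : V) (hv : ∀ y ∈ U, MonoidAlgebra.of k M y • v = v) :
    resVal (resMk v hv : HCRes k j U V hU) = v := rfl

/-- A `k`-linear map that commutes with the group elements is linear over the group algebra. -/
def toEquivariant {Z W : Type*} [AddCommGroup Z] [Module k Z] [Module (MonoidAlgebra k L) Z]
    [IsScalarTower k (MonoidAlgebra k L) Z] [AddCommGroup W] [Module k W]
    [Module (MonoidAlgebra k L) W] [IsScalarTower k (MonoidAlgebra k L) W] (f : Z →ₗ[k] W)
    (h : ∀ l z, f (MonoidAlgebra.of k L l • z) = MonoidAlgebra.of k L l • f z) :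
    Z →ₗ[MonoidAlgebra k L] W :=
  MonoidAlgebra.equivariantOfLinearOfComm f h

/-- From maps to the restriction to maps from the induced module. -/
def adjInd (t : X →ₗ[MonoidAlgebra k L] HCRes k j U V hU) :
    HCInd k j U X →ₗ[MonoidAlgebra k M] V :=
  indLift (resVal ∘ₗ t.restrictScalars k) (fun y hy x => resVal_fixed (t x) hy) (fun l x => by
    simp only [LinearMap.comp_apply, LinearMap.restrictScalars_apply]
    rw [map_smul, resVal_smul])

theorem adjInd_mk (t : X →ₗ[MonoidAlgebra k L] HCRes k j U V hU) (g : M) (x : X) :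
    adjInd t (indMk k j U g x) = MonoidAlgebra.of k M g • resVal (t x) := indLift_mk _ _ _ g x

/-- From maps from the induced module to maps to the restriction. -/
def adjRes (f : HCInd k j U X →ₗ[MonoidAlgebra k M] V) :
    X →ₗ[MonoidAlgebra k L] HCRes k j U V hU :=
  toEquivariant
    { toFun := fun x => resMk (f (indMk k j U 1 x)) (fun y hy => by
        have h := indMk_mul_right (k := k) (j := j) 1 hy x
        rw [← map_smul, smul_indMk, mul_one, ← one_mul y, h])
      map_add' := fun x y => resVal_injective (by simp)
      map_smul' := fun c x => resVal_injective (by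
        rw [RingHom.id_apply, map_smul resVal, resVal_resMk, resVal_resMk, map_smul (indMk k j U 1),
          LinearMap.map_smul_of_tower]) }
    (fun l x => resVal_injective (by
      rw [resVal_smul]
      simp only [LinearMap.coe_mk, AddHom.coe_mk, resVal_resMk]
      rw [← indMk_mul_map, ← map_smul, smul_indMk, one_mul, mul_one]))

end Adjunction

end HarishChandra

namespace HarishChandra

/-! ### Maps between Hom-modules over a self-injective endomorphism ring -/

section SelfInjective

variable {A : Type*} [Ring A] {Z S W : Type*} [AddCommGroup Z] [Module A Z] [AddCommGroup S]
  [Module A S] [AddCommGroup W] [Module A W]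

/-- An element of `HomF` as a linear map. -/
def HomF.toLin (f : HomF A Z S) : Z →ₗ[A] S := f

/-- A linear map as an element of `HomF`. -/
def HomF.ofLin (f : Z →ₗ[A] S) : HomF A Z S := f

theorem HomF.toLin_add (f g : HomF A Z S) : (f + g).toLin = f.toLin + g.toLin := rfl

/-- Composition with a linear map, on the covariant Hom-functor. -/
def HomF.comp (t : S →ₗ[A] W) : HomF A Z S →ₗ[(Module.End A Z)ᵐᵒᵖ] HomF A Z W where
  toFun f := HomF.ofLin (t ∘ₗ f.toLin)
  map_add' f g := LinearMap.comp_add _ _ t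
  map_smul' _ _ := rfl

/-- The coordinates of a homomorphism to a submodule of `Zⁿ`. -/
def HomF.coords {n : ℕ} (i : S →ₗ[A] (Fin n → Z)) :
    HomF A Z S →ₗ[(Module.End A Z)ᵐᵒᵖ] (Fin n → Module.End A Z) where
  toFun f c := LinearMap.proj c ∘ₗ i ∘ₗ f.toLin
  map_add' f g := by
    funext c
    ext z
    simp [HomF.toLin_add]
  map_smul' _ _ := rfl

theorem HomF.coords_injective {n : ℕ} {i : S →ₗ[A] (Fin n → Z)} (hi : Function.Injective i) :
    Function.Injective (HomF.coords (Z := Z) i) := by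
  intro f g h
  refine LinearMap.ext (f := f.toLin) (g := g.toLin) fun z => hi (funext fun c => ?_)
  exact LinearMap.congr_fun (congrFun h c) z

/-- If `S` is a submodule of `Zⁿ` and `End(Z)` is self-injective, then every homomorphism from
`Hom(Z, S)` to `End(Z)` is induced by a homomorphism from `S` to `Z`. -/
theorem exists_hom_of_selfInjective (hinj : IsSelfInjective (Module.End A Z)) {n : ℕ}
    {i : S →ₗ[A] (Fin n → Z)} (hi : Function.Injective i)
    (α : HomF A Z S →ₗ[(Module.End A Z)ᵐᵒᵖ] HomF A Z Z) :
    ∃ h : S →ₗ[A] Z, ∀ f z, (α f).toLin z = h (f.toLin z) := by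
  classical
  let e := LinearEquiv.ofInjective _ (HomF.coords_injective (Z := Z) hi)
  let α' : HomF A Z S →ₗ[(Module.End A Z)ᵐᵒᵖ] Module.End A Z :=
    { toFun := fun f => (α f).toLin
      map_add' := fun f g => α.map_add f g
      map_smul' := fun r f => α.map_smul r f }
  -- Self-injectivity extends the map from the image of `Hom(Z, S)` to all of `End(Z)^n`. There it
  -- is given by the images of the unit vectors, which define the map `S → Z`.
  obtain ⟨β, hβ⟩ := hinj.out (LinearMap.range (HomF.coords (Z := Z) i)).subtype
    Subtype.val_injective (α' ∘ₗ e.symm.toLinearMap)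
  refine ⟨∑ c, (β (Pi.single c 1)) ∘ₗ LinearMap.proj c ∘ₗ i, fun f z => ?_⟩
  have h1 : (α f).toLin = β (HomF.coords i f) := by
    have h2 := hβ (e f)
    rw [LinearMap.comp_apply, LinearEquiv.coe_coe, LinearEquiv.symm_apply_apply] at h2
    exact h2.symm
  have h3 : HomF.coords i f = ∑ c, MulOpposite.op (HomF.coords i f c) •
      (Pi.single c 1 : Fin n → Module.End A Z) := by
    conv_lhs => rw [← Finset.univ_sum_single (HomF.coords i f)]
    refine Finset.sum_congr rfl fun c _ => ?_
    rw [← Pi.single_smul]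
    congr 1
  rw [h1, h3, map_sum, LinearMap.sum_apply, LinearMap.sum_apply]
  refine Finset.sum_congr rfl fun c _ => ?_
  rw [map_smul]
  rfl

/-- Let `S` be a quotient and a submodule of sums of copies of `Z`, with `End(Z)` self-injective.
If the vanishing in `W` can be tested by subgroups that contain either the images of all
homomorphisms from `Z` or the kernel of a homomorphism to `Z`, then every homomorphism from
`Hom(Z, S)` to `Hom(Z, W)` is induced by a homomorphism from `S` to `W`. -/
theorem exists_hom_of_tests (hinj : IsSelfInjective (Module.End A Z)) (hS : InModCat A Z S)
    {ι : Type*} (K : ι → AddSubgroup W) (hK : ∀ w, (∀ t, w ∈ K t) → w = 0)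
    (htest : ∀ t, (∀ (g : Z →ₗ[A] W) z, g z ∈ K t) ∨ ∃ η : W →ₗ[A] Z, ∀ w, η w = 0 → w ∈ K t)
    (α : HomF A Z S →ₗ[(Module.End A Z)ᵐᵒᵖ] HomF A Z W) :
    ∃ s : S →ₗ[A] W, ∀ f z, (α f).toLin z = s (f.toLin z) := by
  classical
  obtain ⟨n, ⟨π, hπ⟩, i, hi⟩ := hS
  -- The value `α f z` depends only on a lift `y` of `f z`. Tests of the first kind contain all
  -- values involved. For the second kind, composing with `η` gives a map to `Hom(Z, Z)`, which is
  -- induced by a map `S → Z` and therefore respects the relation.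
  have hrel : ∀ (f : HomF A Z S) (z : Z) (y : Fin n → Z), f.toLin z = π y →
      (α f).toLin z = ∑ c, (α (HomF.ofLin (π ∘ₗ LinearMap.single A (fun _ => Z) c))).toLin (y c) := by
    intro f z y h
    rw [← sub_eq_zero]
    refine hK _ fun t => ?_
    rcases htest t with h1 | ⟨η, hη⟩
    · exact sub_mem (h1 _ z) (sum_mem fun c _ => h1 _ _)
    · obtain ⟨q, hq⟩ := exists_hom_of_selfInjective hinj hi ((HomF.comp η) ∘ₗ α)
      have hq' : ∀ f z, η ((α f).toLin z) = q (f.toLin z) := hq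
      apply hη
      have h2 : π y = ∑ c, π (Pi.single c (y c)) := by
        rw [← map_sum, Finset.univ_sum_single]
      rw [map_sub, map_sum, hq', h, h2, map_sum, sub_eq_zero]
      exact Finset.sum_congr rfl fun c _ => by rw [hq']; rfl
  let s₀ : (Fin n → Z) →ₗ[A] W :=
    ∑ c, (α (HomF.ofLin (π ∘ₗ LinearMap.single A (fun _ => Z) c))).toLin ∘ₗ LinearMap.proj c
  have hs₀ : ∀ y, s₀ y = ∑ c, (α (HomF.ofLin (π ∘ₗ LinearMap.single A (fun _ => Z) c))).toLin (y c) := by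
    intro y; simp [s₀]
  have hker : LinearMap.ker π ≤ LinearMap.ker s₀ := by
    intro y hy
    rw [LinearMap.mem_ker] at hy ⊢
    rw [hs₀, ← hrel (HomF.ofLin 0) 0 y (by rw [hy]; exact map_zero _)]
    exact map_zero _
  refine ⟨(LinearMap.ker π).liftQ s₀ hker ∘ₗ
    (π.quotKerEquivOfSurjective hπ).symm.toLinearMap, fun f z => ?_⟩
  obtain ⟨y, hy⟩ := hπ (f.toLin z)
  rw [hrel f z y hy.symm, ← hs₀, ← hy]
  have h3 : (π.quotKerEquivOfSurjective hπ).symm (π y) = Submodule.Quotient.mk y := by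
    rw [LinearEquiv.symm_apply_eq]
    rfl
  rw [LinearMap.comp_apply, LinearEquiv.coe_coe, h3]
  rfl

end SelfInjective

end HarishChandra

namespace HarishChandra

/-! ### Averages in modules over group algebras -/

section GroupAverage

variable {G : Type v} [Group G] {k : Type u} [Field k] {W : Type w} [AddCommGroup W] [Module k W]

variable (k W) in
/-- The action of the group elements on a module over the group algebra. -/
def rep [Module (MonoidAlgebra k G) W] [IsScalarTower k (MonoidAlgebra k G) W] (g : G) :
    Module.End k W := Algebra.lsmul k k W (MonoidAlgebra.of k G g)

theorem rep_apply [Module (MonoidAlgebra k G) W] [IsScalarTower k (MonoidAlgebra k G) W] (g : G)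
    (w : W) : rep k W g w = MonoidAlgebra.of k G g • w := rfl

theorem isRepOn_rep [Module (MonoidAlgebra k G) W] [IsScalarTower k (MonoidAlgebra k G) W]
    (H : Subgroup G) : IsRepOn (rep k W) H :=
  ⟨fun w => by rw [rep_apply, map_one, one_smul],
    fun x _ y _ w => by rw [rep_apply, rep_apply, rep_apply, map_mul, mul_smul]⟩

variable [Finite G]

theorem avg_add {ρ : G → Module.End k W} {A : Subgroup G} (w w' : W) :
    avg ρ A (w + w') = avg ρ A w + avg ρ A w' := by
  simp only [avg, map_add, Finset.sum_add_distrib, smul_add]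

/-- The average as a linear map. -/
def avgLin (ρ : G → Module.End k W) (A : Subgroup G) : W →ₗ[k] W where
  toFun := avg ρ A
  map_add' := avg_add
  map_smul' := avg_smul

theorem IsRepOn.apply_avg_of_conj {ρ : G → Module.End k W} {H A : Subgroup G} (hρ : IsRepOn ρ H)
    (hA : A ≤ H) {g : G} (hg : g ∈ H) (hconj : ∀ x ∈ A, g * x * g⁻¹ ∈ A) (w : W) :
    ρ g (avg ρ A w) = avg ρ A (ρ g w) := by
  have h : conjSub g A = A := BNData.conjSub_eq_of_le (by
    rintro _ ⟨x, hx, rfl⟩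
    exact hconj x hx)
  rw [hρ.apply_avg_conj hA hg, h]

/-- The average over a product of two subgroups. -/
theorem IsRepOn.avg_avg_of_mul {ρ : G → Module.End k W} {H A B C : Subgroup G} (hρ : IsRepOn ρ H)
    (hA : A ≤ H) (hB : B ≤ A) (hC : C ≤ A) (hBk : (Nat.card B : k) ≠ 0)
    (hCk : (Nat.card C : k) ≠ 0) (hAk : (Nat.card A : k) ≠ 0)
    (hmul : ∀ a ∈ A, ∃ b ∈ B, ∃ c ∈ C, a = b * c) (hconj : ∀ c ∈ C, ∀ b ∈ B, c * b * c⁻¹ ∈ B)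
    (w : W) : avg ρ C (avg ρ B w) = avg ρ A w := by
  have h1 : ∀ a ∈ A, ρ a (avg ρ C (avg ρ B w)) = avg ρ C (avg ρ B w) := by
    intro a ha
    obtain ⟨b, hb, c, hc, rfl⟩ := hmul a ha
    rw [hρ.mul b (hA (hB hb)) c (hA (hC hc)), hρ.apply_avg (hC.trans hA) hc, avg, map_smul, map_sum]
    congr 1
    refine Finset.sum_congr rfl fun c' hc' => ?_
    have hc' := mem_elems.1 hc'
    have h2 := hconj c'⁻¹ (inv_mem hc') b hb
    rw [inv_inv] at h2
    have h3 : b * c' = c' * (c'⁻¹ * b * c') := by group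
    rw [← hρ.mul b (hA (hB hb)) c' (hA (hC hc')), h3, hρ.mul c' (hA (hC hc')) _ (hA (hB h2)),
      hρ.apply_avg (hB.trans hA) h2]
  rw [← avg_eq_self hAk h1, hρ.avg_avg_of_le hA hC hCk, hρ.avg_avg_of_le hA hB hBk]

end GroupAverage

section Generation

variable {k : Type u} [Field k] {L M : Type v} [Group L] [Group M] {j : L →* M} {U : Subgroup M}
  {X : Type w} [AddCommGroup X] [Module k X] [Module (MonoidAlgebra k L) X]
  [IsScalarTower k (MonoidAlgebra k L) X]

theorem ind_submodule_eq_top {Λ : Submodule (MonoidAlgebra k M) (HCInd k j U X)}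
    (h : ∀ x, indMk k j U 1 x ∈ Λ) : Λ = ⊤ := by
  refine eq_top_iff.2 fun y _ => ?_
  induction y using ind_induction with
  | add y z hy hz => exact Λ.add_mem (hy trivial) (hz trivial)
  | mk g x =>
    have := Λ.smul_mem (MonoidAlgebra.of k M g) (h x)
    rwa [smul_indMk, mul_one] at this

theorem finite_ind [Finite M] [Module.Finite k X] : Module.Finite k (HCInd k j U X) := by
  have h1 : Module.Finite k (MonoidAlgebra k M) := Module.Finite.of_basis (MonoidAlgebra.basis M k)
  have h2 : Module.Finite k (MonoidAlgebra k M ⊗[k] X) := inferInstance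
  have h3 : Module.Finite k
    ((MonoidAlgebra k M ⊗[k] X) ⧸ (indRelations k j U X).restrictScalars k) := inferInstance
  exact Module.Finite.equiv (Submodule.Quotient.restrictScalarsEquiv k (indRelations k j U X))

theorem finite_of_isSimpleModule [Finite L] (h : IsSimpleModule (MonoidAlgebra k L) X) :
    Module.Finite k X := by
  have h1 : Module.Finite k (MonoidAlgebra k L) := Module.Finite.of_basis (MonoidAlgebra.basis L k)
  have := IsSimpleModule.nontrivial (MonoidAlgebra k L) X
  obtain ⟨x, hx⟩ := exists_ne (0 : X)
  exact Module.Finite.of_surjective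
    ((LinearMap.toSpanSingleton (MonoidAlgebra k L) X x).restrictScalars k)
    (IsSimpleModule.toSpanSingleton_surjective _ hx)

/-- The composite is a surjective endomorphism of a finite-dimensional module, hence injective. -/
theorem nonempty_equiv_of_surjective {A : Type*} [Ring A] [Algebra k A] {Y Y' : Type*}
    [AddCommGroup Y] [Module A Y] [Module k Y] [IsScalarTower k A Y] [AddCommGroup Y'] [Module A Y']
    [Module.Finite k Y] {f : Y →ₗ[A] Y'} {g : Y' →ₗ[A] Y} (hf : Function.Surjective f)
    (hg : Function.Surjective g) : Nonempty (Y' ≃ₗ[A] Y) := by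
  have h1 : IsNoetherian A Y := isNoetherian_of_tower k inferInstance
  have h2 := IsNoetherian.injective_of_surjective_endomorphism (g ∘ₗ f) (hg.comp hf)
  exact ⟨(LinearEquiv.ofBijective f ⟨Function.Injective.of_comp h2, hf⟩).symm⟩

end Generation

namespace BNData

/-! ### Independence modulo a stable subspace -/

section IndependenceModulo

variable {G : Type v} [Group G] {D : BNData G} {p : ℕ} [Finite G]
variable {k : Type u} [Field k] {W : Type w} [AddCommGroup W] [Module k W]

/-- This is `indep` for the quotient `W / Λ`. It serves to show that the image of a homomorphism
contains a vector as soon as it contains an average of it. -/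
theorem IsSplitBNPair.mem_of_indep (hp : p.Prime) (hD : D.IsSplitBNPair p)
    (hcomm : D.CommutatorRelations) (hpk : (p : k) ≠ 0) {e : G} {I : Set G} (he : e ∈ D.N)
    (hI : I ⊆ D.S) {ρ : G → Module.End k W} (hρ : IsRepOn ρ (D.levi (D.face e I)))
    {Λ : Submodule k W} (hΛ : ∀ g ∈ D.levi (D.face e I), ∀ w ∈ Λ, ρ g w ∈ Λ)
    {f₁ f₂ : G} {J₁ J₂ : Set G} (hf₁ : f₁ ∈ D.face e I) (hJ₁ : J₁ ⊆ I) (hf₂ : f₂ ∈ D.face e I)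
    (hJ₂ : J₂ ⊆ I) (hpar : D.Parallel (D.face f₁ J₁) (D.face f₂ J₂)) {w : W}
    (hw : ∀ x ∈ D.unip (D.face f₁ J₁) (D.face e I), ρ x w = w)
    (hw' : avg ρ (D.unip (D.face f₂ J₂) (D.face e I)) w ∈ Λ) : w ∈ Λ := by
  classical
  -- Outside the Levi subgroup `Λ` need not be stable; the value there is irrelevant and set to
  -- zero.
  let ρ' : G → Module.End k (W ⧸ Λ) := fun g =>
    if h : g ∈ D.levi (D.face e I) then Λ.mapQ Λ (ρ g) (hΛ g h) else 0
  have hρ'mk : ∀ g ∈ D.levi (D.face e I), ∀ w, ρ' g (Λ.mkQ w) = Λ.mkQ (ρ g w) := by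
    intro g hg w
    simp only [ρ', dif_pos hg]
    rfl
  have hρ' : IsRepOn ρ' (D.levi (D.face e I)) := by
    constructor
    · intro w
      obtain ⟨w, rfl⟩ := Λ.mkQ_surjective w
      rw [hρ'mk 1 (one_mem _), hρ.one]
    · intro x hx y hy w
      obtain ⟨w, rfl⟩ := Λ.mkQ_surjective w
      rw [hρ'mk _ (mul_mem hx hy), hρ'mk y hy, hρ'mk x hx, hρ.mul x hx y hy]
  rw [← Submodule.Quotient.mk_eq_zero]
  refine hD.indep hp hcomm hpk he hI hρ' hf₁ hJ₁ hf₂ hJ₂ hpar (Λ.mkQ w) (fun x hx => ?_) ?_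
  · rw [hρ'mk x (unip_le _ _ hx), hw x hx]
  · have h1 : avg ρ' (D.unip (D.face f₂ J₂) (D.face e I)) (Λ.mkQ w) =
        Λ.mkQ (avg ρ (D.unip (D.face f₂ J₂) (D.face e I)) w) := by
      rw [avg, avg, map_smul, map_sum]
      congr 1
      exact Finset.sum_congr rfl fun a ha => hρ'mk a (unip_le _ _ (mem_elems.1 ha)) w
    rw [h1]
    exact (Submodule.Quotient.mk_eq_zero _).2 hw'

theorem IsSplitBNPair.mem_of_indep_top [Module (MonoidAlgebra k G) W]
    [IsScalarTower k (MonoidAlgebra k G) W] (hp : p.Prime) (hD : D.IsSplitBNPair p)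
    (hcomm : D.CommutatorRelations) (hpk : (p : k) ≠ 0)
    (Λ : Submodule (MonoidAlgebra k G) W)
    {f₁ f₂ : G} {J₁ J₂ : Set G} (hf₁ : f₁ ∈ D.N) (hJ₁ : J₁ ⊆ D.S) (hf₂ : f₂ ∈ D.N)
    (hJ₂ : J₂ ⊆ D.S) (hpar : D.Parallel (D.face f₁ J₁) (D.face f₂ J₂)) {w : W}
    (hw : ∀ x ∈ D.rootSubgroup (D.face f₁ J₁), MonoidAlgebra.of k G x • w = w)
    (hw' : avg (rep k W) (D.rootSubgroup (D.face f₂ J₂)) w ∈ Λ) : w ∈ Λ := by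
  have hN := face_singleton_S hD (D.N.one_mem)
  have hu : ∀ F, D.unip F (D.face 1 D.S) = D.rootSubgroup F := fun F => by
    rw [unip, hN, hD.levi_N hcomm, inf_top_eq]
  refine hD.mem_of_indep hp hcomm hpk D.N.one_mem le_rfl (isRepOn_rep _)
    (Λ := Λ.restrictScalars k) (fun g _ w hw => Λ.smul_mem _ hw) (by rw [hN]; exact hf₁) hJ₁
    (by rw [hN]; exact hf₂) hJ₂ hpar (by rw [hu]; exact hw) (by rw [hu]; exact hw')

end IndependenceModulo

end BNData

end HarishChandra

namespace HarishChandra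
namespace BNData

/-! ### A Levi subgroup in a Levi subgroup, with the unipotent groups of a pair of faces -/

section LeviPair

variable {G : Type v} [Group G] {p : ℕ}

/-- `L ≤ M` are the Levi subgroups of the faces `F ⊆ E` of the chamber `f`, and `UE`, `UF` and `V`
are the unipotent groups of `E` and `F` in `G` and of `F` in `M`. -/
structure IsLeviPair (D : BNData G) (f : G) (I J : Set G) (L M UE UF V : Subgroup G) : Prop where
  mem_N : f ∈ D.N
  I_subset : I ⊆ D.S
  J_subset : J ⊆ I
  L_eq : L = D.levi (D.face f J)
  M_eq : M = D.levi (D.face f I)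
  UE_eq : UE = D.rootSubgroup (D.face f I)
  UF_eq : UF = D.rootSubgroup (D.face f J)
  V_eq : V = D.unip (D.face f J) (D.face f I)

variable [Finite G] {D : BNData G} {f : G} {I J : Set G} {L M UE UF V : Subgroup G}

theorem IsLeviPair.J_subset_S (h : D.IsLeviPair f I J L M UE UF V) : J ⊆ D.S :=
  h.J_subset.trans h.I_subset

theorem IsLeviPair.L_le_M (h : D.IsLeviPair f I J L M UE UF V) : L ≤ M := by
  rw [h.L_eq, h.M_eq]
  exact levi_mono fun a _ ha => ha.mono (face_mono h.J_subset)

theorem IsLeviPair.UE_le_UF (h : D.IsLeviPair f I J L M UE UF V) : UE ≤ UF := by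
  rw [h.UE_eq, h.UF_eq]
  exact rootSubgroup_anti (face_mono h.J_subset)

theorem IsLeviPair.V_le_UF (h : D.IsLeviPair f I J L M UE UF V) : V ≤ UF := by
  rw [h.V_eq, h.UF_eq]
  exact inf_le_left

theorem IsLeviPair.V_le_M (h : D.IsLeviPair f I J L M UE UF V) : V ≤ M := by
  rw [h.V_eq, h.M_eq]
  exact inf_le_right

theorem IsLeviPair.mem_V (h : D.IsLeviPair f I J L M UE UF V) {x : G} (hx : x ∈ UF)
    (hx' : x ∈ M) : x ∈ V := by
  rw [h.V_eq, unip, ← h.UF_eq, ← h.M_eq]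
  exact Subgroup.mem_inf.2 ⟨hx, hx'⟩

theorem IsLeviPair.exists_mul (h : D.IsLeviPair f I J L M UE UF V) (hD : D.IsSplitBNPair p)
    (hcomm : D.CommutatorRelations) : ∀ a ∈ UF, ∃ b ∈ UE, ∃ c ∈ V, a = b * c := by
  intro a ha
  rw [h.UF_eq] at ha
  obtain ⟨b, hb, c, hc, he⟩ := hD.exists_mul_face hcomm h.mem_N h.I_subset
    (hD.face_subset_N h.mem_N h.J_subset_S) (self_mem_face f J) ha
  refine ⟨b, ?_, c, ?_, he⟩
  · rw [h.UE_eq]; exact hb.2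
  · rw [h.V_eq]; exact hc

theorem IsLeviPair.conj_UF (h : D.IsLeviPair f I J L M UE UF V) (hD : D.IsSplitBNPair p)
    (hcomm : D.CommutatorRelations) : ∀ l ∈ L, ∀ x ∈ UF, l * x * l⁻¹ ∈ UF := by
  rw [h.L_eq, h.UF_eq]
  exact le_normalizer_iff.1 (hD.levi_le_normalizer hcomm h.mem_N h.J_subset_S)

theorem IsLeviPair.conj_UE (h : D.IsLeviPair f I J L M UE UF V) (hD : D.IsSplitBNPair p)
    (hcomm : D.CommutatorRelations) : ∀ m ∈ M, ∀ x ∈ UE, m * x * m⁻¹ ∈ UE := by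
  rw [h.M_eq, h.UE_eq]
  exact le_normalizer_iff.1 (hD.levi_le_normalizer hcomm h.mem_N h.I_subset)

theorem IsLeviPair.conj_V (h : D.IsLeviPair f I J L M UE UF V) (hD : D.IsSplitBNPair p)
    (hcomm : D.CommutatorRelations) : ∀ l ∈ L, ∀ x ∈ V, l * x * l⁻¹ ∈ V := fun l hl x hx =>
  h.mem_V (h.conj_UF hD hcomm l hl x (h.V_le_UF hx))
    (mul_mem (mul_mem (h.L_le_M hl) (h.V_le_M hx)) (inv_mem (h.L_le_M hl)))

theorem IsLeviPair.eq_one_UF (h : D.IsLeviPair f I J L M UE UF V) (hD : D.IsSplitBNPair p)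
    (hcomm : D.CommutatorRelations) {x : G} (hx : x ∈ L) (hx' : x ∈ UF) : x = 1 := by
  have h1 := hD.rootSubgroup_face_inf_levi hcomm h.mem_N h.J_subset_S
  rw [← h.UF_eq, ← h.L_eq] at h1
  exact Subgroup.mem_bot.1 (h1 ▸ Subgroup.mem_inf.2 ⟨hx', hx⟩)

theorem IsLeviPair.isPGroup_UF (h : D.IsLeviPair f I J L M UE UF V) (hD : D.IsSplitBNPair p) :
    IsPGroup p UF := by
  rw [h.UF_eq]
  exact hD.isPGroup_rootSubgroup (self_mem_face f J)

variable {k : Type u} [Field k]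

theorem IsLeviPair.card_UF (h : D.IsLeviPair f I J L M UE UF V) (hp : p.Prime)
    (hD : D.IsSplitBNPair p) (hpk : (p : k) ≠ 0) : (Nat.card UF : k) ≠ 0 :=
  natCast_card_ne_zero hp hpk (h.isPGroup_UF hD)

theorem IsLeviPair.card_UE (h : D.IsLeviPair f I J L M UE UF V) (hp : p.Prime)
    (hD : D.IsSplitBNPair p) (hpk : (p : k) ≠ 0) : (Nat.card UE : k) ≠ 0 :=
  natCast_card_ne_zero hp hpk ((h.isPGroup_UF hD).to_le h.UE_le_UF)

theorem IsLeviPair.card_V (h : D.IsLeviPair f I J L M UE UF V) (hp : p.Prime)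
    (hD : D.IsSplitBNPair p) (hpk : (p : k) ≠ 0) : (Nat.card V : k) ≠ 0 :=
  natCast_card_ne_zero hp hpk ((h.isPGroup_UF hD).to_le h.V_le_UF)

theorem IsLeviPair.isSemidirect_UF (h : D.IsLeviPair f I J L M UE UF V) (hD : D.IsSplitBNPair p)
    (hcomm : D.CommutatorRelations) : IsSemidirect L.subtype UF :=
  ⟨fun l x hx => h.conj_UF hD hcomm l l.2 x hx,
    fun l hl => Subtype.ext (h.eq_one_UF hD hcomm l.2 hl)⟩

theorem IsLeviPair.isSemidirect_V (h : D.IsLeviPair f I J L M UE UF V) (hD : D.IsSplitBNPair p)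
    (hcomm : D.CommutatorRelations) (hLM : L ≤ M) :
    IsSemidirect (Subgroup.inclusion hLM) (V.subgroupOf M) :=
  ⟨fun l x hx => h.conj_V hD hcomm l l.2 x hx,
    fun l hl => Subtype.ext (h.eq_one_UF hD hcomm l.2 (h.V_le_UF hl))⟩

variable {W : Type*} [AddCommGroup W] [Module k W] [Module (MonoidAlgebra k G) W]
  [IsScalarTower k (MonoidAlgebra k G) W]

theorem smul_avg {A : Subgroup G} {x : G} (hx : x ∈ A) (w : W) :
    MonoidAlgebra.of k G x • avg (rep k W) A w = avg (rep k W) A w :=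
  (isRepOn_rep ⊤).apply_avg le_top hx w

theorem avg_smul_of_mem {A : Subgroup G} {x : G} (hx : x ∈ A) (w : W) :
    avg (rep k W) A (MonoidAlgebra.of k G x • w) = avg (rep k W) A w :=
  (isRepOn_rep ⊤).avg_apply le_top hx w

theorem smul_avg_of_conj {A : Subgroup G} {g : G} (hconj : ∀ x ∈ A, g * x * g⁻¹ ∈ A) (w : W) :
    MonoidAlgebra.of k G g • avg (rep k W) A w =
      avg (rep k W) A (MonoidAlgebra.of k G g • w) :=
  (isRepOn_rep ⊤).apply_avg_of_conj le_top (Subgroup.mem_top g) hconj w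

variable {X : Type w} [AddCommGroup X] [Module k X] [Module (MonoidAlgebra k L) X]
  [IsScalarTower k (MonoidAlgebra k L) X]

variable (k UE V X) in
/-- The element `1 ⊗ (1 ⊗ x)` of an iterated induced module. -/
def indMkMk (hLM : L ≤ M) : X →ₗ[k]
    HCInd k M.subtype UE (HCInd k (Subgroup.inclusion hLM) (V.subgroupOf M) X) :=
  indMk k M.subtype UE 1 ∘ₗ indMk k (Subgroup.inclusion hLM) (V.subgroupOf M) 1

theorem indMkMk_apply (hLM : L ≤ M) (x : X) : indMkMk UE V k X hLM x =
    indMk k M.subtype UE 1 (indMk k (Subgroup.inclusion hLM) (V.subgroupOf M) 1 x) := rfl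

theorem of_smul_indMkMk (hLM : L ≤ M) {m : G} (hm : m ∈ M) (x : X) :
    MonoidAlgebra.of k G m • indMkMk UE V k X hLM x = indMk k M.subtype UE 1
      (indMk k (Subgroup.inclusion hLM) (V.subgroupOf M) ⟨m, hm⟩ x) := by
  have h1 := indMk_mul_map (k := k) (j := M.subtype) (U := UE) 1 ⟨m, hm⟩
    (indMk k (Subgroup.inclusion hLM) (V.subgroupOf M) 1 x)
  rw [smul_indMk, mul_one, one_mul] at h1
  rw [indMkMk_apply, smul_indMk, mul_one]
  exact h1

theorem of_smul_indMkMk_V (hLM : L ≤ M) (hV : V ≤ M) {y : G} (hy : y ∈ V) (x : X) :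
    MonoidAlgebra.of k G y • indMkMk UE V k X hLM x = indMkMk UE V k X hLM x := by
  rw [of_smul_indMkMk hLM (hV hy), indMkMk_apply, ← one_mul (⟨y, hV hy⟩ : M)]
  exact congrArg _ (indMk_mul_right (U := V.subgroupOf M) (y := ⟨y, hV hy⟩) _ hy x)

theorem of_smul_indMkMk_UE (hLM : L ≤ M) {y : G} (hy : y ∈ UE) (x : X) :
    MonoidAlgebra.of k G y • indMkMk UE V k X hLM x = indMkMk UE V k X hLM x := by
  rw [indMkMk_apply, smul_indMk, mul_one, ← one_mul y]
  exact indMk_mul_right _ hy _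

theorem of_smul_indMkMk_L (hLM : L ≤ M) (l : L) (x : X) :
    MonoidAlgebra.of k G (L.subtype l) • indMkMk UE V k X hLM x =
      indMkMk UE V k X hLM (MonoidAlgebra.of k L l • x) := by
  refine (of_smul_indMkMk hLM (hLM l.2) x).trans ?_
  rw [indMkMk_apply, ← one_mul (⟨(l : G), _⟩ : M)]
  exact congrArg _ (indMk_mul_map (j := Subgroup.inclusion hLM) _ l x)

theorem IsLeviPair.of_smul_indMkMk_UF (h : D.IsLeviPair f I J L M UE UF V)
    (hD : D.IsSplitBNPair p) (hcomm : D.CommutatorRelations) (hLM : L ≤ M) {y : G} (hy : y ∈ UF)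
    (x : X) : MonoidAlgebra.of k G y • indMkMk UE V k X hLM x = indMkMk UE V k X hLM x := by
  obtain ⟨b, hb, c, hc, rfl⟩ := h.exists_mul hD hcomm y hy
  rw [map_mul, mul_smul, of_smul_indMkMk_V hLM h.V_le_M hc, of_smul_indMkMk_UE hLM hb]

theorem ind_ind_submodule_eq_top (hLM : L ≤ M) {Λ : Submodule (MonoidAlgebra k G)
      (HCInd k M.subtype UE (HCInd k (Subgroup.inclusion hLM) (V.subgroupOf M) X))}
    (h : ∀ x, indMkMk UE V k X hLM x ∈ Λ) : Λ = ⊤ := by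
  refine ind_submodule_eq_top fun z => ?_
  induction z using ind_induction with
  | add y z hy hz => rw [map_add]; exact Submodule.add_mem _ hy hz
  | mk m x =>
    have h2 := Submodule.smul_mem _ (MonoidAlgebra.of k G (m : G)) (h x)
    rwa [of_smul_indMkMk hLM m.2] at h2

/-- A linear map to the fixed points. -/
def resMkLin {hM : ∀ (m : M), ∀ x ∈ UE, M.subtype m * x * (M.subtype m)⁻¹ ∈ UE} (b : X →ₗ[k] W)
    (hb : ∀ y ∈ UE, ∀ x, MonoidAlgebra.of k G y • b x = b x) :
    X →ₗ[k] HCRes k M.subtype UE W hM where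
  toFun x := resMk (b x) fun y hy => hb y hy x
  map_add' x y := resVal_injective (by
    rw [map_add resVal, resVal_resMk, resVal_resMk, resVal_resMk, map_add])
  map_smul' c x := resVal_injective (by
    rw [map_smul resVal, resVal_resMk, resVal_resMk, map_smul]; rfl)

theorem resVal_resMkLin {hM : ∀ (m : M), ∀ x ∈ UE, M.subtype m * x * (M.subtype m)⁻¹ ∈ UE}
    (b : X →ₗ[k] W) (hb : ∀ y ∈ UE, ∀ x, MonoidAlgebra.of k G y • b x = b x) (x : X) :
    resVal (resMkLin b hb x : HCRes k M.subtype UE W hM) = b x := rfl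

/-- The universal property of an iterated induced module. -/
theorem exists_lift_lift (hLM : L ≤ M) (hM : ∀ m ∈ M, ∀ x ∈ UE, m * x * m⁻¹ ∈ UE)
    (b : X →ₗ[k] W) (hE : ∀ y ∈ UE, ∀ x, MonoidAlgebra.of k G y • b x = b x)
    (hV : ∀ y ∈ V, ∀ x, MonoidAlgebra.of k G y • b x = b x)
    (hb : ∀ (l : L) x, MonoidAlgebra.of k G (L.subtype l) • b x = b (MonoidAlgebra.of k L l • x)) :
    ∃ s : HCInd k M.subtype UE (HCInd k (Subgroup.inclusion hLM) (V.subgroupOf M) X)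
        →ₗ[MonoidAlgebra k G] W, ∀ x, s (indMkMk UE V k X hLM x) = b x := by
  have hM' : ∀ (m : M), ∀ x ∈ UE, M.subtype m * x * (M.subtype m)⁻¹ ∈ UE := fun m x hx =>
    hM m m.2 x hx
  let b' : X →ₗ[k] HCRes k M.subtype UE W hM' := resMkLin b hE
  have h1 : ∀ y ∈ V.subgroupOf M, ∀ x, MonoidAlgebra.of k M y • b' x = b' x := fun y hy x =>
    resVal_injective ((resVal_smul y _).trans (hV y hy x))
  have h2 : ∀ (l : L) x, MonoidAlgebra.of k M (Subgroup.inclusion hLM l) • b' x =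
      b' (MonoidAlgebra.of k L l • x) := fun l x =>
    resVal_injective ((resVal_smul (Subgroup.inclusion hLM l) _).trans (hb l x))
  refine ⟨adjInd (indLift b' h1 h2), fun x => ?_⟩
  rw [indMkMk_apply, adjInd_mk, map_one, one_smul, indLift_mk, map_one, one_smul]
  rfl

/-- Two modules with maps from `X` that have the universal properties of modules that are induced
via parallel faces are isomorphic. -/
theorem nonempty_equiv_of_parallel (hp : p.Prime) (hD : D.IsSplitBNPair p)
    (hcomm : D.CommutatorRelations) (hpk : (p : k) ≠ 0) {f₁ f₂ : G} {J₁ J₂ : Set G}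
    (hf₁ : f₁ ∈ D.N) (hJ₁ : J₁ ⊆ D.S) (hf₂ : f₂ ∈ D.N) (hJ₂ : J₂ ⊆ D.S)
    (hpar : D.Parallel (D.face f₁ J₁) (D.face f₂ J₂)) (hL : L = D.levi (D.face f₁ J₁))
    {W' : Type*} [AddCommGroup W'] [Module k W'] [Module (MonoidAlgebra k G) W']
    [IsScalarTower k (MonoidAlgebra k G) W'] [Module.Finite k W]
    (b : X →ₗ[k] W) (b' : X →ₗ[k] W')
    (hgen : ∀ Λ : Submodule (MonoidAlgebra k G) W, (∀ x, b x ∈ Λ) → Λ = ⊤)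
    (hgen' : ∀ Λ : Submodule (MonoidAlgebra k G) W', (∀ x, b' x ∈ Λ) → Λ = ⊤)
    (hfix : ∀ y ∈ D.rootSubgroup (D.face f₁ J₁), ∀ x, MonoidAlgebra.of k G y • b x = b x)
    (hfix' : ∀ y ∈ D.rootSubgroup (D.face f₂ J₂), ∀ x, MonoidAlgebra.of k G y • b' x = b' x)
    (hb : ∀ (l : L) x, MonoidAlgebra.of k G (L.subtype l) • b x = b (MonoidAlgebra.of k L l • x))
    (hb' : ∀ (l : L) x,
      MonoidAlgebra.of k G (L.subtype l) • b' x = b' (MonoidAlgebra.of k L l • x))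
    (hlift : ∀ a : X →ₗ[k] W',
      (∀ y ∈ D.rootSubgroup (D.face f₁ J₁), ∀ x, MonoidAlgebra.of k G y • a x = a x) →
      (∀ (l : L) x, MonoidAlgebra.of k G (L.subtype l) • a x = a (MonoidAlgebra.of k L l • x)) →
      ∃ s : W →ₗ[MonoidAlgebra k G] W', ∀ x, s (b x) = a x)
    (hlift' : ∀ a : X →ₗ[k] W,
      (∀ y ∈ D.rootSubgroup (D.face f₂ J₂), ∀ x, MonoidAlgebra.of k G y • a x = a x) →
      (∀ (l : L) x, MonoidAlgebra.of k G (L.subtype l) • a x = a (MonoidAlgebra.of k L l • x)) →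
      ∃ s : W' →ₗ[MonoidAlgebra k G] W, ∀ x, s (b' x) = a x) :
    Nonempty (W' ≃ₗ[MonoidAlgebra k G] W) := by
  have hpar' : D.Parallel (D.face f₂ J₂) (D.face f₁ J₁) := fun a ha => (hpar a ha).symm
  have hL₂ : L = D.levi (D.face f₂ J₂) :=
    hL.trans ((hD.levi_eq_iff hcomm hf₁ hJ₁ hf₂ hJ₂).2 hpar)
  have h₁ : ∀ l ∈ L, ∀ x ∈ D.rootSubgroup (D.face f₁ J₁),
      l * x * l⁻¹ ∈ D.rootSubgroup (D.face f₁ J₁) := by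
    rw [hL]
    exact le_normalizer_iff.1 (hD.levi_le_normalizer hcomm hf₁ hJ₁)
  have h₂ : ∀ l ∈ L, ∀ x ∈ D.rootSubgroup (D.face f₂ J₂),
      l * x * l⁻¹ ∈ D.rootSubgroup (D.face f₂ J₂) := by
    rw [hL₂]
    exact le_normalizer_iff.1 (hD.levi_le_normalizer hcomm hf₂ hJ₂)
  -- The two maps send each generator to the average of the corresponding one. Each is surjective:
  -- its range contains the average of every generator, hence the generator itself by independence
  -- modulo the range.
  obtain ⟨s, hs⟩ := hlift (avgLin (rep k W') (D.rootSubgroup (D.face f₁ J₁)) ∘ₗ b')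
    (fun y hy x => smul_avg hy _) (fun l x => (smul_avg_of_conj (h₁ _ l.2) _).trans (by
      exact congrArg (avg (rep k W') _) (hb' l x)))
  obtain ⟨t, ht⟩ := hlift' (avgLin (rep k W) (D.rootSubgroup (D.face f₂ J₂)) ∘ₗ b)
    (fun y hy x => smul_avg hy _) (fun l x => (smul_avg_of_conj (h₂ _ l.2) _).trans (by
      exact congrArg (avg (rep k W) _) (hb l x)))
  refine nonempty_equiv_of_surjective (k := k) (f := s) (g := t) ?_ ?_
  · exact LinearMap.range_eq_top.1 (hgen' _ fun x => hD.mem_of_indep_top hp hcomm hpk _ hf₂ hJ₂ hf₁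
      hJ₁ hpar' (fun y hy => hfix' y hy x) ⟨_, hs x⟩)
  · exact LinearMap.range_eq_top.1 (hgen _ fun x => hD.mem_of_indep_top hp hcomm hpk _ hf₁ hJ₁ hf₂
      hJ₂ hpar (fun y hy => hfix y hy x) ⟨_, ht x⟩)

theorem indMk_one_fixed {A : Subgroup G} {y : G} (hy : y ∈ A) (x : X) :
    MonoidAlgebra.of k G y • indMk k L.subtype A 1 x = indMk k L.subtype A 1 x := by
  rw [smul_indMk, mul_one, ← one_mul y]
  exact indMk_mul_right 1 hy x

theorem indMk_one_smul {A : Subgroup G} (l : L) (x : X) :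
    MonoidAlgebra.of k G (L.subtype l) • indMk k L.subtype A 1 x =
      indMk k L.subtype A 1 (MonoidAlgebra.of k L l • x) := by
  rw [smul_indMk, mul_one, ← one_mul (L.subtype l)]
  exact indMk_mul_map 1 l x

theorem exists_lift {A : Subgroup G} (a : X →ₗ[k] W)
    (hA : ∀ y ∈ A, ∀ x, MonoidAlgebra.of k G y • a x = a x)
    (ha : ∀ (l : L) x, MonoidAlgebra.of k G (L.subtype l) • a x = a (MonoidAlgebra.of k L l • x)) :
    ∃ s : HCInd k L.subtype A X →ₗ[MonoidAlgebra k G] W, ∀ x, s (indMk k L.subtype A 1 x) = a x :=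
  ⟨indLift a hA ha, fun x => by rw [indLift_mk, map_one, one_smul]⟩

/-- Harish-Chandra induction is transitive and does not depend on the parabolic subgroup. -/
theorem IsLeviPair.nonempty_equiv (h : D.IsLeviPair f I J L M UE UF V) (hp : p.Prime)
    (hD : D.IsSplitBNPair p) (hcomm : D.CommutatorRelations) (hpk : (p : k) ≠ 0) (hLM : L ≤ M)
    [Module.Finite k X] {f₁ : G} {J₁ : Set G} (hf₁ : f₁ ∈ D.N) (hJ₁ : J₁ ⊆ D.S)
    (hL : L = D.levi (D.face f₁ J₁)) {U₁ : Subgroup G} (hU₁ : U₁ = D.rootSubgroup (D.face f₁ J₁)) :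
    Nonempty (HCInd k M.subtype UE (HCInd k (Subgroup.inclusion hLM) (V.subgroupOf M) X)
      ≃ₗ[MonoidAlgebra k G] HCInd k L.subtype U₁ X) := by
  subst hU₁
  have hpar : D.Parallel (D.face f₁ J₁) (D.face f J) :=
    (hD.levi_eq_iff hcomm hf₁ hJ₁ h.mem_N h.J_subset_S).1 (by rw [← hL, h.L_eq])
  have := finite_ind (k := k) (j := L.subtype) (U := D.rootSubgroup (D.face f₁ J₁)) (X := X)
  refine nonempty_equiv_of_parallel hp hD hcomm hpk hf₁ hJ₁ h.mem_N h.J_subset_S hpar hL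
    (indMk k L.subtype _ 1) (indMkMk UE V k X hLM) (fun Λ => ind_submodule_eq_top)
    (fun Λ => ind_ind_submodule_eq_top hLM) (fun y hy x => indMk_one_fixed hy x)
    (fun y hy x => ?_) indMk_one_smul (of_smul_indMkMk_L hLM) exists_lift (fun a hF ha => ?_)
  · rw [← h.UF_eq] at hy
    exact h.of_smul_indMkMk_UF hD hcomm hLM hy x
  · rw [← h.UF_eq] at hF
    exact exists_lift_lift hLM (h.conj_UE hD hcomm) a (fun y hy => hF y (h.UE_le_UF hy))
      (fun y hy => hF y (h.V_le_UF hy)) ha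

end LeviPair

end BNData
end HarishChandra

namespace HarishChandra
namespace BNData

/-! ### The double cosets that support homomorphisms to the restriction of the induced module -/

section Support

variable {G : Type v} [Group G] {p : ℕ} [Finite G] {D : BNData G} {f : G} {I J : Set G}
  {L M UE UF V : Subgroup G} {k : Type u} [Field k]
  {X : Type w} [AddCommGroup X] [Module k X] [Module (MonoidAlgebra k L) X]
  [IsScalarTower k (MonoidAlgebra k L) X]

theorem IsLeviPair.sup_le_sup (h : D.IsLeviPair f I J L M UE UF V) (hD : D.IsSplitBNPair p)
    (hcomm : D.CommutatorRelations) : UF ⊔ L ≤ UE ⊔ M := by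
  refine sup_le (fun a ha => ?_) (h.L_le_M.trans le_sup_right)
  obtain ⟨b, hb, c, hc, rfl⟩ := h.exists_mul hD hcomm a ha
  exact Subgroup.mul_mem_sup hb (h.V_le_M hc)

theorem IsLeviPair.exists_mul_of_mem_leviBorel (h : D.IsLeviPair f I J L M UE UF V)
    (hD : D.IsSplitBNPair p) (hcomm : D.CommutatorRelations) {b : G} (hb : b ∈ D.leviBorel f D.S) :
    ∃ y ∈ UF, ∃ l ∈ L, b = y * l := by
  obtain ⟨y, hy, l, hl, he⟩ := hD.exists_mul_leviBorel hcomm h.mem_N h.J_subset_S le_rfl hb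
  rw [h.UF_eq, h.L_eq]
  exact ⟨y, (Subgroup.mem_inf.1 hy).1, l, hD.leviBorel_le_levi h.mem_N h.J_subset_S hl, he⟩

/-- If some coefficient of an `L`-equivariant map to the `UF`-fixed points of the induced module is
not zero on a double coset, then there is such a coefficient at an element of `N`. -/
theorem IsLeviPair.exists_coef_ne_zero (h : D.IsLeviPair f I J L M UE UF V)
    (hD : D.IsSplitBNPair p) (hcomm : D.CommutatorRelations)
    (hs : IsSemidirect L.subtype UF) {C : Set G}
    (hC : ∀ g, ∀ q ∈ UF ⊔ L, g * q ∈ C ↔ g ∈ C) (hC' : ∀ g, ∀ q ∈ UE ⊔ M, q * g ∈ C ↔ g ∈ C)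
    (hCi : ∀ g, ∀ y ∈ UF, ∀ l, g * (y * L.subtype l) ∈ C ↔ g ∈ C)
    (φ : X →ₗ[k] HCInd k L.subtype UF X)
    (hφ : ∀ y ∈ UF, ∀ x, MonoidAlgebra.of k G y • φ x = φ x)
    (hφL : ∀ (l : L) x, MonoidAlgebra.of k G (L.subtype l) • φ x = φ (MonoidAlgebra.of k L l • x))
    {x : X} (hx : indProj C hCi (φ x) ≠ 0) :
    ∃ n ∈ D.N, n ∈ C ∧ ∃ x, coef hs (MonoidAlgebra.of k G n⁻¹ • φ x) ≠ 0 := by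
  -- By the Bruhat decomposition, an element of `C` is `y l r y' l'` with `r ∈ N`, and `r` is in `C`
  -- too. The outer factors only replace `x` and act on the coefficient by an element of `L`.
  by_contra! hcon
  refine hx (indProj_eq_zero hCi hs fun g hg => ?_)
  obtain ⟨r, hr, -, b, hb, b', hb', rfl⟩ := hD.levi_bruhat hcomm (g := g) h.mem_N le_rfl (by
    rw [face_singleton_S hD h.mem_N, hD.levi_N hcomm]; trivial)
  obtain ⟨y, hy, l, hl, rfl⟩ := h.exists_mul_of_mem_leviBorel hD hcomm hb
  obtain ⟨y', hy', l', hl', rfl⟩ := h.exists_mul_of_mem_leviBorel hD hcomm hb'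
  rw [hC _ _ (Subgroup.mul_mem_sup hy' hl'),
    hC' _ _ (h.sup_le_sup hD hcomm (Subgroup.mul_mem_sup hy hl))] at hg
  have h1 := hcon r hr hg (MonoidAlgebra.of k L (⟨l, hl⟩⁻¹ : L) • x)
  rw [← hφL] at h1
  have h2 : (y * l * r * (y' * l'))⁻¹ = (l'⁻¹ * y'⁻¹ * l') * L.subtype (⟨l', hl'⟩⁻¹ : L) *
      (r⁻¹ * (L.subtype (⟨l, hl⟩⁻¹ : L) * y⁻¹)) := by
    show _ = (l'⁻¹ * y'⁻¹ * l') * l'⁻¹ * (r⁻¹ * (l⁻¹ * y⁻¹))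
    group
  have h3 : l'⁻¹ * y'⁻¹ * l' ∈ UF := by
    have := h.conj_UF hD hcomm l'⁻¹ (inv_mem hl') y'⁻¹ (inv_mem hy')
    rwa [inv_inv] at this
  rw [h2, map_mul, mul_smul, coef_smul hs h3, map_mul, mul_smul, map_mul, mul_smul,
    hφ _ (inv_mem hy), h1, smul_zero]

/-- The coefficient at `n ∈ N` of such a map can be non-zero only if `n` normalizes `L`, by weak
cuspidality. -/
theorem IsLeviPair.conjSub_eq (h : D.IsLeviPair f I J L M UE UF V) (hp : p.Prime)
    (hD : D.IsSplitBNPair p) (hcomm : D.CommutatorRelations)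
    (hs : IsSemidirect L.subtype UF) {𝓛 : Set (Subgroup G)} (h𝓛 : D.IsAdmissible 𝓛) (hL : L ∈ 𝓛)
    (hX : IsWeaklyCuspidal k hD 𝓛 L X) (φ : X →ₗ[k] HCInd k L.subtype UF X)
    (hφ : ∀ y ∈ UF, ∀ x, MonoidAlgebra.of k G y • φ x = φ x)
    {n : G} (hn : n ∈ D.N) {x : X} (hx : coef hs (MonoidAlgebra.of k G n⁻¹ • φ x) ≠ 0) :
    conjSub n L = L := by
  have hn' := inv_mem hn
  have hnf : n⁻¹ * f ∈ D.N := mul_mem hn' h.mem_N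
  have hlevi : D.levi (D.face (n⁻¹ * f) J) = conjSub n⁻¹ L := by
    rw [← smul_face, hD.levi_smul hn', h.L_eq]
  -- The projection of `n⁻¹ F` to `F` has Levi subgroup `L ∩ n⁻¹ L n`, which belongs to `𝓛` and is
  -- proper in `L` unless `n` normalizes `L`.
  obtain ⟨f₃, hf₃, J₃, hJ₃, hside, hcuts, hsub, hproj⟩ :=
    hD.exists_proj_face h.mem_N h.J_subset_S hnf h.J_subset_S
  have hK := hD.levi_inf_levi hcomm h.mem_N h.J_subset_S hnf h.J_subset_S hf₃ hJ₃ hside hcuts hsub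
    hproj
  rw [← h.L_eq, hlevi] at hK
  have hface := face_eq hf₃
  have hf₃N : f₃ ∈ D.N := hD.face_subset_N h.mem_N h.J_subset_S hf₃
  by_contra hne
  have hKL : D.levi (D.face f₃ J₃) ≤ L := hK ▸ inf_le_left
  have hKne : D.levi (D.face f₃ J₃) ≠ L := by
    intro he
    rw [he] at hK
    have h1 : L ≤ conjSub n⁻¹ L := inf_eq_left.1 hK
    refine hne (conjSub_eq_of_le ?_)
    rintro _ ⟨y, hy, rfl⟩
    have h2 := mem_conjSub.1 (h1 hy)
    rwa [inv_inv] at h2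
  have hK𝓛 : D.levi (D.face f₃ J₃) ∈ 𝓛 := hK ▸ h𝓛.inter_mem L hL L hL n⁻¹ hn'
  obtain ⟨P, hP⟩ := hD.exists_parabolic hp hcomm hf₃N h.J_subset_S hJ₃
    (M := L) (L := D.levi (D.face f₃ J₃)) (by rw [hface, h.L_eq]) rfl
  rw [hface, ← h.L_eq] at hP
  -- The radical is contained in `n⁻¹ UF n`. As the values of `φ` are fixed by `UF`, it fixes the
  -- coefficient at `n`, which is zero by weak cuspidality.
  have hY : P.radical p ≤ conjSub n⁻¹ UF := by
    have h1 := hD.inf_levi_le hcomm (c := f₃) (A := D.face f₃ J₃) (J := J)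
      (H := conjSub n⁻¹ UF) hf₃N h.J_subset_S (hD.face_subset_N hf₃N (hJ₃.trans h.J_subset_S))
      (self_mem_face _ _) (fun a ha ha' hac => by
        rw [hface] at hac
        rw [h.UF_eq, ← rootSubgroup_smul, smul_face]
        exact rootSubgroup_anti ((hsub a ha hac).1 ha'))
    rwa [hface, ← h.L_eq, ← hP] at h1
  have hsubs := hX.2 _ hK𝓛 hKL hKne P
  have hfix : ∀ y ∈ (P.radical p).subgroupOf L, MonoidAlgebra.of k L y •
      coef hs (MonoidAlgebra.of k G n⁻¹ • φ x) = coef hs (MonoidAlgebra.of k G n⁻¹ • φ x) := by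
    intro y hy
    have h1 := mem_conjSub.1 (hY hy)
    rw [inv_inv] at h1
    rw [← coef_smul hs UF.one_mem, one_mul, smul_smul, ← map_mul]
    have h2 : L.subtype y * n⁻¹ = n⁻¹ * (n * y * n⁻¹) := by
      show (y : G) * n⁻¹ = _
      group
    rw [h2, map_mul, mul_smul]
    exact congrArg (fun w => coef hs (MonoidAlgebra.of k G n⁻¹ • w)) (hφ _ h1 x)
  have h3 : (resMk _ hfix : ResLevi k hD hKL P X) = resMk 0 (fun _ _ => smul_zero _) :=
    Subsingleton.elim _ _
  exact hx (congrArg resVal h3)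

/-- The coefficient at `n` as a map that is `L`-equivariant up to conjugation by `n`. -/
theorem IsLeviPair.coef_smul_conj (h : D.IsLeviPair f I J L M UE UF V)
    (hs : IsSemidirect L.subtype UF) (φ : X →ₗ[k] HCInd k L.subtype UF X)
    (hφL : ∀ (l : L) x, MonoidAlgebra.of k G (L.subtype l) • φ x = φ (MonoidAlgebra.of k L l • x))
    {n : G} {l l' : L} (hl : (l : G) * n = n * l') (x : X) :
    coef hs (MonoidAlgebra.of k G n⁻¹ • φ (MonoidAlgebra.of k L l • x)) =
      MonoidAlgebra.of k L l' • coef hs (MonoidAlgebra.of k G n⁻¹ • φ x) := by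
  have h2 : n⁻¹ * (l : G) = l' * n⁻¹ := by
    rw [inv_mul_eq_iff_eq_mul, ← mul_assoc, ← hl, mul_inv_cancel_right]
  rw [← hφL, ← coef_smul hs UF.one_mem, one_mul, smul_smul, smul_smul, ← map_mul, ← map_mul]
  exact congrArg (fun g => coef hs (MonoidAlgebra.of k G g • φ x)) h2

theorem exists_conj_mul {n : G} (hn : conjSub n L = L) (l : L) :
    ∃ l' : L, (l : G) * n = n * l' := by
  have h1 : (l : G) ∈ conjSub n L := by rw [hn]; exact l.2
  exact ⟨⟨_, mem_conjSub.1 h1⟩, by simp [mul_assoc]⟩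

theorem exists_mul_conj {n : G} (hn : conjSub n L = L) (l' : L) :
    ∃ l : L, (l : G) * n = n * l' :=
  ⟨⟨n * l' * n⁻¹, by
    have h1 := conj_mem_conjSub (g := n) l'.2
    rwa [hn] at h1⟩, by simp⟩

/-- Since `n` normalizes `L`, the range of the coefficient map is a nonzero submodule of the simple
module `X`. -/
theorem IsLeviPair.coef_surjective (h : D.IsLeviPair f I J L M UE UF V)
    (hs : IsSemidirect L.subtype UF) (hX : IsSimpleModule (MonoidAlgebra k L) X)
    (φ : X →ₗ[k] HCInd k L.subtype UF X)
    (hφL : ∀ (l : L) x, MonoidAlgebra.of k G (L.subtype l) • φ x = φ (MonoidAlgebra.of k L l • x))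
    {n : G} (hn : conjSub n L = L) {x : X} (hx : coef hs (MonoidAlgebra.of k G n⁻¹ • φ x) ≠ 0)
    (x' : X) : ∃ x, coef hs (MonoidAlgebra.of k G n⁻¹ • φ x) = x' := by
  let Θ : X →ₗ[k] X := coef hs ∘ₗ Algebra.lsmul k k _ (MonoidAlgebra.of k G n⁻¹) ∘ₗ φ
  have hΘ : ∀ l : L, ∀ x ∈ LinearMap.range Θ, MonoidAlgebra.of k L l • x ∈ LinearMap.range Θ := by
    rintro l _ ⟨x, rfl⟩
    obtain ⟨l', hl'⟩ := exists_mul_conj hn l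
    exact ⟨MonoidAlgebra.of k L l' • x, h.coef_smul_conj hs φ hφL hl' x⟩
  let Λ : Submodule (MonoidAlgebra k L) X :=
    { LinearMap.range Θ with
      smul_mem' := fun a x hx => by
        change x ∈ LinearMap.range Θ at hx
        change a • x ∈ LinearMap.range Θ
        induction a using MonoidAlgebra.induction_on with
        | of l => exact hΘ l x hx
        | add a b ha hb => rw [add_smul]; exact add_mem ha hb
        | smul c a ha => rw [smul_assoc]; exact Submodule.smul_mem _ c ha }
  have hΛ : ∀ y, y ∈ Λ ↔ y ∈ LinearMap.range Θ := fun y => Iff.rfl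
  rcases eq_bot_or_eq_top Λ with h1 | h1
  · have h2 : Θ x ∈ Λ := (hΛ _).2 ⟨x, rfl⟩
    rw [h1] at h2
    exact absurd ((Submodule.mem_bot _).1 h2) hx
  · have h2 : x' ∈ Λ := h1 ▸ Submodule.mem_top
    exact (hΛ _).1 h2

end Support

end BNData
end HarishChandra

namespace HarishChandra
namespace BNData

/-! ### Translates of the module induced to `M` by elements that normalize `L` -/

section Translate

variable {G : Type v} [Group G] {p : ℕ} [Finite G] {D : BNData G} {f : G} {I J : Set G}
  {L M UE UF V : Subgroup G} {k : Type u} [Field k]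
  {X : Type w} [AddCommGroup X] [Module k X] [Module (MonoidAlgebra k L) X]
  [IsScalarTower k (MonoidAlgebra k L) X]

variable (UE UF V k X) in
/-- The map `m ⊗ x ↦ m ⊗ x` from the module induced to `M` to the module induced to `G`. -/
def indIncl (hLM : L ≤ M) (hUE : UE ≤ UF) (hV : V ≤ UF)
    (hM : ∀ (m : M), ∀ x ∈ UE, M.subtype m * x * (M.subtype m)⁻¹ ∈ UE) :
    HCInd k (Subgroup.inclusion hLM) (V.subgroupOf M) X →ₗ[MonoidAlgebra k M]
      HCRes k M.subtype UE (HCInd k L.subtype UF X) hM :=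
  indLift (resMkLin (indMk k L.subtype UF 1) fun y hy x => indMk_one_fixed (hUE hy) x)
    (fun y hy x => resVal_injective ((resVal_smul y _).trans (indMk_one_fixed (hV hy) x)))
    (fun l x => resVal_injective ((resVal_smul (Subgroup.inclusion hLM l) _).trans
      (indMk_one_smul l x)))

theorem resVal_indIncl (hLM : L ≤ M) (hUE : UE ≤ UF) (hV : V ≤ UF)
    (hM : ∀ (m : M), ∀ x ∈ UE, M.subtype m * x * (M.subtype m)⁻¹ ∈ UE) (m : M) (x : X) :
    resVal (indIncl UE UF V k X hLM hUE hV hM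
      (indMk k (Subgroup.inclusion hLM) (V.subgroupOf M) m x)) = indMk k L.subtype UF (m : G) x := by
  rw [indIncl, indLift_mk, resVal_smul, resVal_resMkLin, smul_indMk, mul_one]
  rfl

/-- Coefficients are unchanged because `UF L ∩ M = V L`. This gives the injectivity of the
inclusion. -/
theorem IsLeviPair.coef_indIncl (h : D.IsLeviPair f I J L M UE UF V)
    (hs : IsSemidirect L.subtype UF) (hLM : L ≤ M)
    (hs' : IsSemidirect (Subgroup.inclusion hLM) (V.subgroupOf M))
    (hM : ∀ (m : M), ∀ x ∈ UE, M.subtype m * x * (M.subtype m)⁻¹ ∈ UE)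
    (z : HCInd k (Subgroup.inclusion hLM) (V.subgroupOf M) X) :
    coef hs (resVal (indIncl UE UF V k X hLM h.UE_le_UF h.V_le_UF hM z)) = coef hs' z := by
  induction z using ind_induction with
  | add a b ha hb => rw [map_add, map_add, map_add, map_add, ha, hb]
  | mk m x =>
    rw [resVal_indIncl]
    by_cases hm : (m : G) ∈ UF ⊔ L.subtype.range
    · obtain ⟨y, hy, l, he⟩ := hs.exists_mul hm
      have hyM : y ∈ M := by
        have h1 : y = m * (L.subtype l)⁻¹ := eq_mul_inv_of_mul_eq he.symm
        rw [h1]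
        exact mul_mem m.2 (inv_mem (hLM l.2))
      have he' : m = ⟨y, hyM⟩ * Subgroup.inclusion hLM l := Subtype.ext he
      have hyV : (⟨y, hyM⟩ : M) ∈ V.subgroupOf M := h.mem_V hy hyM
      rw [he, he', coef_mk_mul hs hy, coef_mk_mul hs' hyV]
    · rw [coef_mk_of_notMem hs hm, coef_mk_of_notMem hs']
      intro h'
      obtain ⟨y, hy, l, rfl⟩ := hs'.exists_mul h'
      exact hm (Subgroup.mul_mem_sup (h.V_le_UF hy) ⟨l, rfl⟩)

theorem IsLeviPair.indIncl_injective (h : D.IsLeviPair f I J L M UE UF V)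
    (hs : IsSemidirect L.subtype UF) (hLM : L ≤ M)
    (hs' : IsSemidirect (Subgroup.inclusion hLM) (V.subgroupOf M))
    (hM : ∀ (m : M), ∀ x ∈ UE, M.subtype m * x * (M.subtype m)⁻¹ ∈ UE) :
    Function.Injective (indIncl UE UF V k X hLM h.UE_le_UF h.V_le_UF hM) := by
  refine (injective_iff_map_eq_zero _).2 fun z hz => eq_zero_of_coef hs' fun g => ?_
  rw [← h.coef_indIncl hs hLM hs' hM, map_smul, hz, smul_zero, map_zero, map_zero]

/-- A coefficient map at `n ∈ N` that normalizes `L` gives an automorphism of the induced module. -/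
theorem IsLeviPair.exists_translate (h : D.IsLeviPair f I J L M UE UF V) (hp : p.Prime)
    (hD : D.IsSplitBNPair p) (hcomm : D.CommutatorRelations) (hpk : (p : k) ≠ 0)
    [Module.Finite k X] {n : G} (hn : n ∈ D.N) (hnL : conjSub n L = L) (θ : X →ₗ[k] X)
    (hθ : ∀ l l' : L, (l : G) * n = n * l' → ∀ x,
      θ (MonoidAlgebra.of k L l • x) = MonoidAlgebra.of k L l' • θ x)
    (hsurj : Function.Surjective θ) :
    ∃ τ : HCInd k L.subtype UF X →ₗ[MonoidAlgebra k G] HCInd k L.subtype UF X,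
      Function.Injective τ ∧ ∀ x, τ (indMk k L.subtype UF 1 x) =
        avg (rep k _) UF (indMk k L.subtype UF n (θ x)) := by
  have hnf : n * f ∈ D.N := mul_mem hn h.mem_N
  have hpar : D.Parallel (D.face (n * f) J) (D.face f J) := by
    refine (hD.levi_eq_iff hcomm hnf h.J_subset_S h.mem_N h.J_subset_S).1 ?_
    rw [← smul_face, hD.levi_smul hn, ← h.L_eq, hnL]
  obtain ⟨τ, hτ⟩ := exists_lift (avgLin (rep k _) UF ∘ₗ indMk k L.subtype UF n ∘ₗ θ)
    (fun y hy x => smul_avg hy _) (by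
    intro l x
    refine (smul_avg_of_conj (h.conj_UF hD hcomm _ l.2) _).trans (congrArg (avg (rep k _) UF) ?_)
    obtain ⟨l', hl'⟩ := exists_conj_mul hnL l
    rw [LinearMap.comp_apply, LinearMap.comp_apply, hθ l l' hl', ← indMk_mul_map, smul_indMk]
    exact congrArg (fun g => indMk k L.subtype UF g (θ x)) hl')
  have hfin := finite_ind (k := k) (j := L.subtype) (U := UF) (X := X)
  have h1 : IsNoetherian (MonoidAlgebra k G) (HCInd k L.subtype UF X) :=
    isNoetherian_of_tower k inferInstance
  refine ⟨τ, IsNoetherian.injective_of_surjective_endomorphism _ (LinearMap.range_eq_top.1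
    (ind_submodule_eq_top fun x => ?_)), hτ⟩
  obtain ⟨x, rfl⟩ := hsurj x
  -- The vector `n ⊗ θ x` is fixed by `n UF n⁻¹`, and its average over `UF` is in the range of `τ`.
  -- Independence for the faces `n F` and `F` then puts the vector itself into the range.
  have h2 : indMk k L.subtype UF n (θ x) ∈ LinearMap.range τ := by
    refine hD.mem_of_indep_top hp hcomm hpk _ hnf h.J_subset_S h.mem_N h.J_subset_S hpar
      (fun y hy => ?_) (by rw [← h.UF_eq]; exact ⟨_, hτ x⟩)
    rw [← smul_face, rootSubgroup_smul, ← h.UF_eq, mem_conjSub] at hy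
    rw [smul_indMk, ← indMk_mul_right n hy]
    congr 2
    group
  have h3 := Submodule.smul_mem _ (MonoidAlgebra.of k G n⁻¹) h2
  rwa [smul_indMk, inv_mul_cancel] at h3

/-- The part of the `UE`-fixed points that is supported on the double coset of `n` is contained in
the image of the module induced to `M` under the automorphism given by `n`. -/
theorem IsLeviPair.indProj_mem (h : D.IsLeviPair f I J L M UE UF V) (hp : p.Prime)
    (hD : D.IsSplitBNPair p) (hcomm : D.CommutatorRelations) (hpk : (p : k) ≠ 0)
    {n : G} (hn : n ∈ D.N) (hnL : conjSub n L = L) (θ : X →ₗ[k] X)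
    (hsurj : Function.Surjective θ) {C : Set G}
    (hC : ∀ g ∈ C, ∃ m ∈ UE ⊔ M, ∃ q ∈ UF ⊔ L, g = m * n * q)
    (hC' : ∀ g, ∀ q ∈ UE ⊔ M, q * g ∈ C ↔ g ∈ C)
    (hCi : ∀ g, ∀ y ∈ UF, ∀ l, g * (y * L.subtype l) ∈ C ↔ g ∈ C)
    {Λ : Submodule k (HCInd k L.subtype UF X)}
    (hΛ : ∀ m ∈ M, ∀ w ∈ Λ, MonoidAlgebra.of k G m • w ∈ Λ)
    (hmem : ∀ x, avg (rep k _) UF (indMk k L.subtype UF n (θ x)) ∈ Λ)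
    {w : HCInd k L.subtype UF X} (hw : ∀ y ∈ UE, MonoidAlgebra.of k G y • w = w) :
    indProj C hCi w ∈ Λ := by
  have hnf : n * f ∈ D.N := mul_mem hn h.mem_N
  have hs := h.isSemidirect_UF hD hcomm
  have hpar : D.Parallel (D.face (n * f) J) (D.face f J) := by
    refine (hD.levi_eq_iff hcomm hnf h.J_subset_S h.mem_N h.J_subset_S).1 ?_
    rw [← smul_face, hD.levi_smul hn, ← h.L_eq, hnL]
  have hUn : D.rootSubgroup (D.face (n * f) J) = conjSub n UF := by
    rw [← smul_face, rootSubgroup_smul, ← h.UF_eq]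
  have hfixn : ∀ y ∈ conjSub n UF, ∀ x : X, MonoidAlgebra.of k G y • indMk k L.subtype UF n x =
      indMk k L.subtype UF n x := by
    intro y hy x
    rw [smul_indMk, ← indMk_mul_right n (mem_conjSub.1 hy) x]
    congr 1
    group
  -- The projection of `n F` to the face of `M` is parallel to `F`, and its unipotent group in `M`
  -- fixes `n ⊗ x`. So independence can be used inside `M`.
  obtain ⟨f₂, hf₂, J₂, hJ₂, hside, hcuts, hsub, hproj⟩ :=
    hD.exists_proj_face h.mem_N h.I_subset hnf h.J_subset_S
  have hface := face_eq hf₂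
  have hf₂N : f₂ ∈ D.N := hD.face_subset_N h.mem_N h.I_subset hf₂
  have hpar₂ : D.Parallel (D.face f₂ J₂) (D.face f J) := fun a ha =>
    ⟨fun h1 => (hpar a ha).1 ((hcuts a ha).1 h1).2, fun h1 =>
      (hcuts a ha).2 ⟨h1.mono (face_mono h.J_subset), (hpar a ha).2 h1⟩⟩
  have hunip : D.unip (D.face f₂ J₂) (D.face f I) ≤ conjSub n UF := by
    rw [← hface]
    refine hD.inf_levi_le hcomm hf₂N h.I_subset
      (hD.face_subset_N hf₂N (hJ₂.trans h.I_subset)) (self_mem_face _ _) fun a ha ha' hac => ?_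
    rw [hface] at hac
    rw [← hUn]
    exact rootSubgroup_anti ((hsub a ha hac).1 ha')
  -- the average of a generator
  have hgen : ∀ x, avg (rep k _) UE (indMk k L.subtype UF n x) ∈ Λ := by
    intro x
    obtain ⟨x, rfl⟩ := hsurj x
    refine hD.mem_of_indep hp hcomm hpk h.mem_N h.I_subset (isRepOn_rep _)
      (fun g hg w hw => hΛ g (by rwa [h.M_eq]) w hw) hf₂ hJ₂ (self_mem_face f I) h.J_subset hpar₂
      (fun y hy => ?_) ?_
    · have hyM : y ∈ M := by rw [h.M_eq]; exact unip_le _ _ hy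
      rw [rep_apply, smul_avg_of_conj (h.conj_UE hD hcomm y hyM), hfixn y (hunip hy)]
    -- As `UF = UE V`, averaging the `UE`-average over `V` gives the average over `UF`.
    · rw [← h.V_eq, (isRepOn_rep ⊤).avg_avg_of_mul le_top h.UE_le_UF h.V_le_UF
        (h.card_UE hp hD hpk) (h.card_V hp hD hpk) (h.card_UF hp hD hpk) (h.exists_mul hD hcomm)
        (fun c hc b hb => h.conj_UE hD hcomm c (h.V_le_M hc) b hb)]
      exact hmem x
  -- A general generator on `C` is `y m n y' l ⊗ x`. The average absorbs `y`, the factors `y' l` act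
  -- on `x` alone, and `m` normalizes `UE` and stabilizes `Λ`.
  have hall : ∀ z, avg (rep k _) UE (indProj C hCi z) ∈ Λ := by
    intro z
    induction z using ind_induction with
    | add a b ha hb => rw [map_add, avg_add]; exact add_mem ha hb
    | mk g x =>
      by_cases hg : g ∈ C
      · rw [indProj_mk_of_mem hCi hg]
        obtain ⟨q, hq, r, hr, rfl⟩ := hC g hg
        obtain ⟨y, hy, m, hm, rfl⟩ := exists_mul_of_mem_sup
          (le_normalizer_iff.2 (h.conj_UE hD hcomm)) hq
        have hr' : r ∈ UF ⊔ L.subtype.range := by rwa [Subgroup.range_subtype]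
        obtain ⟨y', hy', l, rfl⟩ := hs.exists_mul hr'
        rw [indMk_mul_mul _ hy', mul_assoc, ← smul_indMk, avg_smul_of_mem hy, ← smul_indMk,
          ← smul_avg_of_conj (h.conj_UE hD hcomm m hm)]
        exact hΛ m hm _ (hgen _)
      · rw [indProj_mk_of_notMem hCi hg]
        rw [avg_zero]
        exact zero_mem _
  have h1 : avg (rep k _) UE (indProj C hCi w) = indProj C hCi w := by
    refine avg_eq_self (h.card_UE hp hD hpk) fun y hy => ?_
    rw [rep_apply, ← indProj_smul hCi (fun g => hC' g y ((le_sup_left : UE ≤ UE ⊔ M) hy)), hw y hy]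
  rw [← h1]
  exact hall w

end Translate

end BNData
end HarishChandra

namespace HarishChandra

/-! ### Projections to double cosets -/

section DoubleCosets

variable {k : Type u} [Field k] {L G : Type v} [Group L] [Group G] {j : L →* G} {U : Subgroup G}
  {X : Type w} [AddCommGroup X] [Module k X] [Module (MonoidAlgebra k L) X]
  [IsScalarTower k (MonoidAlgebra k L) X] {H K : Subgroup G} [Finite G]

theorem mk_mul_eq_iff (q : DoubleCoset.Quotient (H : Set G) K) (g : G) {x : G} (hx : x ∈ K) :
    g * x ∈ {g | DoubleCoset.mk H K g = q} ↔ g ∈ {g | DoubleCoset.mk H K g = q} := by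
  have h1 : DoubleCoset.mk H K (g * x) = DoubleCoset.mk H K g :=
    ((DoubleCoset.eq H K _ _).2 ⟨1, H.one_mem, x, hx, by rw [one_mul]⟩).symm
  rw [Set.mem_ofPred_eq, Set.mem_ofPred_eq, h1]

theorem mul_mk_eq_iff (q : DoubleCoset.Quotient (H : Set G) K) (g : G) {x : G} (hx : x ∈ H) :
    x * g ∈ {g | DoubleCoset.mk H K g = q} ↔ g ∈ {g | DoubleCoset.mk H K g = q} := by
  have h1 : DoubleCoset.mk H K (x * g) = DoubleCoset.mk H K g :=
    ((DoubleCoset.eq H K _ _).2 ⟨x, hx, 1, K.one_mem, by rw [mul_one]⟩).symm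
  rw [Set.mem_ofPred_eq, Set.mem_ofPred_eq, h1]

theorem mk_mul_mul_eq_iff (hK : U ⊔ j.range ≤ K) (q : DoubleCoset.Quotient (H : Set G) K) (g : G) :
    ∀ y ∈ U, ∀ l, g * (y * j l) ∈ {g | DoubleCoset.mk H K g = q} ↔
      g ∈ {g | DoubleCoset.mk H K g = q} :=
  fun y hy l => mk_mul_eq_iff q g (hK (mul_map_mem_sup hy l))

theorem mem_doubleCoset_mk (g : G) :
    g ∈ {g' | DoubleCoset.mk H K g' = DoubleCoset.mk H K g} := Set.mem_ofPred_eq ▸ rfl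

/-- The projections add up to the identity, since they do so on generators. -/
theorem eq_zero_of_parts {Q W : Type*} [Finite Q] [AddCommGroup W] [Module k W] {c : G → Q}
    {i : G → X →ₗ[k] W}
    (hi : ∀ {motive : W → Prop}, (∀ g x, motive (i g x)) →
      (∀ y z, motive y → motive z → motive (y + z)) → ∀ y, motive y)
    (π : Q → W →ₗ[k] W) (hπ : ∀ g x, π (c g) (i g x) = i g x)
    (hπ' : ∀ q g x, q ≠ c g → π q (i g x) = 0) {w : W} (hw : ∀ q, π q w = 0) : w = 0 := by
  have := Fintype.ofFinite Q
  have h1 : ∀ z : W, ∑ q, π q z = z := by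
    refine hi (fun g x => ?_) fun y z hy hz => ?_
    · rw [Finset.sum_eq_single (c g), hπ]
      · exact fun q _ hq => hπ' q g x hq
      · exact fun h => absurd (Finset.mem_univ _) h
    · conv_rhs => rw [← hy, ← hz]
      rw [← Finset.sum_add_distrib]
      exact Finset.sum_congr rfl fun q _ => map_add _ _ _
  rw [← h1 w]
  exact Finset.sum_eq_zero fun q _ => hw q

/-- An element of the induced module whose parts on all double cosets vanish is zero. -/
theorem eq_zero_of_indProj (hK : U ⊔ j.range ≤ K) {z : HCInd k j U X}
    (hz : ∀ q : DoubleCoset.Quotient (H : Set G) K,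
      indProj {g | DoubleCoset.mk H K g = q} (mk_mul_mul_eq_iff hK q) z = 0) : z = 0 := by
  have : Finite (DoubleCoset.Quotient (H : Set G) K) := Quotient.finite _
  exact eq_zero_of_parts (c := DoubleCoset.mk H K) (i := indMk k j U) ind_induction
    (fun q => indProj {g | DoubleCoset.mk H K g = q} (mk_mul_mul_eq_iff hK q))
    (fun g x => indProj_mk_of_mem (mk_mul_mul_eq_iff hK _) (mem_doubleCoset_mk g) x)
    (fun q g x hq => indProj_mk_of_notMem (mk_mul_mul_eq_iff hK q) (fun h => hq (Eq.symm h)) x) hz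

end DoubleCosets

namespace BNData

/-! ### Tests attached to the double cosets -/

section Tests

variable {G : Type v} [Group G] {p : ℕ} [Finite G] {D : BNData G} {f : G} {I J : Set G}
  {L M UE UF V : Subgroup G} {k : Type u} [Field k]
  {X : Type w} [AddCommGroup X] [Module k X] [Module (MonoidAlgebra k L) X]
  [IsScalarTower k (MonoidAlgebra k L) X]

/-- A map that is invertible on a subspace yields an equivariant map. -/
theorem exists_equivariant {Z V' Y : Type*} [AddCommGroup Z] [Module k Z]
    [Module (MonoidAlgebra k M) Z] [IsScalarTower k (MonoidAlgebra k M) Z] [AddCommGroup V']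
    [Module k V'] [Module (MonoidAlgebra k M) V'] [IsScalarTower k (MonoidAlgebra k M) V']
    [AddCommGroup Y] [Module k Y] [Module (MonoidAlgebra k G) Y]
    (ψ : Z →ₗ[k] Y) (hψ : Function.Injective ψ)
    (hψM : ∀ (m : M) z, ψ (MonoidAlgebra.of k M m • z) = MonoidAlgebra.of k G (m : G) • ψ z)
    (π : V' →ₗ[k] Y) (hπ : ∀ v, π v ∈ LinearMap.range ψ)
    (hπM : ∀ (m : M) v, π (MonoidAlgebra.of k M m • v) = MonoidAlgebra.of k G (m : G) • π v) :
    ∃ η : V' →ₗ[MonoidAlgebra k M] Z, ∀ v, ψ (η v) = π v := by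
  let e := LinearEquiv.ofInjective ψ hψ
  have he : ∀ y, ψ (e.symm y) = y := fun y => congrArg Subtype.val (e.apply_symm_apply y)
  let η := e.symm.toLinearMap ∘ₗ π.codRestrict (LinearMap.range ψ) hπ
  have hη : ∀ v, ψ (η v) = π v := fun v => he ⟨π v, hπ v⟩
  exact ⟨toEquivariant η fun m v => hψ (by rw [hη, hψM, hη, hπM]), hη⟩

/-- A homomorphism to the fixed points of `UE`, in terms of its values at `1 ⊗ x`. -/
theorem IsLeviPair.exists_values (h : D.IsLeviPair f I J L M UE UF V) (hD : D.IsSplitBNPair p)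
    (hcomm : D.CommutatorRelations) (hLM : L ≤ M)
    {Y : Type*} [AddCommGroup Y] [Module k Y] [Module (MonoidAlgebra k G) Y]
    [IsScalarTower k (MonoidAlgebra k G) Y]
    {hM : ∀ (m : M), ∀ x ∈ UE, M.subtype m * x * (M.subtype m)⁻¹ ∈ UE}
    (g : HCInd k (Subgroup.inclusion hLM) (V.subgroupOf M) X →ₗ[MonoidAlgebra k M]
      HCRes k M.subtype UE Y hM) :
    ∃ φ : X →ₗ[k] Y, (∀ y ∈ UF, ∀ x, MonoidAlgebra.of k G y • φ x = φ x) ∧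
      (∀ (l : L) x,
        MonoidAlgebra.of k G (L.subtype l) • φ x = φ (MonoidAlgebra.of k L l • x)) ∧
      ∀ π : Y →ₗ[k] Y, (∀ (m : M) w,
        π (MonoidAlgebra.of k G (m : G) • w) = MonoidAlgebra.of k G (m : G) • π w) →
        (∀ x, π (φ x) = 0) → ∀ z, π (resVal (g z)) = 0 := by
  let φ : X →ₗ[k] Y :=
    resVal ∘ₗ g.restrictScalars k ∘ₗ indMk k (Subgroup.inclusion hLM) (V.subgroupOf M) 1
  have hφ1 : ∀ x, φ x = resVal (g (indMk k (Subgroup.inclusion hLM) (V.subgroupOf M) 1 x)) :=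
    fun x => rfl
  have hφM : ∀ (m : M) x, resVal (g (indMk k (Subgroup.inclusion hLM) (V.subgroupOf M) m x)) =
      MonoidAlgebra.of k G (m : G) • φ x := by
    intro m x
    have h1 := resVal_smul m (g (indMk k (Subgroup.inclusion hLM) (V.subgroupOf M) 1 x))
    rw [← map_smul, smul_indMk, mul_one] at h1
    exact h1
  clear_value φ
  refine ⟨φ, fun y hy x => ?_, fun l x => ?_, fun π hπM hπ z => ?_⟩
  · obtain ⟨b, hb, c, hc, rfl⟩ := h.exists_mul hD hcomm y hy
    have h1 := hφM ⟨c, h.V_le_M hc⟩ x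
    rw [← one_mul (⟨c, h.V_le_M hc⟩ : M), indMk_mul_right 1 (U := V.subgroupOf M) hc, ← hφ1,
      one_mul] at h1
    rw [map_mul, mul_smul, ← h1, hφ1]
    exact resVal_fixed _ hb
  · refine (hφM (Subgroup.inclusion hLM l) x).symm.trans ?_
    rw [hφ1, ← one_mul (Subgroup.inclusion hLM l), indMk_mul_map]
  · induction z using ind_induction with
    | add a b ha hb => rw [map_add, map_add, map_add, ha, hb, add_zero]
    | mk m x => rw [hφM, hπM, hπ, smul_zero]

/-- The module induced to `M` as a subspace of the module induced to `G`, after an injective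
endomorphism. -/
theorem IsLeviPair.exists_incl (h : D.IsLeviPair f I J L M UE UF V) (hD : D.IsSplitBNPair p)
    (hcomm : D.CommutatorRelations) (hLM : L ≤ M)
    (τ : HCInd k L.subtype UF X →ₗ[MonoidAlgebra k G] HCInd k L.subtype UF X)
    (hτ : Function.Injective τ) :
    ∃ ψ : HCInd k (Subgroup.inclusion hLM) (V.subgroupOf M) X →ₗ[k] HCInd k L.subtype UF X,
      Function.Injective ψ ∧
      (∀ (m : M) z, ψ (MonoidAlgebra.of k M m • z) = MonoidAlgebra.of k G (m : G) • ψ z) ∧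
      ∀ x, τ (indMk k L.subtype UF 1 x) ∈ LinearMap.range ψ := by
  have hM : ∀ (m : M), ∀ x ∈ UE, M.subtype m * x * (M.subtype m)⁻¹ ∈ UE := fun m x hx =>
    h.conj_UE hD hcomm m m.2 x hx
  have hι := h.indIncl_injective (k := k) (X := X) (h.isSemidirect_UF hD hcomm) hLM
    (h.isSemidirect_V hD hcomm hLM) hM
  have hι1 := resVal_indIncl (k := k) (X := X) hLM h.UE_le_UF h.V_le_UF hM
  generalize indIncl UE UF V k X hLM h.UE_le_UF h.V_le_UF hM = ι at hι hι1
  refine ⟨τ.restrictScalars k ∘ₗ resVal ∘ₗ ι.restrictScalars k,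
    hτ.comp (resVal_injective.comp hι), fun m z => ?_, fun x => ?_⟩
  · refine (congrArg (fun v => τ (resVal v)) (map_smul ι _ z)).trans ?_
    refine (congrArg τ (resVal_smul m _)).trans ?_
    exact map_smul τ _ _
  · exact ⟨indMk k (Subgroup.inclusion hLM) (V.subgroupOf M) 1 x, congrArg τ (hι1 1 x)⟩

/-- On a double coset that supports a homomorphism from the induced module, the `UE`-fixed points
are contained in a copy of the module induced to `M`. -/
theorem IsLeviPair.exists_incl_of_ne_zero (h : D.IsLeviPair f I J L M UE UF V) (hp : p.Prime)
    (hD : D.IsSplitBNPair p) (hcomm : D.CommutatorRelations) (hpk : (p : k) ≠ 0) (hLM : L ≤ M)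
    {𝓛 : Set (Subgroup G)} (h𝓛 : D.IsAdmissible 𝓛) (hL : L ∈ 𝓛)
    (hX : IsWeaklyCuspidal k hD 𝓛 L X) {C : Set G}
    (hdc : ∀ n ∈ C, ∀ g ∈ C, ∃ m ∈ UE ⊔ M, ∃ q ∈ UF ⊔ L, g = m * n * q)
    (hC : ∀ g, ∀ q ∈ UF ⊔ L, g * q ∈ C ↔ g ∈ C) (hC' : ∀ g, ∀ q ∈ UE ⊔ M, q * g ∈ C ↔ g ∈ C)
    (hCi : ∀ g, ∀ y ∈ UF, ∀ l, g * (y * L.subtype l) ∈ C ↔ g ∈ C)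
    (φ : X →ₗ[k] HCInd k L.subtype UF X)
    (hφ : ∀ y ∈ UF, ∀ x, MonoidAlgebra.of k G y • φ x = φ x)
    (hφL : ∀ (l : L) x, MonoidAlgebra.of k G (L.subtype l) • φ x = φ (MonoidAlgebra.of k L l • x))
    {x : X} (hx : indProj C hCi (φ x) ≠ 0) :
    ∃ ψ : HCInd k (Subgroup.inclusion hLM) (V.subgroupOf M) X →ₗ[k] HCInd k L.subtype UF X,
      Function.Injective ψ ∧
      (∀ (m : M) z, ψ (MonoidAlgebra.of k M m • z) = MonoidAlgebra.of k G (m : G) • ψ z) ∧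
      ∀ w, (∀ y ∈ UE, MonoidAlgebra.of k G y • w = w) →
        indProj C hCi w ∈ LinearMap.range ψ := by
  have hs := h.isSemidirect_UF hD hcomm
  have hfin : Module.Finite k X := finite_of_isSimpleModule hX.1
  obtain ⟨n, hn, hnC, x₁, hx₁⟩ := h.exists_coef_ne_zero hD hcomm hs hC hC' hCi φ hφ hφL hx
  have hnL := h.conjSub_eq hp hD hcomm hs h𝓛 hL hX φ hφ hn hx₁
  have hsurj := h.coef_surjective hs hX.1 φ hφL hnL hx₁
  have hθ : ∀ l l' : L, (l : G) * n = n * l' → ∀ x : X,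
      coef hs (MonoidAlgebra.of k G n⁻¹ • φ (MonoidAlgebra.of k L l • x)) =
        MonoidAlgebra.of k L l' • coef hs (MonoidAlgebra.of k G n⁻¹ • φ x) :=
    fun l l' hl x => h.coef_smul_conj hs φ hφL hl x
  obtain ⟨θ, hθ1⟩ : ∃ θ : X →ₗ[k] X, ∀ x, θ x = coef hs (MonoidAlgebra.of k G n⁻¹ • φ x) :=
    ⟨coef hs ∘ₗ Algebra.lsmul k k _ (MonoidAlgebra.of k G n⁻¹) ∘ₗ φ, fun x => rfl⟩
  simp only [← hθ1] at hsurj hθ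
  obtain ⟨τ, hτ, hτ1⟩ := h.exists_translate hp hD hcomm hpk hn hnL θ hθ hsurj
  obtain ⟨ψ, hψ, hψM, hψτ⟩ := h.exists_incl hD hcomm hLM τ hτ
  refine ⟨ψ, hψ, hψM, fun w hw => ?_⟩
  refine h.indProj_mem hp hD hcomm hpk hn hnL θ hsurj (hdc n hnC) hC' hCi ?_ (fun x => ?_) hw
  · rintro m hm _ ⟨z, rfl⟩
    exact ⟨_, hψM ⟨m, hm⟩ z⟩
  · rw [← hτ1]
    exact hψτ x

/-- The projection maps `UE`-fixed points into the range of `ψ`. Read back through `ψ`, it becomes a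
`kM`-map to `Z`. -/
theorem exists_hom_of_incl {Z Y : Type*} [AddCommGroup Z] [Module k Z]
    [Module (MonoidAlgebra k M) Z] [IsScalarTower k (MonoidAlgebra k M) Z]
    [AddCommGroup Y] [Module k Y] [Module (MonoidAlgebra k G) Y]
    [IsScalarTower k (MonoidAlgebra k G) Y]
    {hM : ∀ (m : M), ∀ x ∈ UE, M.subtype m * x * (M.subtype m)⁻¹ ∈ UE}
    (ψ : Z →ₗ[k] Y) (hψ : Function.Injective ψ)
    (hψM : ∀ (m : M) z, ψ (MonoidAlgebra.of k M m • z) = MonoidAlgebra.of k G (m : G) • ψ z)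
    (π : Y →ₗ[k] Y) (hπM : ∀ (m : M) w,
      π (MonoidAlgebra.of k G (m : G) • w) = MonoidAlgebra.of k G (m : G) • π w)
    (hπ : ∀ w, (∀ y ∈ UE, MonoidAlgebra.of k G y • w = w) → π w ∈ LinearMap.range ψ) :
    ∃ η : HCRes k M.subtype UE Y hM →ₗ[MonoidAlgebra k M] Z, ∀ v, η v = 0 → π (resVal v) = 0 := by
  obtain ⟨η, hη⟩ := exists_equivariant ψ hψ hψM
    (π ∘ₗ (resVal : HCRes k M.subtype UE Y hM →ₗ[k] Y))
    (fun v => hπ _ fun y hy => resVal_fixed v hy)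
    (fun m v => (congrArg π (resVal_smul m v)).trans (hπM m _))
  refine ⟨η, fun v hv => ?_⟩
  have h1 := hη v
  rw [hv, map_zero] at h1
  exact h1.symm

/-- The test for the vanishing of a homomorphism to the restriction of the induced module. -/
theorem IsLeviPair.test (h : D.IsLeviPair f I J L M UE UF V) (hp : p.Prime)
    (hD : D.IsSplitBNPair p) (hcomm : D.CommutatorRelations) (hpk : (p : k) ≠ 0) (hLM : L ≤ M)
    {𝓛 : Set (Subgroup G)} (h𝓛 : D.IsAdmissible 𝓛) (hL : L ∈ 𝓛)
    (hX : IsWeaklyCuspidal k hD 𝓛 L X)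
    (hM : ∀ (m : M), ∀ x ∈ UE, M.subtype m * x * (M.subtype m)⁻¹ ∈ UE) {C : Set G}
    (hdc : ∀ n ∈ C, ∀ g ∈ C, ∃ m ∈ UE ⊔ M, ∃ q ∈ UF ⊔ L, g = m * n * q)
    (hC : ∀ g, ∀ q ∈ UF ⊔ L, g * q ∈ C ↔ g ∈ C) (hC' : ∀ g, ∀ q ∈ UE ⊔ M, q * g ∈ C ↔ g ∈ C)
    (hCi : ∀ g, ∀ y ∈ UF, ∀ l, g * (y * L.subtype l) ∈ C ↔ g ∈ C) :
    (∀ (g : HCInd k (Subgroup.inclusion hLM) (V.subgroupOf M) X →ₗ[MonoidAlgebra k M]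
        HCRes k M.subtype UE (HCInd k L.subtype UF X) hM) z, indProj C hCi (resVal (g z)) = 0) ∨
    ∃ η : HCRes k M.subtype UE (HCInd k L.subtype UF X) hM →ₗ[MonoidAlgebra k M]
        HCInd k (Subgroup.inclusion hLM) (V.subgroupOf M) X,
      ∀ v, η v = 0 → indProj C hCi (resVal v) = 0 := by
  refine or_iff_not_imp_left.2 fun hne => ?_
  push Not at hne
  obtain ⟨g, z, hz⟩ := hne
  have hprM : ∀ (m : M) (w : HCInd k L.subtype UF X),
      indProj C hCi (MonoidAlgebra.of k G (m : G) • w) =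
        MonoidAlgebra.of k G (m : G) • indProj C hCi w := fun m w =>
    indProj_smul hCi (fun g => hC' g m ((le_sup_right : M ≤ UE ⊔ M) m.2)) w
  obtain ⟨φ, hφ, hφL, hφz⟩ := h.exists_values hD hcomm hLM g
  -- The projection commutes with `M`, so if it killed all values at the generators `1 ⊗ x`, it
  -- would kill every value of `g`.
  obtain ⟨x, hx⟩ : ∃ x, indProj C hCi (φ x) ≠ 0 := by
    by_contra! hcon
    exact hz (hφz _ hprM hcon z)
  obtain ⟨ψ, hψ, hψM, hψw⟩ := h.exists_incl_of_ne_zero hp hD hcomm hpk hLM h𝓛 hL hX hdc hC hC' hCi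
    φ hφ hφL hx
  exact exists_hom_of_incl ψ hψ hψM _ hprM hψw

end Tests

end BNData
end HarishChandra

namespace HarishChandra

/-! ### The comparison of homomorphisms over the endomorphism rings -/

section Comparison

variable {k : Type u} [Field k] {M G : Type v} [Group M] [Group G] {j : M →* G} {U : Subgroup G}
  {hU : ∀ (m : M), ∀ x ∈ U, j m * x * (j m)⁻¹ ∈ U}
  {Z : Type*} [AddCommGroup Z] [Module k Z] [Module (MonoidAlgebra k M) Z]
  [IsScalarTower k (MonoidAlgebra k M) Z]
  {S : Type*} [AddCommGroup S] [Module k S] [Module (MonoidAlgebra k M) S]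
  [IsScalarTower k (MonoidAlgebra k M) S]
  {Y : Type*} [AddCommGroup Y] [Module (MonoidAlgebra k G) Y]
  {T : Type*} [AddCommGroup T] [Module k T] [Module (MonoidAlgebra k G) T]
  [IsScalarTower k (MonoidAlgebra k G) T]

/-- The elements `φ(1 ⊗ z)` generate `Y`. -/
theorem hom_ext_of_equiv (φ : HCInd k j U Z ≃ₗ[MonoidAlgebra k G] Y)
    {a b : Y →ₗ[MonoidAlgebra k G] T}
    (h : ∀ z, a (φ (indMk k j U 1 z)) = b (φ (indMk k j U 1 z))) : a = b := by
  have h1 : a ∘ₗ φ.toLinearMap = b ∘ₗ φ.toLinearMap :=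
    LinearMap.eqLocus_eq_top.1 (ind_submodule_eq_top h)
  ext y
  obtain ⟨y, rfl⟩ := φ.surjective y
  exact LinearMap.congr_fun h1 y

/-- A homomorphism `Y ≅ Ind(Z) → T` that corresponds to `Z → Res(T)`. -/
def homOfRes (φ : HCInd k j U Z ≃ₗ[MonoidAlgebra k G] Y)
    (t : Z →ₗ[MonoidAlgebra k M] HCRes k j U T hU) : Y →ₗ[MonoidAlgebra k G] T :=
  adjInd t ∘ₗ φ.symm.toLinearMap

theorem homOfRes_apply (φ : HCInd k j U Z ≃ₗ[MonoidAlgebra k G] Y)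
    (t : Z →ₗ[MonoidAlgebra k M] HCRes k j U T hU) (z : Z) :
    homOfRes φ t (φ (indMk k j U 1 z)) = resVal (t z) := by
  rw [homOfRes, LinearMap.comp_apply, LinearEquiv.coe_coe, LinearEquiv.symm_apply_apply, adjInd_mk,
    map_one, one_smul]

/-- The homomorphism `Z → Res(T)` that corresponds to `Y ≅ Ind(Z) → T`. -/
def resOfHom (φ : HCInd k j U Z ≃ₗ[MonoidAlgebra k G] Y) (a : Y →ₗ[MonoidAlgebra k G] T) :
    Z →ₗ[MonoidAlgebra k M] HCRes k j U T hU :=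
  adjRes (a ∘ₗ φ.toLinearMap)

theorem resVal_resOfHom (φ : HCInd k j U Z ≃ₗ[MonoidAlgebra k G] Y)
    (a : Y →ₗ[MonoidAlgebra k G] T) (z : Z) :
    resVal (resOfHom φ a z : HCRes k j U T hU) = a (φ (indMk k j U 1 z)) := rfl

variable (φ : HCInd k j U Z ≃ₗ[MonoidAlgebra k G] Y)
  (e : Module.End (MonoidAlgebra k M) Z →+* Module.End (MonoidAlgebra k G) Y)

/-- The homomorphism of right modules that corresponds to `s : S → Res(T)`. -/
def compareMap (he : ∀ h z, e h (φ (indMk k j U 1 z)) = φ (indMk k j U 1 (h z)))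
    (s : S →ₗ[MonoidAlgebra k M] HCRes k j U T hU) :
    HomF (MonoidAlgebra k M) Z S →ₗ[(Module.End (MonoidAlgebra k M) Z)ᵐᵒᵖ]
      ResRight e (HomF (MonoidAlgebra k G) Y T) where
  toFun f := homOfRes φ (s ∘ₗ f.toLin)
  map_add' f g := hom_ext_of_equiv φ fun z => by
    show _ = homOfRes φ (s ∘ₗ f.toLin) _ + homOfRes φ (s ∘ₗ g.toLin) _
    rw [homOfRes_apply, homOfRes_apply, homOfRes_apply, ← map_add, HomF.toLin_add]
    exact congrArg resVal (map_add s _ _)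
  map_smul' h f := hom_ext_of_equiv φ fun z => by
    show _ = homOfRes φ (s ∘ₗ f.toLin) (e h.unop _)
    rw [he, homOfRes_apply, homOfRes_apply]
    rfl

theorem compareMap_apply (he : ∀ h z, e h (φ (indMk k j U 1 z)) = φ (indMk k j U 1 (h z)))
    (s : S →ₗ[MonoidAlgebra k M] HCRes k j U T hU)
    (f : HomF (MonoidAlgebra k M) Z S) (z : Z) :
    HomF.toLin (show HomF (MonoidAlgebra k G) Y T from compareMap φ e he s f)
      (φ (indMk k j U 1 z)) = resVal (s (f.toLin z)) :=
  homOfRes_apply φ (s ∘ₗ f.toLin) z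

/-- If every homomorphism of right modules from `Hom(Z, S)` to `Hom(Z, Res(T))` is induced by a
homomorphism from `S` to `Res(T)`, then the homomorphisms from `S` to `Res(T)` are the homomorphisms
from `Hom(Z, S)` to the restriction of `Hom(Y, T)`. -/
theorem nonempty_equiv_hom (he : ∀ h z, e h (φ (indMk k j U 1 z)) = φ (indMk k j U 1 (h z)))
    (hS : InModCat (MonoidAlgebra k M) Z S)
    (hT : ∀ α : HomF (MonoidAlgebra k M) Z S →ₗ[(Module.End (MonoidAlgebra k M) Z)ᵐᵒᵖ]
      HomF (MonoidAlgebra k M) Z (HCRes k j U T hU),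
      ∃ s : S →ₗ[MonoidAlgebra k M] HCRes k j U T hU, ∀ f z, (α f).toLin z = s (f.toLin z)) :
    Nonempty ((HomF (MonoidAlgebra k M) Z S →ₗ[(Module.End (MonoidAlgebra k M) Z)ᵐᵒᵖ]
      ResRight e (HomF (MonoidAlgebra k G) Y T)) ≃ₗ[k]
        (S →ₗ[MonoidAlgebra k M] HCRes k j U T hU)) := by
  let Θ : (S →ₗ[MonoidAlgebra k M] HCRes k j U T hU) →ₗ[k]
      (HomF (MonoidAlgebra k M) Z S →ₗ[(Module.End (MonoidAlgebra k M) Z)ᵐᵒᵖ]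
        ResRight e (HomF (MonoidAlgebra k G) Y T)) :=
    { toFun := compareMap φ e he
      map_add' := fun s t => LinearMap.ext fun f => hom_ext_of_equiv φ fun z => by
        refine (compareMap_apply φ e he (s + t) f z).trans ?_
        refine Eq.trans ?_ (congrArg₂ (· + ·) (compareMap_apply φ e he s f z)
          (compareMap_apply φ e he t f z)).symm
        exact map_add resVal _ _
      map_smul' := fun c s => LinearMap.ext fun f => hom_ext_of_equiv φ fun z => by
        refine (compareMap_apply φ e he (c • s) f z).trans ?_
        refine Eq.trans ?_ (congrArg (c • ·) (compareMap_apply φ e he s f z)).symm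
        exact map_smul resVal _ _ }
  have hΘ : ∀ s, Θ s = compareMap φ e he s := fun s => rfl
  refine ⟨(LinearEquiv.ofBijective Θ ⟨?_, ?_⟩).symm⟩
  · refine (injective_iff_map_eq_zero _).2 fun s hs => ?_
    have h1 : ∀ (f : HomF (MonoidAlgebra k M) Z S) z, s (f.toLin z) = 0 := fun f z => by
      have h2 := compareMap_apply φ e he s f z
      rw [← hΘ, hs] at h2
      exact resVal_injective (h2.symm.trans (map_zero resVal).symm)
    -- Injectivity: `S` is generated by the images of maps from `Z`.
    obtain ⟨n, ⟨π, hπ⟩, -⟩ := hS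
    ext x
    obtain ⟨y, rfl⟩ := hπ x
    have h2 : s ∘ₗ π = 0 := LinearMap.pi_ext fun c z =>
      h1 (HomF.ofLin (π ∘ₗ LinearMap.single _ (fun _ => Z) c)) z
    exact congrArg Subtype.val (LinearMap.congr_fun h2 y)
  · intro β
    let β' : HomF (MonoidAlgebra k M) Z S → (Y →ₗ[MonoidAlgebra k G] T) := fun f => β f
    have hadd : ∀ f g, β' (f + g) = β' f + β' g := fun f g => β.map_add f g
    have hsmul : ∀ (h : (Module.End (MonoidAlgebra k M) Z)ᵐᵒᵖ) f, β' (h • f) = β' f ∘ₗ e h.unop := fun h f => β.map_smul h f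
    -- The adjunction turns `β` into a map to `Hom(Z, Res(T))`. It is linear over `End(Z)` because
    -- `e h` acts on `φ(1 ⊗ z)` as `h` acts on `z`.
    let α : HomF (MonoidAlgebra k M) Z S →ₗ[(Module.End (MonoidAlgebra k M) Z)ᵐᵒᵖ]
        HomF (MonoidAlgebra k M) Z (HCRes k j U T hU) :=
      { toFun := fun f => HomF.ofLin (resOfHom φ (β' f))
        map_add' := fun f g => LinearMap.ext fun z => resVal_injective (by
          refine (resVal_resOfHom φ (β' (f + g)) z).trans ?_
          rw [hadd]
          rfl)
        map_smul' := fun h f => LinearMap.ext fun z => resVal_injective (by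
          refine (resVal_resOfHom φ (β' (h • f)) z).trans ?_
          rw [hsmul, LinearMap.comp_apply, he]
          rfl) }
    obtain ⟨s, hs⟩ := hT α
    refine ⟨s, LinearMap.ext fun f => hom_ext_of_equiv φ fun z => ?_⟩
    refine (compareMap_apply φ e he s f z).trans ?_
    rw [← hs]
    rfl

end Comparison

end HarishChandra

namespace HarishChandra

/-! ### From tests on `Y` to tests on submodules of sums of copies of `Y` -/

section RestrictionMap

variable {k : Type u} [Field k] {M G : Type v} [Group M] [Group G] {j : M →* G} {U : Subgroup G}
  {hU : ∀ (m : M), ∀ x ∈ U, j m * x * (j m)⁻¹ ∈ U}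
  {T : Type*} [AddCommGroup T] [Module k T] [Module (MonoidAlgebra k G) T]
  [IsScalarTower k (MonoidAlgebra k G) T]
  {Y : Type*} [AddCommGroup Y] [Module k Y] [Module (MonoidAlgebra k G) Y]
  [IsScalarTower k (MonoidAlgebra k G) Y]

/-- Functoriality of the Harish-Chandra restriction. -/
def resMap (i : T →ₗ[MonoidAlgebra k G] Y) :
    HCRes k j U T hU →ₗ[MonoidAlgebra k M] HCRes k j U Y hU :=
  toEquivariant
    { toFun := fun v => resMk (i (resVal v)) fun y hy => by rw [← map_smul, resVal_fixed v hy]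
      map_add' := fun v w => resVal_injective (map_add i (resVal v) (resVal w))
      map_smul' := fun c v => resVal_injective (i.map_smul_of_tower c (resVal v)) }
    (fun m v => resVal_injective (by
      refine Eq.trans ?_ (resVal_smul m _).symm
      refine (congrArg i (resVal_smul m v)).trans ?_
      exact map_smul i _ _))

/-- The tests for homomorphisms to `Res(Y)` give tests for homomorphisms to `Res(T)`, if `T` is
contained in a sum of copies of `Y`. -/
theorem exists_hom_of_tests_res {Z S : Type*} [AddCommGroup Z] [Module (MonoidAlgebra k M) Z]
    [AddCommGroup S] [Module (MonoidAlgebra k M) S]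
    (hinj : IsSelfInjective (Module.End (MonoidAlgebra k M) Z))
    (hS : InModCat (MonoidAlgebra k M) Z S) {n : ℕ} {i : T →ₗ[MonoidAlgebra k G] (Fin n → Y)}
    (hi : Function.Injective i) {Q : Type*} (π : Q → Y →ₗ[k] Y)
    (hπ : ∀ y, (∀ q, π q y = 0) → y = 0)
    (htest : ∀ q, (∀ (g : Z →ₗ[MonoidAlgebra k M] HCRes k j U Y hU) z, π q (resVal (g z)) = 0) ∨
      ∃ η : HCRes k j U Y hU →ₗ[MonoidAlgebra k M] Z, ∀ v, η v = 0 → π q (resVal v) = 0)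
    (α : HomF (MonoidAlgebra k M) Z S →ₗ[(Module.End (MonoidAlgebra k M) Z)ᵐᵒᵖ]
      HomF (MonoidAlgebra k M) Z (HCRes k j U T hU)) :
    ∃ s : S →ₗ[MonoidAlgebra k M] HCRes k j U T hU, ∀ f z, (α f).toLin z = s (f.toLin z) := by
  let r : Fin n → HCRes k j U T hU →ₗ[MonoidAlgebra k M] HCRes k j U Y hU := fun c =>
    resMap (LinearMap.proj c ∘ₗ i)
  have hr : ∀ c v, resVal (r c v) = i (resVal v) c := fun c v => rfl
  refine exists_hom_of_tests hinj hS
    -- One test for each coordinate of the embedding into `Yⁿ` and each projection of `Y`.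
    (fun t : Fin n × Q => (LinearMap.ker (π t.2 ∘ₗ resVal ∘ₗ (r t.1).restrictScalars k)).toAddSubgroup)
    (fun w hw => ?_) (fun t => ?_) α
  · refine resVal_injective (hi ?_)
    rw [map_zero resVal, map_zero]
    funext c
    exact hπ _ fun q => hw (c, q)
  · obtain ⟨c, q⟩ := t
    rcases htest q with h | ⟨η, hη⟩
    · exact Or.inl fun g z => h (r c ∘ₗ g) z
    · exact Or.inr ⟨η ∘ₗ r c, fun v hv => hη (r c v) hv⟩

theorem exists_injective_of_equiv {A T Y Y' : Type*} [Ring A] [AddCommGroup T] [Module A T]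
    [AddCommGroup Y] [Module A Y] [AddCommGroup Y'] [Module A Y'] (e : Y ≃ₗ[A] Y') {n : ℕ}
    {i : T →ₗ[A] (Fin n → Y)} (hi : Function.Injective i) :
    ∃ i' : T →ₗ[A] (Fin n → Y'), Function.Injective i' :=
  ⟨(LinearEquiv.piCongrRight fun _ => e).toLinearMap ∘ₗ i,
    (LinearEquiv.piCongrRight fun _ : Fin n => e).injective.comp hi⟩

end RestrictionMap

namespace BNData

/-! ### A common pair of faces for two given parabolic subgroups -/

section Faces

variable {G : Type v} [Group G] {p : ℕ} [Finite G] {D : BNData G} {L M : Subgroup G}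

/-- A parabolic subgroup of `G` with Levi complement `M` and a parabolic subgroup of `M` with Levi
complement `L` come from a pair of faces. -/
theorem exists_isLeviPair (hp : p.Prime) (hD : D.IsSplitBNPair p) (hcomm : D.CommutatorRelations)
    (Q : D.Parabolic ⊤ M) (P : D.Parabolic M L) :
    ∃ f I J, D.IsLeviPair f I J L M (Q.radical p) (D.rootSubgroup (D.face f J)) (P.radical p) := by
  obtain ⟨d, hd, I₂, hI₂, J₂, hJ₂, htop, hM, hQ⟩ := Q.exists_faces hp hD hcomm
  obtain ⟨c, hc, I, hI, J, hJ, hM', hL, hP⟩ := P.exists_faces hp hD hcomm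
  rw [← htop, inf_top_eq] at hQ
  have hJ₂S := hJ₂.trans hI₂
  have hJS := hJ.trans hI
  have hpar : D.Parallel (D.face d J₂) (D.face c I) :=
    (hD.levi_eq_iff hcomm hd hJ₂S hc hI).1 (hM.symm.trans hM')
  -- The two parabolic subgroups may belong to different, though parallel, faces for `M`. Projecting
  -- the face of `L` into the face of `Q` keeps its Levi subgroup and its unipotent radical in `M`.
  obtain ⟨f, hf, J', hJ', hside, hcuts, hsub, hproj⟩ := hD.exists_proj_face hd hJ₂S hc hJS
  have hface := face_eq hf
  have hfN : f ∈ D.N := hD.face_subset_N hd hJ₂S hf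
  have hpar' : D.Parallel (D.face c J) (D.face f J') := fun a ha =>
    ⟨fun h => (hcuts a ha).2 ⟨(hpar a ha).2 (h.mono (face_mono hJ)), h⟩,
      fun h => ((hcuts a ha).1 h).2⟩
  have hL' : D.levi (D.face c J) = D.levi (D.face f J') :=
    (hD.levi_eq_iff hcomm hc hJS hfN (hJ'.trans hJ₂S)).2 hpar'
  refine ⟨f, J₂, J', hfN, hJ₂S, hJ', hL.trans hL', by rw [hface, hM], by rw [hface, hQ], rfl, ?_⟩
  have hleq : D.levi (D.face c I) = D.levi (D.face d J₂) := hM'.symm.trans hM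
  rw [hP, unip, hface]
  refine le_antisymm (le_inf ?_ (inf_le_right.trans hleq.le)) (le_inf ?_ ?_)
  · refine hD.inf_levi_le hcomm hc hI (hD.face_subset_N hc hJS) (self_mem_face _ _)
      fun a ha ha' hac => rootSubgroup_anti ((hsub a ha ((hpar a ha).2 hac)).2 ha')
  · rw [← hface]
    refine hD.inf_levi_le hcomm hfN hJ₂S (hD.face_subset_N hfN (hJ'.trans hJ₂S))
      (self_mem_face _ _) fun a ha ha' hac => rootSubgroup_anti ((hsub a ha ?_).1 ha')
    rwa [← hface]
  · exact inf_le_right.trans hleq.ge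

end Faces

end BNData

section EndEmbedding

variable {k : Type u} [Field k] {G : Type v} [Group G] {D : BNData G} {p : ℕ} {M : Subgroup G}

/-- The only property of the homomorphism between the endomorphism rings that the comparison uses.
-/
theorem endEmbedding_apply (Q : D.Parabolic ⊤ M)
    {Z : Type w} [AddCommGroup Z] [Module k Z] [Module (MonoidAlgebra k M) Z]
    [IsScalarTower k (MonoidAlgebra k M) Z] {Y : Type*} [AddCommGroup Y]
    [Module (MonoidAlgebra k G) Y] (φ : IndG k p Q Z ≃ₗ[MonoidAlgebra k G] Y)
    (h : Module.End (MonoidAlgebra k M) Z) (z : Z) :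
    endEmbedding k Q φ h (φ (indMk k M.subtype (Q.radical p) 1 z)) =
      φ (indMk k M.subtype (Q.radical p) 1 (h z)) := by
  have h1 : endEmbedding k Q φ h (φ (indMk k M.subtype (Q.radical p) 1 z)) =
      φ (indEnd k M.subtype (Q.radical p) Z h (φ.symm (φ (indMk k M.subtype (Q.radical p) 1 z)))) :=
    rfl
  rw [h1, LinearEquiv.symm_apply_apply]
  rfl

end EndEmbedding

end HarishChandra

end

theorem proposition3p3 {G : Type v} [Group G] [Finite G] {p : ℕ} (hp : p.Prime)
    (D : HarishChandra.BNData G) (hD : D.IsSplitBNPair p) (hcomm : D.CommutatorRelations)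
    {k : Type u} [Field k] (hkp : ringChar k ≠ p)
    (hk : ∀ H : Subgroup G, HarishChandra.IsSplittingField k H)
    (𝓛 : Set (Subgroup G)) (h𝓛 : D.IsAdmissible 𝓛)
    (L M : Subgroup G) (hL : L ∈ 𝓛) (hM : M ∈ 𝓛) (hLM : L ≤ M)
    (X : Type w) [AddCommGroup X] [Module k X] [Module (MonoidAlgebra k L) X]
    [IsScalarTower k (MonoidAlgebra k L) X]
    (hX : HarishChandra.IsWeaklyCuspidal k hD 𝓛 L X)
    (PG : D.Parabolic ⊤ L) (PM : D.Parabolic M L) (Q : D.Parabolic ⊤ M)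
    (S : Type*) [AddCommGroup S] [Module k S] [Module (MonoidAlgebra k M) S]
    [IsScalarTower k (MonoidAlgebra k M) S]
    (T : Type*) [AddCommGroup T] [Module k T] [Module (MonoidAlgebra k G) T]
    [IsScalarTower k (MonoidAlgebra k G) T]
    (hS : HarishChandra.InModCat (MonoidAlgebra k M) (HarishChandra.IndLevi k p hLM PM X) S)
    (hT : HarishChandra.InModCat (MonoidAlgebra k G) (HarishChandra.IndG k p PG X) T)
    (hinj : HarishChandra.IsSelfInjective
      (Module.End (MonoidAlgebra k M) (HarishChandra.IndLevi k p hLM PM X))) :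
    Nonempty (HarishChandra.IndG k p Q (HarishChandra.IndLevi k p hLM PM X)
        ≃ₗ[MonoidAlgebra k G] HarishChandra.IndG k p PG X) ∧
    ∀ φ : HarishChandra.IndG k p Q (HarishChandra.IndLevi k p hLM PM X)
        ≃ₗ[MonoidAlgebra k G] HarishChandra.IndG k p PG X,
      Nonempty
        ((HarishChandra.HomF (MonoidAlgebra k M) (HarishChandra.IndLevi k p hLM PM X) S
            →ₗ[(Module.End (MonoidAlgebra k M) (HarishChandra.IndLevi k p hLM PM X))ᵐᵒᵖ]
            HarishChandra.ResRight (HarishChandra.endEmbedding k Q φ)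
              (HarishChandra.HomF (MonoidAlgebra k G) (HarishChandra.IndG k p PG X) T))
          ≃ₗ[k] (S →ₗ[MonoidAlgebra k M] HarishChandra.ResG k hD Q T)) := by
  have hpk : (p : k) ≠ 0 := fun h => hkp <| by
    rcases (Nat.dvd_prime hp).1 (ringChar.dvd h) with h1 | h1
    · exact absurd h1 (CharP.ringChar_ne_one)
    · exact h1
  obtain ⟨f, I, J, hpair⟩ := HarishChandra.BNData.exists_isLeviPair hp hD hcomm Q PM
  obtain ⟨c, hc, I₁, hI₁, J₁, hJ₁, htop, hL₁, hPG⟩ := PG.exists_faces hp hD hcomm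
  rw [← htop, inf_top_eq] at hPG
  have hfin : Module.Finite k X := HarishChandra.finite_of_isSimpleModule hX.1
  have hY := hpair.nonempty_equiv (X := X) hp hD hcomm hpk hLM hc (hJ₁.trans hI₁) hL₁ hPG
  refine ⟨hY, fun φ => ?_⟩
  -- The parabolic subgroup `PG` need not be adapted to the faces of `Q` and `PM`. So `T` is
  -- embedded into copies of the isomorphic module that is induced via `face f J`, where the tests
  -- are available.
  obtain ⟨φ₀⟩ := hpair.nonempty_equiv (X := X) hp hD hcomm hpk hLM hpair.mem_N hpair.J_subset_S
    hpair.L_eq rfl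
  obtain ⟨n, -, i, hi⟩ := hT
  obtain ⟨i', hi'⟩ := HarishChandra.exists_injective_of_equiv (φ.symm.trans φ₀) hi
  have hK : D.rootSubgroup (D.face f J) ⊔ L.subtype.range ≤ D.rootSubgroup (D.face f J) ⊔ L := by
    rw [Subgroup.range_subtype]
  -- The tests are the projections to the double cosets of `O_p(Q) M` and of the product of `L` with
  -- the unipotent group of `face f J`.
  refine HarishChandra.nonempty_equiv_hom φ _ (HarishChandra.endEmbedding_apply Q φ) hS
    (HarishChandra.exists_hom_of_tests_res hinj hS hi'
      (fun q => HarishChandra.indProj _ (HarishChandra.mk_mul_mul_eq_iff (H := Q.radical p ⊔ M) hK q))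
      (fun y hy => HarishChandra.eq_zero_of_indProj hK hy) fun q => ?_)
  refine hpair.test hp hD hcomm hpk hLM h𝓛 hL hX (Q.conj_mem hD) (fun n hn g hg => ?_)
    (fun g x hx => HarishChandra.mk_mul_eq_iff q g hx)
    (fun g x hx => HarishChandra.mul_mk_eq_iff q g hx) _
  obtain ⟨a, ha, b, hb, he⟩ := (DoubleCoset.eq _ _ n g).1 (Eq.trans hn (Eq.symm hg))
  exact ⟨a, ha, b, hb, he⟩
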